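/- Let $P \subseteq \{2,3,\ldots\}\cup\{\infty\}$ be non-empty (the value $\infty$ is also written $\mathbb{N}$). **Trees.** A *$P$-tree* is a finite connected acyclic graph $T$ (the empty graph is allowed) in which every vertex $t$ carries exactly one label $p(t)\in P$, and $\deg(t)\le p(t)$. It is *thick* if every vertex of finite label whose degree is greater than $1$ has degree exactly equal to its label. For vertices $a,b,c,d$ put $R_T(a,b,c,d)$ iff the path from $a$ to $b$ and the path from $c$ to $d$ are disjoint. If $r$ is a vertex of $T'$ (the root), then $a\le_{T'} b$ means that $a$ lies on the path from $r$ to $b$, and the immediate successors of $a$ are its neighbours $a'$ with $a\le_{T'}a'$. A *lexicographical ordering* of the tree $T'$ with root $r$ is a linear ordering $\prec_{T'}$ of its vertices in which every vertex precedes its descendants, and such that if $x\prec_{T'} y$ are immediate successors of one vertex, $x\le_{T'}a$ and $y\le_{T'}b$, then $a\prec_{T'}b$. **The class $\mathcal{T}^\prec_P$.** It consists of the finite structures, in the relational language with relations $R$ (quaternary), $K_p$, $p\in P$ (unary), $\prec$ (binary), $G_i$, $0\le i<\sup P$ (binary) and $C$ (ternary), that arise as follows. Take a $P$-tree $T$,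 a thick $P$-tree $T'$ containing $T$ as an induced subgraph with the same labels, a root $r\in T'$ of degree $1$ in $T'$, and a lexicographical ordering $\prec_{T'}$ of $T'$. On the vertex set of $T$ let $R=R_T$, let $K_p(a)$ iff $p(a)=p$, let $\prec$ be the restriction of $\prec_{T'}$, let $C(a,b,c)$ iff $R_{T'}(a,b,c,r)$, and let $G_i(a,b)$ iff $p(a)$ is finite and there is an immediate successor $a'$ of $a$ in $T'$ with $a'\le_{T'}b$ which has exactly $i$ immediate successors of $a$ before it in the ordering $\prec_{T'}$. **Partial automorphisms.** For $n\ge 1$ let $\mathcal{K}_n$ be the class of all $n$-tuples of partial automorphisms of elements of $\mathcal{T}^\prec_P$, i.e. of all $(A;S_1,\ldots,S_n)$ with $A\in\mathcal{T}^\prec_P$ and each $S_i$ an isomorphism between substructures of $A$ that belong to $\mathcal{T}^\prec_P$. An embedding of $(A;\bar S)$ into $(B;\bar T)$ is an embedding $\phi\colon A\to B$ of structures with $\phi\circ S_i\subseteq T_i\circ\phi$ for every $i$. A class has the amalgamation property (AP) if for all $A,B_1,B_2$ in it and embeddings $\phi_i\colon A\to B_i$ there are $C$ in it and embeddings $\psi_i\colon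 B_i\to C$ with $\psi_1\phi_1=\psi_2\phi_2$. It has CAP if it contains a subclass with AP that is cofinal, i.e. such that every member of the class embeds in a member of the subclass. It has WAP if for every $A$ in it there are $A'$ in it and an embedding $\tau\colon A\to A'$ such that for all $B_1,B_2$ in it and embeddings $\phi_i\colon A'\to B_i$ there are $C$ in it and embeddings $\psi_i\colon B_i\to C$ with $\psi_1\phi_1\tau=\psi_2\phi_2\tau$. **Dendrites.** A *generalized ordered Ważewski dendrite* (for $P$) is a Fraïssé limit of $\mathcal{T}^\prec_P$, i.e. a countable structure $M$ such that every finite subset of $M$ is contained in a substructure of $M$ belonging to $\mathcal{T}^\prec_P$, every element of $\mathcal{T}^\prec_P$ embeds in $M$, and every isomorphism between substructures of $M$ belonging to $\mathcal{T}^\prec_P$ extends to an automorphism of $M$. Its automorphism group $\mathrm{Aut}(M)$ carries the topology of pointwise convergence on the discrete set $M$. An *$n$-diagonal conjugacy class* of a group $G$ is a set $\{(gf_1g^{-1},\ldots,gf_ng^{-1}) : g\in G\}\subseteq G^n$, where $f_1,\ldots,f_n\in G$. **Proposition.** For every non-empty $P\subseteq\{2,3,\ldots\}\cup\{\infty\}$,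 the class $\mathcal{K}_1$ of partial automorphisms of elements of $\mathcal{T}^\prec_P$ has CAP, and the class $\mathcal{K}_2$ of pairs of partial automorphisms of elements of $\mathcal{T}^\prec_P$ does not have WAP. In particular, the automorphism group of every generalized ordered Ważewski dendrite $M$ (for $P$) has a comeager conjugacy class, but no comeager $2$-diagonal conjugacy class. -/

import Mathlib

open FirstOrder FirstOrder.Language

universe u

namespace Dendrite

/-! ### Trees and their betweenness -/

/-- `x` lies on the path of `G` from `a` to `b` (in a tree this path is unique). -/
def OnPath {V : Type u} (G : SimpleGraph V) (a b x : V) : Prop :=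
  ∃ w : G.Walk a b, w.IsPath ∧ x ∈ w.support

/-- The quaternary relation `R(a,b,c,d)`: the path from `a` to `b` and the path from `c` to `d`
are disjoint. -/
def PathsDisjoint {V : Type u} (G : SimpleGraph V) (a b c d : V) : Prop :=
  ∀ x, ¬ (OnPath G a b x ∧ OnPath G c d x)

/-- A finite connected acyclic graph `G` (the empty one is allowed), every vertex `t` of which
carries exactly one label `lab t ∈ P`, and has degree at most `lab t`.
The value `⊤ : ℕ∞` stands for the infinite label. -/
structure IsPTree (P : Set ℕ∞) {V : Type u} (G : SimpleGraph V) (lab : V → ℕ∞) : Prop where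
  finite : Finite V
  preconnected : G.Preconnected
  acyclic : G.IsAcyclic
  lab_mem : ∀ t, lab t ∈ P
  degree_le : ∀ t, (G.neighborSet t).encard ≤ lab t

/-- Every vertex with a finite label has degree equal to that label, except for the end vertices,
which every finite tree must have. -/
def IsThick {V : Type u} (G : SimpleGraph V) (lab : V → ℕ∞) : Prop :=
  ∀ t, lab t ≠ ⊤ → 1 < (G.neighborSet t).encard → (G.neighborSet t).encard = lab t

/-- The tree ordering of the tree `G` with root `r`. -/
def TreeLE {V : Type u} (G : SimpleGraph V) (r a b : V) : Prop := OnPath G r b a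

/-- `b` is an immediate successor of `a` in the tree `G` with root `r`. -/
def IsSucc {V : Type u} (G : SimpleGraph V) (r a b : V) : Prop := G.Adj a b ∧ TreeLE G r a b

/-- `lt` is a (strict) lexicographical ordering of the tree `G` with root `r`: a linear ordering
in which every vertex precedes its descendants, and in which, if `x` precedes `y` for two immediate
successors `x`, `y` of one vertex, then everything above `x` precedes everything above `y`. -/
structure IsLexOrder {V : Type u} (G : SimpleGraph V) (r : V) (lt : V → V → Prop) : Prop where
  strictTotal : IsStrictTotalOrder V lt
  anc : ∀ a b, TreeLE G r a b → a ≠ b → lt a b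
  lex : ∀ m x y a b, IsSucc G r m x → IsSucc G r m y → lt x y →
    TreeLE G r x a → TreeLE G r y b → lt a b

/-! ### The class of ordered trees -/

/-- Relation symbols: `R` (quaternary), `K p` for `p ∈ P` (unary), the ordering `prec` (binary),
`G i` for `i < max P` (binary), `C` (ternary). -/
inductive Rel (P : Set ℕ∞) : ℕ → Type
  | R : Rel P 4
  | K (p : P) : Rel P 1
  | prec : Rel P 2
  | G (i : {i : ℕ // (i : ℕ∞) < sSup P}) : Rel P 2
  | C : Rel P 3

/-- The (purely relational) language of ordered trees. -/
def lang (P : Set ℕ∞) : FirstOrder.Language.{0, 0} := ⟨fun _ => Empty, Rel P⟩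

/-- Membership in the class `𝒯^≺_P`: the structure `A` arises from a tree `T` on its
underlying set, with labels in `P`, by extending `T` to a thick tree `T'` with labels in `P`,
choosing a root `r` of `T'` among its end vertices, and a lexicographical ordering of `T'`.
The immediate successors of a vertex are numbered from `0`. -/
def IsOrderedTree (P : Set ℕ∞) (A : Type u) [(lang P).Structure A] : Prop :=
  ∃ (T : SimpleGraph A) (lab : A → ℕ∞)
    (V : Type u) (T' : SimpleGraph V) (lab' : V → ℕ∞) (e : T ↪g T') (r : V)
    (lt : V → V → Prop),
    IsPTree P T lab ∧ IsPTree P T' lab' ∧ (∀ a, lab' (e a) = lab a) ∧ IsThick T' lab' ∧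
    (T'.neighborSet r).encard = 1 ∧ IsLexOrder T' r lt ∧
    (∀ v : Fin 4 → A, Structure.RelMap (L := lang P) (Rel.R : Rel P 4) v ↔
      PathsDisjoint T (v 0) (v 1) (v 2) (v 3)) ∧
    (∀ (p : P) (v : Fin 1 → A), Structure.RelMap (L := lang P) (Rel.K p : Rel P 1) v ↔
      lab (v 0) = p) ∧
    (∀ v : Fin 2 → A, Structure.RelMap (L := lang P) (Rel.prec : Rel P 2) v ↔
      lt (e (v 0)) (e (v 1))) ∧
    (∀ (i : {i : ℕ // (i : ℕ∞) < sSup P}) (v : Fin 2 → A),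
      Structure.RelMap (L := lang P) (Rel.G i : Rel P 2) v ↔
      lab (v 0) ≠ ⊤ ∧ ∃ a', IsSucc T' r (e (v 0)) a' ∧ TreeLE T' r a' (e (v 1)) ∧
        {c | IsSucc T' r (e (v 0)) c ∧ lt c a'}.encard = (i : ℕ)) ∧
    (∀ v : Fin 3 → A, Structure.RelMap (L := lang P) (Rel.C : Rel P 3) v ↔
      PathsDisjoint T' (e (v 0)) (e (v 1)) (e (v 2)) r)

/-! ### Tuples of partial automorphisms, and amalgamation -/

/-- An `n`-tuple of partial automorphisms of an element of `𝒯^≺_P`, i.e. of isomorphisms between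
substructures that belong to `𝒯^≺_P` (possibly empty). -/
structure PartialAuts (P : Set ℕ∞) (n : ℕ) where
  carrier : Type u
  [str : (lang P).Structure carrier]
  isOrderedTree : IsOrderedTree P carrier
  maps : Fin n → (carrier ≃ₚ[lang P] carrier)
  dom_isOrderedTree : ∀ i, IsOrderedTree P (maps i).dom

attribute [instance] PartialAuts.str

/-- Embeddings of tuples of partial automorphisms: embeddings `φ` of the structures such that
`φ ∘ Sᵢ ⊆ Tᵢ ∘ φ`. -/
structure PartialAuts.Emb {P : Set ℕ∞} {n : ℕ} (S T : PartialAuts.{u} P n) where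
  toEmb : S.carrier ↪[lang P] T.carrier
  comm : ∀ i (x : (S.maps i).dom), ∃ h : toEmb x ∈ (T.maps i).dom,
    ((T.maps i).toEquiv ⟨toEmb x, h⟩ : T.carrier) = toEmb ((S.maps i).toEquiv x)

/-- The subclass `D` has the amalgamation property. -/
def HasAP {P : Set ℕ∞} {n : ℕ} (D : Set (PartialAuts.{u} P n)) : Prop :=
  ∀ A ∈ D, ∀ B₁ ∈ D, ∀ B₂ ∈ D, ∀ (φ₁ : A.Emb B₁) (φ₂ : A.Emb B₂),
    ∃ C ∈ D, ∃ (ψ₁ : B₁.Emb C) (ψ₂ : B₂.Emb C),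
      ∀ x, ψ₁.toEmb (φ₁.toEmb x) = ψ₂.toEmb (φ₂.toEmb x)

/-- The cofinal amalgamation property of the class of `n`-tuples of partial automorphisms. -/
def HasCAP (P : Set ℕ∞) (n : ℕ) : Prop :=
  ∃ D : Set (PartialAuts.{u} P n),
    (∀ S : PartialAuts.{u} P n, ∃ S' ∈ D, Nonempty (S.Emb S')) ∧ HasAP D

/-- The weak amalgamation property of the class of `n`-tuples of partial automorphisms. -/
def HasWAP (P : Set ℕ∞) (n : ℕ) : Prop :=
  ∀ A : PartialAuts.{u} P n, ∃ (A' : PartialAuts.{u} P n) (τ : A.Emb A'),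
    ∀ (B₁ B₂ : PartialAuts.{u} P n) (φ₁ : A'.Emb B₁) (φ₂ : A'.Emb B₂),
      ∃ (C : PartialAuts.{u} P n) (ψ₁ : B₁.Emb C) (ψ₂ : B₂.Emb C),
        ∀ x, ψ₁.toEmb (φ₁.toEmb (τ.toEmb x)) = ψ₂.toEmb (φ₂.toEmb (τ.toEmb x))

/-! ### The limit structures and their automorphism groups -/

/-- `M` is a generalized ordered Ważewski dendrite, i.e. a Fraïssé limit of `𝒯^≺_P`: a countable
structure that is the directed union of its substructures belonging to `𝒯^≺_P`, in which every
element of `𝒯^≺_P` embeds, and such that every isomorphism between substructures belonging to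
`𝒯^≺_P` extends to an automorphism. -/
structure IsWazewskiDendrite (P : Set ℕ∞) (M : Type u) [(lang P).Structure M] : Prop where
  countable : Countable M
  cofinal : ∀ s : Set M, s.Finite →
    ∃ N : (lang P).Substructure M, s ⊆ N ∧ IsOrderedTree P N
  universal : ∀ (A : Type u) [(lang P).Structure A], IsOrderedTree P A →
    Nonempty (A ↪[lang P] M)
  homogeneous : ∀ f : M ≃ₚ[lang P] M, IsOrderedTree P f.dom →
    ∃ g : M ≃[lang P] M, ∀ x : f.dom, g x = f.toEquiv x

/-- The automorphism group of an `L`-structure `M`. -/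
def autSubgroup (L : FirstOrder.Language.{0, 0}) (M : Type u) [L.Structure M] : Subgroup (Equiv.Perm M) where
  carrier := {g | ∃ f : M ≃[L] M, f.toEquiv = g}
  one_mem' := ⟨FirstOrder.Language.Equiv.refl L M, rfl⟩
  mul_mem' := by
    rintro _ _ ⟨f, rfl⟩ ⟨g, rfl⟩
    exact ⟨f.comp g, rfl⟩
  inv_mem' := by
    rintro _ ⟨f, rfl⟩
    exact ⟨f.symm, rfl⟩

/-- The type of automorphisms of `M`. -/
def Aut (L : FirstOrder.Language.{0, 0}) (M : Type u) [L.Structure M] : Type u := autSubgroup L M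

instance (L : FirstOrder.Language.{0, 0}) (M : Type u) [L.Structure M] : Group (Aut L M) :=
  inferInstanceAs (Group (autSubgroup L M))

/-- The topology of pointwise convergence, `M` being discrete. -/
instance (L : FirstOrder.Language.{0, 0}) (M : Type u) [L.Structure M] : TopologicalSpace (Aut L M) :=
  TopologicalSpace.induced (fun (g : autSubgroup L M) (x : M) => (g : Equiv.Perm M) x)
    (@Pi.topologicalSpace M (fun _ => M) (fun _ => ⊥))

/-- `G` has a comeager conjugacy class. -/
def HasComeagerConjClass (G : Type u) [Group G] [TopologicalSpace G] : Prop :=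
  ∃ f : G, {h : G | ∃ g : G, h = g * f * g⁻¹} ∈ residual G

/-- `G` has a comeager `n`-diagonal conjugacy class, i.e. a comeager orbit in `Gⁿ` for the
coordinatewise action of `G` by conjugation. -/
def HasComeagerDiagConjClass (G : Type u) [Group G] [TopologicalSpace G] (n : ℕ) : Prop :=
  ∃ f : Fin n → G, {h : Fin n → G | ∃ g : G, ∀ i, h i = g * f i * g⁻¹} ∈ residual (Fin n → G)

end Dendrite

/-!
A thick tree with a root and a lexicographical ordering is a finite meet-semilattice with a
linear order for which all cones `{x | a ≤ x}` are convex. The relations `C` and `R` are determined by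
the meets, `K` gives the labels, and `G` numbers the branches at the vertices of finite label. The
members of `𝒯^≺_P` are exactly the finite structures of this kind with labels in `P`, called ordered
meet-trees (`OTree`) below; see `isOrderedTree_iff`. Substructures that belong to the class are
meet-closed subsets, and partial automorphisms are generated by partial maps that respect the order
of meets, the linear order, labels and numbers (`PIso`). No finiteness is needed
for most of what follows: automorphisms of infinite ordered meet-trees are used throughout, and the
limit structure is an ordered meet-tree itself, with extension and homogeneity properties collected
in `Nice`.

The main tool is amalgamation of ordered meet-trees together with an automorphism
(`exists_amalgam`): extensions `N1`, `N2` of `N0`, each with an automorphism extending one and the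
same automorphism of `N0`, can be amalgamated if `N1` consists of finitely many orbits over `N0`.
Proceeding in suitable steps, one may assume that all branchings of `N1` already occur in `N0`, and
that either all new elements lie below elements of `N0`, or none does. In both cases the position
of the new elements relative to `N2` can be fixed by a rule that mentions `N0`, `N1` and `N2` only
(`glueRelIn`, `glueRelEnd`), and that is therefore respected by the automorphisms.

For single automorphisms, the iterates of a point form a monotone sequence in the linear order. Since
cones are convex, the meets within finitely many orbits again form finitely many orbits
(`finite_orbits`), and the relations between two orbits are given by convex sets of integers
(`exists_hasCode`). So there are only countably many types of finite families of orbits. If no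
extension of a finite partial automorphism determined the type of the orbits of its elements, then
a generic sequence of extensions would produce a type different from all of them; consequently
finite partial automorphisms that determine, or isolate, the type of the orbits are cofinal
(`exists_isolated`). Over an isolated part, any two extensions contain isomorphic copies of the
full orbits, over which they can be amalgamated (`Nice.exists_joint`). This gives CAP. It also shows
that the automorphisms that are isolated above every finite set and realise all extensions of their
isolated parts form a comeager set, and a back-and-forth argument conjugates any two of them
(`IsGeneric.exists_conj`).

For pairs, consider two automorphisms that both move a point `a₀` up to `a`. Whatever
further finite part of the two automorphisms is prescribed, some word in them can still either fix
or move `a` (`Nice.exists_word`). Such a pair of partial automorphisms therefore has, over each of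
its extensions, two incompatible further extensions, which contradicts WAP. If a diagonal conjugacy
class of pairs were comeager, then by Baire's theorem the conjugates in which `a` corresponds to a
fixed point `b` of the original pair would be dense in some open set of pairs that move `a₀` up to
`a`. In all of these, whether a word fixes `a` is decided by whether the original word fixes `b`, and
this again contradicts the choice of the word.
-/

namespace Dendrite

/-! ### Ordered meet-trees -/

/-- An ordered meet-tree: the intrinsic description of the structures of the class `𝒯^≺_P`, finite
or not. It is a meet-semilattice with a linear order `prec` that extends the strict tree order, and
for which every cone `{x | a ≤ x}` is convex (so that elements with a common upper bound are
comparable). `G i a b` says that `b` lies strictly above `a`, in the `i`-th cone at `a`; it is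
imposed at finite labels only. -/
class OTree (A : Type u) extends SemilatticeInf A where
  prec : A → A → Prop
  lab : A → ℕ∞
  G : ℕ → A → A → Prop
  prec_irrefl : ∀ a, ¬ prec a a
  prec_trans : ∀ {a b c}, prec a b → prec b c → prec a c
  prec_total : ∀ {a b}, a ≠ b → prec a b ∨ prec b a
  prec_of_lt : ∀ {a b : A}, a < b → prec a b
  convex : ∀ {a z c : A}, a ≤ c → prec a z → prec z c → a ≤ z
  two_le_lab : ∀ a, 2 ≤ lab a
  G_dom : ∀ {i} {a b : A}, G i a b → lab a ≠ ⊤ ∧ a < b ∧ (i : ℕ∞) + 1 < lab a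
  G_ex : ∀ {a b : A}, lab a ≠ ⊤ → a < b → ∃ i, G i a b
  G_uniq : ∀ {i j} {a b : A}, G i a b → G j a b → i = j
  G_mono : ∀ {i} {a b c : A}, G i a b → b ≤ c → G i a c
  G_sep : ∀ {i} {a b c : A}, G i a b → G i a c → b ⊓ c ≠ a
  G_prec : ∀ {i j} {a b c : A}, prec b c → G i a b → G j a c → i ≤ j

namespace OTree

variable {A B C : Type u} [OTree A] [OTree B] [OTree C]

/-- The non-strict version of `prec`. -/
def preceq (a b : A) : Prop := a = b ∨ prec a b

theorem preceq_refl (a : A) : preceq a a := Or.inl rfl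

theorem prec_asymm {a b : A} (h : prec a b) : ¬ prec b a :=
  fun h' => prec_irrefl a (prec_trans h h')

theorem preceq_of_le {a b : A} (h : a ≤ b) : preceq a b := by
  rcases h.eq_or_lt with h | h
  · exact Or.inl h
  · exact Or.inr (prec_of_lt h)

theorem preceq_trans {a b c : A} (h : preceq a b) (h' : preceq b c) : preceq a c := by
  rcases h with rfl | h
  · exact h'
  · rcases h' with rfl | h'
    · exact Or.inr h
    · exact Or.inr (prec_trans h h')

theorem prec_of_preceq_of_prec {a b c : A} (h : preceq a b) (h' : prec b c) : prec a c := by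
  rcases h with rfl | h
  · exact h'
  · exact prec_trans h h'

theorem prec_of_prec_of_preceq {a b c : A} (h : prec a b) (h' : preceq b c) : prec a c := by
  rcases h' with rfl | h'
  · exact h
  · exact prec_trans h h'

theorem preceq_or_prec (a b : A) : preceq a b ∨ prec b a := by
  by_cases h : a = b
  · exact Or.inl (Or.inl h)
  · rcases prec_total h with h | h
    · exact Or.inl (Or.inr h)
    · exact Or.inr h

theorem not_prec {a b : A} : ¬ prec a b ↔ preceq b a := by
  constructor
  · intro h; rcases preceq_or_prec b a with h' | h'
    · exact h'
    · exact absurd h' h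
  · rintro (rfl | h) h'
    · exact prec_irrefl _ h'
    · exact prec_asymm h h'

theorem not_preceq {a b : A} : ¬ preceq a b ↔ prec b a := by
  rw [← not_prec, not_not]

theorem convex' {a z c : A} (h : a ≤ c) (h1 : preceq a z) (h2 : preceq z c) : a ≤ z := by
  rcases h1 with rfl | h1
  · exact le_rfl
  · rcases h2 with rfl | h2
    · exact h
    · exact convex h h1 h2

theorem le_total_of_le {a b c : A} (ha : a ≤ c) (hb : b ≤ c) : a ≤ b ∨ b ≤ a := by
  rcases preceq_or_prec a b with h | h
  · exact Or.inl (convex' ha h (preceq_of_le hb))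
  · exact Or.inr (convex' hb (Or.inr h) (preceq_of_le ha))

theorem le_or_lt_of_le {a b c : A} (ha : a ≤ c) (hb : b ≤ c) : a ≤ b ∨ b < a := by
  rcases le_total_of_le ha hb with h | h
  · exact Or.inl h
  · rcases h.eq_or_lt with h | h
    · exact Or.inl h.ge
    · exact Or.inr h

/-- If `y` lies between `x` and `z` in the linear order, then `x ⊓ z ≤ y`. -/
theorem inf_le_of_between {x y z : A} (h1 : preceq x y) (h2 : preceq y z) : x ⊓ z ≤ y :=
  convex' inf_le_right (preceq_trans (preceq_of_le inf_le_left) h1) h2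

/-- Two elements above `a` whose meet is not `a` lie strictly above `a` in the same cone. -/
theorem lt_inf {a b c : A} (hb : a ≤ b) (hc : a ≤ c) (h : b ⊓ c ≠ a) : a < b ⊓ c :=
  lt_of_le_of_ne (le_inf hb hc) (Ne.symm h)

theorem G_iff_of_le {i : ℕ} {a b c : A} (hab : a < b) (hbc : b ≤ c) : G i a b ↔ G i a c := by
  refine ⟨fun h => G_mono h hbc, fun h => ?_⟩
  obtain ⟨j, hj⟩ := G_ex (G_dom h).1 hab
  rwa [G_uniq h (G_mono hj hbc)]

theorem G_eq_of_inf_ne {i j : ℕ} {a b c : A} (h : G i a b) (h' : G j a c) (hbc : b ⊓ c ≠ a) :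
    i = j := by
  have hlt := lt_inf (G_dom h).2.1.le (G_dom h').2.1.le hbc
  exact G_uniq ((G_iff_of_le hlt inf_le_left).2 h) ((G_iff_of_le hlt inf_le_right).2 h')

/-- The order among incomparable elements is inherited by the elements above them. -/
theorem prec_of_le_of_le {x y a b : A} (h : prec x y) (hxy : ¬ x ≤ y) (ha : x ≤ a) (hb : y ≤ b) :
    prec a b := by
  have h1 : prec a y := by
    by_contra hc
    exact hxy (convex' ha (Or.inr h) (not_prec.1 hc))
  exact prec_of_prec_of_preceq h1 (preceq_of_le hb)

/-- One of the three pairwise meets of three elements is the meet of all three. -/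
theorem inf_inf_eq (x y z : A) :
    x ⊓ y ⊓ z = x ⊓ y ∨ x ⊓ y ⊓ z = x ⊓ z := by
  rcases le_total_of_le (inf_le_left : x ⊓ y ≤ x) (inf_le_left : x ⊓ z ≤ x) with h | h
  · left
    exact le_antisymm inf_le_left (le_inf le_rfl (h.trans inf_le_right))
  · right
    exact le_antisymm (le_inf (inf_le_left.trans inf_le_left) inf_le_right)
      (le_inf h inf_le_right)

/-! ### Embeddings, substructures and generated partial isomorphisms -/

/-- Embeddings of ordered meet-trees. -/
structure IsEmb (φ : A → B) : Prop where
  map_inf : ∀ a b, φ (a ⊓ b) = φ a ⊓ φ b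
  prec_iff : ∀ a b, prec (φ a) (φ b) ↔ prec a b
  lab_eq : ∀ a, lab (φ a) = lab a
  G_iff : ∀ i a b, G i (φ a) (φ b) ↔ G i a b

namespace IsEmb

variable {φ : A → B} {ψ : B → C}

theorem injective (h : IsEmb φ) : Function.Injective φ := by
  intro a b hab
  by_contra hne
  rcases prec_total hne with h1 | h1
  · have := (h.prec_iff a b).2 h1
    rw [hab] at this; exact prec_irrefl _ this
  · have := (h.prec_iff b a).2 h1
    rw [hab] at this; exact prec_irrefl _ this

theorem eq_iff (h : IsEmb φ) {a b : A} : φ a = φ b ↔ a = b := h.injective.eq_iff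

theorem le_iff (h : IsEmb φ) {a b : A} : φ a ≤ φ b ↔ a ≤ b := by
  rw [← inf_eq_left, ← h.map_inf, h.eq_iff, inf_eq_left]

theorem lt_iff (h : IsEmb φ) {a b : A} : φ a < φ b ↔ a < b := by
  rw [lt_iff_le_not_ge, lt_iff_le_not_ge, h.le_iff, h.le_iff]

theorem preceq_iff (h : IsEmb φ) {a b : A} : preceq (φ a) (φ b) ↔ preceq a b := by
  rw [← not_prec, ← not_prec, h.prec_iff]

theorem comp (hψ : IsEmb ψ) (h : IsEmb φ) : IsEmb (ψ ∘ φ) where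
  map_inf a b := by simp [h.map_inf, hψ.map_inf]
  prec_iff a b := by simp [h.prec_iff, hψ.prec_iff]
  lab_eq a := by simp [h.lab_eq, hψ.lab_eq]
  G_iff i a b := by simp [h.G_iff, hψ.G_iff]

theorem id : IsEmb (id : A → A) := ⟨fun _ _ => rfl, fun _ _ => Iff.rfl, fun _ => rfl, fun _ _ _ => Iff.rfl⟩

theorem symm {e : A ≃ B} (h : IsEmb e) : IsEmb e.symm where
  map_inf a b := by rw [e.symm_apply_eq, h.map_inf]; simp
  prec_iff a b := by rw [← h.prec_iff]; simp
  lab_eq a := by rw [← h.lab_eq]; simp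
  G_iff i a b := by rw [← h.G_iff]; simp

theorem zpow {F : Equiv.Perm A} (h : IsEmb F) (k : ℤ) : IsEmb (F ^ k : Equiv.Perm A) := by
  have hn : ∀ n : ℕ, IsEmb (F ^ n : Equiv.Perm A) := by
    intro n
    induction n with
    | zero => exact IsEmb.id
    | succ n ih => rw [pow_succ]; exact ih.comp h
  obtain ⟨n, rfl | rfl⟩ := k.eq_nat_or_neg
  · simpa using hn n
  · rw [zpow_neg, zpow_natCast]; exact (hn n).symm

/-- A map that preserves and reflects the tree order and the remaining structure is an embedding as
soon as its range is closed under meets. -/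
theorem of_le_iff (φ : A → B) (hle : ∀ a b, φ a ≤ φ b ↔ a ≤ b)
    (hr : ∀ a b, ∃ c, φ c = φ a ⊓ φ b) (hprec : ∀ a b, prec (φ a) (φ b) ↔ prec a b)
    (hlab : ∀ a, lab (φ a) = lab a) (hG : ∀ i a b, G i (φ a) (φ b) ↔ G i a b) : IsEmb φ where
  map_inf a b := by
    obtain ⟨c, hc⟩ := hr a b
    rw [← hc]
    have h1 : c ≤ a := by rw [← hle, hc]; exact inf_le_left
    have h2 : c ≤ b := by rw [← hle, hc]; exact inf_le_right
    refine le_antisymm ?_ ((hle _ _).2 (le_inf h1 h2))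
    rw [hc]
    exact le_inf ((hle _ _).2 inf_le_left) ((hle _ _).2 inf_le_right)
  prec_iff := hprec
  lab_eq := hlab
  G_iff := hG

end IsEmb

/-- Closedness under meets. -/
def MeetClosed (S : Set A) : Prop := ∀ a ∈ S, ∀ b ∈ S, a ⊓ b ∈ S

/-- The ordered meet-tree carried by a meet-closed subset. -/
@[reducible] def sub (S : Set A) (hS : MeetClosed S) : OTree S where
  toSemilatticeInf := Subtype.semilatticeInf (fun {a b} ha hb => hS a ha b hb)
  prec a b := prec a.1 b.1
  lab a := lab a.1
  G i a b := G i a.1 b.1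
  prec_irrefl a := prec_irrefl a.1
  prec_trans := prec_trans
  prec_total h := prec_total (fun h' => h (Subtype.ext h'))
  prec_of_lt h := prec_of_lt h
  convex h := convex (A := A) h
  two_le_lab a := two_le_lab a.1
  G_dom h := G_dom (A := A) h
  G_ex h := G_ex (A := A) h
  G_uniq := G_uniq
  G_mono := fun h => G_mono (A := A) h
  G_sep h1 h2 h := G_sep h1 h2 (congrArg Subtype.val h)
  G_prec := G_prec

theorem isEmb_val (S : Set A) (hS : MeetClosed S) :
    let := sub S hS; IsEmb (Subtype.val : S → A) :=
  let := sub S hS; ⟨fun _ _ => rfl, fun _ _ => Iff.rfl, fun _ => rfl, fun _ _ _ => Iff.rfl⟩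

/-- The closure of a set under meets; by `inf_inf_eq` binary meets suffice. -/
def clos (S : Set A) : Set A := {x | ∃ p ∈ S, ∃ q ∈ S, p ⊓ q = x}

theorem subset_clos (S : Set A) : S ⊆ clos S := fun x hx => ⟨x, hx, x, hx, inf_idem x⟩

theorem clos_meetClosed (S : Set A) : MeetClosed (clos S) := by
  rintro _ ⟨p, hp, q, hq, rfl⟩ _ ⟨r, hr, s, hs, rfl⟩
  have key : ∀ x ∈ S, ∀ y ∈ S, ∀ z ∈ S, x ⊓ y ⊓ z ∈ clos S := by
    intro x hx y hy z hz
    rcases inf_inf_eq x y z with h | h <;> rw [h]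
    · exact ⟨x, hx, y, hy, rfl⟩
    · exact ⟨x, hx, z, hz, rfl⟩
  rw [← inf_assoc]
  obtain ⟨x, hx, y, hy, h⟩ := key p hp q hq r hr
  rw [← h]
  exact key x hx y hy s hs

theorem clos_mono {S T : Set A} (h : S ⊆ T) : clos S ⊆ clos T := by
  rintro _ ⟨p, hp, q, hq, rfl⟩; exact ⟨p, h hp, q, h hq, rfl⟩

theorem finite_clos {S : Set A} (h : S.Finite) : (clos S).Finite := by
  refine (h.image2 (fun p q => p ⊓ q) h).subset ?_
  rintro _ ⟨p, hp, q, hq, rfl⟩; exact ⟨p, hp, q, hq, rfl⟩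

/-- The relation `Γ` generates an isomorphism between the meet-closures of its projections. -/
def PIso (Γ : Set (A × B)) : Prop :=
  ∀ p ∈ Γ, ∀ q ∈ Γ, ∀ r ∈ Γ, ∀ s ∈ Γ,
    (p.1 ⊓ q.1 ≤ r.1 ⊓ s.1 ↔ p.2 ⊓ q.2 ≤ r.2 ⊓ s.2) ∧
    (prec (p.1 ⊓ q.1) (r.1 ⊓ s.1) ↔ prec (p.2 ⊓ q.2) (r.2 ⊓ s.2)) ∧
    lab (p.1 ⊓ q.1) = lab (p.2 ⊓ q.2) ∧
    ∀ i, G i (p.1 ⊓ q.1) (r.1 ⊓ s.1) ↔ G i (p.2 ⊓ q.2) (r.2 ⊓ s.2)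

theorem PIso.mono {Γ Δ : Set (A × B)} (h : PIso Δ) (hs : Γ ⊆ Δ) : PIso Γ :=
  fun p hp q hq r hr s hs' => h p (hs hp) q (hs hq) r (hs hr) s (hs hs')

theorem PIso.symm {Γ : Set (A × B)} (h : PIso Γ) : PIso (Prod.swap ⁻¹' Γ : Set (B × A)) := by
  intro p hp q hq r hr s hs
  obtain ⟨h1, h2, h3, h4⟩ := h _ hp _ hq _ hr _ hs
  exact ⟨h1.symm, h2.symm, h3.symm, fun i => (h4 i).symm⟩

theorem piso_of_isEmb {ι : Type*} {I : Type u} [OTree I] {φ : I → A} {ψ : I → B} (hφ : IsEmb φ)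
    (hψ : IsEmb ψ) (f : ι → I) : PIso (Set.range fun i => (φ (f i), ψ (f i))) := by
  rintro _ ⟨p, rfl⟩ _ ⟨q, rfl⟩ _ ⟨r, rfl⟩ _ ⟨s, rfl⟩
  simp only [← hφ.map_inf, ← hψ.map_inf, hφ.le_iff, hψ.le_iff, hφ.prec_iff, hψ.prec_iff,
    hφ.lab_eq, hψ.lab_eq, hφ.G_iff, hψ.G_iff]
  simp

/-- Embeddings may be applied to either side of a partial isomorphism. -/
theorem PIso.map {A' B' : Type u} [OTree A'] [OTree B'] {Γ : Set (A × B)} (h : PIso Γ)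
    {φ : A → A'} {ψ : B → B'} (hφ : IsEmb φ) (hψ : IsEmb ψ) : PIso (Prod.map φ ψ '' Γ) := by
  rintro _ ⟨p, hp, rfl⟩ _ ⟨q, hq, rfl⟩ _ ⟨r, hr, rfl⟩ _ ⟨s, hs, rfl⟩
  simp only [Prod.map_fst, Prod.map_snd, ← hφ.map_inf, ← hψ.map_inf, hφ.le_iff, hψ.le_iff,
    hφ.prec_iff, hψ.prec_iff, hφ.lab_eq, hψ.lab_eq, hφ.G_iff, hψ.G_iff]
  exact h p hp q hq r hr s hs

theorem PIso.of_map {A' B' : Type u} [OTree A'] [OTree B'] {Γ : Set (A × B)}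
    {φ : A → A'} {ψ : B → B'} (hφ : IsEmb φ) (hψ : IsEmb ψ) (h : PIso (Prod.map φ ψ '' Γ)) :
    PIso Γ := by
  intro p hp q hq r hr s hs
  have := h _ ⟨p, hp, rfl⟩ _ ⟨q, hq, rfl⟩ _ ⟨r, hr, rfl⟩ _ ⟨s, hs, rfl⟩
  simpa only [Prod.map_fst, Prod.map_snd, ← hφ.map_inf, ← hψ.map_inf, hφ.le_iff, hψ.le_iff,
    hφ.prec_iff, hψ.prec_iff, hφ.lab_eq, hψ.lab_eq, hφ.G_iff, hψ.G_iff] using this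

theorem PIso.comp {Γ : Set (A × B)} {Δ : Set (B × C)} (h : PIso Γ) (h' : PIso Δ) :
    PIso {p : A × C | ∃ b, (p.1, b) ∈ Γ ∧ (b, p.2) ∈ Δ} := by
  rintro p ⟨p', hp, hp'⟩ q ⟨q', hq, hq'⟩ r ⟨r', hr, hr'⟩ s ⟨s', hs, hs'⟩
  obtain ⟨h1, h2, h3, h4⟩ := h _ hp _ hq _ hr _ hs
  obtain ⟨g1, g2, g3, g4⟩ := h' _ hp' _ hq' _ hr' _ hs'
  exact ⟨h1.trans g1, h2.trans g2, h3.trans g3, fun i => (h4 i).trans (g4 i)⟩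

theorem PIso.eq_iff {Γ : Set (A × B)} (h : PIso Γ) {p q : A × B} (hp : p ∈ Γ) (hq : q ∈ Γ) :
    p.1 = q.1 ↔ p.2 = q.2 := by
  have h1 := (h p hp p hp q hq q hq).1
  have h2 := (h q hq q hq p hp p hp).1
  simp only [inf_idem] at h1 h2
  rw [le_antisymm_iff, h1, h2, ← le_antisymm_iff]

/-- The isomorphism between meet-closures that a partial isomorphism generates. -/
theorem PIso.exists_equiv {Γ : Set (A × B)} (h : PIso Γ) :
    let := sub _ (clos_meetClosed (Prod.fst '' Γ))
    let := sub _ (clos_meetClosed (Prod.snd '' Γ))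
    ∃ e : clos (Prod.fst '' Γ) ≃ clos (Prod.snd '' Γ), IsEmb e ∧
      ∀ p (hp : p ∈ Γ), (e ⟨p.1, subset_clos _ ⟨p, hp, rfl⟩⟩ : B) = p.2 := by
  let := sub _ (clos_meetClosed (Prod.fst '' Γ))
  let := sub _ (clos_meetClosed (Prod.snd '' Γ))
  have h1 : ∀ x : clos (Prod.fst '' Γ), ∃ w : (A × B) × (A × B), w.1 ∈ Γ ∧ w.2 ∈ Γ ∧
      w.1.1 ⊓ w.2.1 = x := by
    rintro ⟨_, _, ⟨p, hp, rfl⟩, _, ⟨q, hq, rfl⟩, rfl⟩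
    exact ⟨(p, q), hp, hq, rfl⟩
  choose w hw1 hw2 hw using h1
  let φ : clos (Prod.fst '' Γ) → clos (Prod.snd '' Γ) := fun x =>
    ⟨(w x).1.2 ⊓ (w x).2.2, _, ⟨_, hw1 x, rfl⟩, _, ⟨_, hw2 x, rfl⟩, rfl⟩
  have key := fun x y => h _ (hw1 x) _ (hw2 x) _ (hw1 y) _ (hw2 y)
  simp only [hw] at key
  have hval : ∀ p (hp : p ∈ Γ) q (hq : q ∈ Γ) (x : clos (Prod.fst '' Γ)),
      p.1 ⊓ q.1 = x.1 → (φ x : B) = p.2 ⊓ q.2 := by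
    intro p hp q hq x hx
    have k1 := (h _ (hw1 x) _ (hw2 x) _ hp _ hq).1
    have k2 := (h _ hp _ hq _ (hw1 x) _ (hw2 x)).1
    rw [hw, hx] at k1 k2
    exact le_antisymm (k1.1 le_rfl) (k2.1 le_rfl)
  have hsurj : Function.Surjective φ := by
    rintro ⟨_, _, ⟨p, hp, rfl⟩, _, ⟨q, hq, rfl⟩, rfl⟩
    refine ⟨⟨p.1 ⊓ q.1, _, ⟨p, hp, rfl⟩, _, ⟨q, hq, rfl⟩, rfl⟩, ?_⟩
    exact Subtype.ext (hval p hp q hq _ rfl)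
  have hemb : IsEmb φ := by
    refine IsEmb.of_le_iff φ (fun a b => (key a b).1.symm) (fun a b => hsurj _)
      (fun a b => (key a b).2.1.symm) (fun a => (key a a).2.2.1.symm)
      (fun i a b => ((key a b).2.2.2 i).symm)
  refine ⟨Equiv.ofBijective φ ⟨hemb.injective, hsurj⟩, hemb, fun p hp => ?_⟩
  have := hval p hp p hp ⟨p.1, subset_clos _ ⟨p, hp, rfl⟩⟩ (inf_idem _)
  rw [inf_idem] at this
  exact this

end OTree
end Dendrite

namespace Dendrite
namespace OTree

/-! ### Gluing an extension without new branchings -/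

section Glue

set_option linter.unusedSectionVars false

variable {N0 N1 N2 : Type u} [OTree N0] [OTree N1] [OTree N2]

/-- The elements of `N1` outside `N0`. -/
abbrev NewPart (i1 : N0 → N1) : Type u := {x : N1 // x ∉ Set.range i1}

/-- The relation `y < x` between `y` in `N2` and a new element `x` of `N1`. -/
def Below (i1 : N0 → N1) (i2 : N0 → N2) (y : N2) (x : N1) : Prop := ∃ n, y ≤ i2 n ∧ i1 n < x

theorem Below.mono {i1 : N0 → N1} {i2 : N0 → N2} {y y' : N2} {x : N1} (h : Below i1 i2 y x)
    (hy : y' ≤ y) : Below i1 i2 y' x := by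
  obtain ⟨n, h1, h2⟩ := h; exact ⟨n, hy.trans h1, h2⟩

theorem Below.mono_right {i1 : N0 → N1} {i2 : N0 → N2} {y : N2} {x x' : N1} (h : Below i1 i2 y x)
    (hx : x ≤ x') : Below i1 i2 y x' := by
  obtain ⟨n, h1, h2⟩ := h; exact ⟨n, h1, h2.trans_le hx⟩

theorem below_i2 {i1 : N0 → N1} {i2 : N0 → N2} (h1 : IsEmb i1) (h2 : IsEmb i2) {x : N1} {n : N0} :
    Below i1 i2 (i2 n) x ↔ i1 n < x := by
  constructor
  · rintro ⟨m, h, h'⟩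
    exact lt_of_le_of_lt (h1.le_iff.2 (h2.le_iff.1 h)) h'
  · exact fun h => ⟨n, le_rfl, h⟩

theorem new_ne {i1 : N0 → N1} (x : NewPart i1) (n : N0) : i1 n ≠ x.1 := fun h => x.2 ⟨n, h⟩

/-- The requirements on two relations `Dir x y` and `L y x`, meant to become `x < y` and `prec y x`,
between the new elements `x` of `N1` and the elements `y` of `N2`, under which `N1` and `N2` can be
glued along `N0`. The field `tight` says that all branchings of `N1` occur in `N0`. -/
structure GlueRel (i1 : N0 → N1) (i2 : N0 → N2) (Dir : NewPart i1 → N2 → Prop)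
    (L : N2 → NewPart i1 → Prop) : Prop where
  emb1 : IsEmb i1
  emb2 : IsEmb i2
  tight : ∀ a b : N1, a ≤ b ∨ b ≤ a ∨ ∃ n, i1 n = a ⊓ b
  dir_old : ∀ x n, Dir x (i2 n) ↔ x.1 < i1 n
  dir_up : ∀ x {y y'}, y ≤ y' → Dir x y → Dir x y'
  dir_down : ∀ {x x' : NewPart i1} y, x.1 ≤ x'.1 → Dir x' y → Dir x y
  dir_le : ∀ {x n y}, i1 n < x.1 → Dir x y → i2 n ≤ y
  dir_inf : ∀ {x y y'}, Dir x y → Dir x y' → Dir x (y ⊓ y')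
  dir_glb : ∀ {x y}, ¬ Dir x y → ∃ m, Below i1 i2 m x ∧ m ≤ y ∧ (∀ n, i1 n < x.1 → i2 n ⊓ y ≤ m) ∧
    ∀ x' : NewPart i1, x'.1 ≤ x.1 → Dir x' y → Dir x' m
  L_down : ∀ {x y y'}, prec y' y → L y x → L y' x
  L_up : ∀ {x x' : NewPart i1} {y}, prec x.1 x'.1 → L y x → L y x'
  L_old : ∀ x n, L (i2 n) x ↔ prec (i1 n) x.1
  L_dir : ∀ {x y}, Dir x y → ¬ L y x
  convex_old : ∀ {x n y}, i1 n < x.1 → prec (i2 n) y → L y x → i2 n ≤ y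
  convex_left : ∀ {x y y'}, L y x → ¬ L y' x → y ≤ y' → Below i1 i2 y x
  convex_right : ∀ {x y y'}, Dir x y' → ¬ L y x → prec y y' → Dir x y
  convex_mid : ∀ {x x' : NewPart i1} {y}, x.1 ≤ x'.1 → ¬ L y x → L y x' → Dir x y
  convex_new : ∀ {x x' : NewPart i1} {y}, Dir x y → prec x.1 x'.1 → ¬ L y x' → x.1 ≤ x'.1
  G_dir : ∀ {x n y i}, Dir x y → G i (i1 n) x.1 → G i (i2 n) y
  G_split : ∀ {x n y i}, G i (i1 n) x.1 → G i (i2 n) y → ¬ Dir x y →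
    ∃ n', i1 n' < x.1 ∧ i2 n' ⊓ y ≠ i2 n ∧ n ≤ n'
  G_left : ∀ {x n y i j}, L y x → G i (i2 n) y → G j (i1 n) x.1 → i ≤ j
  G_right : ∀ {x n y i j}, ¬ L y x → G i (i2 n) y → G j (i1 n) x.1 → j ≤ i

/-- A partial order in which any two elements have a greatest lower bound is a meet-semilattice. -/
@[reducible] noncomputable def semilatticeInfOfGLB (α : Type u) [PartialOrder α]
    (h : ∀ a b : α, ∃ m, m ≤ a ∧ m ≤ b ∧ ∀ c, c ≤ a → c ≤ b → c ≤ m) : SemilatticeInf α where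
  inf a b := (h a b).choose
  inf_le_left a b := (h a b).choose_spec.1
  inf_le_right a b := (h a b).choose_spec.2.1
  le_inf a b c h1 h2 := (h b c).choose_spec.2.2 a h1 h2

variable {i1 : N0 → N1} {i2 : N0 → N2} {Dir : NewPart i1 → N2 → Prop}
  {L : N2 → NewPart i1 → Prop}

/-- The underlying set of the glued tree. -/
inductive Glued (i1 : N0 → N1) (N2 : Type u) : Type u
  | old (y : N2) : Glued i1 N2
  | new (x : NewPart i1) : Glued i1 N2

/-- The tree order of the glued tree. -/
def glueLE (i1 : N0 → N1) (i2 : N0 → N2) (Dir : NewPart i1 → N2 → Prop) :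
    Glued i1 N2 → Glued i1 N2 → Prop
  | .old y, .old y' => y ≤ y'
  | .old y, .new x => Below i1 i2 y x
  | .new x, .old y => Dir x y
  | .new x, .new x' => x.1 ≤ x'.1

/-- The linear order of the glued tree. -/
def gluePrec (i1 : N0 → N1) (L : N2 → NewPart i1 → Prop) :
    Glued i1 N2 → Glued i1 N2 → Prop
  | .old y, .old y' => prec y y'
  | .old y, .new x => L y x
  | .new x, .old y => ¬ L y x
  | .new x, .new x' => prec x.1 x'.1

/-- The numbering of cones of the glued tree. A new element has at most one cone in the glued tree;
it gets the number that it has in `N1`, or else the number `0`. -/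
def glueG (i1 : N0 → N1) (i2 : N0 → N2) (Dir : NewPart i1 → N2 → Prop) (i : ℕ) :
    Glued i1 N2 → Glued i1 N2 → Prop
  | .old y, .old y' => G i y y'
  | .old y, .new x => (∃ n, y < i2 n ∧ i1 n < x.1 ∧ G i y (i2 n)) ∨ ∃ n, y = i2 n ∧ G i (i1 n) x.1
  | .new x, .old y => Dir x y ∧ lab x.1 ≠ ⊤ ∧ ((∃ z, G i x.1 z) ∨ ((∀ z, ¬ x.1 < z) ∧ i = 0))
  | .new x, .new x' => G i x.1 x'.1

namespace GlueRel

theorem not_below_dir (g : GlueRel i1 i2 Dir L) {x : NewPart i1} {y : N2} (h : Below i1 i2 y x.1) : ¬ Dir x y := by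
  obtain ⟨n, h1, h2⟩ := h
  intro hd
  exact lt_asymm h2 ((g.dir_old x n).1 (g.dir_up x h1 hd))

theorem below_old (g : GlueRel i1 i2 Dir L) {x : NewPart i1} {n : N0} :
    Below i1 i2 (i2 n) x.1 ↔ i1 n < x.1 := below_i2 g.emb1 g.emb2

theorem L_of_below (g : GlueRel i1 i2 Dir L) {x : NewPart i1} {y : N2} (h : Below i1 i2 y x.1) : L y x := by
  obtain ⟨n, h1, h2⟩ := h
  have h3 := (g.L_old x n).2 (prec_of_lt h2)
  rcases preceq_of_le h1 with rfl | h4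
  · exact h3
  · exact g.L_down h4 h3

theorem dir_of_le_of_below (g : GlueRel i1 i2 Dir L) {x x' : NewPart i1} {y : N2} (h : Dir x y) (h' : Below i1 i2 y x'.1) :
    x.1 ≤ x'.1 := by
  obtain ⟨n, h1, h2⟩ := h'
  exact ((g.dir_old x n).1 (g.dir_up x h1 h)).le.trans h2.le

/-- New elements are not branchings. -/
theorem inf_ne_new (g : GlueRel i1 i2 Dir L) {x : NewPart i1} {z z' : N1} (hz : x.1 < z) (hz' : x.1 < z') :
    z ⊓ z' ≠ x.1 := by
  rcases g.tight z z' with h | h | ⟨n, h⟩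
  · rw [inf_eq_left.2 h]; exact hz.ne'
  · rw [inf_eq_right.2 h]; exact hz'.ne'
  · rw [← h]; exact new_ne x n

/-- The partial order of the glued tree. -/
@[reducible] def partialOrder (g : GlueRel i1 i2 Dir L) : PartialOrder (Glued i1 N2) where
  le := glueLE i1 i2 Dir
  lt a b := glueLE i1 i2 Dir a b ∧ ¬ glueLE i1 i2 Dir b a
  lt_iff_le_not_ge _ _ := Iff.rfl
  le_refl a := by rcases a with y | x <;> exact le_rfl
  le_trans a b c h h' := by
    rcases a with y | x <;> rcases b with y' | x' <;> rcases c with y'' | x''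
    · exact le_trans (α := N2) h h'
    · exact Below.mono h' h
    · obtain ⟨n, h1, h2⟩ := h
      exact h1.trans (g.dir_le h2 h')
    · exact Below.mono_right h h'
    · exact g.dir_up x h' h
    · exact g.dir_of_le_of_below h h'
    · exact g.dir_down _ h h'
    · exact le_trans (α := N1) h h'
  le_antisymm a b h h' := by
    rcases a with y | x <;> rcases b with y' | x'
    · exact congrArg _ (le_antisymm (α := N2) h h')
    · exact absurd h' (g.not_below_dir h)
    · exact absurd h (g.not_below_dir h')
    · exact congrArg _ (Subtype.ext (le_antisymm (α := N1) h h'))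

/-- The meet of a new element `x` and `y` in `N2` is `x` if `Dir x y`, and otherwise an element of `N2`
that `dir_glb` provides. Meets of two new elements exist by `tight`. -/
theorem exists_glb (g : GlueRel i1 i2 Dir L) (a b : Glued i1 N2) : ∃ m, glueLE i1 i2 Dir m a ∧ glueLE i1 i2 Dir m b ∧
    ∀ c, glueLE i1 i2 Dir c a → glueLE i1 i2 Dir c b → glueLE i1 i2 Dir c m := by
  have mixed : ∀ (y : N2) (x : NewPart i1), ∃ m, glueLE i1 i2 Dir m (.old y) ∧
      glueLE i1 i2 Dir m (.new x) ∧ ∀ c, glueLE i1 i2 Dir c (.old y) →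
        glueLE i1 i2 Dir c (.new x) → glueLE i1 i2 Dir c m := by
    intro y x
    by_cases hd : Dir x y
    · exact ⟨.new x, hd, le_rfl (a := x.1), fun c _ h => h⟩
    · obtain ⟨m, h1, h2, h3, h4⟩ := g.dir_glb hd
      refine ⟨.old m, h2, h1, ?_⟩
      rintro (y' | x') hc hc'
      · obtain ⟨n, hn, hn'⟩ := hc'
        exact (le_inf hn hc).trans (h3 n hn')
      · exact h4 x' hc' hc
  rcases a with y | x <;> rcases b with y' | x'
  · refine ⟨.old (y ⊓ y'), inf_le_left (α := N2), inf_le_right (α := N2), ?_⟩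
    rintro (y'' | x'') h h'
    · exact le_inf (α := N2) h h'
    · exact g.dir_inf h h'
  · exact mixed y x'
  · obtain ⟨m, h1, h2, h3⟩ := mixed y' x
    exact ⟨m, h2, h1, fun c hc hc' => h3 c hc' hc⟩
  · rcases g.tight x.1 x'.1 with h | h | ⟨n, h⟩
    · exact ⟨.new x, le_rfl (a := x.1), h, fun c hc _ => hc⟩
    · exact ⟨.new x', h, le_rfl (a := x'.1), fun c _ hc => hc⟩
    · have hn : i1 n < x.1 := lt_of_le_of_ne (h ▸ inf_le_left) (new_ne x n)
      have hn' : i1 n < x'.1 := lt_of_le_of_ne (h ▸ inf_le_right) (new_ne x' n)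
      refine ⟨.old (i2 n), ⟨n, le_rfl, hn⟩, ⟨n, le_rfl, hn'⟩, ?_⟩
      rintro (y | x'') hc hc'
      · obtain ⟨m, h1, h2⟩ := hc
        obtain ⟨m', h1', h2'⟩ := hc'
        refine (le_inf h1 h1').trans ?_
        rw [← g.emb2.map_inf, g.emb2.le_iff, ← g.emb1.le_iff, h, g.emb1.map_inf]
        exact inf_le_inf h2.le h2'.le
      · have hx : x''.1 ≤ i1 n := by rw [h]; exact le_inf (α := N1) hc hc'
        exact (g.dir_old x'' n).2 (lt_of_le_of_ne hx (new_ne x'' n).symm)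

/-- The meet-semilattice structure of the glued tree. -/
@[reducible] noncomputable def semilattice (g : GlueRel i1 i2 Dir L) : SemilatticeInf (Glued i1 N2) :=
  letI := g.partialOrder
  semilatticeInfOfGLB _ g.exists_glb

theorem le_iff (g : GlueRel i1 i2 Dir L) (a b : Glued i1 N2) :
    letI := g.semilattice
    a ≤ b ↔ glueLE i1 i2 Dir a b := Iff.rfl

theorem old_lt_old (g : GlueRel i1 i2 Dir L) {y y' : N2} :
    letI := g.semilattice
    (Glued.old y : Glued i1 N2) < .old y' ↔ y < y' := by
  let := g.semilattice
  rw [lt_iff_le_not_ge, lt_iff_le_not_ge]; exact Iff.rfl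

theorem new_lt_new (g : GlueRel i1 i2 Dir L) {x x' : NewPart i1} :
    letI := g.semilattice
    (Glued.new x : Glued i1 N2) < .new x' ↔ x.1 < x'.1 := by
  let := g.semilattice
  rw [lt_iff_le_not_ge, lt_iff_le_not_ge]; exact Iff.rfl

theorem old_lt_new (g : GlueRel i1 i2 Dir L) {y : N2} {x : NewPart i1} :
    letI := g.semilattice
    (Glued.old y : Glued i1 N2) < .new x ↔ Below i1 i2 y x.1 := by
  let := g.semilattice
  rw [lt_iff_le_not_ge]
  exact ⟨fun h => h.1, fun h => ⟨h, g.not_below_dir h⟩⟩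

theorem new_lt_old (g : GlueRel i1 i2 Dir L) {y : N2} {x : NewPart i1} :
    letI := g.semilattice
    (Glued.new x : Glued i1 N2) < .old y ↔ Dir x y := by
  let := g.semilattice
  rw [lt_iff_le_not_ge]
  exact ⟨fun h => h.1, fun h => ⟨h, fun h' => g.not_below_dir h' h⟩⟩

theorem glue_convex (g : GlueRel i1 i2 Dir L) {a z c : Glued i1 N2} (h : glueLE i1 i2 Dir a c)
    (h1 : gluePrec i1 L a z) (h2 : gluePrec i1 L z c) : glueLE i1 i2 Dir a z := by
  have c1 : ∀ {n y' y} {x : NewPart i1}, y ≤ i2 n → i1 n < x.1 → prec y y' → L y' x → y ≤ y' := by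
    intro n y' y x hy hn hp hl
    rcases preceq_or_prec y' (i2 n) with h | h
    · exact convex' hy (Or.inr hp) h
    · exact hy.trans (g.convex_old hn h hl)
  rcases a with y | x <;> rcases z with y' | x' <;> rcases c with y'' | x''
  · exact convex (A := N2) h h1 h2
  · obtain ⟨n, hn, hn'⟩ := h
    exact c1 hn hn' h1 h2
  · exact g.convex_left h1 h2 h
  · obtain ⟨n, hn, hn'⟩ := h
    by_cases hl : L (i2 n) x'
    · have h3 := (g.L_old x' n).1 hl
      exact ⟨n, hn, lt_of_le_of_ne (convex hn'.le h3 h2) (new_ne x' n)⟩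
    · exact g.convex_left h1 hl hn
  · exact g.convex_right h h1 h2
  · exact g.convex_mid h h1 h2
  · exact g.convex_new h h1 h2
  · exact convex (A := N1) h h1 h2

theorem glueG_new_uniq (g : GlueRel i1 i2 Dir L) {i j : ℕ} {x : NewPart i1} {b c : Glued i1 N2}
    (h : glueG i1 i2 Dir i (.new x) b) (h' : glueG i1 i2 Dir j (.new x) c) : i = j := by
  have h1 : ∀ {k} {b : Glued i1 N2}, glueG i1 i2 Dir k (.new x) b →
      (∃ z, G k x.1 z) ∨ ((∀ z, ¬ x.1 < z) ∧ k = 0) := by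
    rintro k (y | x') hk
    · exact hk.2.2
    · exact Or.inl ⟨_, hk⟩
  rcases h1 h with ⟨z, hz⟩ | ⟨hz, rfl⟩ <;> rcases h1 h' with ⟨z', hz'⟩ | ⟨hz', rfl⟩
  · exact G_eq_of_inf_ne hz hz' (g.inf_ne_new (G_dom hz).2.1 (G_dom hz').2.1)
  · exact absurd (G_dom hz).2.1 (hz' z)
  · exact absurd (G_dom hz').2.1 (hz z')
  · rfl

theorem glueG_old_new (g : GlueRel i1 i2 Dir L) {i : ℕ} {n : N0} {x : NewPart i1} :
    glueG i1 i2 Dir i (.old (i2 n)) (.new x) ↔ G i (i1 n) x.1 := by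
  constructor
  · rintro (⟨m, h1, h2, h3⟩ | ⟨m, h1, h2⟩)
    · exact G_mono ((g.emb1.G_iff _ _ _).2 ((g.emb2.G_iff _ _ _).1 h3)) h2.le
    · rwa [g.emb2.injective h1]
  · exact fun h => Or.inr ⟨n, rfl, h⟩

/-- The label of an element of the glued tree. -/
def glueLab (i1 : N0 → N1) (N2 : Type u) [OTree N2] : Glued i1 N2 → ℕ∞
  | .old y => lab y
  | .new x => lab x.1

theorem glueG_dom (g : GlueRel i1 i2 Dir L) {i : ℕ} {a b : Glued i1 N2}
    (h : glueG i1 i2 Dir i a b) :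
    letI := g.semilattice
    glueLab i1 N2 a ≠ ⊤ ∧ a < b ∧ (i : ℕ∞) + 1 < glueLab i1 N2 a := by
  rcases a with y | x <;> rcases b with y' | x'
  · obtain ⟨h1, h2, h3⟩ := G_dom (A := N2) h
    exact ⟨h1, g.old_lt_old.2 h2, h3⟩
  · rcases h with ⟨n, hn, hn', h⟩ | ⟨n, rfl, h⟩
    · obtain ⟨h1, h2, h3⟩ := G_dom h
      exact ⟨h1, g.old_lt_new.2 ⟨n, hn.le, hn'⟩, h3⟩
    · obtain ⟨h1, h2, h3⟩ := G_dom h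
      have : glueLab i1 N2 (.old (i2 n)) = lab (i1 n) := by
        change lab (i2 n) = _
        rw [g.emb1.lab_eq, g.emb2.lab_eq]
      rw [this]
      exact ⟨h1, g.old_lt_new.2 ⟨n, le_rfl, h2⟩, h3⟩
  · obtain ⟨h1, h2, h3⟩ := h
    refine ⟨h2, g.new_lt_old.2 h1, ?_⟩
    rcases h3 with ⟨z, hz⟩ | ⟨-, rfl⟩
    · exact (G_dom hz).2.2
    · refine lt_of_lt_of_le ?_ (two_le_lab x.1)
      norm_num
  · obtain ⟨h1, h2, h3⟩ := G_dom (A := N1) h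
    exact ⟨h1, g.new_lt_new.2 h2, h3⟩

theorem glueG_ex (g : GlueRel i1 i2 Dir L) {a b : Glued i1 N2} (h : glueLab i1 N2 a ≠ ⊤)
    (hab : letI := g.semilattice; a < b) : ∃ i, glueG i1 i2 Dir i a b := by
  rcases a with y | x <;> rcases b with y' | x'
  · exact G_ex (A := N2) h (g.old_lt_old.1 hab)
  · obtain ⟨n, hn, hn'⟩ := g.old_lt_new.1 hab
    rcases hn.eq_or_lt with rfl | hn
    · have : lab (i1 n) ≠ ⊤ := by rw [g.emb1.lab_eq, ← g.emb2.lab_eq]; exact h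
      obtain ⟨i, hi⟩ := G_ex this hn'
      exact ⟨i, Or.inr ⟨n, rfl, hi⟩⟩
    · obtain ⟨i, hi⟩ := G_ex h hn
      exact ⟨i, Or.inl ⟨n, hn, hn', hi⟩⟩
  · have hd := g.new_lt_old.1 hab
    by_cases hz : ∃ z, x.1 < z
    · obtain ⟨z, hz⟩ := hz
      obtain ⟨i, hi⟩ := G_ex h hz
      exact ⟨i, hd, h, Or.inl ⟨z, hi⟩⟩
    · push Not at hz
      exact ⟨0, hd, h, Or.inr ⟨hz, rfl⟩⟩
  · exact G_ex (A := N1) h (g.new_lt_new.1 hab)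

theorem glueG_mono (g : GlueRel i1 i2 Dir L) {i : ℕ} {a b c : Glued i1 N2}
    (h : glueG i1 i2 Dir i a b) (hbc : glueLE i1 i2 Dir b c) : glueG i1 i2 Dir i a c := by
  rcases a with y | x
  · rcases b with y' | x' <;> rcases c with y'' | x''
    · exact G_mono (A := N2) h hbc
    · obtain ⟨n, hn, hn'⟩ := hbc
      exact Or.inl ⟨n, ((G_dom (A := N2) h).2.1).trans_le hn, hn', G_mono (A := N2) h hn⟩
    · rcases h with ⟨n, hn, hn', h⟩ | ⟨n, rfl, h⟩
      · exact G_mono (A := N2) h (g.dir_le hn' hbc)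
      · exact g.G_dir hbc h
    · rcases h with ⟨n, hn, hn', h⟩ | ⟨n, rfl, h⟩
      · exact Or.inl ⟨n, hn, hn'.trans_le hbc, h⟩
      · exact Or.inr ⟨n, rfl, G_mono (A := N1) h hbc⟩
  · have hlt : letI := g.semilattice; (.new x : Glued i1 N2) < c := by
      let := g.semilattice
      exact lt_of_lt_of_le (g.glueG_dom h).2.1 hbc
    obtain ⟨j, hj⟩ := g.glueG_ex (g.glueG_dom h).1 hlt
    rwa [g.glueG_new_uniq h hj]

theorem glueG_sep (g : GlueRel i1 i2 Dir L) {i : ℕ} {a b c : Glued i1 N2}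
    (h : glueG i1 i2 Dir i a b) (h' : glueG i1 i2 Dir i a c) :
    ∃ d, glueLE i1 i2 Dir d b ∧ glueLE i1 i2 Dir d c ∧ ¬ glueLE i1 i2 Dir d a := by
  have mixed : ∀ {y y' : N2} {x : NewPart i1}, glueG i1 i2 Dir i (.old y) (.old y') →
      glueG i1 i2 Dir i (.old y) (.new x) →
      ∃ d, glueLE i1 i2 Dir d (.old y') ∧ glueLE i1 i2 Dir d (.new x) ∧
        ¬ glueLE i1 i2 Dir d (.old y) := by
    intro y y' x h h'
    rcases h' with ⟨n, hn, hn', h'⟩ | ⟨n, rfl, h'⟩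
    · have h1 := lt_inf (G_dom (A := N2) h).2.1.le (G_dom h').2.1.le (G_sep (A := N2) h h')
      exact ⟨.old (y' ⊓ i2 n), inf_le_left (α := N2), ⟨n, inf_le_right, hn'⟩, h1.not_ge⟩
    · by_cases hd : Dir x y'
      · exact ⟨.new x, hd, le_rfl (a := x.1),
          fun hx => lt_asymm (G_dom h').2.1 ((g.dir_old x n).1 hx)⟩
      · obtain ⟨n', h1, h2, h3⟩ := g.G_split h' h hd
        have h4 := lt_inf (g.emb2.le_iff.2 h3) (G_dom (A := N2) h).2.1.le h2
        exact ⟨.old (i2 n' ⊓ y'), inf_le_right (α := N2), ⟨n', inf_le_left, h1⟩, h4.not_ge⟩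
  rcases a with y | x
  · rcases b with y' | x' <;> rcases c with y'' | x''
    · have h1 := lt_inf (G_dom (A := N2) h).2.1.le (G_dom (A := N2) h').2.1.le
        (G_sep (A := N2) h h')
      exact ⟨.old (y' ⊓ y''), inf_le_left (α := N2), inf_le_right (α := N2), h1.not_ge⟩
    · exact mixed h h'
    · obtain ⟨d, h1, h2, h3⟩ := mixed h' h
      exact ⟨d, h2, h1, h3⟩
    · by_cases hy : ∃ n, y = i2 n
      · obtain ⟨n, rfl⟩ := hy
        have h1 := g.glueG_old_new.1 h
        have h2 := g.glueG_old_new.1 h'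
        rcases g.tight x'.1 x''.1 with h3 | h3 | ⟨m, hm⟩
        · exact ⟨.new x', le_rfl (a := x'.1), h3,
            fun hx => lt_asymm (G_dom h1).2.1 ((g.dir_old x' n).1 hx)⟩
        · exact ⟨.new x'', h3, le_rfl (a := x''.1),
            fun hx => lt_asymm (G_dom h2).2.1 ((g.dir_old x'' n).1 hx)⟩
        · have h3 := lt_inf (G_dom h1).2.1.le (G_dom h2).2.1.le (G_sep h1 h2)
          rw [← hm] at h3
          refine ⟨.old (i2 m), g.below_old.2 (lt_of_le_of_ne ?_ (new_ne x' m)),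
            g.below_old.2 (lt_of_le_of_ne ?_ (new_ne x'' m)), ?_⟩
          · rw [hm]; exact inf_le_left
          · rw [hm]; exact inf_le_right
          · exact (g.emb2.lt_iff.2 (g.emb1.lt_iff.1 h3)).not_ge
      · rcases h with ⟨n, hn, hn', h⟩ | ⟨n, rfl, h⟩
        · rcases h' with ⟨m, hm, hm', h'⟩ | ⟨m, rfl, h'⟩
          · have h1 := lt_inf (G_dom h).2.1.le (G_dom h').2.1.le (G_sep h h')
            exact ⟨.old (i2 n ⊓ i2 m), ⟨n, inf_le_left, hn'⟩, ⟨m, inf_le_right, hm'⟩, h1.not_ge⟩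
          · exact absurd ⟨m, rfl⟩ hy
        · exact absurd ⟨n, rfl⟩ hy
  · let := g.semilattice
    have hb := (g.glueG_dom h).2.1
    have hc := (g.glueG_dom h').2.1
    have key : ∀ {x' : NewPart i1} {y : N2}, x.1 < x'.1 → Dir x y →
        ∃ d, glueLE i1 i2 Dir d (.new x') ∧ glueLE i1 i2 Dir d (.old y) ∧
          ¬ glueLE i1 i2 Dir d (.new x) := by
      intro x' y hx hd
      by_cases hd' : Dir x' y
      · exact ⟨.new x', le_rfl (a := x'.1), hd', hx.not_ge⟩
      · obtain ⟨m, h1, h2, h3, h4⟩ := g.dir_glb hd'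
        exact ⟨.old m, h1, h2, fun hm => g.not_below_dir hm (h4 x hx.le hd)⟩
    rcases b with y' | x' <;> rcases c with y'' | x''
    · have h1 := g.dir_inf (g.new_lt_old.1 hb) (g.new_lt_old.1 hc)
      exact ⟨.old (y' ⊓ y''), inf_le_left (α := N2), inf_le_right (α := N2),
        fun hx => g.not_below_dir hx h1⟩
    · obtain ⟨d, h1, h2, h3⟩ := key (g.new_lt_new.1 hc) (g.new_lt_old.1 hb)
      exact ⟨d, h2, h1, h3⟩
    · exact key (g.new_lt_new.1 hb) (g.new_lt_old.1 hc)
    · have h1 := g.new_lt_new.1 hb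
      have h2 := g.new_lt_new.1 hc
      rcases g.tight x'.1 x''.1 with h3 | h3 | ⟨m, hm⟩
      · exact ⟨.new x', le_rfl (a := x'.1), h3, h1.not_ge⟩
      · exact ⟨.new x'', h3, le_rfl (a := x''.1), h2.not_ge⟩
      · refine ⟨.old (i2 m), g.below_old.2 (lt_of_le_of_ne ?_ (new_ne x' m)),
          g.below_old.2 (lt_of_le_of_ne ?_ (new_ne x'' m)), fun hx => ?_⟩
        · rw [hm]; exact inf_le_left
        · rw [hm]; exact inf_le_right
        · refine (g.below_old.1 hx).not_ge ?_
          rw [hm]; exact le_inf h1.le h2.le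

theorem glueG_prec (g : GlueRel i1 i2 Dir L) {i j : ℕ} {a b c : Glued i1 N2}
    (hbc : gluePrec i1 L b c) (h : glueG i1 i2 Dir i a b) (h' : glueG i1 i2 Dir j a c) :
    i ≤ j := by
  rcases a with y | x
  · rcases b with y' | x' <;> rcases c with y'' | x''
    · exact G_prec (A := N2) hbc h h'
    · rcases h' with ⟨n, hn, hn', h'⟩ | ⟨n, rfl, h'⟩
      · rcases preceq_or_prec y' (i2 n) with (rfl | h1) | h1
        · exact (G_uniq (A := N2) h h').le
        · exact G_prec (A := N2) h1 h h'
        · exact (G_uniq (A := N2) (G_mono h' (g.convex_old hn' h1 hbc)) h).ge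
      · exact g.G_left hbc h h'
    · rcases h with ⟨n, hn, hn', h⟩ | ⟨n, rfl, h⟩
      · rcases preceq_or_prec y'' (i2 n) with h1 | h1
        · exfalso
          apply hbc
          have h2 : L (i2 n) x' := g.L_of_below (g.below_old.2 hn')
          rcases h1 with rfl | h1
          · exact h2
          · exact g.L_down h1 h2
        · exact G_prec (A := N2) h1 h h'
      · exact g.G_right hbc h' h
    · by_cases hy : ∃ n, y = i2 n
      · obtain ⟨n, rfl⟩ := hy
        exact G_prec hbc (g.glueG_old_new.1 h) (g.glueG_old_new.1 h')
      · rcases h with ⟨n, hn, hn', h⟩ | ⟨n, rfl, h⟩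
        · rcases h' with ⟨m, hm, hm', h'⟩ | ⟨m, rfl, h'⟩
          · rcases preceq_or_prec n m with (rfl | h1) | h1
            · exact (G_uniq h h').le
            · exact G_prec (g.emb2.prec_iff n m |>.2 h1) h h'
            · have h2 : i1 m ≤ i1 n := by
                have hp : prec (i1 n) x''.1 := prec_trans (prec_of_lt hn') hbc
                exact convex hm'.le ((g.emb1.prec_iff _ _).2 h1) hp
              exact (G_uniq h (G_mono h' (g.emb2.le_iff.2 (g.emb1.le_iff.1 h2)))).le
          · exact absurd ⟨m, rfl⟩ hy
        · exact absurd ⟨n, rfl⟩ hy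
  · exact (g.glueG_new_uniq h h').le

/-- The glued tree. -/
@[reducible] noncomputable def glue (g : GlueRel i1 i2 Dir L) : OTree (Glued i1 N2) where
  toSemilatticeInf := g.semilattice
  prec := gluePrec i1 L
  lab := glueLab i1 N2
  G := glueG i1 i2 Dir
  prec_irrefl a := by rcases a with y | x <;> exact prec_irrefl _
  prec_trans {a b c} h h' := by
    rcases a with y | x <;> rcases b with y' | x' <;> rcases c with y'' | x''
    · exact prec_trans (A := N2) h h'
    · exact g.L_down h h'
    · rcases preceq_or_prec y'' y with (rfl | h1) | h1
      · exact absurd h h'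
      · exact absurd (g.L_down h1 h) h'
      · exact h1
    · exact g.L_up h' h
    · exact fun hl => h (g.L_down h' hl)
    · rcases preceq_or_prec x''.1 x.1 with h1 | h1
      · rcases h1 with h1 | h1
        · rw [Subtype.ext h1] at h'; exact absurd h' h
        · exact absurd (g.L_up h1 h') h
      · exact h1
    · exact fun hl => h' (g.L_up h hl)
    · exact prec_trans (A := N1) h h'
  prec_total {a b} h := by
    rcases a with y | x <;> rcases b with y' | x'
    · exact prec_total (A := N2) (fun e => h (congrArg _ e))
    · exact em _
    · exact (em _).symm
    · exact prec_total (A := N1) (fun e => h (congrArg _ (Subtype.ext e)))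
  prec_of_lt {a b} h := by
    rcases a with y | x <;> rcases b with y' | x'
    · exact prec_of_lt (A := N2) (g.old_lt_old.1 h)
    · exact g.L_of_below (g.old_lt_new.1 h)
    · exact g.L_dir (g.new_lt_old.1 h)
    · exact prec_of_lt (A := N1) (g.new_lt_new.1 h)
  convex h h1 h2 := g.glue_convex h h1 h2
  two_le_lab a := by rcases a with y | x <;> exact two_le_lab _
  G_dom h := g.glueG_dom h
  G_ex h h' := g.glueG_ex h h'
  G_uniq {i j a b} h h' := by
    rcases a with y | x
    · rcases b with y' | x'
      · exact G_uniq (A := N2) h h'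
      · rcases h with ⟨n, hn, hn', h⟩ | ⟨n, rfl, h⟩
        · rcases h' with ⟨m, hm, hm', h'⟩ | ⟨m, rfl, h'⟩
          · rcases le_total_of_le hn'.le hm'.le with h1 | h1 <;>
              rw [g.emb1.le_iff, ← g.emb2.le_iff] at h1
            · exact G_uniq (G_mono h h1) h'
            · exact G_uniq h (G_mono h' h1)
          · have := (g.emb1.G_iff _ _ _).2 ((g.emb2.G_iff _ _ _).1 h)
            exact G_uniq (G_mono this hn'.le) h'
        · exact G_uniq h (g.glueG_old_new.1 h')
    · exact g.glueG_new_uniq h h'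
  G_mono h h' := g.glueG_mono h h'
  G_sep {i a b c} h h' hbc := by
    let := g.semilattice
    obtain ⟨d, h1, h2, h3⟩ := g.glueG_sep h h'
    exact h3 (hbc ▸ le_inf (α := Glued i1 N2) h1 h2)
  G_prec hbc h h' := g.glueG_prec hbc h h'

theorem isEmb_old (g : GlueRel i1 i2 Dir L) :
    letI := g.glue
    IsEmb (Glued.old : N2 → Glued i1 N2) := by
  let := g.glue
  refine IsEmb.of_le_iff _ (fun a b => Iff.rfl) (fun a b => ⟨a ⊓ b, ?_⟩) (fun a b => Iff.rfl)
    (fun a => rfl) (fun i a b => Iff.rfl)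
  refine le_antisymm (le_inf ((g.le_iff _ _).2 (inf_le_left : a ⊓ b ≤ a))
    ((g.le_iff _ _).2 (inf_le_right : a ⊓ b ≤ b))) ?_
  have h1 : (.old a ⊓ .old b : Glued i1 N2) ≤ .old a := inf_le_left
  have h2 : (.old a ⊓ .old b : Glued i1 N2) ≤ .old b := inf_le_right
  revert h1 h2
  generalize (.old a ⊓ .old b : Glued i1 N2) = c
  rcases c with y | x
  · exact fun h h' => le_inf (α := N2) h h'
  · exact fun h h' => g.dir_inf h h'

open Classical in
/-- The embedding of `N1` into the glued tree. -/
noncomputable def inN1 (i1 : N0 → N1) (i2 : N0 → N2) (z : N1) : Glued i1 N2 :=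
  if h : z ∈ Set.range i1 then .old (i2 h.choose) else .new ⟨z, h⟩

theorem inN1_old (g : GlueRel i1 i2 Dir L) (n : N0) :
    inN1 i1 i2 (i1 n) = (.old (i2 n) : Glued i1 N2) := by
  have h : i1 n ∈ Set.range i1 := ⟨n, rfl⟩
  rw [inN1, dif_pos h, g.emb1.injective h.choose_spec]

theorem inN1_new (x : NewPart i1) : inN1 i1 i2 x.1 = (.new x : Glued i1 N2) := by
  rw [inN1, dif_neg x.2]

theorem old_or_new (z : N1) : (∃ n, z = i1 n) ∨ ∃ x : NewPart i1, z = x.1 := by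
  by_cases h : z ∈ Set.range i1
  · obtain ⟨n, rfl⟩ := h; exact Or.inl ⟨n, rfl⟩
  · exact Or.inr ⟨⟨z, h⟩, rfl⟩

theorem old_le_inN1 (g : GlueRel i1 i2 Dir L) (y : N2) (z : N1) :
    glueLE i1 i2 Dir (.old y) (inN1 i1 i2 z) ↔ ∃ n, y ≤ i2 n ∧ i1 n ≤ z := by
  rcases old_or_new (i1 := i1) z with ⟨n, rfl⟩ | ⟨x, rfl⟩
  · rw [g.inN1_old]
    constructor
    · exact fun h => ⟨n, h, le_rfl⟩
    · rintro ⟨m, h1, h2⟩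
      exact h1.trans (g.emb2.le_iff.2 (g.emb1.le_iff.1 h2))
  · rw [inN1_new]
    constructor
    · rintro ⟨n, h1, h2⟩; exact ⟨n, h1, h2.le⟩
    · rintro ⟨n, h1, h2⟩; exact ⟨n, h1, lt_of_le_of_ne h2 (new_ne x n)⟩

theorem isEmb_inN1 (g : GlueRel i1 i2 Dir L) :
    letI := g.glue
    IsEmb (inN1 i1 i2 : N1 → Glued i1 N2) := by
  let := g.glue
  have hle : ∀ a b : N1, (inN1 i1 i2 a : Glued i1 N2) ≤ inN1 i1 i2 b ↔ a ≤ b := by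
    intro a b
    rcases old_or_new (i1 := i1) a with ⟨n, rfl⟩ | ⟨x, rfl⟩
    · rw [g.inN1_old, g.le_iff, g.old_le_inN1]
      constructor
      · rintro ⟨m, h1, h2⟩
        exact (g.emb1.le_iff.2 (g.emb2.le_iff.1 h1)).trans h2
      · exact fun h => ⟨n, le_rfl, h⟩
    · rcases old_or_new (i1 := i1) b with ⟨m, rfl⟩ | ⟨x', rfl⟩
      · rw [g.inN1_old, inN1_new, g.le_iff]
        refine (g.dir_old x m).trans ⟨le_of_lt, fun h => lt_of_le_of_ne h (new_ne x m).symm⟩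
      · rw [inN1_new, inN1_new]; exact Iff.rfl
  refine IsEmb.of_le_iff _ hle (fun a b => ?_) (fun a b => ?_) (fun a => ?_) (fun i a b => ?_)
  · rcases g.tight a b with h | h | ⟨n, h⟩
    · exact ⟨a, (inf_eq_left.2 ((hle _ _).2 h)).symm⟩
    · exact ⟨b, (inf_eq_right.2 ((hle _ _).2 h)).symm⟩
    · refine ⟨i1 n, le_antisymm (le_inf ((hle _ _).2 (h ▸ inf_le_left))
        ((hle _ _).2 (h ▸ inf_le_right))) ?_⟩
      have h1 : (inN1 i1 i2 a ⊓ inN1 i1 i2 b : Glued i1 N2) ≤ inN1 i1 i2 a := inf_le_left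
      have h2 : (inN1 i1 i2 a ⊓ inN1 i1 i2 b : Glued i1 N2) ≤ inN1 i1 i2 b := inf_le_right
      revert h1 h2
      generalize (inN1 i1 i2 a ⊓ inN1 i1 i2 b : Glued i1 N2) = c
      intro h1 h2
      rcases c with y | x
      · obtain ⟨m, hm, hm'⟩ := (g.old_le_inN1 y a).1 h1
        obtain ⟨k, hk, hk'⟩ := (g.old_le_inN1 y b).1 h2
        refine (g.le_iff _ _).2 ((g.old_le_inN1 y _).2 ⟨m ⊓ k, ?_, ?_⟩)
        · rw [g.emb2.map_inf]; exact le_inf hm hk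
        · rw [h, g.emb1.map_inf]; exact inf_le_inf hm' hk'
      · rw [← inN1_new (i2 := i2), hle] at h1 h2
        rw [← inN1_new (i2 := i2), hle, h]
        exact le_inf h1 h2
  · rcases old_or_new (i1 := i1) a with ⟨n, rfl⟩ | ⟨x, rfl⟩ <;>
      rcases old_or_new (i1 := i1) b with ⟨m, rfl⟩ | ⟨x', rfl⟩ <;>
      simp only [g.inN1_old, inN1_new]
    · rw [g.emb1.prec_iff, ← g.emb2.prec_iff]; exact Iff.rfl
    · exact g.L_old x' n
    · refine (not_congr (g.L_old x m)).trans ?_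
      rw [not_prec]
      exact ⟨fun h => h.resolve_left (new_ne x m).symm, Or.inr⟩
    · exact Iff.rfl
  · rcases old_or_new (i1 := i1) a with ⟨n, rfl⟩ | ⟨x, rfl⟩
    · rw [g.inN1_old, g.emb1.lab_eq, ← g.emb2.lab_eq]; rfl
    · rw [inN1_new]; rfl
  · rcases old_or_new (i1 := i1) a with ⟨n, rfl⟩ | ⟨x, rfl⟩ <;>
      rcases old_or_new (i1 := i1) b with ⟨m, rfl⟩ | ⟨x', rfl⟩ <;>
      simp only [g.inN1_old, inN1_new]
    · rw [g.emb1.G_iff, ← g.emb2.G_iff]; exact Iff.rfl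
    · exact g.glueG_old_new
    · constructor
      · rintro ⟨h1, h2, h3⟩
        have h4 := (g.dir_old x m).1 h1
        rcases h3 with ⟨z, hz⟩ | ⟨hz, rfl⟩
        · obtain ⟨j, hj⟩ := G_ex h2 h4
          rwa [G_eq_of_inf_ne hz hj (g.inf_ne_new (G_dom hz).2.1 h4)]
        · exact absurd h4 (hz _)
      · intro h
        exact ⟨(g.dir_old x m).2 (G_dom h).2.1, (G_dom h).1, Or.inl ⟨_, h⟩⟩
    · exact Iff.rfl

end GlueRel
end Glue
end OTree
end Dendrite

namespace Dendrite
namespace OTree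

section Glue

variable {N0 N1 N2 : Type u} [OTree N0] [OTree N1] [OTree N2] {i1 : N0 → N1} {i2 : N0 → N2}

/-! ### New elements inside the branches of the common part -/

/-- The relation `x < y` for gluing when every new element is below an element of `N0`: the new
elements are put immediately above the elements of `N0` below them. -/
def DirIn (i1 : N0 → N1) (i2 : N0 → N2) (x : NewPart i1) (y : N2) : Prop :=
  ∃ v, x.1 < i1 v ∧ ¬ Below i1 i2 (i2 v ⊓ y) x.1

/-- The relation `prec y x` that goes with `DirIn`. -/
def LIn (i1 : N0 → N1) (i2 : N0 → N2) (y : N2) (x : NewPart i1) : Prop :=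
  ¬ DirIn i1 i2 x y ∧ ∃ v, x.1 < i1 v ∧ prec y (i2 v)

/-- If every new element is below an element of `N0`, then gluing is possible: meets of elements of
`N1` can be computed below elements of `N0`, so no branchings are new, and a new element `x` is
placed with respect to `N2` by any element of `N0` above it. -/
theorem glueRelIn (h1 : IsEmb i1) (h2 : IsEmb i2) (hin : ∀ x : NewPart i1, ∃ v, x.1 < i1 v) :
    GlueRel i1 i2 (DirIn i1 i2) (LIn i1 i2) := by
  have tight : ∀ a b : N1, a ≤ b ∨ b ≤ a ∨ ∃ n, i1 n = a ⊓ b := by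
    intro a b
    have hup : ∀ a : N1, ∃ v, a ≤ i1 v := by
      intro a
      by_cases h : a ∈ Set.range i1
      · obtain ⟨n, rfl⟩ := h; exact ⟨n, le_rfl⟩
      · obtain ⟨v, hv⟩ := hin ⟨a, h⟩; exact ⟨v, hv.le⟩
    obtain ⟨v, hv⟩ := hup a
    obtain ⟨w, hw⟩ := hup b
    have ha : i1 (v ⊓ w) ≤ i1 v := h1.le_iff.2 inf_le_left
    have hb : i1 (v ⊓ w) ≤ i1 w := h1.le_iff.2 inf_le_right
    rcases le_or_lt_of_le hv ha with h | h
    · rcases le_total_of_le (h.trans hb) hw with h' | h'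
      · exact Or.inl h'
      · exact Or.inr (Or.inl h')
    rcases le_or_lt_of_le hw hb with h' | h'
    · rcases le_total_of_le hv (h'.trans ha) with h' | h'
      · exact Or.inl h'
      · exact Or.inr (Or.inl h')
    refine Or.inr (Or.inr ⟨v ⊓ w, le_antisymm (le_inf h.le h'.le) ?_⟩)
    rw [h1.map_inf]
    exact inf_le_inf hv hw
  have above : ∀ {x : NewPart i1} {n v m}, i1 n < x.1 → x.1 < i1 v → m ≤ i2 v →
      ¬ Below i1 i2 m x.1 → i2 n < m := by
    intro x n v m hn hv hm hb
    have : i2 n ≤ i2 v := h2.le_iff.2 (h1.le_iff.1 (hn.trans hv).le)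
    rcases le_or_lt_of_le hm this with h | h
    · exact absurd ⟨n, h, hn⟩ hb
    · exact h
  have dir_all : ∀ {x y}, DirIn i1 i2 x y → ∀ v, x.1 < i1 v → ¬ Below i1 i2 (i2 v ⊓ y) x.1 := by
    rintro x y ⟨v, hv, hb⟩ w hw hb'
    apply hb
    have hx : x.1 < i1 (v ⊓ w) := by
      rw [h1.map_inf]; exact lt_of_le_of_ne (le_inf hv.le hw.le) (by
        rw [← h1.map_inf]; exact (new_ne x _).symm)
    rcases le_total_of_le (inf_le_left : i2 v ⊓ y ≤ i2 v)
      (h2.le_iff.2 inf_le_left : i2 (v ⊓ w) ≤ i2 v) with h | h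
    · refine hb'.mono (le_inf (h.trans (h2.le_iff.2 inf_le_right)) inf_le_right)
    · have : i2 (v ⊓ w) ≤ i2 w ⊓ y := le_inf (h2.le_iff.2 inf_le_right) (h.trans inf_le_right)
      exact absurd ((below_i2 h1 h2).1 (hb'.mono this)) hx.not_gt
  have dir_old : ∀ x n, DirIn i1 i2 x (i2 n) ↔ x.1 < i1 n := by
    intro x n
    constructor
    · rintro ⟨v, hv, hb⟩
      rw [← h2.map_inf, below_i2 h1 h2] at hb
      rcases le_or_lt_of_le hv.le (h1.le_iff.2 inf_le_left : i1 (v ⊓ n) ≤ i1 v) with h | h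
      · exact lt_of_le_of_ne (h.trans (h1.le_iff.2 inf_le_right)) (new_ne x n).symm
      · exact absurd h hb
    · intro h
      refine ⟨n, h, ?_⟩
      rw [inf_idem, below_i2 h1 h2]
      exact h.not_gt
  have dir_up : ∀ (x : NewPart i1) {y y' : N2}, y ≤ y' → DirIn i1 i2 x y → DirIn i1 i2 x y' := by
    rintro x y y' hy ⟨v, hv, hb⟩
    exact ⟨v, hv, fun h => hb (h.mono (inf_le_inf_left _ hy))⟩
  have dir_down : ∀ {x x' : NewPart i1} (y : N2), x.1 ≤ x'.1 → DirIn i1 i2 x' y →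
      DirIn i1 i2 x y := by
    rintro x x' y hx ⟨v, hv, hb⟩
    exact ⟨v, hx.trans_lt hv, fun h => hb (h.mono_right hx)⟩
  have dir_le : ∀ {x : NewPart i1} {n} {y : N2}, i1 n < x.1 → DirIn i1 i2 x y → i2 n ≤ y := by
    rintro x n y hn ⟨v, hv, hb⟩
    exact (above hn hv inf_le_left hb).le.trans inf_le_right
  -- an element that is right of `x` is either above `x` or right of everything above `x`
  have right : ∀ {x : NewPart i1} {y : N2} {v}, x.1 < i1 v → ¬ LIn i1 i2 y x →
      DirIn i1 i2 x y ∨ preceq (i2 v) y := by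
    intro x y v hv hl
    by_cases hd : DirIn i1 i2 x y
    · exact Or.inl hd
    · right
      rw [← not_prec]
      exact fun h => hl ⟨hd, v, hv, h⟩
  have above_inc : ∀ {x x' : NewPart i1} {v v' n}, prec x.1 x'.1 → x.1 < i1 v → x'.1 < i1 v' →
      ¬ x.1 ≤ x'.1 → i1 n = x.1 ⊓ x'.1 → i2 v ⊓ i2 v' ≤ i2 n := by
    intro x x' v v' n hp hv hv' hx hn
    rw [← h2.map_inf, h2.le_iff, ← h1.le_iff, hn, h1.map_inf]
    rcases le_or_lt_of_le hv.le (inf_le_left : i1 v ⊓ i1 v' ≤ i1 v) with h | h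
    · rcases le_or_lt_of_le hv'.le (h.trans inf_le_right) with h' | h'
      · have := convex' h' (Or.inr ?_) (preceq_of_le (le_refl x.1))
        · exact absurd (le_antisymm (convex' (h.trans inf_le_right) (Or.inr hp)
            (preceq_of_le hv'.le)) this) (fun e => hx e.le)
        · exact absurd (convex' (h.trans inf_le_right) (Or.inr hp) (preceq_of_le hv'.le)) hx
      · exact absurd h'.le hx
    · refine le_inf h.le ?_
      rcases le_or_lt_of_le hv'.le (inf_le_right : i1 v ⊓ i1 v' ≤ i1 v') with h' | h'
      · exact absurd (prec_of_lt (h'.trans_lt h)) (prec_asymm hp)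
      · exact h'.le
  refine
    { emb1 := h1, emb2 := h2, tight := tight, dir_old := dir_old, dir_up := dir_up,
      dir_down := dir_down, dir_le := dir_le, dir_inf := ?_, dir_glb := ?_, L_down := ?_,
      L_up := ?_, L_old := ?_, L_dir := fun h h' => h'.1 h, convex_old := ?_, convex_left := ?_,
      convex_right := ?_, convex_mid := ?_, convex_new := ?_, G_dir := ?_, G_split := ?_,
      G_left := ?_, G_right := ?_ }
  · rintro x y y' ⟨v, hv, hb⟩ hd'
    refine ⟨v, hv, fun h => ?_⟩
    have hb' := dir_all hd' v hv
    rcases le_total_of_le (inf_le_left : i2 v ⊓ y ≤ i2 v) (inf_le_left : i2 v ⊓ y' ≤ i2 v)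
      with h3 | h3
    · exact hb (h.mono (le_inf inf_le_left (le_inf inf_le_right (h3.trans inf_le_right))))
    · exact hb' (h.mono (le_inf inf_le_left (le_inf (h3.trans inf_le_right) inf_le_right)))
  · intro x y hd
    obtain ⟨v, hv⟩ := hin x
    have hb : Below i1 i2 (i2 v ⊓ y) x.1 := by
      by_contra hb; exact hd ⟨v, hv, hb⟩
    refine ⟨i2 v ⊓ y, hb, inf_le_right, fun n hn => inf_le_inf_right _ ?_, fun x' hx' hd' => ?_⟩
    · exact h2.le_iff.2 (h1.le_iff.1 (hn.trans hv).le)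
    · refine ⟨v, hx'.trans_lt hv, ?_⟩
      rw [← inf_assoc, inf_idem]
      exact dir_all hd' v (hx'.trans_lt hv)
  · rintro x y y' hp ⟨hd, v, hv, hy⟩
    refine ⟨fun hd' => hd ⟨v, hv, fun hb => dir_all hd' v hv (hb.mono ?_)⟩, v, hv,
      prec_trans hp hy⟩
    refine le_inf inf_le_left ?_
    rw [inf_comm]
    exact inf_le_of_between (Or.inr hp) (Or.inr hy)
  · rintro x x' y hp ⟨hd, v, hv, hy⟩
    obtain ⟨v', hv'⟩ := hin x'
    by_cases hx : x.1 ≤ x'.1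
    · refine ⟨fun hd' => hd (dir_down y hx hd'), v', hv', ?_⟩
      by_contra hc
      refine hd ⟨v', hx.trans_lt hv', fun hb => ?_⟩
      have hvv : i2 (v ⊓ v') ≤ y := by
        rw [h2.map_inf, inf_comm]
        exact inf_le_of_between (not_prec.1 hc) (Or.inr hy)
      have : i2 (v ⊓ v') ≤ i2 v' ⊓ y := le_inf (h2.le_iff.2 inf_le_right) hvv
      have h3 := (below_i2 h1 h2).1 (hb.mono this)
      rw [h1.map_inf] at h3
      exact h3.not_ge (le_inf hv.le (hx.trans hv'.le))
    · obtain ⟨n, hn⟩ : ∃ n, i1 n = x.1 ⊓ x'.1 := by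
        rcases tight x.1 x'.1 with h | h | h
        · exact absurd h hx
        · exact absurd (preceq_of_le h) (not_preceq.2 hp)
        · exact h
      have hvv := above_inc hp hv hv' hx hn
      have hvp : prec (i2 v) (i2 v') := by
        rw [h2.prec_iff, ← h1.prec_iff]
        exact prec_of_le_of_le hp hx hv.le hv'.le
      have hn' : i1 n < x'.1 := lt_of_le_of_ne (hn ▸ inf_le_right) (new_ne x' n)
      refine ⟨fun hd' => dir_all hd' v' hv' ⟨n, ?_, hn'⟩, v', hv', prec_trans hy hvp⟩
      refine (le_inf ?_ inf_le_left).trans hvv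
      rw [inf_comm]
      exact inf_le_of_between (Or.inr hy) (Or.inr hvp)
  · intro x n
    constructor
    · rintro ⟨hd, v, hv, hy⟩
      rw [dir_old] at hd
      rw [h2.prec_iff, ← h1.prec_iff] at hy
      by_contra hc
      exact hd (lt_of_le_of_ne (convex' hv.le (not_prec.1 hc) (Or.inr hy)) (new_ne x n).symm)
    · intro h
      obtain ⟨v, hv⟩ := hin x
      refine ⟨fun hd => prec_asymm h (prec_of_lt ((dir_old x n).1 hd)), v, hv, ?_⟩
      rw [h2.prec_iff, ← h1.prec_iff]
      exact prec_trans h (prec_of_lt hv)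
  · rintro x n y hn hp ⟨hd, v, hv, hy⟩
    exact convex (h2.le_iff.2 (h1.le_iff.1 (hn.trans hv).le)) hp hy
  · rintro x y y' ⟨hd, v, hv, hy⟩ hl hyy
    have hyv : y ≤ i2 v := by
      rcases right hv hl with h | h
      · rcases le_total_of_le hyy (inf_le_right : i2 v ⊓ y' ≤ y') with h3 | h3
        · exact h3.trans inf_le_left
        · exact absurd ⟨v, hv, fun hb => dir_all h v hv (hb.mono (le_inf inf_le_left h3))⟩ hd
      · exact convex' hyy (Or.inr hy) h
    by_contra hb
    refine hd ⟨v, hv, ?_⟩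
    rwa [inf_eq_right.2 hyv]
  · intro x y y' hd hl hp
    obtain ⟨v, hv⟩ := hin x
    rcases right hv hl with h | h
    · exact h
    · exact ⟨v, hv, fun hb => dir_all hd v hv
        (hb.mono (le_inf inf_le_left (inf_le_of_between h (Or.inr hp))))⟩
  · rintro x x' y hx hl ⟨hd, v, hv, hy⟩
    rcases right (hx.trans_lt hv) hl with h | h
    · exact h
    · exact absurd hy (not_prec.2 h)
  · intro x x' y hd hp hl
    by_contra hx
    obtain ⟨n, hn⟩ : ∃ n, i1 n = x.1 ⊓ x'.1 := by
      rcases tight x.1 x'.1 with h | h | h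
      · exact absurd h hx
      · exact absurd (preceq_of_le h) (not_preceq.2 hp)
      · exact h
    obtain ⟨v, hv⟩ := hin x
    obtain ⟨v', hv'⟩ := hin x'
    have hvv := above_inc hp hv hv' hx hn
    have hvp : prec (i2 v) (i2 v') := by
      rw [h2.prec_iff, ← h1.prec_iff]
      exact prec_of_le_of_le hp hx hv.le hv'.le
    have hn1 : i1 n < x.1 := lt_of_le_of_ne (hn ▸ inf_le_left) (new_ne x n)
    have hn' : i1 n < x'.1 := lt_of_le_of_ne (hn ▸ inf_le_right) (new_ne x' n)
    have hny := above hn1 hv inf_le_left (dir_all hd v hv)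
    rcases right hv' hl with h | h
    · have hny' := above hn' hv' inf_le_left (dir_all h v' hv')
      rcases le_total_of_le (inf_le_right : i2 v ⊓ y ≤ y) (inf_le_right : i2 v' ⊓ y ≤ y)
        with h3 | h3
      · exact hny.not_ge ((le_inf inf_le_left (h3.trans inf_le_left)).trans hvv)
      · exact hny'.not_ge ((le_inf (h3.trans inf_le_left) inf_le_left).trans hvv)
    · exact hny.not_ge ((le_inf inf_le_left
        (inf_le_of_between (Or.inr hvp) h)).trans hvv)
  · rintro x n y i ⟨v, hv, hb⟩ hG
    have h3 := above (G_dom hG).2.1 hv inf_le_left hb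
    have h4 := (h2.G_iff _ _ _).2 ((h1.G_iff _ _ _).1 (G_mono hG hv.le))
    exact G_mono ((G_iff_of_le h3 inf_le_left).2 h4) inf_le_right
  · intro x n y i hG hG' hd
    obtain ⟨v, hv⟩ := hin x
    have hb : Below i1 i2 (i2 v ⊓ y) x.1 := by
      by_contra hb; exact hd ⟨v, hv, hb⟩
    have h4 := (h2.G_iff _ _ _).2 ((h1.G_iff _ _ _).1 (G_mono hG hv.le))
    have h5 := lt_inf (G_dom h4).2.1.le (G_dom hG').2.1.le (G_sep h4 hG')
    obtain ⟨n', hn, hn'⟩ := hb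
    exact ⟨n', hn', (h5.trans_le (le_inf hn inf_le_right)).ne',
      (h2.lt_iff.1 (h5.trans_le hn)).le⟩
  · rintro x n y i j ⟨hd, v, hv, hy⟩ hG hG'
    exact G_prec hy hG ((h2.G_iff _ _ _).2 ((h1.G_iff _ _ _).1 (G_mono hG' hv.le)))
  · intro x n y i j hl hG hG'
    obtain ⟨v, hv⟩ := hin x
    have h4 := (h2.G_iff _ _ _).2 ((h1.G_iff _ _ _).1 (G_mono hG' hv.le))
    rcases right hv hl with h | h
    · have h3 := above (G_dom hG').2.1 hv inf_le_left (dir_all h v hv)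
      exact (G_eq_of_inf_ne h4 hG h3.ne').le
    · rcases h with rfl | h
      · exact (G_uniq h4 hG).le
      · exact G_prec h h4 hG

end Glue
end OTree
end Dendrite

namespace Dendrite
namespace OTree

section Glue

variable {N0 N1 N2 : Type u} [OTree N0] [OTree N1] [OTree N2] {i1 : N0 → N1} {i2 : N0 → N2}

/-! ### New elements at the ends of the common part -/

/-- The relation `x < y` for gluing when no new element is below an element of `N0`: if `N2` has
elements in the position of `x`, then `x` is put below all of them. -/
def DirEnd (i1 : N0 → N1) (i2 : N0 → N2) (x : NewPart i1) (y : N2) : Prop :=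
  ∀ n, i1 n < x.1 → i2 n < y ∧
    ((∃ n', n < n' ∧ i1 n' < x.1) ∨ ∃ i, G i (i1 n) x.1 ∧ G i (i2 n) y)

/-- The relation `prec y x` that goes with `DirEnd`. -/
def LEnd (i1 : N0 → N1) (i2 : N0 → N2) (y : N2) (x : NewPart i1) : Prop :=
  (∃ c, prec (i1 c) x.1 ∧ (preceq y (i2 c) ∨ ¬ Below i1 i2 (i2 c ⊓ y) x.1)) ∨
    ∃ d i j, G j (i1 d) x.1 ∧ G i (i2 d) y ∧ i < j

/-- If `N0` is a lower set in `N1` and contains all branchings of new elements, then gluing is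
possible: a new element `x` becomes a branch of its own if the elements of `N0` below it have a
largest one, of infinite label; otherwise it is put below all elements of `N2` in its position. -/
theorem glueRelEnd (h1 : IsEmb i1) (h2 : IsEmb i2) (hdown : ∀ z n, z ≤ i1 n → z ∈ Set.range i1)
    (htight : ∀ x x' : NewPart i1, x.1 ≤ x'.1 ∨ x'.1 ≤ x.1 ∨ ∃ n, i1 n = x.1 ⊓ x'.1) :
    GlueRel i1 i2 (DirEnd i1 i2) (LEnd i1 i2) := by
  have hno : ∀ (x : NewPart i1) n, ¬ x.1 ≤ i1 n := fun x n h => x.2 (hdown _ _ h)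
  have tight : ∀ a b : N1, a ≤ b ∨ b ≤ a ∨ ∃ n, i1 n = a ⊓ b := by
    intro a b
    by_cases ha : a ∈ Set.range i1
    · obtain ⟨n, rfl⟩ := ha
      exact Or.inr (Or.inr (hdown _ n inf_le_left))
    · by_cases hb : b ∈ Set.range i1
      · obtain ⟨n, rfl⟩ := hb
        exact Or.inr (Or.inr (hdown _ n inf_le_right))
      · exact htight ⟨a, ha⟩ ⟨b, hb⟩
  have to2 : ∀ {n m}, i1 n < i1 m → i2 n < i2 m := fun h => h2.lt_iff.2 (h1.lt_iff.1 h)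
  have prec2 : ∀ {n m}, prec (i1 n) (i1 m) ↔ prec (i2 n) (i2 m) := fun {n m} =>
    (h1.prec_iff n m).trans (h2.prec_iff n m).symm
  have G2 : ∀ {i n m}, G i (i1 n) (i1 m) ↔ G i (i2 n) (i2 m) := fun {i n m} =>
    (h1.G_iff i n m).trans (h2.G_iff i n m).symm
  -- elements of `N0` below comparable new elements are the same
  have same : ∀ {x x' : NewPart i1} {n}, x.1 ≤ x'.1 → i1 n < x'.1 → i1 n < x.1 := by
    intro x x' n hx hn
    rcases le_or_lt_of_le hx hn.le with h | h
    · exact absurd h (hno x n)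
    · exact h
  have meet_old : ∀ (x : NewPart i1) n, ∃ m, i1 m = i1 n ⊓ x.1 := fun x n =>
    hdown _ n inf_le_left
  have dir_old : ∀ x n, DirEnd i1 i2 x (i2 n) ↔ x.1 < i1 n := by
    intro x n
    refine ⟨fun hd => ?_, fun h => absurd h.le (hno x n)⟩
    exfalso
    obtain ⟨m, hm⟩ := meet_old x n
    have hmx : i1 m < x.1 := lt_of_le_of_ne (hm ▸ inf_le_right) (new_ne x m)
    obtain ⟨hmn, ⟨n', hn', hn''⟩ | ⟨i, hi, hi'⟩⟩ := hd m hmx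
    · have h3 := (hd n' hn'').1
      have h4 : i1 n' ≤ i1 m := by
        rw [hm]; exact le_inf (h1.le_iff.2 (h2.le_iff.1 h3.le)) hn''.le
      exact (h1.le_iff.1 h4).not_gt hn'
    · exact G_sep (G2.2 hi') hi hm.symm
  have dir_up : ∀ (x : NewPart i1) {y y' : N2}, y ≤ y' → DirEnd i1 i2 x y →
      DirEnd i1 i2 x y' := by
    intro x y y' hy hd n hn
    obtain ⟨h3, h4⟩ := hd n hn
    exact ⟨h3.trans_le hy, h4.imp_right fun ⟨i, hi, hi'⟩ => ⟨i, hi, G_mono hi' hy⟩⟩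
  have dir_down : ∀ {x x' : NewPart i1} (y : N2), x.1 ≤ x'.1 → DirEnd i1 i2 x' y →
      DirEnd i1 i2 x y := by
    intro x x' y hx hd n hn
    obtain ⟨h3, h4⟩ := hd n (hn.trans_le hx)
    refine ⟨h3, ?_⟩
    rcases h4 with ⟨n', hn', hn''⟩ | ⟨i, hi, hi'⟩
    · exact Or.inl ⟨n', hn', same hx hn''⟩
    · exact Or.inr ⟨i, (G_iff_of_le hn hx).2 hi, hi'⟩
  have dir_le : ∀ {x : NewPart i1} {n} {y : N2}, i1 n < x.1 → DirEnd i1 i2 x y → i2 n ≤ y :=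
    fun hn hd => (hd _ hn).1.le
  -- the cone of an element in the direction of `x` is that of `x`
  have dirG : ∀ {x : NewPart i1} {n y i}, DirEnd i1 i2 x y → G i (i1 n) x.1 → G i (i2 n) y := by
    intro x n y i hd hi
    obtain ⟨h3, ⟨n', hn', hn''⟩ | ⟨j, hj, hj'⟩⟩ := hd n (G_dom hi).2.1
    · have h4 := (G_iff_of_le (h1.lt_iff.2 hn') hn''.le).2 hi
      exact G_mono (G2.1 h4) (hd n' hn'').1.le
    · rwa [G_uniq hi hj]
  have below_of_le : ∀ {x : NewPart i1} {n y}, i1 n < x.1 → y ≤ i2 n → Below i1 i2 y x.1 :=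
    fun hn hy => ⟨_, hy, hn⟩
  -- a branching of `x` and an element of `N0` left of it is seen by everything above `x`
  have meet_dir : ∀ {x : NewPart i1} {c m y}, prec (i1 c) x.1 → i1 m = i1 c ⊓ x.1 →
      ¬ i1 c < x.1 → DirEnd i1 i2 x y → prec (i2 c) y ∧ i2 c ⊓ y ≤ i2 m := by
    intro x c m y hc hm hcx hd
    have hmx : i1 m < x.1 := lt_of_le_of_ne (hm ▸ inf_le_right) (new_ne x m)
    have hmc' : i1 m < i1 c := lt_of_le_of_ne (hm ▸ inf_le_left) (by
      intro e; rw [e] at hmx; exact hcx hmx)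
    have hmc := to2 hmc'
    obtain ⟨hmy, ⟨n', hn', hn''⟩ | ⟨i, hi, hi'⟩⟩ := hd m hmx
    · have hny := (hd n' hn'').1
      have hcn : ¬ i1 n' ≤ i1 c := by
        intro h
        have : i1 n' ≤ i1 m := by rw [hm]; exact le_inf h hn''.le
        exact (h1.le_iff.1 this).not_gt hn'
      have hcn' : ¬ i1 c ≤ i1 n' := fun h => hcx (h.trans_lt hn'')
      have hp : prec (i1 c) (i1 n') := by
        rcases preceq_or_prec (i1 n') (i1 c) with h | h
        · exact absurd (convex' hn''.le h (Or.inr hc)) hcn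
        · exact h
      refine ⟨prec_trans (prec2.1 hp) (prec_of_lt hny), ?_⟩
      rcases le_or_lt_of_le (inf_le_left : i2 c ⊓ y ≤ i2 c) hmc.le with h | h
      · exact h
      · exfalso
        rcases le_total_of_le (inf_le_right : i2 c ⊓ y ≤ y) hny.le with h3 | h3
        · have h4 : i2 c ⊓ y ≤ i2 (c ⊓ n') := by rw [h2.map_inf]; exact le_inf inf_le_left h3
          have h5 : i1 (c ⊓ n') ≤ i1 m := by
            rw [hm, h1.map_inf]; exact inf_le_inf_left _ hn''.le
          exact (h.trans_le (h4.trans (h2.le_iff.2 (h1.le_iff.1 h5)))).false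
        · exact hcn (h1.le_iff.2 (h2.le_iff.1 (h3.trans inf_le_left)))
    · obtain ⟨j, hj⟩ := G_ex (G_dom hi).1 hmc'
      have hji : j ≠ i := by
        rintro rfl
        exact G_sep hj hi hm.symm
      have hlt := lt_of_le_of_ne (G_prec hc hj hi) hji
      constructor
      · by_contra h
        rcases not_prec.1 h with h | h
        · rw [h] at hi'
          exact hji (G_uniq (G2.1 hj) hi')
        · exact hlt.not_ge (G_prec h hi' (G2.1 hj))
      · by_contra h
        have : i2 c ⊓ y ≠ i2 m := fun e => h e.le
        exact hji (G_eq_of_inf_ne (G2.1 hj) hi' this)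
  have below_mono' : ∀ {x : NewPart i1} {y y' : N2}, Below i1 i2 y x.1 → y' ≤ y →
      Below i1 i2 y' x.1 := fun h h' => h.mono h'
  have L_down : ∀ {x : NewPart i1} {y y' : N2}, prec y' y → LEnd i1 i2 y x →
      LEnd i1 i2 y' x := by
    rintro x y y' hp (⟨c, hc, h | h⟩ | ⟨d, i, j, hj, hi, hij⟩)
    · exact Or.inl ⟨c, hc, Or.inl (Or.inr (prec_of_prec_of_preceq hp h))⟩
    · rcases preceq_or_prec y' (i2 c) with h3 | h3
      · exact Or.inl ⟨c, hc, Or.inl h3⟩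
      · refine Or.inl ⟨c, hc, Or.inr fun hb => h (hb.mono ?_)⟩
        exact le_inf inf_le_left (inf_le_of_between (Or.inr h3) (Or.inr hp))
    · have hd2 := (G_dom hi).2.1
      by_cases h3 : i2 d < y'
      · obtain ⟨k, hk⟩ := G_ex (G_dom hi).1 h3
        exact Or.inr ⟨d, k, j, hj, hk, (G_prec hp hk hi).trans_lt hij⟩
      · refine Or.inl ⟨d, prec_of_lt (G_dom hj).2.1, Or.inl ?_⟩
        rcases preceq_or_prec y' (i2 d) with h4 | h4
        · exact h4
        · refine absurd (lt_of_le_of_ne (convex hd2.le h4 hp) ?_) h3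
          rintro rfl; exact prec_irrefl _ h4
  -- comparable new elements have the same elements of `N2` to their left
  have same_prec : ∀ {x x' : NewPart i1} {c}, x.1 ≤ x'.1 → prec (i1 c) x'.1 →
      prec (i1 c) x.1 := by
    intro x x' c hx hc
    by_contra h
    exact hno x c (convex' hx (not_prec.1 h) (Or.inr hc))
  have same_L : ∀ {x x' : NewPart i1} {y}, x.1 ≤ x'.1 → LEnd i1 i2 y x' → LEnd i1 i2 y x := by
    rintro x x' y hx (⟨c, hc, h⟩ | ⟨d, i, j, hj, hi, hij⟩)
    · exact Or.inl ⟨c, same_prec hx hc, h.imp_right fun h h' => h (h'.mono_right hx)⟩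
    · exact Or.inr ⟨d, i, j, (G_iff_of_le (same hx (G_dom hj).2.1) hx).2 hj, hi, hij⟩
  have convex_old : ∀ {x : NewPart i1} {n} {y : N2}, i1 n < x.1 → prec (i2 n) y →
      LEnd i1 i2 y x → i2 n ≤ y := by
    rintro x n y hn hp (⟨c, hc, h⟩ | ⟨d, i, j, hj, hi, hij⟩)
    · by_cases hyc : preceq y (i2 c)
      · have h3 : prec (i1 n) (i1 c) := prec2.2 (prec_of_prec_of_preceq hp hyc)
        have h4 : i1 n ≤ i1 c := convex hn.le h3 hc
        exact convex' (h2.le_iff.2 (h1.le_iff.1 h4)) (Or.inr hp) hyc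
      · have h := h.resolve_left hyc
        have hcy := not_preceq.1 hyc
        rcases preceq_or_prec (i1 c) (i1 n) with h3 | h3
        · have h3' : preceq (i2 c) (i2 n) := by
            rcases h3 with h3 | h3
            · exact Or.inl (by rw [h1.injective h3])
            · exact Or.inr (prec2.1 h3)
          exact absurd (below_of_le hn (inf_le_of_between h3' (Or.inr hp))) h
        · have h4 : i1 n ≤ i1 c := convex hn.le h3 hc
          rcases le_total_of_le (inf_le_left : i2 c ⊓ y ≤ i2 c) (h2.le_iff.2 (h1.le_iff.1 h4))
            with h5 | h5
          · exact absurd (below_of_le hn h5) h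
          · exact h5.trans inf_le_right
    · have hdy := (G_dom hi).2.1
      rcases le_or_lt_of_le hn.le (G_dom hj).2.1.le with h3 | h3
      · exact (h2.le_iff.2 (h1.le_iff.1 h3)).trans hdy.le
      · have h4 := G2.1 ((G_iff_of_le h3 hn.le).2 hj)
        exact absurd (G_prec hp h4 hi) hij.not_ge
  have L_old : ∀ x n, LEnd i1 i2 (i2 n) x ↔ prec (i1 n) x.1 := by
    intro x n
    constructor
    · rintro (⟨c, hc, h | h⟩ | ⟨d, i, j, hj, hi, hij⟩)
      · rw [h2.preceq_iff, ← h1.preceq_iff] at h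
        exact prec_of_preceq_of_prec h hc
      · by_contra hn
        apply h
        have h3 := inf_le_of_between (Or.inr hc) (not_prec.1 hn)
        rw [← h1.map_inf] at h3
        rw [← h2.map_inf, below_i2 h1 h2]
        exact lt_of_le_of_ne h3 (new_ne x _)
      · by_contra hn
        rcases not_prec.1 hn with h | h
        · exact new_ne x n h.symm
        · exact (G_prec h hj (G2.2 hi)).not_gt hij
    · exact fun h => Or.inl ⟨n, h, Or.inl (preceq_refl _)⟩
  have L_dir : ∀ {x : NewPart i1} {y : N2}, DirEnd i1 i2 x y → ¬ LEnd i1 i2 y x := by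
    rintro x y hd (⟨c, hc, h⟩ | ⟨d, i, j, hj, hi, hij⟩)
    · by_cases hcx : i1 c < x.1
      · have h3 := (hd c hcx).1
        rcases h with h | h
        · exact not_prec.2 h (prec_of_lt h3)
        · exact h (below_of_le hcx inf_le_left)
      · obtain ⟨m, hm⟩ := meet_old x c
        have hmx : i1 m < x.1 := lt_of_le_of_ne (hm ▸ inf_le_right) (new_ne x m)
        obtain ⟨h3, h4⟩ := meet_dir hc hm hcx hd
        rcases h with h | h
        · exact not_prec.2 h h3
        · exact h (below_of_le hmx h4)
    · exact hij.ne (G_uniq hi (dirG hd hj))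
  refine
    { emb1 := h1, emb2 := h2, tight := tight, dir_old := dir_old, dir_up := dir_up,
      dir_down := dir_down, dir_le := dir_le, dir_inf := ?_, dir_glb := ?_, L_down := L_down,
      L_up := ?_, L_old := L_old, L_dir := L_dir, convex_old := convex_old, convex_left := ?_,
      convex_right := ?_, convex_mid := fun hx hl hl' => absurd (same_L hx hl') hl,
      convex_new := ?_, G_dir := dirG, G_split := ?_, G_left := ?_, G_right := ?_ }
  · intro x y y' hd hd' n hn
    obtain ⟨h3, h4⟩ := hd n hn
    obtain ⟨h3', h4'⟩ := hd' n hn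
    rcases h4 with ⟨n', hn', hn''⟩ | ⟨i, hi, hi'⟩
    · exact ⟨(h2.lt_iff.2 hn').trans_le (le_inf (hd n' hn'').1.le (hd' n' hn'').1.le),
        Or.inl ⟨n', hn', hn''⟩⟩
    · have h5 := dirG hd' hi
      have h6 := lt_inf h3.le h3'.le (G_sep hi' h5)
      exact ⟨h6, Or.inr ⟨i, hi, (G_iff_of_le h6 inf_le_left).2 hi'⟩⟩
  · intro x y hd
    by_cases hall : ∀ n, i1 n < x.1 → i2 n ≤ y
    · by_cases hby : Below i1 i2 y x.1
      · exact ⟨y, hby, le_rfl, fun _ _ => inf_le_right, fun _ _ h => h⟩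
      · have : ∃ d, i1 d < x.1 ∧ (¬ ∃ n', d < n' ∧ i1 n' < x.1) ∧
            ¬ ∃ i, G i (i1 d) x.1 ∧ G i (i2 d) y := by
          by_contra hcon
          push Not at hcon
          refine hd fun n hn => ⟨lt_of_le_of_ne (hall n hn) ?_, ?_⟩
          · rintro rfl; exact hby ⟨n, le_rfl, hn⟩
          · by_cases hex : ∃ n', n < n' ∧ i1 n' < x.1
            · exact Or.inl hex
            · push Not at hex
              exact Or.inr (hcon n hn hex)
        obtain ⟨d, hdx, hmax, hG⟩ := this
        refine ⟨i2 d, ⟨d, le_rfl, hdx⟩, hall d hdx, fun n hn => ?_, fun x' hx' hd' => ?_⟩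
        · rcases le_or_lt_of_le hn.le hdx.le with h | h
          · exact inf_le_left.trans (h2.le_iff.2 (h1.le_iff.1 h))
          · exact absurd ⟨n, h1.lt_iff.1 h, hn⟩ hmax
        · exfalso
          obtain ⟨-, ⟨n', hn', hn''⟩ | ⟨i, hi, hi'⟩⟩ := hd' d (same hx' hdx)
          · exact hmax ⟨n', hn', hn''.trans_le hx'⟩
          · exact hG ⟨i, G_mono hi hx', hi'⟩
    · push Not at hall
      obtain ⟨n, hn, hny⟩ := hall
      refine ⟨i2 n ⊓ y, below_of_le hn inf_le_left, inf_le_right, fun n' hn' => ?_,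
        fun x' hx' hd' => absurd (dir_le (same hx' hn) hd') hny⟩
      rcases le_total_of_le hn'.le hn.le with h | h
      · exact inf_le_inf_right _ (h2.le_iff.2 (h1.le_iff.1 h))
      · rcases le_total_of_le (inf_le_left : i2 n' ⊓ y ≤ i2 n') (h2.le_iff.2 (h1.le_iff.1 h))
          with h3 | h3
        · exact le_inf h3 inf_le_right
        · exact absurd (h3.trans inf_le_right) hny
  · rintro x x' y hp (⟨c, hc, h | h⟩ | ⟨d, i, j, hj, hi, hij⟩)
    · exact Or.inl ⟨c, prec_trans hc hp, Or.inl h⟩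
    · by_cases hb : Below i1 i2 (i2 c ⊓ y) x'.1
      · exfalso
        obtain ⟨n, hn, hn'⟩ := hb
        by_cases hnx : prec (i1 n) x.1
        · exact h (below_of_le (lt_of_le_of_ne (convex hn'.le hnx hp) (new_ne x n)) hn)
        · have h3 := inf_le_of_between (Or.inr hc) (not_prec.1 hnx)
          rw [← h1.map_inf] at h3
          refine h (below_of_le (lt_of_le_of_ne h3 (new_ne x _)) ?_)
          rw [h2.map_inf]
          exact le_inf inf_le_left hn
      · exact Or.inl ⟨c, prec_trans hc hp, Or.inr hb⟩
    · by_cases hdx : i1 d < x'.1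
      · obtain ⟨k, hk⟩ := G_ex (G_dom hj).1 hdx
        exact Or.inr ⟨d, i, k, hk, hi, hij.trans_le (G_prec hp hj hk)⟩
      · refine Or.inl ⟨d, prec_trans (prec_of_lt (G_dom hj).2.1) hp, Or.inr fun hb => hdx ?_⟩
        rw [inf_eq_left.2 (G_dom hi).2.1.le, below_i2 h1 h2] at hb
        exact hb
  · rintro x y y' (⟨c, hc, h⟩ | ⟨d, i, j, hj, hi, hij⟩) hl hyy
    · have hcy : ¬ preceq y' (i2 c) := fun h' => hl (Or.inl ⟨c, hc, Or.inl h'⟩)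
      have hb : Below i1 i2 (i2 c ⊓ y') x.1 := by
        by_contra hb; exact hl (Or.inl ⟨c, hc, Or.inr hb⟩)
      by_cases hyc : preceq y (i2 c)
      · exact hb.mono (le_inf (convex' hyy hyc (Or.inr (not_preceq.1 hcy))) hyy)
      · exact absurd (hb.mono (inf_le_inf_left _ hyy)) (h.resolve_left hyc)
    · exact absurd (Or.inr ⟨d, i, j, hj, G_mono hi hyy, hij⟩) hl
  · intro x y y' hd hl hp n hn
    have hny : prec (i2 n) y := by
      by_contra h
      refine hl (Or.inl ⟨n, prec_of_lt hn, Or.inl (not_prec.1 h)⟩)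
    obtain ⟨h3, h4⟩ := hd n hn
    have h5 : i2 n < y := lt_of_le_of_ne (convex h3.le hny hp) (by
      rintro rfl; exact prec_irrefl _ hny)
    refine ⟨h5, h4.imp_right ?_⟩
    rintro ⟨i, hi, hi'⟩
    obtain ⟨k, hk⟩ := G_ex (G_dom hi').1 h5
    rcases (G_prec hp hk hi').lt_or_eq with h6 | rfl
    · exact absurd (Or.inr ⟨n, k, i, hi, hk, h6⟩) hl
    · exact ⟨k, hi, hk⟩
  · intro x x' y hd hp hl
    by_contra hx
    obtain ⟨m, hm⟩ : ∃ n, i1 n = x.1 ⊓ x'.1 := by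
      rcases tight x.1 x'.1 with h | h | h
      · exact absurd h hx
      · exact absurd (preceq_of_le h) (not_preceq.2 hp)
      · exact h
    have hmx : i1 m < x.1 := lt_of_le_of_ne (hm ▸ inf_le_left) (new_ne x m)
    have hmx' : i1 m < x'.1 := lt_of_le_of_ne (hm ▸ inf_le_right) (new_ne x' m)
    obtain ⟨hmy, ⟨n', hn', hn''⟩ | ⟨i, hi, hi'⟩⟩ := hd m hmx
    · have hny := (hd n' hn'').1
      have hnx' : ¬ i1 n' < x'.1 := by
        intro h
        have : i1 n' ≤ i1 m := by rw [hm]; exact le_inf hn''.le h.le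
        exact (h1.le_iff.1 this).not_gt hn'
      refine hl (Or.inl ⟨n', prec_trans (prec_of_lt hn'') hp, Or.inr ?_⟩)
      rw [inf_eq_left.2 hny.le, below_i2 h1 h2]
      exact hnx'
    · obtain ⟨j, hj⟩ := G_ex (G_dom hi).1 hmx'
      refine hl (Or.inr ⟨m, i, j, hj, hi', lt_of_le_of_ne (G_prec hp hi hj) ?_⟩)
      rintro rfl
      exact G_sep hi hj hm.symm
  · intro x n y i hi hi' hd
    have hn := (G_dom hi).2.1
    by_cases hex : ∃ n', n < n' ∧ i1 n' < x.1
    · obtain ⟨n', hn', hn''⟩ := hex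
      have h3 := G2.1 ((G_iff_of_le (h1.lt_iff.2 hn') hn''.le).2 hi)
      exact ⟨n', hn'', G_sep h3 hi', hn'.le⟩
    · exfalso
      push Not at hex
      have hny := (G_dom hi').2.1
      refine hd fun m hm => ?_
      rcases le_total_of_le hm.le hn.le with h | h
      · rcases h.eq_or_lt with h | h
        · rw [h1.injective h]
          exact ⟨hny, Or.inr ⟨i, hi, hi'⟩⟩
        · exact ⟨(to2 h).trans hny, Or.inl ⟨n, h1.lt_iff.1 h, hn⟩⟩
      · rcases h.eq_or_lt with h | h
        · rw [← h1.injective h]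
          exact ⟨hny, Or.inr ⟨i, hi, hi'⟩⟩
        · exact absurd hm (hex m (h1.lt_iff.1 h))
  · intro x n y i j hl hi hj
    by_contra hlt
    push Not at hlt
    rcases hl with ⟨c, hc, h⟩ | ⟨d, k, l, hl, hk, hkl⟩
    · have hny := (G_dom hi).2.1
      have hnx := (G_dom hj).2.1
      rcases preceq_or_prec (i1 c) (i1 n) with h3 | h3
      · have h3' : preceq (i2 c) (i2 n) := by
          rwa [h2.preceq_iff, ← h1.preceq_iff]
        rcases h with h | h
        · exact not_prec.2 (preceq_trans h h3') (prec_of_lt hny)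
        · exact h (below_of_le hnx (inf_le_of_between h3' (preceq_of_le hny.le)))
      · have h4 : i1 n < i1 c := lt_of_le_of_ne (convex hnx.le h3 hc) (by
          intro e; rw [e] at h3; exact prec_irrefl _ h3)
        obtain ⟨k, hk⟩ := G_ex (G_dom hj).1 h4
        have hkj := G_prec hc hk hj
        have hk2 := G2.1 hk
        rcases h with h | h
        · rcases h with rfl | h
          · exact (hkj.trans_lt hlt).ne (G_uniq hk2 hi)
          · exact (G_prec h hi hk2).not_gt (hkj.trans_lt hlt)
        · have : i2 c ⊓ y = i2 n := by
            by_contra hne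
            exact (hkj.trans_lt hlt).ne (G_eq_of_inf_ne hk2 hi hne)
          exact h (below_of_le hnx this.le)
    · have hdx := (G_dom hl).2.1
      have hnx := (G_dom hj).2.1
      rcases le_total_of_le hdx.le hnx.le with h | h
      · rcases h.eq_or_lt with h | h
        · have := h1.injective h
          subst this
          rw [G_uniq hk hi, G_uniq hl hj] at hkl
          exact lt_asymm hkl hlt
        · have h4 := G2.1 ((G_iff_of_le h hnx.le).2 hl)
          exact hkl.ne' (G_uniq (G_mono h4 (G_dom hi).2.1.le) hk)
      · rcases h.eq_or_lt with h | h
        · have := h1.injective h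
          subst this
          rw [G_uniq hk hi, G_uniq hl hj] at hkl
          exact lt_asymm hkl hlt
        · have h4 := G2.1 ((G_iff_of_le h hdx.le).2 hj)
          exact hlt.ne (G_uniq (G_mono h4 (G_dom hk).2.1.le) hi)
  · intro x n y i j hl hi hj
    by_contra hlt
    push Not at hlt
    exact hl (Or.inr ⟨n, i, j, hj, hi, hlt⟩)

end Glue
end OTree
end Dendrite

namespace Dendrite
namespace OTree

/-! ### Equivariant amalgamation -/

section Amalgam

set_option linter.unusedSectionVars false

variable {N0 N1 N2 : Type u} [OTree N0] [OTree N1] [OTree N2] {i1 : N0 → N1} {i2 : N0 → N2}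

theorem exists_perm_congr {A : Type u} (F : Equiv.Perm A) {p q : A → Prop}
    (h : ∀ n, p (F n) ↔ q n) : (∃ n, p n) ↔ ∃ n, q n :=
  F.surjective.exists.trans (exists_congr h)

theorem forall_perm_congr {A : Type u} (F : Equiv.Perm A) {p q : A → Prop}
    (h : ∀ n, p (F n) ↔ q n) : (∀ n, p n) ↔ ∀ n, q n :=
  F.surjective.forall.trans (forall_congr' h)

theorem zpow_comm {A B : Type u} {F : Equiv.Perm A} {F' : Equiv.Perm B} {f : A → B}
    (h : ∀ x, F' (f x) = f (F x)) (k : ℤ) (x : A) : (F' ^ k) (f x) = f ((F ^ k) x) := by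
  have h1 : ∀ (n : ℕ) x, (F' ^ n) (f x) = f ((F ^ n) x) := by
    intro n
    induction n with
    | zero => intro x; rfl
    | succ n ih => intro x; rw [pow_succ, pow_succ, Equiv.Perm.mul_apply, h, ih]; rfl
  obtain ⟨n, rfl | rfl⟩ := k.eq_nat_or_neg
  · exact h1 n x
  · rw [zpow_neg, zpow_neg, zpow_natCast, zpow_natCast, Equiv.Perm.inv_eq_iff_eq, h1]
    simp

/-- The relations between orbits under an automorphism that increases a point. -/
theorem rel_zpow {A : Type u} {F : Equiv.Perm A} (r : A → A → Prop) [IsTrans A r]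
    (hF : ∀ a b, r a b → r (F a) (F b)) (hF' : ∀ a b, r (F a) (F b) → r a b) {a : A}
    (h : r a (F a)) {k l : ℤ} (hkl : k < l) : r ((F ^ k) a) ((F ^ l) a) := by
  refine Int.rel_of_forall_rel_succ_of_lt r (f := fun k : ℤ => (F ^ k) a) (fun k => ?_) hkl
  induction k using Int.induction_on with
  | zero => simpa using h
  | succ n ih =>
    have := hF _ _ ih
    rwa [← Equiv.Perm.mul_apply, ← Equiv.Perm.mul_apply, ← zpow_one_add, ← zpow_one_add,
      add_comm 1, add_comm 1] at this
  | pred n ih =>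
    apply hF'
    rw [← Equiv.Perm.mul_apply, ← Equiv.Perm.mul_apply, ← zpow_one_add, ← zpow_one_add,
      show 1 + (-(n : ℤ) - 1) = -n by ring, show 1 + (-(n : ℤ) - 1 + 1) = -n + 1 by ring]
    exact ih

instance {A : Type u} [OTree A] : IsTrans A (prec : A → A → Prop) := ⟨fun _ _ _ => prec_trans⟩

theorem prec_zpow {A : Type u} [OTree A] {F : Equiv.Perm A} (hF : IsEmb F) {a : A}
    (h : prec a (F a)) {k l : ℤ} (hkl : k < l) : prec ((F ^ k) a) ((F ^ l) a) :=
  rel_zpow prec (fun _ _ => (hF.prec_iff _ _).2) (fun _ _ => (hF.prec_iff _ _).1) h hkl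

theorem prec_zpow' {A : Type u} [OTree A] {F : Equiv.Perm A} (hF : IsEmb F) {a : A}
    (h : prec (F a) a) {k l : ℤ} (hkl : k < l) : prec ((F ^ l) a) ((F ^ k) a) :=
  haveI : IsTrans A (fun x y => prec y x) := ⟨fun _ _ _ h h' => prec_trans h' h⟩
  rel_zpow (fun x y => prec y x) (fun _ _ => (hF.prec_iff _ _).2)
    (fun _ _ => (hF.prec_iff _ _).1) h hkl

/-- The iterates of a point that is comparable with its image are pairwise comparable. -/
theorem zpow_le_total {A : Type u} [OTree A] {F : Equiv.Perm A} (hF : IsEmb F) {a : A}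
    (h : a ≤ F a ∨ F a ≤ a) (k l : ℤ) : (F ^ k) a ≤ (F ^ l) a ∨ (F ^ l) a ≤ (F ^ k) a := by
  have key : ∀ {k l : ℤ}, k < l → (F ^ k) a ≤ (F ^ l) a ∨ (F ^ l) a ≤ (F ^ k) a := by
    intro k l hkl
    rcases h with h | h
    · exact Or.inl (rel_zpow (· ≤ ·) (fun _ _ => hF.le_iff.2) (fun _ _ => hF.le_iff.1) h hkl)
    · exact Or.inr (rel_zpow (· ≥ ·) (fun _ _ => hF.le_iff.2) (fun _ _ => hF.le_iff.1) h hkl)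
  rcases lt_trichotomy k l with h | rfl | h
  · exact key h
  · exact Or.inl le_rfl
  · exact (key h).symm

/-- The meet of two iterates of a point `a` lies below an iterate of `a ⊓ F a`. -/
theorem zpow_inf_zpow_le {A : Type u} [OTree A] {F : Equiv.Perm A} (hF : IsEmb F) {a : A}
    {k l : ℤ} (hkl : k < l) : (F ^ k) a ⊓ (F ^ l) a ≤ (F ^ k) (a ⊓ F a) := by
  have e : (F ^ k) (a ⊓ F a) = (F ^ k) a ⊓ (F ^ (k + 1)) a := by
    rw [(hF.zpow k).map_inf, ← Equiv.Perm.mul_apply, ← zpow_add_one]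
  rw [e]
  refine le_inf inf_le_left ?_
  rcases (Int.add_one_le_of_lt hkl).eq_or_lt with h | h
  · rw [h]; exact inf_le_right
  by_cases hfix : a = F a
  · have hk : ∀ m : ℤ, (F ^ m) a = a := fun m =>
      Equiv.Perm.zpow_apply_eq_self_of_apply_eq_self hfix.symm m
    rw [hk, hk, hk, inf_idem]
  rcases prec_total hfix with hp | hp
  · exact inf_le_of_between (Or.inr (prec_zpow hF hp (lt_add_one k))) (Or.inr (prec_zpow hF hp h))
  · rw [inf_comm]
    exact inf_le_of_between (Or.inr (prec_zpow' hF hp h))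
      (Or.inr (prec_zpow' hF hp (lt_add_one k)))

/-- `U` is an amalgam of `N1` and `N2` over `N0`, with compatible automorphisms. -/
def IsAmalgam (i1 : N0 → N1) (i2 : N0 → N2) (F1 : Equiv.Perm N1) (F2 : Equiv.Perm N2)
    (U : Type u) [OTree U] (j1 : N1 → U) (j2 : N2 → U) (F : Equiv.Perm U) : Prop :=
  IsEmb j1 ∧ IsEmb j2 ∧ IsEmb F ∧ (∀ n, j1 (i1 n) = j2 (i2 n)) ∧ (∀ x, F (j1 x) = j1 (F1 x)) ∧
    (∀ y, F (j2 y) = j2 (F2 y)) ∧ ∀ u, (∃ x, j1 x = u) ∨ ∃ y, j2 y = u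

section Step

variable {F0 : Equiv.Perm N0} {F1 : Equiv.Perm N1} {F2 : Equiv.Perm N2}

theorem not_mem_range_iff (c1 : ∀ n, F1 (i1 n) = i1 (F0 n)) (x : N1) :
    x ∉ Set.range i1 ↔ F1 x ∉ Set.range i1 := by
  refine not_congr ⟨?_, ?_⟩
  · rintro ⟨n, rfl⟩; exact ⟨F0 n, (c1 n).symm⟩
  · rintro ⟨n, hn⟩
    refine ⟨F0.symm n, F1.injective ?_⟩
    rw [c1, Equiv.apply_symm_apply, hn]

/-- The permutation of the new part that an automorphism induces. -/
def newPerm (c1 : ∀ n, F1 (i1 n) = i1 (F0 n)) : Equiv.Perm (NewPart i1) :=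
  F1.subtypeEquiv (not_mem_range_iff c1)

/-- If the gluing data are invariant under the automorphisms, then these act on the glued tree. -/
theorem glue_amalgam {Dir : NewPart i1 → N2 → Prop} {L : N2 → NewPart i1 → Prop}
    (g : GlueRel i1 i2 Dir L) (hF1 : IsEmb F1) (hF2 : IsEmb F2)
    (c1 : ∀ n, F1 (i1 n) = i1 (F0 n)) (c2 : ∀ n, F2 (i2 n) = i2 (F0 n))
    (hDir : ∀ x y, Dir (newPerm c1 x) (F2 y) ↔ Dir x y)
    (hL : ∀ x y, L (F2 y) (newPerm c1 x) ↔ L y x) :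
    letI := g.glue
    ∃ (j1 : N1 → Glued i1 N2) (j2 : N2 → Glued i1 N2) (F : Equiv.Perm (Glued i1 N2)),
      IsAmalgam i1 i2 F1 F2 (Glued i1 N2) j1 j2 F := by
  let := g.glue
  let F : Equiv.Perm (Glued i1 N2) :=
    { toFun := fun a => match a with
        | .old y => .old (F2 y)
        | .new x => .new (newPerm c1 x)
      invFun := fun a => match a with
        | .old y => .old (F2.symm y)
        | .new x => .new ((newPerm c1).symm x)
      left_inv := by rintro (y | x) <;> simp
      right_inv := by rintro (y | x) <;> simp }
  have hval : ∀ x, (newPerm c1 x).1 = F1 x.1 := fun x => rfl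
  have hbelow : ∀ y (x : NewPart i1), Below i1 i2 (F2 y) (F1 x.1) ↔ Below i1 i2 y x.1 := by
    intro y x
    refine exists_perm_congr F0 fun n => ?_
    rw [← c1, ← c2, hF1.lt_iff, hF2.le_iff]
  have hF : IsEmb F := by
    refine IsEmb.of_le_iff F ?_ (fun a b => ⟨F.symm (F a ⊓ F b), by simp⟩) ?_ ?_ ?_
    · rintro (y | x) (y' | x')
      · exact hF2.le_iff
      · exact hbelow y x'
      · exact hDir x y'
      · exact hF1.le_iff
    · rintro (y | x) (y' | x')
      · exact hF2.prec_iff _ _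
      · exact hL x' y
      · exact not_congr (hL x y')
      · exact hF1.prec_iff _ _
    · rintro (y | x)
      · exact hF2.lab_eq _
      · exact hF1.lab_eq _
    · rintro i (y | x) (y' | x')
      · exact hF2.G_iff _ _ _
      · change ((∃ n, F2 y < i2 n ∧ i1 n < F1 x'.1 ∧ G i (F2 y) (i2 n)) ∨
          ∃ n, F2 y = i2 n ∧ G i (i1 n) (F1 x'.1)) ↔ ((∃ n, y < i2 n ∧ i1 n < x'.1 ∧ G i y (i2 n)) ∨
          ∃ n, y = i2 n ∧ G i (i1 n) x'.1)
        refine or_congr (exists_perm_congr F0 fun n => ?_) (exists_perm_congr F0 fun n => ?_)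
        · rw [← c1, ← c2, hF1.lt_iff, hF2.lt_iff, hF2.G_iff]
        · rw [← c1, ← c2, hF2.eq_iff, hF1.G_iff]
      · change (Dir (newPerm c1 x) (F2 y') ∧ lab (F1 x.1) ≠ ⊤ ∧ ((∃ z, G i (F1 x.1) z) ∨
          ((∀ z, ¬ F1 x.1 < z) ∧ i = 0))) ↔ (Dir x y' ∧ lab x.1 ≠ ⊤ ∧ ((∃ z, G i x.1 z) ∨
          ((∀ z, ¬ x.1 < z) ∧ i = 0)))
        rw [hDir, hF1.lab_eq, exists_perm_congr F1 (fun z => hF1.G_iff i x.1 z),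
          forall_perm_congr F1 (fun z => not_congr (hF1.lt_iff (a := x.1) (b := z)))]
      · exact hF1.G_iff _ _ _
  refine ⟨GlueRel.inN1 i1 i2, .old, F, g.isEmb_inN1, g.isEmb_old, hF, g.inN1_old, fun x => ?_,
    fun y => rfl, ?_⟩
  · rcases GlueRel.old_or_new (i1 := i1) x with ⟨n, rfl⟩ | ⟨x, rfl⟩
    · rw [c1, g.inN1_old, g.inN1_old, ← c2]; rfl
    · rw [← hval, GlueRel.inN1_new, GlueRel.inN1_new]; rfl
  · rintro (y | x)
    · exact Or.inr ⟨y, rfl⟩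
    · exact Or.inl ⟨x.1, GlueRel.inN1_new x⟩

/-- Amalgamation for the two kinds of extensions without new branchings. -/
theorem amalgam_step (h1 : IsEmb i1) (h2 : IsEmb i2) (hF1 : IsEmb F1) (hF2 : IsEmb F2)
    (c1 : ∀ n, F1 (i1 n) = i1 (F0 n)) (c2 : ∀ n, F2 (i2 n) = i2 (F0 n))
    (h : (∀ x : NewPart i1, ∃ v, x.1 < i1 v) ∨ ((∀ z n, z ≤ i1 n → z ∈ Set.range i1) ∧
      ∀ x x' : NewPart i1, x.1 ≤ x'.1 ∨ x'.1 ≤ x.1 ∨ ∃ n, i1 n = x.1 ⊓ x'.1)) :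
    ∃ (U : Type u) (_ : OTree U) (j1 : N1 → U) (j2 : N2 → U) (F : Equiv.Perm U),
      IsAmalgam i1 i2 F1 F2 U j1 j2 F := by
  have hbelow : ∀ y (x : N1), Below i1 i2 (F2 y) (F1 x) ↔ Below i1 i2 y x := by
    intro y x
    refine exists_perm_congr F0 fun n => ?_
    rw [← c1, ← c2, hF1.lt_iff, hF2.le_iff]
  have hval : ∀ x, (newPerm c1 x).1 = F1 x.1 := fun x => rfl
  rcases h with h | ⟨hd, ht⟩
  · have hDir : ∀ x y, DirIn i1 i2 (newPerm c1 x) (F2 y) ↔ DirIn i1 i2 x y := by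
      intro x y
      refine exists_perm_congr F0 fun n => ?_
      rw [hval, ← c1, ← c2, hF1.lt_iff, ← hF2.map_inf, hbelow]
    obtain ⟨j1, j2, F, hA⟩ := glue_amalgam (glueRelIn h1 h2 h) hF1 hF2 c1 c2 hDir (by
      intro x y
      refine and_congr (not_congr (hDir x y)) (exists_perm_congr F0 fun n => ?_)
      rw [hval, ← c1, ← c2, hF1.lt_iff, hF2.prec_iff])
    exact ⟨_, _, j1, j2, F, hA⟩
  · obtain ⟨j1, j2, F, hA⟩ := glue_amalgam (glueRelEnd h1 h2 hd ht) hF1 hF2 c1 c2 (by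
      intro x y
      have : ∀ n, (∃ n', F0 n < n' ∧ i1 n' < F1 x.1) ↔ ∃ n', n < n' ∧ i1 n' < x.1 := by
        intro n
        refine exists_perm_congr F0 fun n' => ?_
        rw [← h1.lt_iff, ← c1, ← c1, hF1.lt_iff, h1.lt_iff, hF1.lt_iff]
      refine forall_perm_congr F0 fun n => ?_
      simp only [hval, this, ← c1, ← c2, hF1.lt_iff, hF2.lt_iff, hF1.G_iff, hF2.G_iff]) (by
      intro x y
      refine or_congr (exists_perm_congr F0 fun n => ?_) (exists_perm_congr F0 fun n => ?_) <;>
      simp only [hval, ← c1, ← c2, hF1.prec_iff, hF2.preceq_iff, ← hF2.map_inf, hbelow, hF1.G_iff,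
        hF2.G_iff])
    exact ⟨_, _, j1, j2, F, hA⟩

/-- A proper extension with an automorphism contains a proper invariant extension without new
branchings, consisting of all elements below elements of `N0`, or of a single orbit. -/
theorem exists_step (h1 : IsEmb i1) (hF1 : IsEmb F1) (c1 : ∀ n, F1 (i1 n) = i1 (F0 n))
    {x0 : N1} (hx0 : x0 ∉ Set.range i1) :
    ∃ S : Set N1, MeetClosed S ∧ (∀ n, i1 n ∈ S) ∧ (∀ x, x ∈ S ↔ F1 x ∈ S) ∧
      (∃ x ∈ S, x ∉ Set.range i1) ∧ ((∀ x ∈ S, x ∉ Set.range i1 → ∃ v, x < i1 v) ∨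
      ((∀ z ∈ S, ∀ n, z ≤ i1 n → z ∈ Set.range i1) ∧
        ∀ x ∈ S, ∀ x' ∈ S, x ∉ Set.range i1 → x' ∉ Set.range i1 →
          x ≤ x' ∨ x' ≤ x ∨ ∃ n, i1 n = x ⊓ x')) := by
  by_cases hcase : ∃ x n, x ∉ Set.range i1 ∧ x ≤ i1 n
  · obtain ⟨x, n, hx, hn⟩ := hcase
    refine ⟨{x | ∃ n, x ≤ i1 n}, ?_, fun n => ⟨n, le_rfl⟩, fun x => ?_, ⟨x, ⟨n, hn⟩, hx⟩,
      Or.inl ?_⟩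
    · rintro a ⟨n, hn⟩ b -
      exact ⟨n, inf_le_left.trans hn⟩
    · change (∃ n, x ≤ i1 n) ↔ ∃ n, F1 x ≤ i1 n
      exact (exists_perm_congr F0 fun n => by rw [← c1, hF1.le_iff]).symm
    · rintro x ⟨n, hn⟩ hx
      exact ⟨n, lt_of_le_of_ne hn (fun e => hx ⟨n, e.symm⟩)⟩
  · push Not at hcase
    have hdown : ∀ z n, z ≤ i1 n → z ∈ Set.range i1 := fun z n hz => by
      by_contra h; exact hcase z n h hz
    have horb : ∀ n (k : ℤ), (F1 ^ k) (i1 n) ∈ Set.range i1 := fun n k =>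
      ⟨(F0 ^ k) n, (zpow_comm c1 k n).symm⟩
    -- a point whose orbit is admissible
    obtain ⟨q, hq, ht⟩ : ∃ q, q ∉ Set.range i1 ∧ ∀ k l : ℤ, (F1 ^ k) q ≤ (F1 ^ l) q ∨
        (F1 ^ l) q ≤ (F1 ^ k) q ∨ ∃ n, i1 n = (F1 ^ k) q ⊓ (F1 ^ l) q := by
      by_cases hq : x0 ⊓ F1 x0 ∈ Set.range i1
      · refine ⟨x0, hx0, ?_⟩
        have key : ∀ k l : ℤ, k < l → ∃ n, i1 n = (F1 ^ k) x0 ⊓ (F1 ^ l) x0 := by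
          intro k l hkl
          obtain ⟨n, hn⟩ := hq
          have h3 := zpow_inf_zpow_le hF1 (a := x0) hkl
          rw [← hn] at h3
          obtain ⟨m, hm⟩ := horb n k
          rw [← hm] at h3
          exact hdown _ m h3
        intro k l
        rcases lt_trichotomy k l with h | rfl | h
        · exact Or.inr (Or.inr (key k l h))
        · exact Or.inl le_rfl
        · rw [inf_comm]; exact Or.inr (Or.inr (key l k h))
      · refine ⟨_, hq, fun k l => ?_⟩
        rw [← or_assoc]
        refine Or.inl (zpow_le_total hF1 ?_ k l)
        rw [hF1.map_inf]
        exact le_total_of_le (c := F1 x0) inf_le_right inf_le_left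
    refine ⟨Set.range i1 ∪ {z | ∃ k : ℤ, (F1 ^ k) q = z}, ?_, fun n => Or.inl ⟨n, rfl⟩,
      fun x => ?_, ⟨q, Or.inr ⟨0, rfl⟩, hq⟩, Or.inr ⟨fun z _ n hz => hdown z n hz, ?_⟩⟩
    · rintro a (⟨n, rfl⟩ | ⟨k, rfl⟩) b (⟨m, rfl⟩ | ⟨l, rfl⟩)
      · exact Or.inl ⟨n ⊓ m, h1.map_inf _ _⟩
      · exact Or.inl (hdown _ n inf_le_left)
      · exact Or.inl (hdown _ m inf_le_right)
      · rcases ht k l with h | h | ⟨n, hn⟩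
        · rw [inf_eq_left.2 h]; exact Or.inr ⟨k, rfl⟩
        · rw [inf_eq_right.2 h]; exact Or.inr ⟨l, rfl⟩
        · exact Or.inl ⟨n, hn⟩
    · have h3 := not_congr (not_mem_range_iff c1 x)
      rw [not_not, not_not] at h3
      refine or_congr h3 ⟨?_, ?_⟩
      · rintro ⟨k, rfl⟩
        exact ⟨1 + k, by rw [zpow_one_add]; rfl⟩
      · rintro ⟨k, hk⟩
        refine ⟨-1 + k, ?_⟩
        rw [zpow_add, Equiv.Perm.mul_apply, hk, zpow_neg_one, Equiv.Perm.inv_def,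
          Equiv.symm_apply_apply]
    · rintro x (hx | ⟨k, rfl⟩) x' (hx' | ⟨l, rfl⟩) h h'
      · exact absurd hx h
      · exact absurd hx h
      · exact absurd hx' h'
      · exact ht k l

end Step

/-- **Equivariant amalgamation**: two ordered meet-trees with automorphisms can be amalgamated over
a common invariant part if one of them has finitely many orbits outside of it. -/
theorem exists_amalgam {N0 N1 N2 : Type u} [OTree N0] [OTree N1] [OTree N2] (i1 : N0 → N1)
    (i2 : N0 → N2) (h1 : IsEmb i1) (h2 : IsEmb i2) (F0 : Equiv.Perm N0) (F1 : Equiv.Perm N1)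
    (F2 : Equiv.Perm N2) (hF1 : IsEmb F1) (hF2 : IsEmb F2)
    (c1 : ∀ n, F1 (i1 n) = i1 (F0 n)) (c2 : ∀ n, F2 (i2 n) = i2 (F0 n)) (s : Finset N1)
    (hs : ∀ x, x ∉ Set.range i1 → ∃ b ∈ s, ∃ k : ℤ, (F1 ^ k) b = x) :
    ∃ (U : Type u) (_ : OTree U) (j1 : N1 → U) (j2 : N2 → U) (F : Equiv.Perm U),
      IsAmalgam i1 i2 F1 F2 U j1 j2 F := by
  classical
  induction hn : s.card using Nat.strong_induction_on generalizing N0 N2 s with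
  | _ n ih =>
    by_cases hx : ∃ x0, x0 ∉ Set.range i1
    · obtain ⟨x0, hx0⟩ := hx
      obtain ⟨S, hS, hiS, hFS, ⟨x, hxS, hx⟩, hstep⟩ := exists_step h1 hF1 c1 hx0
      let := sub S hS
      have hval := isEmb_val S hS
      have hF1' : IsEmb (F1.subtypeEquiv hFS : S → S) :=
        ⟨fun a b => Subtype.ext (hF1.map_inf _ _), fun a b => hF1.prec_iff _ _,
          fun a => hF1.lab_eq _, fun i a b => hF1.G_iff _ _ _⟩
      have hr : ∀ x : S, x ∈ Set.range (fun n => (⟨i1 n, hiS n⟩ : S)) ↔ x.1 ∈ Set.range i1 :=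
        fun x => ⟨fun ⟨n, hn⟩ => ⟨n, congrArg Subtype.val hn⟩, fun ⟨n, hn⟩ => ⟨n, Subtype.ext hn⟩⟩
      obtain ⟨U, _, j1, j2, F, g1, g2, g3, g4, g5, g6, g7⟩ :=
        amalgam_step (i1 := fun n => (⟨i1 n, hiS n⟩ : S)) (i2 := i2) (F0 := F0)
          (F1 := F1.subtypeEquiv hFS) (F2 := F2)
          ⟨fun a b => Subtype.ext (h1.map_inf _ _), fun a b => h1.prec_iff _ _,
            fun a => h1.lab_eq _, fun i a b => h1.G_iff _ _ _⟩ h2 hF1' hF2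
          (fun n => Subtype.ext (c1 n)) c2 (by
            rcases hstep with hstep | ⟨hd, ht⟩
            · exact Or.inl fun x => hstep x.1.1 x.1.2 (fun h => x.2 ((hr _).2 h))
            · refine Or.inr ⟨fun z n hz => (hr z).2 (hd z.1 z.2 n hz), fun x x' => ?_⟩
              refine (ht x.1.1 x.1.2 x'.1.1 x'.1.2 (fun h => x.2 ((hr _).2 h))
                (fun h => x'.2 ((hr _).2 h))).imp_right (Or.imp_right ?_)
              exact fun ⟨n, hn⟩ => ⟨n, Subtype.ext hn⟩)
      have hzS : ∀ (k : ℤ) b, (F1 ^ k) b ∈ S ↔ b ∈ S := by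
        intro k b
        induction k using Int.induction_on with
        | zero => rfl
        | succ m ihm => rw [← ihm, add_comm, zpow_one_add, Equiv.Perm.mul_apply, ← hFS]
        | pred m ihm =>
          rw [hFS, ← Equiv.Perm.mul_apply, ← zpow_one_add,
            show 1 + (-(m : ℤ) - 1) = -m by ring, ihm]
      obtain ⟨b, hb, k, rfl⟩ := hs x hx
      have hbS := (hzS k b).1 hxS
      obtain ⟨U', _, j1', j2', F', k1, k2, k3, k4, k5, k6, k7⟩ :=
        ih (s.erase b).card (by rw [← hn]; exact Finset.card_erase_lt_of_mem hb)
          (Subtype.val : S → N1) j1 hval g1 (F1.subtypeEquiv hFS) F g3 (fun n => rfl) g5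
          (s.erase b) (by
            intro x hx'
            have hxS' : x ∉ S := fun h => hx' ⟨⟨x, h⟩, rfl⟩
            obtain ⟨b', hb', k', rfl⟩ := hs x fun ⟨n, hn⟩ => hxS' (hn ▸ hiS n)
            refine ⟨b', Finset.mem_erase.2 ⟨?_, hb'⟩, k', rfl⟩
            rintro rfl
            exact hxS' ((hzS k' _).2 hbS)) rfl
      refine ⟨U', inferInstance, j1', j2' ∘ j2, F', k1, k2.comp g2, k3, fun n => ?_, k5,
        fun y => ?_, fun u => ?_⟩
      · change _ = j2' (j2 (i2 n))
        rw [← g4 n, ← k4]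
      · change F' (j2' (j2 y)) = j2' (j2 (F2 y))
        rw [k6, g6]
      · rcases k7 u with h | ⟨y, rfl⟩
        · exact Or.inl h
        · rcases g7 y with ⟨x, rfl⟩ | ⟨y, rfl⟩
          · exact Or.inl ⟨x, k4 x⟩
          · exact Or.inr ⟨y, rfl⟩
    · push Not at hx
      choose e he using hx
      have hmap : ∀ x, i1 (e x) = x := he
      have hE : IsEmb e :=
        ⟨fun a b => h1.injective (by rw [h1.map_inf, he, he, he]),
          fun a b => by rw [← h1.prec_iff, he, he],
          fun a => by rw [← h1.lab_eq, he],
          fun i a b => by rw [← h1.G_iff, he, he]⟩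
      refine ⟨N2, inferInstance, i2 ∘ e, id, F2, h2.comp hE, IsEmb.id, hF2, fun n => ?_,
        fun x => ?_, fun y => rfl, fun u => Or.inr ⟨u, rfl⟩⟩
      · exact congrArg i2 (h1.injective (he _))
      · change F2 (i2 (e x)) = i2 (e (F1 x))
        rw [c2]
        exact congrArg i2 (h1.injective (by rw [← c1, he, he]))

end Amalgam
end OTree
end Dendrite

namespace Dendrite

/-! ### Trees as covering graphs of meet-semilattices -/

/-- `G` is the covering graph of a finite meet-semilattice in which the elements below a given
one form a chain. -/
structure IsHasse {V : Type u} [SemilatticeInf V] (G : SimpleGraph V) : Prop where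
  finite : Finite V
  chain : ∀ a b c : V, a ≤ c → b ≤ c → a ≤ b ∨ b ≤ a
  adj_iff : ∀ u v, G.Adj u v ↔ u ⋖ v ∨ v ⋖ u

namespace IsHasse

variable {V : Type u} [SemilatticeInf V] {G : SimpleGraph V} {a b x : V}

theorem le_of_lt_of_covBy (h : IsHasse G) {u v w : V} (h1 : u ⋖ v) (h2 : w < v) : w ≤ u := by
  rcases h.chain w u v h2.le h1.le with h3 | h3
  · exact h3
  · rcases h3.eq_or_lt with h4 | h4
    · exact h4.ge
    · exact absurd h2 (h1.2 h4)

/-- A walk from `a` to `b` descends through everything between `a` and `a ⊓ b`. -/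
theorem mem_support_of_le (h : IsHasse G) (w : G.Walk a b) (h1 : a ⊓ b ≤ x) (h2 : x ≤ a) :
    x ∈ w.support := by
  induction w with
  | nil => rw [inf_idem] at h1; rw [le_antisymm h1 h2]; simp
  | @cons a v b hav w ih =>
    rcases h2.eq_or_lt with rfl | hxa
    · simp
    refine List.mem_cons_of_mem _ (ih ?_ ?_)
    · rcases (h.adj_iff _ _).1 hav with hc | hc
      · rcases h.chain (v ⊓ b) a v inf_le_left hc.le with h3 | h3
        · exact (le_inf h3 inf_le_right).trans h1
        · exact absurd (h1.trans_lt hxa) (by rw [inf_eq_left.2 (h3.trans inf_le_right)]; simp)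
      · exact (inf_le_inf_right b hc.le).trans h1
    · rcases (h.adj_iff _ _).1 hav with hc | hc
      · exact hxa.le.trans hc.le
      · exact h.le_of_lt_of_covBy hc hxa

theorem exists_walk_of_le (h : IsHasse G) (hab : a ≤ b) :
    ∃ w : G.Walk a b, ∀ x ∈ w.support, a ≤ x ∧ x ≤ b := by
  have := h.finite
  induction b using WellFoundedLT.induction with
  | _ b ih =>
    rcases hab.eq_or_lt with rfl | hlt
    · exact ⟨.nil, by simp⟩
    obtain ⟨c, hac, hcb⟩ := exists_le_covBy_of_lt hlt
    obtain ⟨w, hw⟩ := ih c hcb.lt hac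
    refine ⟨w.concat ((h.adj_iff _ _).2 (Or.inl hcb)), fun x hx => ?_⟩
    rw [SimpleGraph.Walk.support_concat, List.mem_append] at hx
    rcases hx with hx | hx
    · exact ⟨(hw x hx).1, (hw x hx).2.trans hcb.le⟩
    · obtain rfl := List.mem_singleton.1 hx; exact ⟨hab, le_rfl⟩

theorem exists_walk (h : IsHasse G) (a b : V) :
    ∃ w : G.Walk a b, ∀ x ∈ w.support, a ⊓ b ≤ x ∧ (x ≤ a ∨ x ≤ b) := by
  obtain ⟨w1, h1⟩ := h.exists_walk_of_le (inf_le_left : a ⊓ b ≤ a)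
  obtain ⟨w2, h2⟩ := h.exists_walk_of_le (inf_le_right : a ⊓ b ≤ b)
  refine ⟨w1.reverse.append w2, fun x hx => ?_⟩
  rw [SimpleGraph.Walk.mem_support_append_iff, SimpleGraph.Walk.support_reverse,
    List.mem_reverse] at hx
  rcases hx with hx | hx
  · exact ⟨(h1 x hx).1, Or.inl (h1 x hx).2⟩
  · exact ⟨(h2 x hx).1, Or.inr (h2 x hx).2⟩

theorem preconnected (h : IsHasse G) : G.Preconnected :=
  fun a b => ⟨(h.exists_walk a b).choose⟩

theorem edge_mem (h : IsHasse G) {u v : V} (huv : u ⋖ v) (w : G.Walk a b) (h1 : v ≤ a)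
    (h2 : ¬ v ≤ b) : s(u, v) ∈ w.edges := by
  induction w with
  | nil => exact absurd h1 h2
  | @cons a c b hac w ih =>
    rw [SimpleGraph.Walk.edges_cons, List.mem_cons]
    by_cases hc : v ≤ c
    · exact Or.inr (ih hc h2)
    · left
      rcases (h.adj_iff _ _).1 hac with h3 | h3
      · exact absurd (h1.trans h3.le) hc
      · have hva : v = a := by
          by_contra hne
          exact hc (h.le_of_lt_of_covBy h3 (lt_of_le_of_ne h1 hne))
        subst hva
        have : u = c := le_antisymm (h.le_of_lt_of_covBy h3 huv.lt)
          (h.le_of_lt_of_covBy huv h3.lt)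
        rw [this, Sym2.eq_swap]

theorem isAcyclic (h : IsHasse G) : G.IsAcyclic := by
  rw [SimpleGraph.isAcyclic_iff_forall_adj_isBridge]
  intro u v huv
  rw [SimpleGraph.isBridge_iff_forall_walk_mem_edges]
  intro p
  rcases (h.adj_iff _ _).1 huv with hc | hc
  · have := h.edge_mem hc p.reverse le_rfl hc.lt.not_ge
    rwa [SimpleGraph.Walk.edges_reverse, List.mem_reverse] at this
  · rw [Sym2.eq_swap]; exact h.edge_mem hc p le_rfl hc.lt.not_ge

/-- The path between two vertices consists of the vertices below one of them and above their
meet. -/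
theorem onPath_iff (h : IsHasse G) : OnPath G a b x ↔ a ⊓ b ≤ x ∧ (x ≤ a ∨ x ≤ b) := by
  classical
  constructor
  · rintro ⟨w, hw, hx⟩
    obtain ⟨w', hw'⟩ := h.exists_walk a b
    have := (h.isAcyclic.subsingleton_path a b).elim ⟨w, hw⟩ ⟨w'.bypass, w'.bypass_isPath⟩
    rw [Subtype.mk.injEq] at this
    subst this
    exact hw' x (w'.support_bypass_subset_support hx)
  · rintro ⟨h1, h2⟩
    obtain ⟨w, hw⟩ := h.preconnected.exists_isPath a b
    refine ⟨w, hw, ?_⟩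
    rcases h2 with h2 | h2
    · exact h.mem_support_of_le w h1 h2
    · have := h.mem_support_of_le w.reverse (by rwa [inf_comm]) h2
      rwa [SimpleGraph.Walk.support_reverse, List.mem_reverse] at this

theorem treeLE_iff (h : IsHasse G) {r : V} (hr : ∀ x, r ≤ x) : TreeLE G r a b ↔ a ≤ b := by
  rw [TreeLE, h.onPath_iff, inf_eq_left.2 (hr b)]
  exact ⟨fun h => h.2.elim (fun h => h.trans (hr b)) id, fun h => ⟨hr a, Or.inr h⟩⟩

theorem isSucc_iff (h : IsHasse G) {r : V} (hr : ∀ x, r ≤ x) : IsSucc G r a b ↔ a ⋖ b := by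
  rw [IsSucc, h.treeLE_iff hr, h.adj_iff]
  exact ⟨fun ⟨h1, h2⟩ => h1.elim id fun h3 => absurd h2 h3.lt.not_ge, fun h1 => ⟨Or.inl h1, h1.le⟩⟩

end IsHasse

section Rooted

variable {V : Type u} {G : SimpleGraph V} {r : V}

theorem treeLE_iff_mem (hG : G.IsAcyclic) {a b : V} (p : G.Walk r b) (hp : p.IsPath) :
    TreeLE G r a b ↔ a ∈ p.support := by
  constructor
  · rintro ⟨q, hq, ha⟩
    have := (hG.subsingleton_path r b).elim ⟨p, hp⟩ ⟨q, hq⟩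
    rw [Subtype.mk.injEq] at this
    rwa [this]
  · exact fun h => ⟨p, hp, h⟩

theorem treeLE_refl (hc : G.Preconnected) (a : V) : TreeLE G r a a := by
  obtain ⟨p, hp⟩ := hc.exists_isPath r a
  exact ⟨p, hp, p.end_mem_support⟩

theorem treeLE_trans (hG : G.IsAcyclic) {a b c : V} (h1 : TreeLE G r a b) (h2 : TreeLE G r b c) :
    TreeLE G r a c := by
  classical
  obtain ⟨p, hp, hb⟩ := h2
  rw [treeLE_iff_mem hG (p.takeUntil b hb) (hp.takeUntil hb)] at h1
  exact ⟨p, hp, p.support_takeUntil_subset_support hb h1⟩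

theorem treeLE_antisymm (hG : G.IsAcyclic) {a b : V} (h1 : TreeLE G r a b)
    (h2 : TreeLE G r b a) : a = b := by
  classical
  by_contra hne
  obtain ⟨p, hp, ha⟩ := h1
  have hq := hp.takeUntil ha
  rw [treeLE_iff_mem hG _ hq] at h2
  have h3 := (hG.subsingleton_path r b).elim ⟨p, hp⟩ ⟨_, hq.takeUntil h2⟩
  rw [Subtype.mk.injEq] at h3
  have h4 := SimpleGraph.Walk.length_takeUntil_lt_length ha hne
  have h5 := (p.takeUntil a ha).length_takeUntil_le_length h2
  rw [← h3] at h5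
  exact absurd (h5.trans_lt h4) (lt_irrefl _)

theorem treeLE_total (hG : G.IsAcyclic) {a b c : V} (h1 : TreeLE G r a c) (h2 : TreeLE G r b c) :
    TreeLE G r a b ∨ TreeLE G r b a := by
  classical
  obtain ⟨p, hp, hb⟩ := h2
  rw [treeLE_iff_mem hG p hp, ← p.take_spec hb, SimpleGraph.Walk.mem_support_append_iff] at h1
  rcases h1 with h1 | h1
  · exact Or.inl ⟨_, hp.takeUntil hb, h1⟩
  · right
    refine ⟨(p.takeUntil b hb).append ((p.dropUntil b hb).takeUntil a h1), ?_, ?_⟩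
    · rw [← p.take_spec hb, ← (p.dropUntil b hb).take_spec h1, SimpleGraph.Walk.append_assoc] at hp
      exact hp.of_append_left
    · rw [SimpleGraph.Walk.mem_support_append_iff]
      exact Or.inl (SimpleGraph.Walk.end_mem_support _)

/-- The meet-semilattice of the vertices of a finite tree with a root. -/
theorem exists_treeSemilattice [Finite V] (hG : G.IsAcyclic) (hc : G.Preconnected) (r : V) :
    ∃ s : SemilatticeInf V, ∀ a b, s.le a b ↔ TreeLE G r a b := by
  let po : PartialOrder V :=
    { le := TreeLE G r
      le_refl := treeLE_refl hc
      le_trans := fun _ _ _ => treeLE_trans hG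
      le_antisymm := fun _ _ => treeLE_antisymm hG }
  have hr : ∀ x : V, r ≤ x := fun x => by
    obtain ⟨p, hp⟩ := hc.exists_isPath r x
    exact ⟨p, hp, p.start_mem_support⟩
  have key : ∀ a b : V, ∃ m, m ≤ a ∧ m ≤ b ∧ ∀ x, x ≤ a → x ≤ b → x ≤ m := by
    intro a b
    obtain ⟨m, ⟨hm1, hm2⟩, hmax⟩ :=
      (Set.toFinite {x | x ≤ a ∧ x ≤ b}).exists_maximal ⟨r, hr a, hr b⟩
    refine ⟨m, hm1, hm2, fun x h1 h2 => ?_⟩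
    rcases treeLE_total hG h1 hm1 with h | h
    · exact h
    · exact hmax ⟨h1, h2⟩ h
  choose m hm1 hm2 hm3 using key
  exact ⟨{ po with
    inf := m, inf_le_left := hm1, inf_le_right := hm2,
    le_inf := fun x a b => hm3 a b x }, fun _ _ => Iff.rfl⟩

/-- A tree is the covering graph of the order that a choice of root defines on it. -/
theorem isHasse_of_treeLE [s : SemilatticeInf V] [Finite V] (hG : G.IsAcyclic) (hc : G.Preconnected)
    (hs : ∀ a b : V, a ≤ b ↔ TreeLE G r a b) : IsHasse G := by
  have hadj : ∀ u v, G.Adj u v → u ≤ v → u ⋖ v := by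
    intro u v huv hle
    have hlt : u < v := lt_of_le_of_ne hle huv.ne
    obtain ⟨p, hp⟩ := hc.exists_isPath r u
    have hv : v ∉ p.support := fun h => hlt.not_ge ((hs v u).2 ⟨p, hp, h⟩)
    refine ⟨hlt, fun w h1 h2 => ?_⟩
    rw [lt_iff_le_and_ne, hs, treeLE_iff_mem hG _ (hp.concat hv huv),
      SimpleGraph.Walk.support_concat, List.mem_append,
      List.mem_singleton] at h2
    rcases h2.1 with h3 | h3
    · exact h1.not_ge ((hs w u).2 ⟨p, hp, h3⟩)
    · exact h2.2 h3
  refine ⟨inferInstance, fun a b c h1 h2 => ?_, fun u v => ⟨fun huv => ?_, ?_⟩⟩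
  · rw [hs] at h1 h2 ⊢
    rw [hs]
    exact treeLE_total hG h1 h2
  · by_cases h : u ≤ v
    · exact Or.inl (hadj u v huv h)
    · right
      apply hadj v u huv.symm
      obtain ⟨p, hp⟩ := hc.exists_isPath r v
      have hu : u ∉ p.support := fun h' => h ((hs u v).2 ⟨p, hp, h'⟩)
      rw [hs, treeLE_iff_mem hG _ (hp.concat hu huv.symm)]
      rw [SimpleGraph.Walk.support_concat, List.mem_append]
      exact Or.inl p.end_mem_support
  · have hcov : ∀ u v, u ⋖ v → G.Adj u v := by
      intro u v huv
      obtain ⟨p, hp⟩ := hc.exists_isPath r v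
      have hu : u ∈ p.support := (treeLE_iff_mem hG p hp).1 ((hs u v).1 huv.le)
      cases p using SimpleGraph.Walk.concatRec with
      | Hnil =>
        rw [SimpleGraph.Walk.support_nil, List.mem_singleton] at hu
        exact absurd hu huv.lt.ne
      | @Hconcat _ w _ p hwv _ =>
        rw [SimpleGraph.Walk.concat_isPath_iff] at hp
        rw [SimpleGraph.Walk.support_concat, List.mem_append,
          List.mem_singleton] at hu
        have h1 : u ≤ w := (hs u w).2 ⟨p, hp.1, hu.resolve_right huv.lt.ne⟩
        have h2 : w ≤ v := by
          rw [hs, treeLE_iff_mem hG _ (hp.1.concat hp.2 hwv)]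
          rw [SimpleGraph.Walk.support_concat, List.mem_append]
          exact Or.inl p.end_mem_support
        rcases h1.eq_or_lt with h3 | h3
        · rwa [h3]
        · exact absurd (lt_of_le_of_ne h2 hwv.ne) (huv.2 h3)
    rintro (h | h)
    · exact hcov u v h
    · exact (hcov v u h).symm

end Rooted
end Dendrite

namespace Dendrite

/-! ### Ordered trees as finite ordered meet-trees -/

/-- All labels belong to `P`. -/
def LabIn (P : Set ℕ∞) (A : Type u) [OTree A] : Prop := ∀ a : A, OTree.lab a ∈ P

/-- The interpretations of the relation symbols agree with their quantifier-free definitions in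
the ordered meet-tree `A`. -/
structure Compat (P : Set ℕ∞) (A : Type u) [OTree A] [(lang P).Structure A] : Prop where
  R_iff : ∀ v : Fin 4 → A, Structure.RelMap (L := lang P) (Rel.R : Rel P 4) v ↔
    ¬ ∃ u w, (u = v 0 ∨ u = v 1) ∧ (w = v 2 ∨ w = v 3) ∧
      v 0 ⊓ v 1 ≤ u ⊓ w ∧ v 2 ⊓ v 3 ≤ u ⊓ w
  K_iff : ∀ (p : P) (v : Fin 1 → A), Structure.RelMap (L := lang P) (Rel.K p : Rel P 1) v ↔
    OTree.lab (v 0) = p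
  prec_iff : ∀ v : Fin 2 → A, Structure.RelMap (L := lang P) (Rel.prec : Rel P 2) v ↔
    OTree.prec (v 0) (v 1)
  G_iff : ∀ (i : {i : ℕ // (i : ℕ∞) < sSup P}) (v : Fin 2 → A),
    Structure.RelMap (L := lang P) (Rel.G i : Rel P 2) v ↔ OTree.G i (v 0) (v 1)
  C_iff : ∀ v : Fin 3 → A, Structure.RelMap (L := lang P) (Rel.C : Rel P 3) v ↔
    ¬ v 0 ⊓ v 1 ≤ v 2

namespace OTree

/-- The ordered meet-tree induced by an injection whose range is closed under meets. -/
@[reducible] noncomputable def pullback {A B : Type u} [OTree B] (e : A → B)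
    (he : Function.Injective e) (hm : ∀ a b, ∃ c, e c = e a ⊓ e b) : OTree A where
  le a b := e a ≤ e b
  lt a b := e a < e b
  lt_iff_le_not_ge _ _ := lt_iff_le_not_ge
  le_refl _ := le_rfl
  le_trans _ _ _ := le_trans
  le_antisymm _ _ h h' := he (le_antisymm h h')
  inf a b := (hm a b).choose
  inf_le_left a b := (hm a b).choose_spec.trans_le inf_le_left
  inf_le_right a b := (hm a b).choose_spec.trans_le inf_le_right
  le_inf _ b c h h' := (le_inf h h').trans_eq (hm b c).choose_spec.symm
  prec a b := prec (e a) (e b)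
  lab a := lab (e a)
  G i a b := G i (e a) (e b)
  prec_irrefl a := prec_irrefl (e a)
  prec_trans := prec_trans
  prec_total h := prec_total (he.ne h)
  prec_of_lt h := prec_of_lt h
  convex h := convex (A := B) h
  two_le_lab a := two_le_lab (e a)
  G_dom h := G_dom (A := B) h
  G_ex h := G_ex (A := B) h
  G_uniq := G_uniq
  G_mono := fun h => G_mono (A := B) h
  G_sep {_ _ b c} h1 h2 h := G_sep h1 h2 ((hm b c).choose_spec.symm.trans (congrArg e h))
  G_prec := G_prec

theorem isEmb_pullback {A B : Type u} [OTree B] (e : A → B)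
    (he : Function.Injective e) (hm : ∀ a b, ∃ c, e c = e a ⊓ e b) :
    letI := pullback e he hm
    IsEmb e :=
  letI := pullback e he hm
  ⟨fun a b => (hm a b).choose_spec, fun _ _ => Iff.rfl, fun _ => rfl, fun _ _ _ => Iff.rfl⟩

end OTree

section OfLex

variable {V : Type u} [SemilatticeInf V] {G : SimpleGraph V} {lt : V → V → Prop}

theorem IsHasse.exists_cover (h : IsHasse G) {m a : V} (hma : m < a) : ∃ x, m ⋖ x ∧ x ≤ a :=
  have := h.finite
  exists_covBy_le_of_lt hma

theorem IsHasse.cover_unique (h : IsHasse G) {m x y a : V} (hx : m ⋖ x) (hy : m ⋖ y)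
    (hxa : x ≤ a) (hya : y ≤ a) : x = y := by
  rcases h.chain x y a hxa hya with h1 | h1
  · rcases h1.eq_or_lt with h2 | h2
    · exact h2
    · exact absurd h2 (hy.2 hx.lt)
  · rcases h1.eq_or_lt with h2 | h2
    · exact h2.symm
    · exact absurd h2 (hx.2 hy.lt)

/-- Lexicographical orderings in terms of the tree order. -/
structure IsLex (lt : V → V → Prop) : Prop where
  strictTotal : IsStrictTotalOrder V lt
  anc : ∀ a b, a < b → lt a b
  lex : ∀ m x y a b, m ⋖ x → m ⋖ y → lt x y → x ≤ a → y ≤ b → lt a b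

theorem isLex_iff (h : IsHasse G) {r : V} (hr : ∀ x, r ≤ x) : IsLexOrder G r lt ↔ IsLex lt := by
  constructor
  · rintro ⟨h1, h2, h3⟩
    simp only [h.isSucc_iff hr, h.treeLE_iff hr] at h2 h3
    exact ⟨h1, fun a b hab => h2 a b hab.le hab.ne, h3⟩
  · rintro ⟨h1, h2, h3⟩
    refine ⟨h1, ?_, ?_⟩
    · simp only [h.treeLE_iff hr]
      exact fun a b hab hne => h2 a b (lt_of_le_of_ne hab hne)
    · simpa only [h.isSucc_iff hr, h.treeLE_iff hr] using h3

/-- The children of `a` that precede `x`. -/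
def before (lt : V → V → Prop) (a x : V) : Set V := {c | a ⋖ c ∧ lt c x}

theorem before_encard_lt (h : IsHasse G) (hl : IsLex lt) {a x y : V} (hx : a ⋖ x) (hxy : lt x y) :
    (before lt a x).encard < (before lt a y).encard := by
  have := h.finite
  have := hl.strictTotal
  refine Set.Finite.encard_lt_encard (Set.toFinite _) ⟨fun c hc => ⟨hc.1, trans_of lt hc.2 hxy⟩, ?_⟩
  exact fun hs => irrefl_of lt x (hs ⟨hx, hxy⟩ : x ∈ before lt a x).2

theorem before_encard_add_two_le (h : IsHasse G) (hl : IsLex lt) {lab : V → ℕ∞} {r : V}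
    (hr : ∀ x, r ≤ x) (h2 : ∀ a, 2 ≤ lab a) (hdeg : ∀ t, (G.neighborSet t).encard ≤ lab t)
    (hr1 : (G.neighborSet r).encard = 1) {a x : V} (hx : a ⋖ x) :
    (before lt a x).encard + 1 + 1 ≤ lab a := by
  have := hl.strictTotal
  have hfin := h.finite
  have hsub : (before lt a x).encard + 1 ≤ {c | a ⋖ c}.encard := by
    rw [← Set.encard_insert_of_notMem (a := x) (fun hs => irrefl_of lt x hs.2)]
    refine Set.encard_le_encard ?_
    rintro c (rfl | hc)
    · exact hx
    · exact hc.1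
  by_cases hra : a = r
  · subst hra
    have : {c | a ⋖ c}.encard ≤ 1 := by
      rw [← hr1]
      exact Set.encard_le_encard fun c hc => (h.adj_iff _ _).2 (Or.inl hc)
    calc (before lt a x).encard + 1 + 1 ≤ 1 + 1 := by gcongr; exact hsub.trans this
      _ ≤ lab a := by rw [one_add_one_eq_two]; exact h2 a
  · obtain ⟨p, -, hp⟩ := exists_le_covBy_of_lt (lt_of_le_of_ne (hr a) (Ne.symm hra))
    refine le_trans ?_ (hdeg a)
    have hp' : p ∉ {c | a ⋖ c} := fun hc => hc.lt.not_gt hp.lt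
    calc (before lt a x).encard + 1 + 1 ≤ {c | a ⋖ c}.encard + 1 := by gcongr
      _ = (insert p {c | a ⋖ c}).encard := (Set.encard_insert_of_notMem hp').symm
      _ ≤ _ := by
        refine Set.encard_le_encard ?_
        rintro c (rfl | hc)
        · exact (h.adj_iff _ _).2 (Or.inr hp)
        · exact (h.adj_iff _ _).2 (Or.inl hc)

/-- The ordered meet-tree of a labelled tree with a lexicographical ordering. -/
@[reducible] def otreeOfLex (h : IsHasse G) (hl : IsLex lt) (lab : V → ℕ∞) {r : V}
    (hr : ∀ x, r ≤ x) (h2 : ∀ a, 2 ≤ lab a) (hdeg : ∀ t, (G.neighborSet t).encard ≤ lab t)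
    (hr1 : (G.neighborSet r).encard = 1) : OTree V where
  prec := lt
  lab := lab
  G i a b := lab a ≠ ⊤ ∧ ∃ x, a ⋖ x ∧ x ≤ b ∧ (before lt a x).encard = i
  prec_irrefl := hl.strictTotal.irrefl
  prec_trans := hl.strictTotal.trans _ _ _
  prec_total {a b} hab := by
    have := hl.strictTotal
    exact (trichotomous_of lt a b).imp_right fun h => h.resolve_left hab
  prec_of_lt := hl.anc _ _
  convex {a z c} hac haz hzc := by
    have := hl.strictTotal
    by_contra hle
    have hlt : a ⊓ z < a := inf_lt_left.2 hle
    rcases (inf_le_right : a ⊓ z ≤ z).eq_or_lt with hz | hz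
    · rw [hz] at hlt
      exact asymm_of lt haz (hl.anc _ _ hlt)
    obtain ⟨x, hx, hxa⟩ := h.exists_cover hlt
    obtain ⟨y, hy, hyz⟩ := h.exists_cover hz
    rcases trichotomous_of lt x y with hxy | rfl | hxy
    · exact asymm_of lt hzc (hl.lex _ _ _ _ _ hx hy hxy (hxa.trans hac) hyz)
    · exact hx.lt.not_ge (le_inf hxa hyz)
    · exact asymm_of lt haz (hl.lex _ _ _ _ _ hy hx hxy hyz hxa)
  two_le_lab := h2
  G_dom := by
    rintro i a b ⟨h1, x, hx, hxb, hi⟩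
    refine ⟨h1, hx.lt.trans_le hxb, ?_⟩
    have := before_encard_add_two_le h hl hr h2 hdeg hr1 hx
    rw [hi] at this
    exact (ENat.add_one_le_iff (by exact_mod_cast ENat.natCast_ne_top (i + 1))).1 this
  G_ex := by
    intro a b h1 hab
    have := h.finite
    obtain ⟨x, hx, hxb⟩ := h.exists_cover hab
    obtain ⟨i, hi⟩ := ENat.ne_top_iff_exists.1
      (Set.encard_ne_top_iff.2 (Set.toFinite (before lt a x)))
    exact ⟨i, h1, x, hx, hxb, hi.symm⟩
  G_uniq := by
    rintro i j a b ⟨-, x, hx, hxb, hi⟩ ⟨-, y, hy, hyb, hj⟩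
    rw [h.cover_unique hx hy hxb hyb, hj] at hi
    exact_mod_cast hi.symm
  G_mono := by
    rintro i a b c ⟨h1, x, hx, hxb, hi⟩ hbc
    exact ⟨h1, x, hx, hxb.trans hbc, hi⟩
  G_sep := by
    have := hl.strictTotal
    rintro i a b c ⟨-, x, hx, hxb, hi⟩ ⟨-, y, hy, hyc, hj⟩ he
    rcases trichotomous_of lt x y with hxy | rfl | hxy
    · exact (before_encard_lt h hl hx hxy).ne (hi.trans hj.symm)
    · exact hx.lt.not_ge (he ▸ le_inf hxb hyc)
    · exact (before_encard_lt h hl hy hxy).ne (hj.trans hi.symm)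
  G_prec := by
    have := hl.strictTotal
    rintro i j a b c hbc ⟨-, x, hx, hxb, hi⟩ ⟨-, y, hy, hyc, hj⟩
    rcases trichotomous_of lt x y with hxy | rfl | hxy
    · have := (before_encard_lt h hl hx hxy).le
      rw [hi, hj] at this
      exact_mod_cast this
    · rw [hi] at hj
      exact (Nat.cast_injective hj).le
    · exact absurd hbc (asymm_of lt (hl.lex _ _ _ _ _ hy hx hxy hyc hxb))

end OfLex

theorem onPath_map {A V : Type u} {T : SimpleGraph A} {T' : SimpleGraph V} (e : T ↪g T')
    (hT : T.Preconnected) (hT' : T'.IsAcyclic) {a b : A} {x : V} :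
    OnPath T' (e a) (e b) x ↔ ∃ y, e y = x ∧ OnPath T a b y := by
  constructor
  · rintro ⟨w, hw, hx⟩
    obtain ⟨p, hp⟩ := hT.exists_isPath a b
    have := (hT'.subsingleton_path _ _).elim ⟨w, hw⟩
      ⟨p.map e.toHom, hp.map e.injective⟩
    rw [Subtype.mk.injEq] at this
    rw [this, SimpleGraph.Walk.support_map, List.mem_map] at hx
    obtain ⟨y, hy, rfl⟩ := hx
    exact ⟨y, rfl, p, hp, hy⟩
  · rintro ⟨y, rfl, p, hp, hy⟩
    refine ⟨p.map e.toHom, hp.map e.injective, ?_⟩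
    rw [SimpleGraph.Walk.support_map]
    exact List.mem_map_of_mem hy

/-- A path description of disjointness. -/
theorem exists_mem_both_iff {V : Type u} [SemilatticeInf V] {a b c d : V} :
    (∃ x, (a ⊓ b ≤ x ∧ (x ≤ a ∨ x ≤ b)) ∧ c ⊓ d ≤ x ∧ (x ≤ c ∨ x ≤ d)) ↔
      ∃ u w, (u = a ∨ u = b) ∧ (w = c ∨ w = d) ∧ a ⊓ b ≤ u ⊓ w ∧ c ⊓ d ≤ u ⊓ w := by
  constructor
  · rintro ⟨x, ⟨h1, h2⟩, h3, h4⟩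
    rcases h2 with h2 | h2 <;> rcases h4 with h4 | h4
    · exact ⟨a, c, Or.inl rfl, Or.inl rfl, h1.trans (le_inf h2 h4), h3.trans (le_inf h2 h4)⟩
    · exact ⟨a, d, Or.inl rfl, Or.inr rfl, h1.trans (le_inf h2 h4), h3.trans (le_inf h2 h4)⟩
    · exact ⟨b, c, Or.inr rfl, Or.inl rfl, h1.trans (le_inf h2 h4), h3.trans (le_inf h2 h4)⟩
    · exact ⟨b, d, Or.inr rfl, Or.inr rfl, h1.trans (le_inf h2 h4), h3.trans (le_inf h2 h4)⟩
  · rintro ⟨u, w, h1, h2, h3, h4⟩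
    refine ⟨u ⊓ w, ⟨h3, h1.imp ?_ ?_⟩, h4, h2.imp ?_ ?_⟩ <;> rintro rfl
    · exact inf_le_left
    · exact inf_le_left
    · exact inf_le_right
    · exact inf_le_right

theorem IsHasse.pathsDisjoint_iff {V : Type u} [SemilatticeInf V] {G : SimpleGraph V}
    (h : IsHasse G) (a b c d : V) : PathsDisjoint G a b c d ↔
      ¬ ∃ u w, (u = a ∨ u = b) ∧ (w = c ∨ w = d) ∧ a ⊓ b ≤ u ⊓ w ∧ c ⊓ d ≤ u ⊓ w := by
  rw [← exists_mem_both_iff]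
  simp only [PathsDisjoint, h.onPath_iff, not_exists]

theorem IsHasse.pathsDisjoint_root_iff {V : Type u} [SemilatticeInf V] {G : SimpleGraph V}
    (h : IsHasse G) {r : V} (hr : ∀ x, r ≤ x) (a b c : V) :
    PathsDisjoint G a b c r ↔ ¬ a ⊓ b ≤ c := by
  simp only [PathsDisjoint, h.onPath_iff, inf_eq_right.2 (hr c), ← not_exists]
  refine not_congr ⟨?_, fun h1 => ⟨a ⊓ b, ⟨le_rfl, Or.inl inf_le_left⟩, hr _, Or.inl h1⟩⟩
  rintro ⟨x, ⟨h1, -⟩, -, h2⟩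
  exact h1.trans (h2.elim id fun h2 => h2.trans (hr c))

/-- Members of the class `𝒯^≺_P` are finite ordered meet-trees. -/
theorem IsOrderedTree.exists_otree {P : Set ℕ∞} (hP : ∀ p ∈ P, 2 ≤ p) {A : Type u}
    [(lang P).Structure A] (hA : IsOrderedTree P A) :
    Finite A ∧ ∃ _ : OTree A, LabIn P A ∧ Compat P A := by
  obtain ⟨T, lab, V, T', lab', e, r, lt, hT, hT', hlab, -, hr1, hlex, hR, hK, hprec, hG, hC⟩ := hA
  have := hT.finite
  have := hT'.finite
  obtain ⟨s, hs⟩ := exists_treeSemilattice hT'.acyclic hT'.preconnected r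
  have hr : ∀ x : V, r ≤ x := fun x => by
    rw [hs]
    obtain ⟨p, hp⟩ := hT'.preconnected.exists_isPath r x
    exact ⟨p, hp, p.start_mem_support⟩
  have hH : IsHasse T' := isHasse_of_treeLE hT'.acyclic hT'.preconnected hs
  let oV : OTree V := otreeOfLex hH ((isLex_iff hH hr).1 hlex) lab' hr
    (fun a => hP _ (hT'.lab_mem a)) hT'.degree_le hr1
  have hm : ∀ a b, ∃ c, e c = e a ⊓ e b := fun a b => by
    have : OnPath T' (e a) (e b) (e a ⊓ e b) :=
      hH.onPath_iff.2 ⟨le_rfl, Or.inl inf_le_left⟩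
    rw [onPath_map e hT.preconnected hT'.acyclic] at this
    obtain ⟨y, hy, -⟩ := this
    exact ⟨y, hy⟩
  let oA : OTree A := OTree.pullback e e.injective hm
  have he : OTree.IsEmb e := OTree.isEmb_pullback e e.injective hm
  refine ⟨inferInstance, oA, fun a => ?_, ?_⟩
  · change lab' (e a) ∈ P
    exact hT'.lab_mem _
  · refine ⟨fun v => ?_, fun p v => ?_, fun v => hprec v, fun i v => ?_, fun v => ?_⟩
    · rw [hR]
      have : PathsDisjoint T (v 0) (v 1) (v 2) (v 3) ↔
          PathsDisjoint T' (e (v 0)) (e (v 1)) (e (v 2)) (e (v 3)) := by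
        simp only [PathsDisjoint, onPath_map e hT.preconnected hT'.acyclic]
        constructor
        · rintro h1 _ ⟨⟨y, rfl, hy⟩, z, hz, hz'⟩
          exact h1 y ⟨hy, e.injective hz ▸ hz'⟩
        · rintro h1 x ⟨hx, hx'⟩
          exact h1 (e x) ⟨⟨x, rfl, hx⟩, x, rfl, hx'⟩
      rw [this, hH.pathsDisjoint_iff]
      refine not_congr ⟨?_, ?_⟩
      · rintro ⟨u, w, hu, hw, h1, h2⟩
        have hu' : ∃ u', u = e u' ∧ (u' = v 0 ∨ u' = v 1) := by
          rcases hu with rfl | rfl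
          · exact ⟨_, rfl, Or.inl rfl⟩
          · exact ⟨_, rfl, Or.inr rfl⟩
        have hw' : ∃ u', w = e u' ∧ (u' = v 2 ∨ u' = v 3) := by
          rcases hw with rfl | rfl
          · exact ⟨_, rfl, Or.inl rfl⟩
          · exact ⟨_, rfl, Or.inr rfl⟩
        obtain ⟨u', rfl, hu'⟩ := hu'
        obtain ⟨w', rfl, hw'⟩ := hw'
        rw [← he.map_inf, ← he.map_inf, he.le_iff] at h1
        rw [← he.map_inf, ← he.map_inf, he.le_iff] at h2
        exact ⟨u', w', hu', hw', h1, h2⟩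
      · rintro ⟨u, w, hu, hw, h1, h2⟩
        refine ⟨e u, e w, hu.imp (congrArg e) (congrArg e), hw.imp (congrArg e) (congrArg e), ?_, ?_⟩
        · rwa [← he.map_inf, ← he.map_inf, he.le_iff]
        · rwa [← he.map_inf, ← he.map_inf, he.le_iff]
    · rw [hK, ← hlab]; rfl
    · rw [hG, ← hlab]
      simp only [hH.isSucc_iff hr, hH.treeLE_iff hr]
      rfl
    · rw [hC, hH.pathsDisjoint_root_iff hr, ← he.map_inf]
      rfl

end Dendrite

namespace Dendrite
namespace OTree

/-! ### Chains and one-point extensions -/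

/-- A linear order as an ordered meet-tree; above `a` everything lies in the cone `ι a`. -/
@[reducible] def chain {α : Type u} [LinearOrder α] (lab : α → ℕ∞) (ι : α → ℕ)
    (h2 : ∀ a, 2 ≤ lab a) (hι : ∀ a, lab a ≠ ⊤ → (ι a : ℕ∞) + 1 < lab a) : OTree α where
  prec := (· < ·)
  lab := lab
  G i a b := lab a ≠ ⊤ ∧ a < b ∧ i = ι a
  prec_irrefl := lt_irrefl
  prec_trans := lt_trans
  prec_total := lt_or_gt_of_ne
  prec_of_lt := id
  convex _ h _ := h.le
  two_le_lab := h2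
  G_dom h := ⟨h.1, h.2.1, h.2.2 ▸ hι _ h.1⟩
  G_ex h h' := ⟨_, h, h', rfl⟩
  G_uniq h h' := h.2.2.trans h'.2.2.symm
  G_mono h h' := ⟨h.1, h.2.1.trans_le h', h.2.2⟩
  G_sep h h' := (lt_inf_iff.2 ⟨h.2.1, h'.2.1⟩).ne'
  G_prec _ h h' := (h.2.2.trans h'.2.2.symm).le

theorem zero_add_one_lt {p : ℕ∞} (h : 2 ≤ p) : ((0 : ℕ) : ℕ∞) + 1 < p :=
  lt_of_lt_of_le (by norm_num) h

/-- The tree with one vertex of label `p`. -/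
@[reducible] def point (p : ℕ∞) (h : 2 ≤ p) : OTree PUnit.{u + 1} :=
  chain (fun _ => p) (fun _ => 0) (fun _ => h) (fun _ _ => zero_add_one_lt h)

theorem isEmb_point {A : Type u} [OTree A] (a : A) :
    letI := point.{u} (lab a) (two_le_lab a)
    IsEmb (fun _ : PUnit.{u + 1} => a) := by
  let := point.{u} (lab a) (two_le_lab a)
  refine ⟨fun _ _ => (inf_idem a).symm, fun x y => ?_, fun _ => rfl, fun i x y => ?_⟩
  · exact iff_of_false (prec_irrefl a) (lt_irrefl (α := PUnit) x)
  · exact iff_of_false (fun h => lt_irrefl _ (G_dom h).2.1) (fun h => lt_irrefl (α := PUnit) x h.2.1)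

/-- The tree with two vertices, of labels `p` and `q`, the second one lying in the cone `i` at
the first one. -/
@[reducible] def pair (p q : ℕ∞) (i : ℕ) (hp : 2 ≤ p) (hq : 2 ≤ q) (hi : p ≠ ⊤ → (i : ℕ∞) + 1 < p) :
    OTree (ULift.{u} Bool) :=
  chain (fun x => if x.down then q else p) (fun x => if x.down then 0 else i)
    (fun x => by split_ifs <;> assumption)
    (fun x hx => by
      split_ifs at hx ⊢
      · exact zero_add_one_lt hq
      · exact hi hx)

theorem exists_amalgam_id {N0 N1 N2 : Type u} [OTree N0] [OTree N1] [OTree N2] [Finite N1]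
    (i1 : N0 → N1) (i2 : N0 → N2) (h1 : IsEmb i1) (h2 : IsEmb i2) :
    ∃ (U : Type u) (_ : OTree U) (j1 : N1 → U) (j2 : N2 → U), IsEmb j1 ∧ IsEmb j2 ∧
      (∀ n, j1 (i1 n) = j2 (i2 n)) ∧ ∀ u, (∃ x, j1 x = u) ∨ ∃ y, j2 y = u := by
  obtain ⟨U, o, j1, j2, F, g1, g2, -, g4, -, -, g7⟩ := exists_amalgam i1 i2 h1 h2 1 1 1
    IsEmb.id IsEmb.id (fun _ => rfl) (fun _ => rfl) (Set.toFinite (Set.univ : Set N1)).toFinset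
    (fun x _ => ⟨x, by simp, 0, rfl⟩)
  exact ⟨U, o, j1, j2, g1, g2, g4, g7⟩

/-- A missing cone at a vertex can be filled by a leaf. -/
theorem exists_leaf {V : Type u} [OTree V] (a : V) (i : ℕ) (ha : lab a ≠ ⊤)
    (hi : (i : ℕ∞) + 1 < lab a) (hmiss : ∀ b, ¬ G i a b) {p : ℕ∞} (hp : 2 ≤ p) :
    ∃ (U : Type u) (_ : OTree U) (j : V → U) (l : U), IsEmb j ∧ (∀ u, u = l ∨ ∃ y, j y = u) ∧
      G i (j a) l ∧ lab l = p ∧ ∀ y, ¬ l ≤ j y := by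
  let := point.{u} (lab a) (two_le_lab a)
  let := pair.{u} (lab a) p i (two_le_lab a) hp (fun _ => hi)
  have h1 : IsEmb (fun _ : PUnit.{u + 1} => (ULift.up false : ULift.{u} Bool)) :=
    isEmb_point (ULift.up false : ULift.{u} Bool)
  obtain ⟨U, _, j1, j2, g1, g2, g3, g4⟩ := exists_amalgam_id _ _ h1 (isEmb_point a)
  have hG : G i (j2 a) (j1 (ULift.up true)) := by
    rw [← g3 PUnit.unit, g1.G_iff]
    exact ⟨ha, by decide, rfl⟩
  refine ⟨U, inferInstance, j2, j1 (ULift.up true), g2, fun u => ?_, hG, g1.lab_eq _, ?_⟩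
  · rcases g4 u with ⟨⟨_ | _⟩, rfl⟩ | h
    · exact Or.inr ⟨a, (g3 PUnit.unit).symm⟩
    · exact Or.inl rfl
    · exact Or.inr h
  · intro y hy
    exact hmiss y ((g2.G_iff _ _ _).1 (G_mono hG hy))

/-- A new root below everything. -/
theorem exists_root {A : Type u} [OTree A] [Finite A] [Nonempty A] {p : ℕ∞} (hp : 2 ≤ p) :
    ∃ (U : Type u) (_ : OTree U) (j : A → U) (r : U), IsEmb j ∧ (∀ u, u = r ∨ ∃ y, j y = u) ∧
      lab r = p ∧ (∀ y, r < j y) ∧ ∃ m : A, ∀ y, j m ≤ j y := by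
  obtain ⟨m, hm⟩ : ∃ m : A, ∀ y, m ≤ y := by
    obtain ⟨m, -, hm⟩ := (Set.toFinite (Set.univ : Set A)).exists_minimal Set.univ_nonempty
    exact ⟨m, fun y => (hm (Set.mem_univ (m ⊓ y)) inf_le_left).trans inf_le_right⟩
  let := point.{u} (lab m) (two_le_lab m)
  let := pair.{u} p (lab m) 0 hp (two_le_lab m) (fun _ => zero_add_one_lt hp)
  have h1 : IsEmb (fun _ : PUnit.{u + 1} => (ULift.up true : ULift.{u} Bool)) :=
    isEmb_point (ULift.up true : ULift.{u} Bool)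
  obtain ⟨U, _, j1, j2, g1, g2, g3, g4⟩ := exists_amalgam_id _ _ h1 (isEmb_point m)
  refine ⟨U, inferInstance, j2, j1 (ULift.up false), g2, fun u => ?_, g1.lab_eq _, fun y => ?_,
    m, fun y => g2.le_iff.2 (hm y)⟩
  · rcases g4 u with ⟨⟨_ | _⟩, rfl⟩ | h
    · exact Or.inl rfl
    · exact Or.inr ⟨m, (g3 PUnit.unit).symm⟩
    · exact Or.inr h
  · refine lt_of_lt_of_le ?_ (g2.le_iff.2 (hm y))
    rw [← g3 PUnit.unit, g1.lt_iff]
    exact (by decide : (ULift.up false : ULift.{u} Bool) < ULift.up true)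

/-- Finitely many cones can be filled by leaves. -/
theorem exists_leaves {P : Set ℕ∞} {A : Type u} [OTree A] [Finite A] (hA : LabIn P A) {p : ℕ∞}
    (hpP : p ∈ P) (hp : 2 ≤ p) (l : List (A × ℕ))
    (hl : ∀ x ∈ l, lab x.1 ≠ ⊤ ∧ (x.2 : ℕ∞) + 1 < lab x.1) :
    ∃ (V : Type u) (_ : OTree V) (e : A → V), Finite V ∧ LabIn P V ∧ IsEmb e ∧
      (∀ v, (∃ a, e a = v) ∨ ((∀ w, v ≤ w → w = v) ∧ ∃ x ∈ l, e x.1 < v)) ∧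
      ∀ x ∈ l, ∃ b, G x.2 (e x.1) b := by
  induction l with
  | nil => exact ⟨A, inferInstance, id, inferInstance, hA, IsEmb.id, fun v => Or.inl ⟨v, rfl⟩, by simp⟩
  | cons x l ih =>
    obtain ⟨V, _, e, hfin, hV, he, h1, h2⟩ := ih (fun x hx => hl x (List.mem_cons_of_mem _ hx))
    obtain ⟨hx1, hx2⟩ := hl x List.mem_cons_self
    by_cases hmiss : ∃ b, G x.2 (e x.1) b
    · refine ⟨V, inferInstance, e, hfin, hV, he, fun v => (h1 v).imp_right ?_, ?_⟩
      · rintro ⟨h, y, hy, hlt⟩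
        exact ⟨h, y, List.mem_cons_of_mem _ hy, hlt⟩
      · intro y hy
        rcases List.mem_cons.1 hy with rfl | hy
        · exact hmiss
        · exact h2 y hy
    · push Not at hmiss
      obtain ⟨U, _, j, z, hj, hU, hG, hlab, hz⟩ := exists_leaf (e x.1) x.2 (by rwa [he.lab_eq])
        (by rwa [he.lab_eq]) hmiss hp
      refine ⟨U, inferInstance, j ∘ e, ?_, fun u => ?_, hj.comp he, fun u => ?_, fun y hy => ?_⟩
      · have : Set.Finite (insert z (Set.range j)) := (Set.finite_range j).insert z
        exact Set.finite_univ_iff.1 (this.subset fun u _ => (hU u).imp id id)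
      · rcases hU u with rfl | ⟨y, rfl⟩
        · rw [hlab]; exact hpP
        · rw [hj.lab_eq]; exact hV y
      · rcases hU u with rfl | ⟨v, rfl⟩
        · refine Or.inr ⟨fun w hw => ?_, x, List.mem_cons_self, (G_dom hG).2.1⟩
          rcases hU w with rfl | ⟨y, rfl⟩
          · rfl
          · exact absurd hw (hz y)
        · rcases h1 v with ⟨a, rfl⟩ | ⟨hmax, y, hy, hlt⟩
          · exact Or.inl ⟨a, rfl⟩
          by_cases hv : v = e x.1
          · exact Or.inl ⟨x.1, congrArg j hv.symm⟩
          refine Or.inr ⟨fun w hw => ?_, y, List.mem_cons_of_mem _ hy, hj.lt_iff.2 hlt⟩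
          rcases hU w with rfl | ⟨w, rfl⟩
          · exfalso
            rcases le_or_lt_of_le hw (G_dom hG).2.1.le with h3 | h3
            · exact hv (hmax _ (hj.le_iff.1 h3)).symm
            · exact hmiss v ((hj.G_iff _ _ _).1 ((G_iff_of_le h3 hw).2 hG))
          · rw [hmax w (hj.le_iff.1 hw)]
      · rcases List.mem_cons.1 hy with rfl | hy
        · exact ⟨z, hG⟩
        · obtain ⟨b, hb⟩ := h2 y hy
          exact ⟨j b, (hj.G_iff _ _ _).2 hb⟩

/-! ### Counting children -/

section Full

set_option linter.unusedSectionVars false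

variable {V : Type u} [OTree V] [Finite V] {v : V}

theorem cover_unique {x y b : V} (hx : v ⋖ x) (hy : v ⋖ y) (hxb : x ≤ b) (hyb : y ≤ b) : x = y := by
  rcases le_or_lt_of_le hxb hyb with h1 | h1
  · rcases h1.eq_or_lt with h2 | h2
    · exact h2
    · exact absurd h2 (hy.2 hx.lt)
  · exact absurd h1 (hx.2 hy.lt)

theorem cover_eq_of_G {x y : V} {i : ℕ} (hx : v ⋖ x) (hy : v ⋖ y) (h : G i v x) (h' : G i v y) :
    x = y := by
  have h1 := lt_inf hx.le hy.le (G_sep h h')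
  have h2 : x ⊓ y = x := by
    by_contra hne
    exact hx.2 h1 (lt_of_le_of_ne inf_le_left hne)
  have h3 : x ⊓ y = y := by
    by_contra hne
    exact hy.2 h1 (lt_of_le_of_ne inf_le_right hne)
  rw [← h2, h3]

/-- If all cones at `v` are non-empty, then the cone of a child is given by the number of preceding
children. -/
theorem encard_before (hv : lab v ≠ ⊤) (hfull : ∀ i : ℕ, (i : ℕ∞) + 1 < lab v → ∃ b, G i v b) {x : V}
    (hx : v ⋖ x) {j : ℕ} (hj : G j v x) : {c | v ⋖ c ∧ prec c x}.encard = j := by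
  have hjl := (G_dom hj).2.2
  have h1 : ∀ i : ℕ, i < j → ∃ c, v ⋖ c ∧ G i v c := by
    intro i hi
    obtain ⟨b, hb⟩ := hfull i (lt_of_le_of_lt (by gcongr) hjl)
    obtain ⟨c, hc, hcb⟩ := exists_covBy_le_of_lt (G_dom hb).2.1
    exact ⟨c, hc, (G_iff_of_le hc.lt hcb).2 hb⟩
  have : Nonempty V := ⟨v⟩
  choose! g hg1 hg2 using h1
  have himg : {c | v ⋖ c ∧ prec c x} = g '' Set.Iio j := by
    ext c
    constructor
    · rintro ⟨hc, hcx⟩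
      obtain ⟨k, hk⟩ := G_ex hv hc.lt
      have hkj : k < j := by
        refine lt_of_le_of_ne (G_prec hcx hk hj) ?_
        rintro rfl
        rw [cover_eq_of_G hc hx hk hj] at hcx
        exact prec_irrefl _ hcx
      exact ⟨k, hkj, cover_eq_of_G (hg1 k hkj) hc (hg2 k hkj) hk⟩
    · rintro ⟨k, hk, rfl⟩
      refine ⟨hg1 k hk, ?_⟩
      by_contra hn
      rcases not_prec.1 hn with h | h
      · have := hg2 k hk
        rw [← h] at this
        exact absurd (G_uniq this hj) (ne_of_lt hk)
      · exact absurd (G_prec h hj (hg2 k hk)) (not_le.2 hk)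
  rw [himg, Set.InjOn.encard_image]
  · rw [← Finset.coe_range, Set.encard_coe_eq_coe_finsetCard, Finset.card_range]
  · intro k hk l hl h
    have := hg2 k hk
    rw [h] at this
    exact G_uniq this (hg2 l hl)

/-- A vertex of finite label all of whose branch numbers are used has one child for each number. -/
theorem encard_covers_add_one (hv : lab v ≠ ⊤)
    (hfull : ∀ i : ℕ, (i : ℕ∞) + 1 < lab v → ∃ b, G i v b) :
    {c | v ⋖ c}.encard + 1 = lab v := by
  obtain ⟨n, hn⟩ := ENat.ne_top_iff_exists.1 hv
  have h2 := two_le_lab v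
  rw [← hn] at h2 ⊢
  have h2' : 2 ≤ n := by exact_mod_cast h2
  have hlt : ((n - 2 : ℕ) : ℕ∞) + 1 < lab v := by
    rw [← hn]; exact_mod_cast (by lia : n - 2 + 1 < n)
  obtain ⟨b, hb⟩ := hfull _ hlt
  obtain ⟨x, hx, hxb⟩ := exists_covBy_le_of_lt (G_dom hb).2.1
  have hGx := (G_iff_of_le hx.lt hxb).2 hb
  -- the child with the largest index is the last one
  have hins : {c | v ⋖ c} = insert x {c | v ⋖ c ∧ prec c x} := by
    ext c
    constructor
    · intro hc
      by_cases hcx : c = x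
      · exact Or.inl hcx
      refine Or.inr ⟨hc, ?_⟩
      rcases prec_total hcx with h | h
      · exact h
      exfalso
      obtain ⟨k, hk⟩ := G_ex hv hc.lt
      have h3 := G_prec h hGx hk
      have h4 := (G_dom hk).2.2
      rw [← hn] at h4
      have h5 : k + 1 < n := by exact_mod_cast h4
      obtain rfl : k = n - 2 := by lia
      exact hcx (cover_eq_of_G hc hx hk hGx)
    · rintro (rfl | hc)
      · exact hx
      · exact hc.1
  rw [hins, Set.encard_insert_of_notMem (fun h => prec_irrefl _ h.2), encard_before hv hfull hx hGx]
  exact_mod_cast (by lia : n - 2 + 1 + 1 = n)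

theorem neighborSet_hasse {p : V} (hp : p ⋖ v) :
    (SimpleGraph.hasse V).neighborSet v = insert p {c | v ⋖ c} := by
  ext c
  simp only [SimpleGraph.mem_neighborSet, SimpleGraph.hasse_adj, Set.mem_insert_iff,
    Set.mem_ofPred_eq, or_comm (a := v ⋖ c)]
  refine or_congr_left ⟨fun hc => ?_, fun h => h ▸ hp⟩
  rcases le_or_lt_of_le hc.le hp.le with h | h
  · rcases h.eq_or_lt with h | h
    · exact h
    · exact absurd hp.lt (hc.2 h)
  · exact absurd hc.lt (hp.2 h)

theorem isHasse : IsHasse (SimpleGraph.hasse V) :=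
  ⟨inferInstance, fun _ _ _ => le_total_of_le, fun _ _ => Iff.rfl⟩

theorem isLex : IsLex (prec : V → V → Prop) where
  strictTotal :=
    { irrefl := prec_irrefl
      trans := fun _ _ _ => prec_trans
      trichotomous := fun a b h1 h2 => by
        by_contra hne
        exact (prec_total hne).elim h1 h2 }
  anc _ _ := prec_of_lt
  lex _ _ _ _ _ hx hy hxy hxa hyb := by
    refine prec_of_le_of_le hxy (fun h => ?_) hxa hyb
    rw [cover_unique hx hy h le_rfl] at hxy
    exact prec_irrefl _ hxy

end Full

end OTree

open OTree in
/-- Finite ordered meet-trees with labels in `P` belong to the class `𝒯^≺_P`: a thick tree is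
obtained by adding a root and a leaf in each empty cone. -/
theorem isOrderedTree_of_convex {P : Set ℕ∞} (hP : ∀ p ∈ P, 2 ≤ p) (hne : P.Nonempty)
    {A B : Type u} [(lang P).Structure A] [OTree A] (hC : Compat P A) [OTree B] [Finite B]
    [Nonempty B] (hB : LabIn P B) (i : A → B) (hi : IsEmb i)
    (hconv : ∀ x y b, i x ≤ b → b ≤ i y → ∃ z, i z = b) : IsOrderedTree P A := by
  obtain ⟨p, hp⟩ := hne
  have hfA : Finite A := Finite.of_injective i hi.injective
  obtain ⟨B1, _, f, r, hf, hB1, hrlab, hr, m, hm⟩ := exists_root (A := B) (hP p hp)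
  have hfB1 : Finite B1 := by
    have : Set.Finite (insert r (Set.range f)) := (Set.finite_range f).insert r
    exact Set.finite_univ_iff.1 (this.subset fun u _ => (hB1 u).imp id id)
  have hLB1 : LabIn P B1 := fun u => by
    rcases hB1 u with rfl | ⟨y, rfl⟩
    · rw [hrlab]; exact hp
    · rw [hf.lab_eq]; exact hB y
  have hrB1 : ∀ x, r ≤ x := fun u => by
    rcases hB1 u with rfl | ⟨y, rfl⟩
    · exact le_rfl
    · exact (hr y).le
  have hpairs : Set.Finite {x : B1 × ℕ | x.1 ≠ r ∧ lab x.1 ≠ ⊤ ∧ (x.2 : ℕ∞) + 1 < lab x.1} := by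
    have : ∀ b : B1, ({b} ×ˢ {i : ℕ | lab b ≠ ⊤ ∧ (i : ℕ∞) + 1 < lab b} : Set (B1 × ℕ)).Finite := by
      intro b
      refine (Set.finite_singleton b).prod ?_
      by_cases hb : lab b = ⊤
      · simp [hb]
      obtain ⟨n, hn⟩ := ENat.ne_top_iff_exists.1 hb
      refine (Set.finite_Iio n).subset ?_
      rintro i ⟨-, hi⟩
      rw [← hn] at hi
      have : i + 1 < n := by exact_mod_cast hi
      exact (Nat.lt_succ_self i).trans this
    refine (Set.finite_iUnion this).subset ?_
    rintro ⟨b, i⟩ ⟨-, h⟩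
    exact Set.mem_iUnion.2 ⟨b, rfl, h⟩
  obtain ⟨V, _, e, hfV, hLV, he, hnew, hfill⟩ := exists_leaves hLB1 hp (hP p hp)
    hpairs.toFinset.toList (by simp)
  simp only [Finset.mem_toList, Set.Finite.mem_toFinset, Set.mem_ofPred_eq] at hnew hfill
  have hH : IsHasse (SimpleGraph.hasse V) := isHasse
  have hroot : ∀ v, e r ≤ v := fun v => by
    rcases hnew v with ⟨a, rfl⟩ | ⟨-, x, -, hx⟩
    · exact he.le_iff.2 (hrB1 a)
    · exact (he.le_iff.2 (hrB1 _)).trans hx.le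
  -- the vertex `m` of `B` is the only child of the root
  have hrm : ∀ v, v ≠ e r → e (f m) ≤ v := fun v hv => by
    have hle : ∀ u, u ≠ r → e (f m) ≤ e u := fun u hu => by
      rcases hB1 u with rfl | ⟨y, rfl⟩
      · exact absurd rfl hu
      · exact he.le_iff.2 (hm y)
    rcases hnew v with ⟨a, rfl⟩ | ⟨-, x, ⟨hx, -⟩, hx'⟩
    · exact hle a fun h => hv (congrArg e h)
    · exact (hle x.1 hx).trans hx'.le
  have hcov : e r ⋖ e (f m) :=
    ⟨he.lt_iff.2 (hr m), fun v h1 h2 => (hrm v h1.ne').not_gt h2⟩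
  have hnr : (SimpleGraph.hasse V).neighborSet (e r) = {e (f m)} := by
    ext v
    rw [SimpleGraph.mem_neighborSet, SimpleGraph.hasse_adj, Set.mem_singleton_iff]
    constructor
    · rintro (h | h)
      · exact (cover_unique hcov h (hrm v h.lt.ne') le_rfl).symm
      · exact absurd (hroot v) h.lt.not_ge
    · rintro rfl
      exact Or.inl hcov
  have hpar : ∀ v, v ≠ e r → ∃ q, q ⋖ v := fun v hv => by
    obtain ⟨q, -, hq⟩ := exists_le_covBy_of_lt (lt_of_le_of_ne (hroot v) (Ne.symm hv))
    exact ⟨q, hq⟩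
  have hfull : ∀ a, a ≠ r → lab (e a) ≠ ⊤ →
      ∀ i : ℕ, (i : ℕ∞) + 1 < lab (e a) → ∃ b, G i (e a) b := by
    intro a ha hlab i hi
    rw [he.lab_eq] at hlab hi
    exact hfill (a, i) ⟨ha, hlab, hi⟩
  -- the degrees of the vertices
  have hdeg : ∀ v, ((SimpleGraph.hasse V).neighborSet v).encard = 1 ∨ lab v = ⊤ ∨
      ((SimpleGraph.hasse V).neighborSet v).encard = lab v := by
    intro v
    by_cases hv : v = e r
    · left; rw [hv, hnr, Set.encard_singleton]
    obtain ⟨q, hq⟩ := hpar v hv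
    rcases hnew v with ⟨a, rfl⟩ | ⟨hmax, -⟩
    · by_cases hlab : lab (e a) = ⊤
      · exact Or.inr (Or.inl hlab)
      · right; right
        rw [neighborSet_hasse hq, Set.encard_insert_of_notMem (fun h => hq.lt.not_gt h.lt),
          encard_covers_add_one hlab (hfull a (fun h => hv (congrArg e h)) hlab)]
    · left
      have : {c | v ⋖ c} = ∅ := by
        ext c
        simp only [Set.mem_ofPred_eq, Set.mem_empty_iff_false, iff_false]
        exact fun hc => hc.lt.ne' (hmax c hc.le)
      rw [neighborSet_hasse hq, this]
      simp
  have hdegle : ∀ v, ((SimpleGraph.hasse V).neighborSet v).encard ≤ lab v := by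
    intro v
    rcases hdeg v with h | h | h
    · rw [h]; exact le_trans (by norm_num) (two_le_lab v)
    · rw [h]; exact le_top
    · exact h.le
  let φ : A → V := fun a => e (f (i a))
  have hφ : IsEmb φ := he.comp (hf.comp hi)
  have hφr : ∀ a, f (i a) ≠ r := fun a => (hr _).ne'
  have hφconv : ∀ x y v, φ x ≤ v → v ≤ φ y → ∃ z, φ z = v := by
    intro x y v h1 h2
    rcases hnew v with ⟨u, rfl⟩ | ⟨hmax, -⟩
    · rcases hB1 u with rfl | ⟨b, rfl⟩
      · exact absurd (he.le_iff.1 h1) (hr _).not_ge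
      · obtain ⟨z, rfl⟩ := hconv x y b (hf.le_iff.1 (he.le_iff.1 h1))
          (hf.le_iff.1 (he.le_iff.1 h2))
        exact ⟨z, rfl⟩
    · exact ⟨y, hmax _ h2⟩
  have hcovφ : ∀ x y, φ x ⋖ φ y ↔ x ⋖ y := by
    intro x y
    refine ⟨fun h => ⟨hφ.lt_iff.1 h.lt, fun z h1 h2 => h.2 (hφ.lt_iff.2 h1) (hφ.lt_iff.2 h2)⟩,
      fun h => ⟨hφ.lt_iff.2 h.lt, fun v h1 h2 => ?_⟩⟩
    obtain ⟨z, rfl⟩ := hφconv x y v h1.le h2.le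
    exact h.2 (hφ.lt_iff.1 h1) (hφ.lt_iff.1 h2)
  let T : SimpleGraph A := (SimpleGraph.hasse V).comap φ
  have hT : IsHasse T := ⟨hfA, fun _ _ _ => le_total_of_le, fun u v => by
    change φ u ⋖ φ v ∨ φ v ⋖ φ u ↔ _
    rw [hcovφ, hcovφ]⟩
  refine ⟨T, lab, V, SimpleGraph.hasse V, lab, SimpleGraph.Embedding.comap ⟨φ, hφ.injective⟩ _, e r,
    prec, ⟨hfA, hT.preconnected, hT.isAcyclic, fun a => ?_, fun a => ?_⟩,
    ⟨hfV, hH.preconnected, hH.isAcyclic, hLV, hdegle⟩, hφ.lab_eq, ?_, ?_,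
    (isLex_iff hH hroot).2 isLex, ?_, ?_, ?_, ?_, ?_⟩
  · rw [← hφ.lab_eq]; exact hLV _
  · rw [← hφ.lab_eq, ← hφ.injective.encard_image]
    refine le_trans (Set.encard_le_encard ?_) (hdegle (φ a))
    rintro _ ⟨b, hb, rfl⟩
    exact hb
  · intro v h1 h2
    rcases hdeg v with h | h | h
    · rw [h] at h2; exact absurd h2 (lt_irrefl _)
    · exact absurd h h1
    · exact h
  · rw [hnr, Set.encard_singleton]
  · intro v
    rw [hC.R_iff, hT.pathsDisjoint_iff]
  · exact hC.K_iff
  · intro v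
    rw [hC.prec_iff]
    exact (hφ.prec_iff _ _).symm
  · intro k v
    rw [hC.G_iff]
    simp only [hH.isSucc_iff hroot, hH.treeLE_iff hroot]
    change _ ↔ _ ∧ ∃ a', φ (v 0) ⋖ a' ∧ a' ≤ φ (v 1) ∧ _
    rw [← hφ.G_iff, ← hφ.lab_eq (v 0)]
    constructor
    · intro h
      obtain ⟨x, hx, hxb⟩ := exists_covBy_le_of_lt (G_dom h).2.1
      refine ⟨(G_dom h).1, x, hx, hxb, ?_⟩
      exact encard_before (G_dom h).1 (hfull _ (hφr _) (G_dom h).1) hx ((G_iff_of_le hx.lt hxb).2 h)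
    · rintro ⟨hlab, x, hx, hxb, hcard⟩
      obtain ⟨j, hj⟩ := G_ex hlab hx.lt
      have := encard_before hlab (hfull _ (hφr _) hlab) hx hj
      have hjk : (j : ℕ∞) = (k : ℕ) := this.symm.trans hcard
      rw [← Nat.cast_injective hjk]
      exact G_mono hj hxb
  · intro v
    rw [hC.C_iff, hH.pathsDisjoint_root_iff hroot]
    change _ ↔ ¬ φ (v 0) ⊓ φ (v 1) ≤ φ (v 2)
    rw [← hφ.map_inf, hφ.le_iff]

open OTree in
/-- The class `𝒯^≺_P` consists of the finite ordered meet-trees with labels in `P`. -/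
theorem isOrderedTree_iff {P : Set ℕ∞} (hP : ∀ p ∈ P, 2 ≤ p) (hne : P.Nonempty) {A : Type u}
    [(lang P).Structure A] :
    IsOrderedTree P A ↔ Finite A ∧ ∃ _ : OTree A, LabIn P A ∧ Compat P A := by
  refine ⟨fun h => h.exists_otree hP, ?_⟩
  rintro ⟨hfin, _, hL, hC⟩
  cases isEmpty_or_nonempty A
  · obtain ⟨p, hp⟩ := hne
    let := point.{u} p (hP p hp)
    exact isOrderedTree_of_convex hP ⟨p, hp⟩ hC (B := PUnit.{u + 1}) (fun _ => hp) isEmptyElim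
      ⟨isEmptyElim, isEmptyElim, isEmptyElim, fun _ => isEmptyElim⟩ isEmptyElim
  · exact isOrderedTree_of_convex hP hne hC hL id IsEmb.id (fun x y b _ _ => ⟨b, rfl⟩)

end Dendrite

namespace Dendrite

/-! ### First-order embeddings and substructures -/

/-- The structure of the language of ordered trees carried by an ordered meet-tree. -/
@[reducible] def strOf (P : Set ℕ∞) (A : Type u) [OTree A] : (lang P).Structure A where
  funMap f := nomatch f
  RelMap r := match r with
    | Rel.R => fun v => ¬ ∃ u w, (u = v 0 ∨ u = v 1) ∧ (w = v 2 ∨ w = v 3) ∧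
        v 0 ⊓ v 1 ≤ u ⊓ w ∧ v 2 ⊓ v 3 ≤ u ⊓ w
    | Rel.K p => fun v => OTree.lab (v 0) = p
    | Rel.prec => fun v => OTree.prec (v 0) (v 1)
    | Rel.G i => fun v => OTree.G i (v 0) (v 1)
    | Rel.C => fun v => ¬ v 0 ⊓ v 1 ≤ v 2

theorem compat_strOf (P : Set ℕ∞) (A : Type u) [OTree A] :
    letI := strOf P A
    Compat P A :=
  letI := strOf P A
  ⟨fun _ => Iff.rfl, fun _ _ => Iff.rfl, fun _ => Iff.rfl, fun _ _ => Iff.rfl, fun _ => Iff.rfl⟩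

section Link

set_option linter.unusedSectionVars false

variable {P : Set ℕ∞} {A B : Type u} [OTree A] [OTree B] [(lang P).Structure A]
  [(lang P).Structure B]

theorem LabIn.lt_sSup (hA : LabIn P A) {i : ℕ} {a b : A} (h : OTree.G i a b) : (i : ℕ∞) < sSup P :=
  lt_of_lt_of_le (lt_of_le_of_lt le_self_add (OTree.G_dom h).2.2) (le_sSup (hA a))

/-- Preservation of the relation symbols makes a map an embedding of ordered meet-trees. -/
theorem isEmb_of_relMap (hA : Compat P A) (hB : Compat P B) (lA : LabIn P A) (lB : LabIn P B)
    (φ : A → B) (hφ : ∀ {n} (r : (lang P).Relations n) (v : Fin n → A),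
      Structure.RelMap r (φ ∘ v) ↔ Structure.RelMap r v) : OTree.IsEmb φ := by
  have hC : ∀ a b c, φ a ⊓ φ b ≤ φ c ↔ a ⊓ b ≤ c := fun a b c => by
    have := hφ (Rel.C : Rel P 3) ![a, b, c]
    rw [hA.C_iff, hB.C_iff, not_iff_not] at this
    exact this
  have hle : ∀ a b, φ a ≤ φ b ↔ a ≤ b := fun a b => by simpa using hC a a b
  have hlab : ∀ a, OTree.lab (φ a) = OTree.lab a := fun a => by
    have := hφ (Rel.K ⟨OTree.lab a, lA a⟩ : Rel P 1) ![a]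
    rw [hA.K_iff, hB.K_iff] at this
    exact this.2 rfl
  refine ⟨fun a b => ?_, fun a b => ?_, hlab, fun i a b => ?_⟩
  · exact le_antisymm (le_inf ((hle _ _).2 inf_le_left) ((hle _ _).2 inf_le_right))
      ((hC _ _ _).2 le_rfl)
  · have := hφ (Rel.prec : Rel P 2) ![a, b]
    rw [hA.prec_iff, hB.prec_iff] at this
    exact this
  · by_cases hi : (i : ℕ∞) < sSup P
    · have := hφ (Rel.G ⟨i, hi⟩ : Rel P 2) ![a, b]
      rw [hA.G_iff, hB.G_iff] at this
      exact this
    · exact iff_of_false (fun h => hi (lB.lt_sSup h)) (fun h => hi (lA.lt_sSup h))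

theorem relMap_of_isEmb (hA : Compat P A) (hB : Compat P B) {φ : A → B} (hφ : OTree.IsEmb φ)
    {n : ℕ} (r : (lang P).Relations n) (v : Fin n → A) :
    Structure.RelMap r (φ ∘ v) ↔ Structure.RelMap r v := by
  cases r with
  | R =>
    refine (hB.R_iff _).trans (Iff.trans (not_congr ?_) (hA.R_iff v).symm)
    constructor
    · rintro ⟨u, w, hu, hw, h1, h2⟩
      obtain ⟨u, hu', rfl⟩ : ∃ u', (u' = v 0 ∨ u' = v 1) ∧ φ u' = u := by
        rcases hu with rfl | rfl
        · exact ⟨_, Or.inl rfl, rfl⟩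
        · exact ⟨_, Or.inr rfl, rfl⟩
      obtain ⟨w, hw', rfl⟩ : ∃ u', (u' = v 2 ∨ u' = v 3) ∧ φ u' = w := by
        rcases hw with rfl | rfl
        · exact ⟨_, Or.inl rfl, rfl⟩
        · exact ⟨_, Or.inr rfl, rfl⟩
      simp only [Function.comp_apply, ← hφ.map_inf, hφ.le_iff] at h1 h2
      exact ⟨u, w, hu', hw', h1, h2⟩
    · rintro ⟨u, w, hu, hw, h1, h2⟩
      refine ⟨φ u, φ w, hu.imp (congrArg φ) (congrArg φ), hw.imp (congrArg φ) (congrArg φ), ?_, ?_⟩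
      · simpa only [Function.comp_apply, ← hφ.map_inf, hφ.le_iff]
      · simpa only [Function.comp_apply, ← hφ.map_inf, hφ.le_iff]
  | K p =>
    refine (hB.K_iff p _).trans (Iff.trans ?_ (hA.K_iff p v).symm)
    rw [Function.comp_apply, hφ.lab_eq]
  | prec => exact (hB.prec_iff _).trans ((hφ.prec_iff _ _).trans (hA.prec_iff v).symm)
  | G i => exact (hB.G_iff i _).trans ((hφ.G_iff _ _ _).trans (hA.G_iff i v).symm)
  | C =>
    refine (hB.C_iff _).trans (Iff.trans (not_congr ?_) (hA.C_iff v).symm)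
    simp only [Function.comp_apply, ← hφ.map_inf, hφ.le_iff]

theorem Compat.of_relMap (hB : Compat P B) {φ : A → B} (hφ : OTree.IsEmb φ)
    (hr : ∀ {n} (r : (lang P).Relations n) (v : Fin n → A),
      Structure.RelMap r (φ ∘ v) ↔ Structure.RelMap r v) : Compat P A := by
  have h1 := @relMap_of_isEmb P A B _ _ (strOf P A) _ (compat_strOf P A) hB φ hφ
  have h2 : ∀ {n} (r : (lang P).Relations n) (v : Fin n → A),
      Structure.RelMap r v ↔ @Structure.RelMap (lang P) A (strOf P A) n r v :=
    fun r v => (hr r v).symm.trans (h1 r v)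
  exact ⟨fun v => h2 Rel.R v, fun p v => h2 (Rel.K p) v, fun v => h2 Rel.prec v,
    fun i v => h2 (Rel.G i) v, fun v => h2 Rel.C v⟩

/-- First-order embeddings from embeddings of ordered meet-trees. -/
def embOfIsEmb (hA : Compat P A) (hB : Compat P B) {φ : A → B} (hφ : OTree.IsEmb φ) :
    A ↪[lang P] B where
  toFun := φ
  inj' := hφ.injective
  map_fun' f := nomatch f
  map_rel' r v := relMap_of_isEmb hA hB hφ r v

/-- First-order isomorphisms from isomorphisms of ordered meet-trees. -/
def equivOfIsEmb (hA : Compat P A) (hB : Compat P B) (e : A ≃ B) (he : OTree.IsEmb e) :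
    A ≃[lang P] B where
  toEquiv := e
  map_fun' f := nomatch f
  map_rel' r v := relMap_of_isEmb hA hB he r v

theorem isEmb_of_embedding (hA : Compat P A) (hB : Compat P B) (lA : LabIn P A) (lB : LabIn P B)
    (φ : A ↪[lang P] B) : OTree.IsEmb φ :=
  isEmb_of_relMap hA hB lA lB φ fun r v => φ.map_rel r v

theorem isEmb_of_equiv (hA : Compat P A) (hB : Compat P B) (lA : LabIn P A) (lB : LabIn P B)
    (φ : A ≃[lang P] B) : OTree.IsEmb φ :=
  isEmb_of_relMap hA hB lA lB φ fun r v => φ.map_rel r v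

/-- In a relational language every set is the universe of a substructure. -/
def subst (P : Set ℕ∞) {M : Type u} [(lang P).Structure M] (S : Set M) : (lang P).Substructure M where
  carrier := S
  fun_mem f := nomatch f

end Link

/-! ### The limit as an ordered meet-tree -/

/-- The properties of the limit that are used: it is countable, each finite extension of a finite
part of it is realised in it, and partial isomorphisms between finite parts extend to
automorphisms. -/
structure Nice (P : Set ℕ∞) (M : Type u) [OTree M] : Prop where
  countable : Countable M
  labIn : LabIn P M
  ext : ∀ (B : Type u) [OTree B] [Finite B], LabIn P B → ∀ Γ : Set (M × B), OTree.PIso Γ →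
    ∃ θ : B → M, OTree.IsEmb θ ∧ ∀ p ∈ Γ, θ p.2 = p.1
  hom : ∀ Γ : Set (M × M), Γ.Finite → OTree.PIso Γ →
    ∃ g : Equiv.Perm M, OTree.IsEmb g ∧ ∀ p ∈ Γ, g p.1 = p.2

namespace OTree

theorem PIso.finite_of_finite {A B : Type u} [OTree A] [OTree B] [Finite B] {Γ : Set (A × B)}
    (h : PIso Γ) : Γ.Finite := by
  refine Set.Finite.of_injOn (f := Prod.snd) (t := Set.univ) (fun _ _ => trivial) ?_ Set.finite_univ
  exact fun p hp q hq hpq => Prod.ext ((h.eq_iff hp hq).2 hpq) hpq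

end OTree

section Limit

variable {P : Set ℕ∞} {M : Type u} [(lang P).Structure M]

theorem IsWazewskiDendrite.exists_sub (hP : ∀ p ∈ P, 2 ≤ p) (h : IsWazewskiDendrite P M)
    {s : Set M} (hs : s.Finite) : ∃ (N : Type u) (_ : (lang P).Structure N) (_ : OTree N)
      (v : N → M), Function.Injective v ∧ s ⊆ Set.range v ∧ LabIn P N ∧ Compat P N ∧
      ∀ {n} (r : (lang P).Relations n) (w : Fin n → N),
        Structure.RelMap r (v ∘ w) ↔ Structure.RelMap r w := by
  obtain ⟨N, hsN, hN⟩ := h.cofinal s hs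
  obtain ⟨-, oN, lN, cN⟩ := hN.exists_otree hP
  exact ⟨N, inferInstance, oN, Subtype.val, Subtype.val_injective, fun x hx => ⟨⟨x, hsN hx⟩, rfl⟩,
    lN, cN, fun r w => Iff.rfl⟩

/-- The axioms of ordered meet-trees concern finitely many points each, so the limit inherits them
from its finite parts. The tree order is read off from `C`, since `C(a, a, b)` says that `a` is not
on the path from the root to `b`. -/
theorem IsWazewskiDendrite.exists_otree (hP : ∀ p ∈ P, 2 ≤ p) (h : IsWazewskiDendrite P M) :
    ∃ _ : OTree M, LabIn P M ∧ Compat P M := by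
  let le : M → M → Prop := fun a b =>
    ¬ Structure.RelMap (L := lang P) (Rel.C : Rel P 3) ![a, a, b]
  let pr : M → M → Prop := fun a b =>
    Structure.RelMap (L := lang P) (Rel.prec : Rel P 2) ![a, b]
  let G : ℕ → M → M → Prop := fun i a b => ∃ hi : (i : ℕ∞) < sSup P,
    Structure.RelMap (L := lang P) (Rel.G ⟨i, hi⟩ : Rel P 2) ![a, b]
  have hlab : ∀ a : M, ∃ p : P, ∀ q : P,
      Structure.RelMap (L := lang P) (Rel.K q : Rel P 1) ![a] ↔ q = p := by
    intro a
    obtain ⟨N, _, _, v, -, hs, lN, cN, hr⟩ := h.exists_sub hP (Set.finite_singleton a)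
    obtain ⟨a, rfl⟩ := hs rfl
    refine ⟨⟨OTree.lab a, lN a⟩, fun q => ?_⟩
    have h1 := (hr (Rel.K q : Rel P 1) ![a]).trans (cN.K_iff q _)
    rw [show (v ∘ ![a] : Fin 1 → M) = ![v a] from by ext i; fin_cases i; rfl] at h1
    rw [h1, Subtype.ext_iff]
    exact eq_comm
  choose lab hlab using hlab
  -- a finite set lies in a part on which the relations are those of an ordered meet-tree
  have key : ∀ s : Set M, s.Finite → ∃ (N : Type u) (_ : (lang P).Structure N) (_ : OTree N)
      (v : N → M), s ⊆ Set.range v ∧ Compat P N ∧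
      (∀ {n} (r : (lang P).Relations n) (w : Fin n → N),
        Structure.RelMap r (v ∘ w) ↔ Structure.RelMap r w) ∧ (∀ x y, le (v x) (v y) ↔ x ≤ y) ∧
      (∀ x y, pr (v x) (v y) ↔ OTree.prec x y) ∧ (∀ x, (lab (v x) : ℕ∞) = OTree.lab x) ∧
      (∀ i x y, G i (v x) (v y) ↔ OTree.G i x y) ∧ ∀ x y z,
        Structure.RelMap (L := lang P) (Rel.C : Rel P 3) ![v x, v y, v z] ↔ ¬ x ⊓ y ≤ z := by
    intro s hs
    obtain ⟨N, _, _, v, hv, hs, lN, cN, hr⟩ := h.exists_sub hP hs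
    have hC : ∀ x y z, Structure.RelMap (L := lang P) (Rel.C : Rel P 3) ![v x, v y, v z] ↔
        ¬ x ⊓ y ≤ z := by
      intro x y z
      have h1 := (hr (Rel.C : Rel P 3) ![x, y, z]).trans (cN.C_iff _)
      rwa [show (v ∘ ![x, y, z] : Fin 3 → M) = ![v x, v y, v z] from by
        ext i; fin_cases i <;> rfl] at h1
    have hv2 : ∀ x y, (v ∘ ![x, y] : Fin 2 → M) = ![v x, v y] := by
      intro x y; ext i; fin_cases i <;> rfl
    refine ⟨N, inferInstance, inferInstance, v, hs, cN, hr, fun x y => ?_,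
      fun x y => ?_, fun x => ?_, fun i x y => ?_, hC⟩
    · rw [← not_iff_not, not_not, hC, inf_idem]
    · have h1 := (hr (Rel.prec : Rel P 2) ![x, y]).trans (cN.prec_iff _)
      rwa [hv2] at h1
    · have h1 := (hr (Rel.K (lab (v x)) : Rel P 1) ![x]).trans (cN.K_iff _ _)
      rw [show (v ∘ ![x] : Fin 1 → M) = ![v x] from by ext i; fin_cases i; rfl, hlab] at h1
      exact (h1.1 rfl).symm
    · by_cases hi : (i : ℕ∞) < sSup P
      · have h1 := (hr (Rel.G ⟨i, hi⟩ : Rel P 2) ![x, y]).trans (cN.G_iff _ _)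
        rw [hv2] at h1
        exact ⟨fun ⟨_, h2⟩ => h1.1 h2, fun h2 => ⟨hi, h1.2 h2⟩⟩
      · exact iff_of_false (fun ⟨h2, _⟩ => hi h2) (fun h2 => hi (lN.lt_sSup h2))
  have key4 : ∀ a b c d : M, ∃ (N : Type u) (_ : OTree N) (v : N → M),
      (∃ x, v x = a) ∧ (∃ x, v x = b) ∧ (∃ x, v x = c) ∧ (∃ x, v x = d) ∧
      (∀ x y, le (v x) (v y) ↔ x ≤ y) ∧
      (∀ x y, pr (v x) (v y) ↔ OTree.prec x y) ∧ (∀ x, (lab (v x) : ℕ∞) = OTree.lab x) ∧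
      (∀ i x y, G i (v x) (v y) ↔ OTree.G i x y) ∧ ∀ x y z,
        Structure.RelMap (L := lang P) (Rel.C : Rel P 3) ![v x, v y, v z] ↔ ¬ x ⊓ y ≤ z := by
    intro a b c d
    obtain ⟨N, _, _, v, hs, -, -, h2⟩ := key {a, b, c, d} (Set.toFinite _)
    exact ⟨N, inferInstance, v, hs (by simp), hs (by simp), hs (by simp), hs (by simp), h2⟩
  let po : PartialOrder M :=
    { le := le
      le_refl := fun a => by
        obtain ⟨N, _, v, ⟨x, rfl⟩, -, -, -, hle, -⟩ := key4 a a a a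
        exact (hle _ _).2 le_rfl
      le_trans := fun a b c => by
        obtain ⟨N, _, v, ⟨x, rfl⟩, ⟨y, rfl⟩, ⟨z, rfl⟩, -, hle, -⟩ := key4 a b c c
        rw [hle, hle, hle]
        exact le_trans
      le_antisymm := fun a b => by
        obtain ⟨N, _, v, ⟨x, rfl⟩, ⟨y, rfl⟩, -, -, hle, -⟩ := key4 a b b b
        rw [hle, hle]
        exact fun h1 h2 => congrArg v (le_antisymm h1 h2) }
  have hlt : ∀ {N : Type u} [OTree N] {v : N → M}, (∀ x y, le (v x) (v y) ↔ x ≤ y) →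
      ∀ x y, v x < v y ↔ x < y := by
    intro N _ v hle x y
    rw [lt_iff_le_not_ge, lt_iff_le_not_ge]
    exact and_congr (hle _ _) (not_congr (hle _ _))
  have hinf : ∀ a b : M, ∃ m : M, m ≤ a ∧ m ≤ b ∧ ∀ c,
      Structure.RelMap (L := lang P) (Rel.C : Rel P 3) ![a, b, c] ↔ ¬ m ≤ c := by
    intro a b
    obtain ⟨m, h1, h2, h3⟩ : ∃ m : M, m ≤ a ∧ m ≤ b ∧
        ¬ Structure.RelMap (L := lang P) (Rel.C : Rel P 3) ![a, b, m] := by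
      obtain ⟨N, _, v, ⟨x, rfl⟩, ⟨y, rfl⟩, -, -, hle, -, -, -, hC⟩ := key4 a b b b
      exact ⟨v (x ⊓ y), (hle _ _).2 inf_le_left, (hle _ _).2 inf_le_right, by simp [hC]⟩
    refine ⟨m, h1, h2, fun c => ?_⟩
    obtain ⟨N, _, v, ⟨x, rfl⟩, ⟨y, rfl⟩, ⟨z, rfl⟩, ⟨m, rfl⟩, hle, -, -, -, hC⟩ := key4 a b c m
    have h1' := (hle _ _).1 h1
    have h2' := (hle _ _).1 h2
    rw [hC, not_not] at h3
    rw [hC]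
    change _ ↔ ¬ le _ _
    rw [hle, le_antisymm h3 (le_inf h1' h2')]
  choose m hm1 hm2 hm3 using hinf
  let si : SemilatticeInf M :=
    { po with
      inf := m
      inf_le_left := hm1
      inf_le_right := hm2
      le_inf := fun c a b h1 h2 => by
        have h4 : ¬ Structure.RelMap (L := lang P) (Rel.C : Rel P 3) ![a, b, m a b] :=
          fun h => (hm3 a b _).1 h le_rfl
        generalize m a b = d at h4 ⊢
        obtain ⟨N, _, v, ⟨x, rfl⟩, ⟨y, rfl⟩, ⟨z, rfl⟩, ⟨m, rfl⟩, hle, -, -, -, hC⟩ := key4 a b c d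
        rw [hC, not_not] at h4
        exact (hle _ _).2 ((le_inf ((hle _ _).1 h1) ((hle _ _).1 h2)).trans h4) }
  let oM : OTree M :=
    { si with
      prec := pr
      lab := fun a => lab a
      G := G
      prec_irrefl := fun a => by
        obtain ⟨N, _, v, ⟨x, rfl⟩, -, -, -, hle, hpr, -⟩ := key4 a a a a
        rw [hpr]; exact OTree.prec_irrefl x
      prec_trans := fun {a b c} => by
        obtain ⟨N, _, v, ⟨x, rfl⟩, ⟨y, rfl⟩, ⟨z, rfl⟩, -, hle, hpr, -⟩ := key4 a b c c
        rw [hpr, hpr, hpr]; exact OTree.prec_trans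
      prec_total := fun {a b} => by
        obtain ⟨N, _, v, ⟨x, rfl⟩, ⟨y, rfl⟩, -, -, hle, hpr, -⟩ := key4 a b b b
        rw [hpr, hpr]; exact fun h => OTree.prec_total fun e => h (congrArg v e)
      prec_of_lt := fun {a b} => by
        obtain ⟨N, _, v, ⟨x, rfl⟩, ⟨y, rfl⟩, -, -, hle, hpr, -⟩ := key4 a b b b
        rw [hpr, hlt hle]; exact OTree.prec_of_lt
      convex := fun {a b c} => by
        obtain ⟨N, _, v, ⟨x, rfl⟩, ⟨y, rfl⟩, ⟨z, rfl⟩, -, hle, hpr, -⟩ := key4 a b c c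
        change le _ _ → _ → _ → le _ _
        rw [hpr, hpr, hle, hle]; exact OTree.convex
      two_le_lab := fun a => hP _ (lab a).2
      G_dom := fun {i a b} => by
        obtain ⟨N, _, v, ⟨x, rfl⟩, ⟨y, rfl⟩, -, -, hle, hpr, hl, hG, -⟩ := key4 a b b b
        rw [hG, hlt hle, hl]; exact OTree.G_dom
      G_ex := fun {a b} => by
        obtain ⟨N, _, v, ⟨x, rfl⟩, ⟨y, rfl⟩, -, -, hle, hpr, hl, hG, -⟩ := key4 a b b b
        simp only [hG, hlt hle, hl]; exact OTree.G_ex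
      G_uniq := fun {i j a b} => by
        obtain ⟨N, _, v, ⟨x, rfl⟩, ⟨y, rfl⟩, -, -, hle, hpr, hl, hG, -⟩ := key4 a b b b
        rw [hG, hG]; exact OTree.G_uniq
      G_mono := fun {i a b c} => by
        obtain ⟨N, _, v, ⟨x, rfl⟩, ⟨y, rfl⟩, ⟨z, rfl⟩, -, hle, hpr, hl, hG, -⟩ := key4 a b c c
        change _ → le _ _ → _
        rw [hG, hG, hle]; exact OTree.G_mono
      G_sep := fun {i a b c} h1 h2 h3 => by
        have h4 := hm3 b c a
        replace h3 : m b c = a := h3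
        rw [h3] at h4
        obtain ⟨N, _, v, ⟨x, rfl⟩, ⟨y, rfl⟩, ⟨z, rfl⟩, -, hle, hpr, hl, hG, hC⟩ := key4 a b c c
        rw [hG] at h1 h2
        rw [hC] at h4
        have h5 := not_iff_not.1 h4 |>.2 le_rfl
        exact OTree.G_sep h1 h2
          (le_antisymm h5 (le_inf (OTree.G_dom h1).2.1.le (OTree.G_dom h2).2.1.le))
      G_prec := fun {i j a b c} => by
        obtain ⟨N, _, v, ⟨x, rfl⟩, ⟨y, rfl⟩, ⟨z, rfl⟩, -, hle, hpr, hl, hG, -⟩ := key4 a b c c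
        rw [hG, hG, hpr]; exact OTree.G_prec }
  have hrel : ∀ {n} (r : (lang P).Relations n) (w : Fin n → M),
      Structure.RelMap r w ↔ @Structure.RelMap (lang P) M (strOf P M) n r w := by
    intro n r w
    obtain ⟨N, _, _, v, hs, cN, hr, hle, hpr, hl, hG, hC⟩ := key _ (Set.finite_range w)
    have hv : OTree.IsEmb v := by
      refine ⟨fun x y => le_antisymm (le_inf ((hle _ _).2 inf_le_left) ((hle _ _).2 inf_le_right)) ?_,
        hpr, hl, hG⟩
      change m (v x) (v y) ≤ _
      rw [← not_not (a := m (v x) (v y) ≤ _), ← hm3, hC, not_not]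
    choose w' hw' using fun i => hs ⟨i, rfl⟩
    obtain rfl : w = v ∘ w' := funext fun i => (hw' i).symm
    exact (hr r w').trans
      (@relMap_of_isEmb P N M _ _ _ (strOf P M) cN (compat_strOf P M) v hv n r w').symm
  exact ⟨oM, fun a => (lab a).2, fun v => hrel Rel.R v, fun p v => hrel (Rel.K p) v,
    fun v => hrel Rel.prec v, fun i v => hrel (Rel.G i) v, fun v => hrel Rel.C v⟩

theorem IsWazewskiDendrite.nice (hP : ∀ p ∈ P, 2 ≤ p) (hne : P.Nonempty)
    (h : IsWazewskiDendrite P M) [OTree M] (lM : LabIn P M) (cM : Compat P M) : Nice P M := by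
  have hom : ∀ Γ : Set (M × M), Γ.Finite → OTree.PIso Γ →
      ∃ g : Equiv.Perm M, OTree.IsEmb g ∧ ∀ p ∈ Γ, g p.1 = p.2 := by
    intro Γ hfin hΓ
    obtain ⟨e, he, hv⟩ := hΓ.exists_equiv
    let N1 := subst P (OTree.clos (Prod.fst '' Γ))
    let N2 := subst P (OTree.clos (Prod.snd '' Γ))
    let : OTree N1 := OTree.sub _ (OTree.clos_meetClosed (Prod.fst '' Γ))
    let : OTree N2 := OTree.sub _ (OTree.clos_meetClosed (Prod.snd '' Γ))
    have c1 : Compat P N1 := cM.of_relMap (φ := (Subtype.val : N1 → M))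
      (OTree.isEmb_val _ (OTree.clos_meetClosed (Prod.fst '' Γ))) fun _ _ => Iff.rfl
    have c2 : Compat P N2 := cM.of_relMap (φ := (Subtype.val : N2 → M))
      (OTree.isEmb_val _ (OTree.clos_meetClosed (Prod.snd '' Γ))) fun _ _ => Iff.rfl
    let f : M ≃ₚ[lang P] M :=
      ⟨N1, N2, equivOfIsEmb c1 c2 e he⟩
    obtain ⟨g, hg⟩ := h.homogeneous f ((isOrderedTree_iff hP hne).2
      ⟨(OTree.finite_clos (hfin.image _)).to_subtype, _, fun a => lM a.1, c1⟩)
    refine ⟨g.toEquiv, isEmb_of_equiv cM cM lM lM g, fun p hp => ?_⟩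
    exact (hg ⟨p.1, OTree.subset_clos _ ⟨p, hp, rfl⟩⟩).trans (hv p hp)
  refine ⟨h.countable, lM, fun B _ _ hB Γ hΓ => ?_, hom⟩
  let := strOf P B
  obtain ⟨i⟩ := h.universal B
    ((isOrderedTree_iff hP hne).2 ⟨inferInstance, inferInstance, hB, compat_strOf P B⟩)
  have hi := isEmb_of_embedding (compat_strOf P B) cM hB lM i
  have h1 := hΓ.symm.map hi OTree.IsEmb.id
  have hfin : (Prod.swap ⁻¹' Γ : Set (B × M)).Finite := by
    rw [← Set.image_swap_eq_preimage_swap]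
    exact hΓ.finite_of_finite.image _
  obtain ⟨g, hg, hg'⟩ := hom _ (hfin.image _) h1
  exact ⟨g ∘ i, hg.comp hi, fun p hp => hg' _ ⟨(p.2, p.1), hp, rfl⟩⟩

end Limit
end Dendrite

namespace Dendrite

/-! ### Generic sequences and back-and-forth -/

/-- Countably many cofinal sets are all met infinitely often by one monotone sequence. -/
theorem exists_generic_seq {Q : Type*} [Preorder Q] (q0 : Q) {ι : Type*} [Countable ι]
    (D : ι → Set Q) (hD : ∀ i q, ∃ q' ∈ D i, q ≤ q') :
    ∃ s : ℕ → Q, Monotone s ∧ s 0 = q0 ∧ ∀ i N, ∃ n, N ≤ n ∧ s n ∈ D i := by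
  have := Encodable.ofCountable (ι × ℕ)
  let 𝒟 : ι × ℕ → Order.Cofinal Q := fun i => ⟨D i.1, fun q => hD i.1 q⟩
  refine ⟨Order.sequenceOfCofinals q0 𝒟, Order.sequenceOfCofinals.monotone _ _, rfl, fun i N => ?_⟩
  have hinj : Function.Injective fun m : ℕ => Encodable.encode (i, m) := fun m m' h => by
    simpa using Encodable.encode_injective h
  obtain ⟨_, ⟨m, rfl⟩, hm⟩ := (Set.infinite_range_of_injective hinj).exists_gt N
  exact ⟨_, hm.le.trans (Nat.le_succ _), Order.sequenceOfCofinals.encode_mem q0 𝒟 (i, m)⟩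

/-- Back-and-forth: a family of partial bijections with the extension property in both directions
yields a bijection that is approximated by members of the family. -/
theorem back_and_forth {M : Type u} [Countable M] (𝓑 : Set (Set (M × M)))
    (hfun : ∀ Γ ∈ 𝓑, ∀ p ∈ Γ, ∀ q ∈ Γ, p.1 = q.1 ↔ p.2 = q.2)
    (forth : ∀ Γ ∈ 𝓑, ∀ x, ∃ Δ ∈ 𝓑, Γ ⊆ Δ ∧ ∃ y, (x, y) ∈ Δ)
    (back : ∀ Γ ∈ 𝓑, ∀ y, ∃ Δ ∈ 𝓑, Γ ⊆ Δ ∧ ∃ x, (x, y) ∈ Δ) {Γ₀ : Set (M × M)} (h₀ : Γ₀ ∈ 𝓑) :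
    ∃ g : Equiv.Perm M, (∀ p ∈ Γ₀, g p.1 = p.2) ∧ ∀ F : Set M, F.Finite →
      ∃ Γ ∈ 𝓑, (∀ p ∈ Γ, g p.1 = p.2) ∧ ∀ x ∈ F, (x, g x) ∈ Γ := by
  let D : M ⊕ M → Set 𝓑 := fun i => match i with
    | .inl x => {Γ | ∃ y, (x, y) ∈ Γ.1}
    | .inr y => {Γ | ∃ x, (x, y) ∈ Γ.1}
  obtain ⟨s, hmono, hs0, hs⟩ := exists_generic_seq (⟨Γ₀, h₀⟩ : 𝓑) D (by
    rintro (x | y) ⟨Γ, hΓ⟩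
    · obtain ⟨Δ, hΔ, hsub, h⟩ := forth Γ hΓ x
      exact ⟨⟨Δ, hΔ⟩, h, hsub⟩
    · obtain ⟨Δ, hΔ, hsub, h⟩ := back Γ hΓ y
      exact ⟨⟨Δ, hΔ⟩, h, hsub⟩)
  have hm : ∀ {m n}, m ≤ n → (s m).1 ⊆ (s n).1 := fun h => hmono h
  have h1 : ∀ x, ∃ y n, (x, y) ∈ (s n).1 := fun x => by
    obtain ⟨n, -, y, hy⟩ := hs (.inl x) 0
    exact ⟨y, n, hy⟩
  have h2 : ∀ y, ∃ x n, (x, y) ∈ (s n).1 := fun y => by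
    obtain ⟨n, -, x, hx⟩ := hs (.inr y) 0
    exact ⟨x, n, hx⟩
  choose g n hg using h1
  choose g' n' hg' using h2
  have huniq : ∀ {x y x' y' m m'}, (x, y) ∈ (s m).1 → (x', y') ∈ (s m').1 → (x = x' ↔ y = y') := by
    intro x y x' y' m m' h h'
    exact hfun _ (s (max m m')).2 _ (hm (le_max_left m m') h) _ (hm (le_max_right m m') h')
  let e : Equiv.Perm M := ⟨g, g', fun x => (huniq (hg' (g x)) (hg x)).2 rfl,
    fun y => (huniq (hg (g' y)) (hg' y)).1 rfl⟩
  refine ⟨e, fun p hp => ?_, fun F hF => ?_⟩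
  · have : p ∈ (s 0).1 := by rw [hs0]; exact hp
    exact (huniq (hg p.1) this).1 rfl
  · obtain ⟨N, hN⟩ := (hF.image n).bddAbove
    exact ⟨s N, (s N).2, fun p hp => (huniq (hg p.1) hp).1 rfl,
      fun x hx => hm (hN ⟨x, hx, rfl⟩) (hg x)⟩

namespace OTree

/-! ### Existence of the limit -/

/-- An ordered meet-tree given by its finite parts. -/
theorem exists_ofLocal {M : Type u} (inf : M → M → M) (pr : M → M → Prop) (lb : M → ℕ∞)
    (g : ℕ → M → M → Prop)
    (h : ∀ a b c : M, ∃ (N : Type u) (_ : OTree N) (v : N → M), (∃ x, v x = a) ∧ (∃ x, v x = b) ∧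
      (∃ x, v x = c) ∧ (∀ x y, v (x ⊓ y) = inf (v x) (v y)) ∧ (∀ x y, pr (v x) (v y) ↔ prec x y) ∧
      (∀ x, lb (v x) = lab x) ∧ ∀ i x y, g i (v x) (v y) ↔ G i x y) :
    ∃ o : OTree M, o.inf = inf ∧ o.prec = pr ∧ o.lab = lb ∧ o.G = g := by
  have hle : ∀ {N : Type u} [OTree N] {v : N → M}, (∀ x y, v (x ⊓ y) = inf (v x) (v y)) →
      (∀ x y, pr (v x) (v y) ↔ prec x y) → ∀ x y, inf (v x) (v y) = v x ↔ x ≤ y := by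
    intro N _ v h1 h2 x y
    rw [← h1, ← inf_eq_left]
    refine ⟨fun h => ?_, congrArg v⟩
    by_contra hne
    rcases prec_total hne with h3 | h3 <;> rw [← h2, h] at h3
    · exact prec_irrefl x ((h2 _ _).1 h3)
    · exact prec_irrefl x ((h2 _ _).1 h3)
  let po : PartialOrder M :=
    { le := fun a b => inf a b = a
      le_refl := fun a => by
        obtain ⟨N, _, v, ⟨x, rfl⟩, -, -, hi, hp, -⟩ := h a a a
        exact (hle hi hp _ _).2 le_rfl
      le_trans := fun a b c => by
        obtain ⟨N, _, v, ⟨x, rfl⟩, ⟨y, rfl⟩, ⟨z, rfl⟩, hi, hp, -⟩ := h a b c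
        rw [hle hi hp, hle hi hp, hle hi hp]
        exact le_trans
      le_antisymm := fun a b => by
        obtain ⟨N, _, v, ⟨x, rfl⟩, ⟨y, rfl⟩, -, hi, hp, -⟩ := h a b b
        rw [hle hi hp, hle hi hp]
        exact fun h1 h2 => congrArg v (le_antisymm h1 h2) }
  let si : SemilatticeInf M :=
    { po with
      inf := inf
      inf_le_left := fun a b => by
        obtain ⟨N, _, v, ⟨x, rfl⟩, ⟨y, rfl⟩, -, hi, hp, -⟩ := h a b b
        change inf (inf _ _) _ = inf _ _
        rw [← hi, hle hi hp]
        exact inf_le_left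
      inf_le_right := fun a b => by
        obtain ⟨N, _, v, ⟨x, rfl⟩, ⟨y, rfl⟩, -, hi, hp, -⟩ := h a b b
        change inf (inf _ _) _ = inf _ _
        rw [← hi, hle hi hp]
        exact inf_le_right
      le_inf := fun c a b => by
        obtain ⟨N, _, v, ⟨x, rfl⟩, ⟨y, rfl⟩, ⟨z, rfl⟩, hi, hp, -⟩ := h a b c
        change inf _ _ = _ → inf _ _ = _ → inf _ (inf _ _) = _
        rw [← hi x y, hle hi hp, hle hi hp, hle hi hp]
        exact le_inf }
  have hlt : ∀ {N : Type u} [OTree N] {v : N → M}, (∀ x y, v (x ⊓ y) = inf (v x) (v y)) →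
      (∀ x y, pr (v x) (v y) ↔ prec x y) → ∀ x y, v x < v y ↔ x < y := by
    intro N _ v hi hp x y
    rw [lt_iff_le_not_ge, lt_iff_le_not_ge]
    exact and_congr (hle hi hp _ _) (not_congr (hle hi hp _ _))
  refine ⟨{ si with
      prec := pr
      lab := lb
      G := g
      prec_irrefl := fun a => ?_
      prec_trans := fun {a b c} => ?_
      prec_total := fun {a b} => ?_
      prec_of_lt := fun {a b} => ?_
      convex := fun {a b c} => ?_
      two_le_lab := fun a => ?_
      G_dom := fun {i a b} => ?_
      G_ex := fun {a b} => ?_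
      G_uniq := fun {i j a b} => ?_
      G_mono := fun {i a b c} => ?_
      G_sep := fun {i a b c} => ?_
      G_prec := fun {i j a b c} => ?_ }, rfl, rfl, rfl, rfl⟩
  · obtain ⟨N, _, v, ⟨x, rfl⟩, -, -, hi, hp, -⟩ := h a a a
    rw [hp]; exact prec_irrefl x
  · obtain ⟨N, _, v, ⟨x, rfl⟩, ⟨y, rfl⟩, ⟨z, rfl⟩, hi, hp, -⟩ := h a b c
    rw [hp, hp, hp]; exact prec_trans
  · obtain ⟨N, _, v, ⟨x, rfl⟩, ⟨y, rfl⟩, -, hi, hp, -⟩ := h a b b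
    rw [hp, hp]; exact fun h => prec_total fun e => h (congrArg v e)
  · obtain ⟨N, _, v, ⟨x, rfl⟩, ⟨y, rfl⟩, -, hi, hp, -⟩ := h a b b
    rw [hp, hlt hi hp]; exact prec_of_lt
  · obtain ⟨N, _, v, ⟨x, rfl⟩, ⟨y, rfl⟩, ⟨z, rfl⟩, hi, hp, -⟩ := h a b c
    change inf _ _ = _ → _ → _ → inf _ _ = _
    rw [hp, hp, hle hi hp, hle hi hp]; exact convex
  · obtain ⟨N, _, v, ⟨x, rfl⟩, -, -, hi, hp, hl, -⟩ := h a a a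
    rw [hl]; exact two_le_lab x
  · obtain ⟨N, _, v, ⟨x, rfl⟩, ⟨y, rfl⟩, -, hi, hp, hl, hg⟩ := h a b b
    rw [hg, hlt hi hp, hl]; exact G_dom
  · obtain ⟨N, _, v, ⟨x, rfl⟩, ⟨y, rfl⟩, -, hi, hp, hl, hg⟩ := h a b b
    simp only [hg, hlt hi hp, hl]; exact G_ex
  · obtain ⟨N, _, v, ⟨x, rfl⟩, ⟨y, rfl⟩, -, hi, hp, hl, hg⟩ := h a b b
    rw [hg, hg]; exact G_uniq
  · obtain ⟨N, _, v, ⟨x, rfl⟩, ⟨y, rfl⟩, ⟨z, rfl⟩, hi, hp, hl, hg⟩ := h a b c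
    change _ → inf _ _ = _ → _
    rw [hg, hg, hle hi hp]; exact G_mono
  · obtain ⟨N, _, v, ⟨x, rfl⟩, ⟨y, rfl⟩, ⟨z, rfl⟩, hi, hp, hl, hg⟩ := h a b c
    change _ → _ → inf _ _ ≠ _
    rw [hg, hg, ← hi]
    intro h1 h2 h3
    refine G_sep h1 h2 (le_antisymm ((hle hi hp _ _).1 ?_)
      (le_inf (G_dom h1).2.1.le (G_dom h2).2.1.le))
    rw [h3, ← hi, inf_idem]
  · obtain ⟨N, _, v, ⟨x, rfl⟩, ⟨y, rfl⟩, ⟨z, rfl⟩, hi, hp, hl, hg⟩ := h a b c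
    rw [hg, hg, hp]; exact G_prec

/-- Amalgamation along a partial isomorphism. -/
theorem exists_amalgam_piso {A B : Type u} [OTree A] [OTree B] [Finite B] {Γ : Set (A × B)}
    (hΓ : PIso Γ) : ∃ (U : Type u) (_ : OTree U) (jA : A → U) (jB : B → U), IsEmb jA ∧ IsEmb jB ∧
      (∀ p ∈ Γ, jA p.1 = jB p.2) ∧ ∀ u, (∃ x, jA x = u) ∨ ∃ y, jB y = u := by
  let := sub _ (clos_meetClosed (Prod.fst '' Γ))
  let := sub _ (clos_meetClosed (Prod.snd '' Γ))
  obtain ⟨e, he, hv⟩ := hΓ.exists_equiv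
  obtain ⟨U, _, j1, j2, g1, g2, g3, g4⟩ := exists_amalgam_id
    (fun x => (e x : B)) Subtype.val ((isEmb_val _ (clos_meetClosed (Prod.snd '' Γ))).comp he)
    (isEmb_val _ (clos_meetClosed (Prod.fst '' Γ)))
  refine ⟨U, inferInstance, j2, j1, g2, g1, fun p hp => ?_, fun u => (g4 u).symm⟩
  have := g3 ⟨p.1, subset_clos _ ⟨p, hp, rfl⟩⟩
  rw [hv p hp] at this
  exact this.symm

end OTree

/-- A countably infinite set without further structure, which provides the points of the limit. -/
structure Name : Type u where
  n : ℕ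

/-- Names are numbers. -/
def nameEquiv : Name.{u} ≃ ℕ := ⟨Name.n, Name.mk, fun _ => rfl, fun _ => rfl⟩

instance : Countable Name.{u} := nameEquiv.countable_iff.2 inferInstance

instance : Infinite Name.{u} := nameEquiv.infinite_iff.2 inferInstance

/-- Finite ordered meet-trees on subsets of a fixed countable set, the approximations of the
limit. -/
structure Approx (P : Set ℕ∞) where
  s : Set (Name.{u})
  fin : s.Finite
  o : OTree s
  labIn : LabIn P s

attribute [instance] Approx.o

namespace Approx

variable {P : Set ℕ∞}

instance : Preorder (Approx.{u} P) where
  le p q := ∃ h : p.s ⊆ q.s, OTree.IsEmb (Set.inclusion h)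
  le_refl p := ⟨subset_rfl, OTree.IsEmb.id⟩
  le_trans _ _ _ := fun ⟨h, e⟩ ⟨h', e'⟩ => ⟨h.trans h', e'.comp e⟩

/-- Any finite extension of an approximation can be named by elements that are not in use yet. -/
theorem exists_extension (p : Approx.{u} P) {U : Type u} [OTree U] [Finite U] (hU : LabIn P U)
    {j : p.s → U} (hj : OTree.IsEmb j) : ∃ (q : Approx.{u} P) (h : p ≤ q) (e : U → q.s),
      OTree.IsEmb e ∧ ∀ x, e (j x) = Set.inclusion h.1 x := by
  classical
  have : Infinite (p.sᶜ : Set (Name.{u})) := p.fin.infinite_compl.to_subtype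
  obtain ⟨n, ⟨en⟩⟩ := Finite.exists_equiv_fin U
  let f : U → (p.sᶜ : Set (Name.{u})) := fun u => Infinite.natEmbedding _ (en u)
  have hf : Function.Injective f := fun a b h =>
    en.injective (Fin.ext ((Infinite.natEmbedding _).injective h))
  let φ : U → Name.{u} := fun u => if h : ∃ x, j x = u then h.choose.1 else (f u).1
  have hφj : ∀ x, φ (j x) = x.1 := fun x => by
    have h : ∃ y, j y = j x := ⟨x, rfl⟩
    change dite _ _ _ = _
    rw [dif_pos h, hj.injective h.choose_spec]
  have hφn : ∀ u, (¬ ∃ x, j x = u) → φ u = (f u).1 := fun u h => dif_neg h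
  have hφ : Function.Injective φ := by
    intro a b hab
    by_cases ha : ∃ x, j x = a <;> by_cases hb : ∃ x, j x = b
    · obtain ⟨x, rfl⟩ := ha
      obtain ⟨y, rfl⟩ := hb
      rw [hφj, hφj] at hab
      rw [Subtype.ext hab]
    · obtain ⟨x, rfl⟩ := ha
      rw [hφj, hφn b hb] at hab
      exact absurd (hab ▸ x.2) (f b).2
    · obtain ⟨y, rfl⟩ := hb
      rw [hφj, hφn a ha] at hab
      exact absurd (hab ▸ y.2) (f a).2
    · rw [hφn a ha, hφn b hb] at hab
      exact hf (Subtype.ext hab)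
  let e := Equiv.ofInjective φ hφ
  have hm : ∀ a b : Set.range φ, ∃ c, e.symm c = e.symm a ⊓ e.symm b :=
    fun a b => ⟨e (e.symm a ⊓ e.symm b), by simp⟩
  let := OTree.pullback e.symm e.symm.injective hm
  have he : OTree.IsEmb e.symm := OTree.isEmb_pullback e.symm e.symm.injective hm
  let q : Approx.{u} P := ⟨Set.range φ, Set.finite_range φ, inferInstance, fun x => by
    rw [← he.lab_eq]; exact hU _⟩
  have hsub : p.s ⊆ q.s := fun x hx => ⟨j ⟨x, hx⟩, hφj _⟩
  have hval : ∀ x, e (j x) = Set.inclusion hsub x := fun x => Subtype.ext (hφj x)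
  refine ⟨q, ⟨hsub, ?_⟩, e, he.symm, hval⟩
  have := he.symm.comp hj
  rwa [show (e.symm.symm ∘ j : p.s → q.s) = Set.inclusion hsub from funext hval] at this

end Approx
end Dendrite

namespace Dendrite
namespace OTree

open Classical in
/-- A countable encoding of the ordered meet-trees on a finite set. -/
noncomputable def code {F : Type u} (o : OTree F) (a b : F) : F × Prop × ℕ∞ × Option ℕ :=
  (a ⊓ b, prec a b, lab a, if h : ∃ i, G i a b then some h.choose else none)

theorem isEmb_of_code_eq {F : Type u} (o o' : OTree F) (h : code o = code o') :
    @IsEmb F F o o' id := by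
  have hG : ∀ (o : OTree F) i a b, (code o a b).2.2.2 = some i ↔ o.G i a b := by
    intro o i a b
    by_cases h : ∃ i, G i a b
    · simp only [code, dif_pos h, Option.some.injEq]
      exact ⟨fun h' => h' ▸ h.choose_spec, fun h' => G_uniq h.choose_spec h'⟩
    · simp only [code, dif_neg h]
      exact iff_of_false (by simp) fun h' => h ⟨i, h'⟩
  have h' : ∀ a b, code o a b = code o' a b := fun a b => by rw [h]
  refine @IsEmb.mk F F o o' id (fun a b => congrArg (·.1) (h' a b))
    (fun a b => (congrArg (·.2.1) (h' a b)).symm.to_iff) (fun a => (congrArg (·.2.2.1) (h' a a)).symm)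
    (fun i a b => ?_)
  change o'.G i a b ↔ o.G i a b
  rw [← hG, ← hG, h]

end OTree

/-- Finite extensions of finite parts are realised, in a countable ordered meet-tree. -/
structure Saturated (P : Set ℕ∞) (M : Type u) [OTree M] : Prop where
  countable : Countable M
  labIn : LabIn P M
  ext : ∀ (B : Type u) [OTree B] [Finite B], LabIn P B → ∀ Γ : Set (M × B), OTree.PIso Γ →
    ∃ θ : B → M, OTree.IsEmb θ ∧ ∀ p ∈ Γ, θ p.2 = p.1

theorem Saturated.extend {P : Set ℕ∞} {M : Type u} [OTree M] (h : Saturated P M)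
    {Γ : Set (M × M)} (hfin : Γ.Finite) (hΓ : OTree.PIso Γ) (x : M) :
    ∃ y, OTree.PIso (insert (x, y) Γ) := by
  let S := OTree.clos (insert x (Prod.fst '' Γ))
  let := OTree.sub S (OTree.clos_meetClosed _)
  have hval : OTree.IsEmb (Subtype.val : S → M) := OTree.isEmb_val S (OTree.clos_meetClosed _)
  have : Finite S := (OTree.finite_clos ((hfin.image _).insert x)).to_subtype
  have hS : ∀ p ∈ Γ, p.1 ∈ S := fun p hp => OTree.subset_clos _ (Or.inr ⟨p, hp, rfl⟩)
  obtain ⟨θ, hθ, hθ'⟩ := h.ext S (fun a => h.labIn a.1)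
    {q | (q.2.1, q.1) ∈ Γ} (OTree.PIso.of_map (OTree.IsEmb.id) hval (hΓ.symm.mono (by
      rintro _ ⟨q, hq, rfl⟩
      exact hq)))
  let x' : S := ⟨x, OTree.subset_clos _ (Or.inl rfl)⟩
  refine ⟨θ x', (OTree.piso_of_isEmb hval hθ id).mono ?_⟩
  rintro p (rfl | hp)
  · exact ⟨x', rfl⟩
  · exact ⟨⟨p.1, hS p hp⟩, Prod.ext rfl (hθ' (p.2, ⟨p.1, hS p hp⟩) hp)⟩

theorem OTree.PIso.insert_swap {A B : Type u} [OTree A] [OTree B] {Γ : Set (A × B)} {x : A} {y : B}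
    (h : OTree.PIso (insert (y, x) (Prod.swap ⁻¹' Γ))) : OTree.PIso (insert (x, y) Γ) := by
  refine h.symm.mono ?_
  rintro p (rfl | hp)
  · exact Or.inl rfl
  · exact Or.inr hp

theorem finite_swap {A B : Type u} {Γ : Set (A × B)} (h : Γ.Finite) :
    (Prod.swap ⁻¹' Γ : Set (B × A)).Finite := by
  rw [← Set.image_swap_eq_preimage_swap]
  exact h.image _

theorem piso_of_finite {A B : Type u} [OTree A] [OTree B] {Γ : Set (A × B)}
    (h : ∀ Δ ⊆ Γ, Δ.Finite → OTree.PIso Δ) : OTree.PIso Γ := by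
  intro p hp q hq r hr s hs
  refine h {p, q, r, s} ?_ (Set.toFinite _) p (by simp) q (by simp) r (by simp) s (by simp)
  rintro x (rfl | rfl | rfl | rfl) <;> assumption

/-- A map all of whose finite restrictions generate isomorphisms is an embedding. -/
theorem OTree.isEmb_of_piso {A B : Type u} [OTree A] [OTree B] {φ : A → B}
    (h : OTree.PIso (Set.range fun a => (a, φ a))) : OTree.IsEmb φ := by
  have key := fun p q r s => h _ ⟨p, rfl⟩ _ ⟨q, rfl⟩ _ ⟨r, rfl⟩ _ ⟨s, rfl⟩
  have key' := fun p q => key p p q q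
  simp only [inf_idem] at key'
  refine ⟨fun a b => ?_, fun a b => (key' a b).2.1.symm, fun a => (key' a a).2.2.1.symm,
    fun i a b => ((key' a b).2.2.2 i).symm⟩
  have h1 := (key a b (a ⊓ b) (a ⊓ b)).1
  have h2 := (key (a ⊓ b) (a ⊓ b) a b).1
  simp only [inf_idem] at h1 h2
  exact le_antisymm (h2.1 le_rfl) (h1.1 le_rfl)

theorem Saturated.nice {P : Set ℕ∞} {M : Type u} [OTree M] (h : Saturated P M) : Nice P M := by
  refine ⟨h.countable, h.labIn, h.ext, fun Γ hfin hΓ => ?_⟩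
  have := h.countable
  obtain ⟨g, hg, hg'⟩ := back_and_forth {Γ : Set (M × M) | Γ.Finite ∧ OTree.PIso Γ}
    (fun Γ hΓ p hp q hq => hΓ.2.eq_iff hp hq)
    (fun Γ hΓ x => by
      obtain ⟨y, hy⟩ := h.extend hΓ.1 hΓ.2 x
      exact ⟨_, ⟨hΓ.1.insert _, hy⟩, Set.subset_insert _ _, y, Or.inl rfl⟩)
    (fun Γ hΓ y => by
      obtain ⟨x, hx⟩ := h.extend (finite_swap hΓ.1) hΓ.2.symm y
      exact ⟨_, ⟨hΓ.1.insert _, hx.insert_swap⟩, Set.subset_insert _ _, x, Or.inl rfl⟩)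
    (Γ₀ := Γ) ⟨hfin, hΓ⟩
  refine ⟨g, OTree.isEmb_of_piso (piso_of_finite fun Δ hΔ hfin => ?_), hg⟩
  obtain ⟨Γ', h1, -, h3⟩ := hg' _ (hfin.image Prod.fst)
  refine h1.2.mono fun p hp => ?_
  obtain ⟨a, rfl⟩ := hΔ hp
  exact h3 a ⟨_, hp, rfl⟩

namespace Approx

variable {P : Set ℕ∞}

/-- An extension of finite trees that an approximation may realise. -/
abbrev Task : Type u := Σ k : ℕ, (ULift.{u} (Fin k) → ULift.{u} (Fin k) →
  ULift.{u} (Fin k) × Prop × ℕ∞ × Option ℕ) × Finset (Name.{u} × ULift.{u} (Fin k))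

/-- The approximation `p` realises the extension `t` if it is an extension of a part of `p`. -/
def Realises (p : Approx.{u} P) (t : Task.{u}) : Prop :=
  (∀ x ∈ t.2.2, x.1 ∈ p.s) → ∀ o : OTree (ULift.{u} (Fin t.1)), OTree.code o = t.2.1 →
    LabIn P (ULift.{u} (Fin t.1)) →
    OTree.PIso {x : p.s × ULift.{u} (Fin t.1) | (x.1.1, x.2) ∈ t.2.2} →
    ∃ θ : ULift.{u} (Fin t.1) → p.s, OTree.IsEmb θ ∧ ∀ x b, (x.1, b) ∈ t.2.2 → θ b = x

theorem exists_realises (t : Task.{u}) (p : Approx.{u} P) : ∃ q, q.Realises t ∧ p ≤ q := by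
  by_cases h1 : ∀ x ∈ t.2.2, x.1 ∈ p.s
  swap
  · exact ⟨p, fun h => absurd h h1, le_rfl⟩
  by_cases h2 : ∃ o : OTree (ULift.{u} (Fin t.1)), OTree.code o = t.2.1 ∧
      LabIn P (ULift.{u} (Fin t.1)) ∧
      OTree.PIso {x : p.s × ULift.{u} (Fin t.1) | (x.1.1, x.2) ∈ t.2.2}
  swap
  · exact ⟨p, fun _ o c l g => absurd ⟨o, c, l, g⟩ h2, le_rfl⟩
  obtain ⟨o, hc, hl, hΓ⟩ := h2
  have := p.fin.to_subtype
  obtain ⟨U, _, jA, jB, hA, hB, hAB, hU⟩ := OTree.exists_amalgam_piso hΓ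
  have : Finite U := Set.finite_univ_iff.1
    (((Set.finite_range jA).union (Set.finite_range jB)).subset fun u _ => hU u)
  obtain ⟨q, hpq, e, he, hej⟩ := p.exists_extension (U := U) (fun u => by
    rcases hU u with ⟨x, rfl⟩ | ⟨x, rfl⟩
    · rw [hA.lab_eq]; exact p.labIn x
    · rw [hB.lab_eq]; exact hl x) hA
  have hejB := he.comp hB
  refine ⟨q, fun _ o' hc' _ _ => ?_, hpq⟩
  refine ⟨e ∘ jB, ?_, fun x b hx => ?_⟩
  · exact @OTree.IsEmb.comp _ _ _ o' o _ _ _ hejB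
      (OTree.isEmb_of_code_eq o' o (hc'.trans hc.symm))
  · have := hAB (⟨x.1, h1 _ hx⟩, b) hx
    exact (congrArg e this).symm.trans (hej _)

end Approx

/-- The limit exists. -/
theorem exists_nice (P : Set ℕ∞) : ∃ (M : Type u) (_ : OTree M), Nice P M := by
  let := OTree.point.{u} ⊤ le_top
  let q0 : Approx.{u} P := ⟨∅, Set.finite_empty, OTree.pullback (B := PUnit.{u + 1})
    (fun _ => PUnit.unit) (fun x => x.2.elim) (fun x => x.2.elim), fun x => x.2.elim⟩
  obtain ⟨s, hs, -, hreal⟩ := exists_generic_seq q0 (fun t : Approx.Task.{u} => {p | p.Realises t})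
    Approx.exists_realises
  let M := {x : Name.{u} // ∃ n, x ∈ (s n).s}
  let emb : ∀ n, (s n).s → M := fun n x => ⟨x.1, n, x.2⟩
  have hinc : ∀ {m n} (h : m ≤ n) (x : (s m).s), emb n (Set.inclusion (hs h).1 x) = emb m x :=
    fun h x => rfl
  have hie : ∀ {m n} (h : m ≤ n), OTree.IsEmb (Set.inclusion (hs h).1) := fun h => (hs h).2
  have hinj : ∀ n, Function.Injective (emb n) := fun n x y h =>
    Subtype.ext (congrArg (fun z : M => z.1) h)
  -- two representations of the same points become equal at a later stage
  have hlift : ∀ {m n} (x : (s m).s) (y : (s n).s), emb m x = emb n y →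
      Set.inclusion (hs (le_max_left m n)).1 x = Set.inclusion (hs (le_max_right m n)).1 y :=
    fun x y h => Subtype.ext (congrArg (fun z : M => z.1) h)
  have hstage : ∀ F : Set M, F.Finite → ∃ N, ∀ n, N ≤ n → ∀ x ∈ F, ∃ y, emb n y = x := by
    intro F hF
    choose k hk using fun x : M => x.2
    obtain ⟨N, hN⟩ := (hF.image k).bddAbove
    exact ⟨N, fun n hn x hx => ⟨⟨x.1, (hs ((hN ⟨x, hx, rfl⟩).trans hn)).1 (hk x)⟩, rfl⟩⟩
  have hinf : ∀ a b : M, ∃ m, ∀ n x y, emb n x = a → emb n y = b → emb n (x ⊓ y) = m := by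
    intro a b
    obtain ⟨N, hN⟩ := hstage {a, b} (Set.toFinite _)
    obtain ⟨x, rfl⟩ := hN N le_rfl a (by simp)
    obtain ⟨y, rfl⟩ := hN N le_rfl b (by simp)
    refine ⟨emb N (x ⊓ y), fun n x' y' hx hy => ?_⟩
    rw [← hinc (le_max_left n N), ← hinc (le_max_right n N), (hie (le_max_left n N)).map_inf,
      (hie (le_max_right n N)).map_inf,
      hlift _ _ hx, hlift _ _ hy]
  choose inf hinf using hinf
  have hpr : ∀ n (x y : (s n).s), (∃ n' x' y', emb n' x' = emb n x ∧ emb n' y' = emb n y ∧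
      OTree.prec x' y') ↔ OTree.prec x y := by
    refine fun n x y => ⟨?_, fun h => ⟨n, x, y, rfl, rfl, h⟩⟩
    rintro ⟨n', x', y', hx, hy, h⟩
    rw [← (hie (le_max_left n' n)).prec_iff, hlift _ _ hx, hlift _ _ hy, (hie (le_max_right n' n)).prec_iff] at h
    exact h
  have hG : ∀ i n (x y : (s n).s), (∃ n' x' y', emb n' x' = emb n x ∧ emb n' y' = emb n y ∧
      OTree.G i x' y') ↔ OTree.G i x y := by
    refine fun i n x y => ⟨?_, fun h => ⟨n, x, y, rfl, rfl, h⟩⟩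
    rintro ⟨n', x', y', hx, hy, h⟩
    rw [← (hie (le_max_left n' n)).G_iff, hlift _ _ hx, hlift _ _ hy, (hie (le_max_right n' n)).G_iff] at h
    exact h
  have hlab : ∀ a : M, ∃ l, ∀ n x, emb n x = a → OTree.lab x = l := by
    intro a
    obtain ⟨N, hN⟩ := hstage {a} (Set.toFinite _)
    obtain ⟨x, rfl⟩ := hN N le_rfl a (by simp)
    refine ⟨OTree.lab x, fun n x' hx => ?_⟩
    rw [← (hie (le_max_left n N)).lab_eq, hlift _ _ hx, (hie (le_max_right n N)).lab_eq]
  choose lab hlab using hlab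
  obtain ⟨o, o1, o2, o3, o4⟩ := OTree.exists_ofLocal inf (fun a b => ∃ n x y, emb n x = a ∧
      emb n y = b ∧ OTree.prec x y) lab (fun i a b => ∃ n x y, emb n x = a ∧ emb n y = b ∧
      OTree.G i x y) (fun a b c => by
    obtain ⟨N, hN⟩ := hstage {a, b, c} (Set.toFinite _)
    exact ⟨(s N).s, inferInstance, emb N, hN N le_rfl a (by simp), hN N le_rfl b (by simp),
      hN N le_rfl c (by simp), fun x y => hinf _ _ N x y rfl rfl, hpr N,
      fun x => (hlab _ N x rfl).symm, fun i => hG i N⟩)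
  have hemb : ∀ n, OTree.IsEmb (emb n) := by
    intro n
    refine ⟨fun x y => ?_, fun x y => ?_, fun x => ?_, fun i x y => ?_⟩
    · exact (hinf _ _ n x y rfl rfl).trans (congrFun (congrFun o1 _) _).symm
    · rw [← hpr]; exact (congrFun (congrFun o2 _) _).to_iff
    · exact (congrFun o3 _).trans (hlab _ n x rfl).symm
    · rw [← hG]; exact (congrFun (congrFun (congrFun o4 _) _) _).to_iff
  refine ⟨M, o, Saturated.nice ⟨inferInstance, fun a => ?_, fun B _ _ hB Γ hΓ => ?_⟩⟩
  · obtain ⟨N, hN⟩ := hstage {a} (Set.toFinite _)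
    obtain ⟨x, rfl⟩ := hN N le_rfl a (by simp)
    rw [(hemb N).lab_eq]
    exact (s N).labIn x
  · classical
    obtain ⟨k, ⟨e0⟩⟩ := Finite.exists_equiv_fin B
    let e : B ≃ ULift.{u} (Fin k) := e0.trans Equiv.ulift.symm
    have hm : ∀ a b, ∃ c, e.symm c = e.symm a ⊓ e.symm b :=
      fun a b => ⟨e (e.symm a ⊓ e.symm b), by simp⟩
    let := OTree.pullback e.symm e.symm.injective hm
    have he : OTree.IsEmb e.symm := OTree.isEmb_pullback e.symm e.symm.injective hm
    have hfin := hΓ.finite_of_finite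
    obtain ⟨N, hN⟩ := hstage _ (hfin.image Prod.fst)
    obtain ⟨n, hn, hr⟩ := hreal ⟨k, OTree.code this, (hfin.image
      (fun p : M × B => (p.1.1, e p.2))).toFinset⟩ N
    simp only [Approx.Realises, Set.mem_ofPred_eq, Set.Finite.mem_toFinset, Set.mem_image] at hr
    have hmem : ∀ (x : (s n).s) b, (∃ p ∈ Γ, (p.1.1, e p.2) = (x.1, b)) ↔
        (emb n x, e.symm b) ∈ Γ := by
      intro x b
      constructor
      · rintro ⟨p, hp, h⟩
        rw [Prod.mk.injEq] at h
        rwa [← h.2, show emb n x = p.1 from Subtype.ext h.1.symm, e.symm_apply_apply]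
      · exact fun h => ⟨_, h, by simp [emb]⟩
    simp only [hmem] at hr
    obtain ⟨θ, hθ, hθ'⟩ := hr (by
      rintro _ ⟨p, hp, rfl⟩
      obtain ⟨y, hy⟩ := hN n hn p.1 ⟨p, hp, rfl⟩
      rw [← hy]; exact y.2) this rfl (fun b => by rw [← he.lab_eq]; exact hB _) (by
      refine OTree.PIso.of_map (hemb n) he (hΓ.mono ?_)
      rintro _ ⟨p, hp, rfl⟩
      exact hp)
    refine ⟨emb n ∘ θ ∘ e, (hemb n).comp (hθ.comp he.symm), fun p hp => ?_⟩
    obtain ⟨y, hy⟩ := hN n hn p.1 ⟨p, hp, rfl⟩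
    rw [Function.comp_apply, Function.comp_apply, hθ' y (e p.2) (by simpa [hy] using hp), hy]

end Dendrite

namespace Dendrite

/-! ### Tuples of partial automorphisms -/

variable {P : Set ℕ∞} {n : ℕ}

/-- The graph of a member of a tuple of partial automorphisms. -/
def PartialAuts.graph (S : PartialAuts.{u} P n) (i : Fin n) : Set (S.carrier × S.carrier) :=
  {p | ∃ h : p.1 ∈ (S.maps i).dom, ((S.maps i).toEquiv ⟨p.1, h⟩ : S.carrier) = p.2}

theorem PartialAuts.exists_otree (hP : ∀ p ∈ P, 2 ≤ p) (S : PartialAuts.{u} P n) :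
    Finite S.carrier ∧ ∃ _ : OTree S.carrier, LabIn P S.carrier ∧ Compat P S.carrier ∧
      ∀ i, OTree.PIso (S.graph i) := by
  obtain ⟨hfin, o, hL, hC⟩ := S.isOrderedTree.exists_otree hP
  refine ⟨hfin, o, hL, hC, fun i => ?_⟩
  obtain ⟨-, _, hL', hC'⟩ := (S.dom_isOrderedTree i).exists_otree hP
  have h1 : OTree.IsEmb (Subtype.val : (S.maps i).dom → S.carrier) :=
    isEmb_of_relMap hC' hC hL' hL _ fun _ _ => Iff.rfl
  have h2 : OTree.IsEmb (fun x : (S.maps i).dom => ((S.maps i).toEquiv x : S.carrier)) :=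
    isEmb_of_relMap hC' hC hL' hL _ fun r v => (S.maps i).toEquiv.map_rel r v
  refine (OTree.piso_of_isEmb h1 h2 id).mono ?_
  rintro p ⟨h, hp⟩
  exact ⟨⟨p.1, h⟩, Prod.ext rfl hp⟩

theorem PartialAuts.Emb.graph_mem {S T : PartialAuts.{u} P n} (φ : S.Emb T) {i : Fin n}
    {p : S.carrier × S.carrier} (hp : p ∈ S.graph i) :
    (φ.toEmb p.1, φ.toEmb p.2) ∈ T.graph i := by
  obtain ⟨h, hp⟩ := hp
  obtain ⟨h', h2⟩ := φ.comm i ⟨p.1, h⟩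
  exact ⟨h', h2.trans (congrArg φ.toEmb hp)⟩

/-- Embeddings of tuples of partial automorphisms are embeddings of ordered meet-trees that
preserve the graphs. -/
theorem PartialAuts.exists_emb {S T : PartialAuts.{u} P n} [OTree S.carrier] [OTree T.carrier]
    (hS : Compat P S.carrier) (hT : Compat P T.carrier) {φ : S.carrier → T.carrier}
    (hφ : OTree.IsEmb φ) (hg : ∀ i, ∀ p ∈ S.graph i, (φ p.1, φ p.2) ∈ T.graph i) :
    ∃ ψ : S.Emb T, ∀ x, ψ.toEmb x = φ x :=
  ⟨⟨embOfIsEmb hS hT hφ, fun i x => hg i (x.1, (S.maps i).toEquiv x) ⟨x.2, rfl⟩⟩, fun _ => rfl⟩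

/-- A finite ordered meet-tree with partial isomorphisms yields a tuple of partial automorphisms. -/
theorem exists_partialAuts (hP : ∀ p ∈ P, 2 ≤ p) (hne : P.Nonempty) (E : Type u) [OTree E]
    [Finite E] (hE : LabIn P E) (Γ : Fin n → Set (E × E)) (hΓ : ∀ i, OTree.PIso (Γ i)) :
    ∃ (S : PartialAuts.{u} P n) (_ : OTree S.carrier) (e : E ≃ S.carrier), Compat P S.carrier ∧
      LabIn P S.carrier ∧ OTree.IsEmb e ∧ ∀ i, ∀ p ∈ Γ i, (e p.1, e p.2) ∈ S.graph i := by
  let := strOf P E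
  have hC := compat_strOf P E
  have key : ∀ i, ∃ f : E ≃ₚ[lang P] E, IsOrderedTree P f.dom ∧
      ∀ p ∈ Γ i, ∃ h : p.1 ∈ f.dom, (f.toEquiv ⟨p.1, h⟩ : E) = p.2 := by
    intro i
    obtain ⟨e, he, hv⟩ := (hΓ i).exists_equiv
    let N1 := subst P (OTree.clos (Prod.fst '' Γ i))
    let N2 := subst P (OTree.clos (Prod.snd '' Γ i))
    let : OTree N1 := OTree.sub _ (OTree.clos_meetClosed (Prod.fst '' Γ i))
    let : OTree N2 := OTree.sub _ (OTree.clos_meetClosed (Prod.snd '' Γ i))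
    have c1 : Compat P N1 := hC.of_relMap (φ := (Subtype.val : N1 → E))
      (OTree.isEmb_val _ (OTree.clos_meetClosed (Prod.fst '' Γ i))) fun _ _ => Iff.rfl
    have c2 : Compat P N2 := hC.of_relMap (φ := (Subtype.val : N2 → E))
      (OTree.isEmb_val _ (OTree.clos_meetClosed (Prod.snd '' Γ i))) fun _ _ => Iff.rfl
    refine ⟨⟨N1, N2, equivOfIsEmb c1 c2 e he⟩, (isOrderedTree_iff hP hne).2
      ⟨inferInstanceAs (Finite (OTree.clos (Prod.fst '' Γ i))), inferInstance,
        fun a => hE a.1, c1⟩, fun p hp => ⟨OTree.subset_clos _ ⟨p, hp, rfl⟩, hv p hp⟩⟩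
  choose f hf1 hf2 using key
  exact ⟨⟨E, (isOrderedTree_iff hP hne).2 ⟨inferInstance, inferInstance, hE, hC⟩, f, hf1⟩,
    inferInstanceAs (OTree E), Equiv.refl E, hC, hE, OTree.IsEmb.id (A := E), hf2⟩

end Dendrite

namespace Dendrite
namespace OTree

/-! ### Orbits of automorphisms -/

section Orbits

set_option linter.unusedSectionVars false

variable {A : Type u} [OTree A] {F : Equiv.Perm A}

/-- The union of the orbits of the elements of `s`. -/
def orbits (F : Equiv.Perm A) (s : Set A) : Set A := {x | ∃ b ∈ s, ∃ k : ℤ, (F ^ k) b = x}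

/-- The iterates of a point form a monotone sequence in the linear order. -/
theorem zpow_between (hF : IsEmb F) (b : A) {k m l : ℤ} (hkm : k ≤ m) (hml : m ≤ l) :
    (preceq ((F ^ k) b) ((F ^ m) b) ∧ preceq ((F ^ m) b) ((F ^ l) b)) ∨
      (preceq ((F ^ l) b) ((F ^ m) b) ∧ preceq ((F ^ m) b) ((F ^ k) b)) := by
  rcases hkm.eq_or_lt with rfl | hkm
  · exact (preceq_or_prec ((F ^ k) b) ((F ^ l) b)).imp (fun h => ⟨preceq_refl _, h⟩)
      fun h => ⟨Or.inr h, preceq_refl _⟩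
  rcases hml.eq_or_lt with rfl | hml
  · exact (preceq_or_prec ((F ^ k) b) ((F ^ m) b)).imp (fun h => ⟨h, preceq_refl _⟩)
      fun h => ⟨preceq_refl _, Or.inr h⟩
  by_cases hb : b = F b
  · have hk : ∀ m : ℤ, (F ^ m) b = b := fun m =>
      Equiv.Perm.zpow_apply_eq_self_of_apply_eq_self hb.symm m
    rw [hk, hk, hk]
    exact Or.inl ⟨preceq_refl _, preceq_refl _⟩
  rcases prec_total hb with h | h
  · exact Or.inl ⟨Or.inr (prec_zpow hF h hkm), Or.inr (prec_zpow hF h hml)⟩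
  · exact Or.inr ⟨Or.inr (prec_zpow' hF h hml), Or.inr (prec_zpow' hF h hkm)⟩

theorem zpow_inf_le (hF : IsEmb F) (b : A) {k m l : ℤ} (hkm : k ≤ m) (hml : m ≤ l) :
    (F ^ k) b ⊓ (F ^ l) b ≤ (F ^ m) b := by
  rcases zpow_between hF b hkm hml with h | h
  · exact inf_le_of_between h.1 h.2
  · rw [inf_comm]; exact inf_le_of_between h.1 h.2

/-- Meets of different iterates of `b` are iterates of `b ⊓ F b`. -/
theorem exists_zpow_inf_eq (hF : IsEmb F) (b : A) {k l : ℤ} (hkl : k < l) :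
    ∃ m : ℤ, (F ^ k) b ⊓ (F ^ l) b = (F ^ m) (b ⊓ F b) := by
  have e : ∀ k : ℤ, (F ^ k) b ⊓ (F ^ (k + 1)) b = (F ^ k) (b ⊓ F b) := fun k => by
    rw [(hF.zpow k).map_inf, ← Equiv.Perm.mul_apply, ← zpow_add_one]
  induction l, hkl using Int.leInduction with
  | base => exact ⟨k, e k⟩
  | succ l hl ih =>
    obtain ⟨m, hm⟩ := ih
    have hl' : k ≤ l := by lia
    have h1 : (F ^ k) b ⊓ (F ^ (l + 1)) b ≤ (F ^ l) b := zpow_inf_le hF b hl' (by lia)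
    have h2 : (F ^ k) b ⊓ (F ^ (l + 1)) b ≤ (F ^ k) b ⊓ (F ^ l) b := le_inf inf_le_left h1
    have h3 : (F ^ k) b ⊓ (F ^ (l + 1)) b ≤ (F ^ l) b ⊓ (F ^ (l + 1)) b := le_inf h1 inf_le_right
    rcases le_total_of_le (inf_le_right : (F ^ k) b ⊓ (F ^ l) b ≤ _)
      (inf_le_left : (F ^ l) b ⊓ (F ^ (l + 1)) b ≤ _) with h | h
    · exact ⟨m, by rw [← hm]; exact le_antisymm h2 (le_inf inf_le_left (h.trans inf_le_right))⟩
    · exact ⟨l, by rw [← e]; exact le_antisymm h3 (le_inf (h.trans inf_le_left) inf_le_right)⟩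

/-- Up to one exception, the meets of `a` with the iterates of `b` are iterates of `b ⊓ F b`: the
smaller one of two different such meets is a meet of iterates of `b`. -/
theorem exists_inf_zpow (hF : IsEmb F) (a b : A) : ∃ v, ∀ k : ℤ,
    (∃ m : ℤ, a ⊓ (F ^ k) b = (F ^ m) (b ⊓ F b)) ∨ a ⊓ (F ^ k) b = v := by
  by_cases h : ∃ k : ℤ, ¬ ∃ m : ℤ, a ⊓ (F ^ k) b = (F ^ m) (b ⊓ F b)
  swap
  · push Not at h
    exact ⟨a, fun k => Or.inl (h k)⟩
  obtain ⟨l, hl⟩ := h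
  refine ⟨a ⊓ (F ^ l) b, fun k => ?_⟩
  by_contra hk
  push Not at hk
  obtain ⟨hk, hne⟩ := hk
  have hsym : ∀ k l : ℤ, k ≠ l → ∃ m : ℤ, (F ^ k) b ⊓ (F ^ l) b = (F ^ m) (b ⊓ F b) := by
    intro k l hkl
    rcases lt_or_gt_of_ne hkl with h | h
    · exact exists_zpow_inf_eq hF b h
    · rw [inf_comm]; exact exists_zpow_inf_eq hF b h
  have key : ∀ k l : ℤ, k ≠ l → a ⊓ (F ^ k) b < a ⊓ (F ^ l) b →
      a ⊓ (F ^ k) b = (F ^ k) b ⊓ (F ^ l) b := by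
    intro k l hkl hlt
    refine le_antisymm (le_inf inf_le_right (hlt.le.trans inf_le_right)) ?_
    refine le_inf ?_ inf_le_left
    rcases le_or_lt_of_le (inf_le_right : (F ^ k) b ⊓ (F ^ l) b ≤ _)
      (inf_le_right : a ⊓ (F ^ l) b ≤ _) with h | h
    · exact h.trans inf_le_left
    · exact absurd hlt (le_inf inf_le_left (h.le.trans inf_le_left)).not_gt
  have hkl : k ≠ l := by rintro rfl; exact hne rfl
  rcases le_total_of_le (inf_le_left : a ⊓ (F ^ k) b ≤ a) (inf_le_left : a ⊓ (F ^ l) b ≤ a)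
    with h | h
  · obtain ⟨m, hm⟩ := hsym k l hkl
    exact hk m ((key k l hkl (lt_of_le_of_ne h hne)).trans hm)
  · obtain ⟨m, hm⟩ := hsym l k hkl.symm
    exact hl ⟨m, (key l k hkl.symm (lt_of_le_of_ne h hne.symm)).trans hm⟩

/-- The meet-closure of finitely many orbits consists of finitely many orbits. -/
theorem finite_orbits (hF : IsEmb F) {s : Set A} (hs : s.Finite) :
    ∃ t : Set A, t.Finite ∧ clos (orbits F s) ⊆ orbits F t := by
  choose v hv using exists_inf_zpow hF
  refine ⟨(fun b => b ⊓ F b) '' s ∪ Set.image2 v s s, (hs.image _).union (hs.image2 _ hs), ?_⟩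
  rintro _ ⟨_, ⟨a, ha, k, rfl⟩, _, ⟨b, hb, l, rfl⟩, rfl⟩
  have h1 : (F ^ k) a ⊓ (F ^ l) b = (F ^ k) (a ⊓ (F ^ (l - k)) b) := by
    rw [(hF.zpow k).map_inf, ← Equiv.Perm.mul_apply, ← zpow_add]
    congr 3; ring
  rcases hv a b (l - k) with ⟨m, hm⟩ | h
  · exact ⟨_, Or.inl ⟨b, hb, rfl⟩, k + m, by rw [h1, hm, zpow_add, Equiv.Perm.mul_apply]⟩
  · exact ⟨_, Or.inr ⟨a, ha, b, hb, rfl⟩, k, by rw [h1, h]⟩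

theorem subset_orbits (F : Equiv.Perm A) (s : Set A) : s ⊆ orbits F s :=
  fun x hx => ⟨x, hx, 0, rfl⟩

theorem mem_clos_orbits_iff (hF : IsEmb F) (s : Set A) (x : A) :
    x ∈ clos (orbits F s) ↔ F x ∈ clos (orbits F s) := by
  constructor
  · rintro ⟨_, ⟨a, ha, k, rfl⟩, _, ⟨b, hb, l, rfl⟩, rfl⟩
    refine ⟨_, ⟨a, ha, 1 + k, rfl⟩, _, ⟨b, hb, 1 + l, rfl⟩, ?_⟩
    rw [hF.map_inf, zpow_one_add, zpow_one_add]; rfl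
  · rintro ⟨_, ⟨a, ha, k, rfl⟩, _, ⟨b, hb, l, rfl⟩, h⟩
    refine ⟨_, ⟨a, ha, -1 + k, rfl⟩, _, ⟨b, hb, -1 + l, rfl⟩, F.injective ?_⟩
    rw [hF.map_inf, ← h, ← Equiv.Perm.mul_apply, ← Equiv.Perm.mul_apply, ← zpow_one_add,
      ← zpow_one_add]
    simp

end Orbits

/-! ### Types of orbits and their countability -/

/-- Convex sets of integers. -/
abbrev ConvexSet : Type := {c : Set ℤ // c.OrdConnected}

theorem isUpperSet_int {s : Set ℤ} (hs : IsUpperSet s) :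
    s = ∅ ∨ s = Set.univ ∨ ∃ m, s = Set.Ici m := by
  by_cases h0 : s = ∅
  · exact Or.inl h0
  by_cases hb : BddBelow s
  · right; right
    obtain ⟨m, hm⟩ := hb
    obtain ⟨a, ha, hmin⟩ := Int.exists_least_of_bdd (P := (· ∈ s)) ⟨m, fun z hz => hm hz⟩
      (Set.nonempty_iff_ne_empty.2 h0)
    exact ⟨a, Set.Subset.antisymm (fun x hx => hmin x hx) fun x hx => hs hx ha⟩
  · right; left
    rw [not_bddBelow_iff] at hb
    refine Set.eq_univ_of_forall fun x => ?_
    obtain ⟨y, hy, hyx⟩ := hb x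
    exact hs hyx.le hy

/-- A convex set of integers is the intersection of an upper and a lower set, and each of these is
given by at most one integer. -/
instance : Countable ConvexSet := by
  have hU : {s : Set ℤ | IsUpperSet s}.Countable := by
    refine (((Set.countable_range (Set.Ici : ℤ → Set ℤ)).insert Set.univ).insert ∅).mono ?_
    intro s hs
    rcases isUpperSet_int hs with h | h | ⟨m, h⟩
    · exact Or.inl h
    · exact Or.inr (Or.inl h)
    · exact Or.inr (Or.inr ⟨m, h.symm⟩)
  have hI := hU.image2 hU fun s t => s ∩ Neg.neg ⁻¹' t
  refine Set.Countable.to_subtype (s := {c : Set ℤ | c.OrdConnected}) (hI.mono ?_)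
  intro c hc
  refine ⟨{x | ∃ y ∈ c, y ≤ x}, fun x y hxy ⟨z, hz, hzx⟩ => ⟨z, hz, hzx.trans hxy⟩,
    {x | ∃ y ∈ c, -x ≤ y}, fun x y hxy ⟨z, hz, hzx⟩ => ⟨z, hz, (neg_le_neg hxy).trans hzx⟩, ?_⟩
  ext x
  simp only [Set.mem_inter_iff, Set.mem_preimage, Set.mem_ofPred_eq, neg_neg]
  constructor
  · rintro ⟨⟨y, hy, hyx⟩, z, hz, hxz⟩
    exact Set.OrdConnected.out hc hy hz ⟨hyx, hxz⟩
  · exact fun hx => ⟨⟨x, hx, le_rfl⟩, x, hx, le_rfl⟩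

/-- Codes for the types of families `a : X → A` under an automorphism: the relations between the
iterates of finitely many points whose orbits contain everything, as sets of integers, and the
positions of the points of the family. -/
abbrev Code (X : Type u) : Type u := Σ m : ℕ, (Fin m → Fin m → ConvexSet) ×
  (Fin m → Fin m → ConvexSet) × (Fin m → ℕ∞) × (Fin m → Fin m → Finset (ℕ × ConvexSet)) ×
  (X → ℤ × Fin m)

/-- `c` is a code of the family `a` under the automorphism `F`. -/
structure HasCode {A X : Type u} [OTree A] (F : Equiv.Perm A) (a : X → A) (c : Code X)
    (b : Fin c.1 → A) : Prop where
  exists_eq : ∀ x, ∃ (k : ℤ) (s : _), (F ^ k) (b s) = x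
  le_iff : ∀ s t (k : ℤ), b s ≤ (F ^ k) (b t) ↔ k ∈ (c.2.1 s t).1
  prec_iff : ∀ s t (k : ℤ), prec (b s) ((F ^ k) (b t)) ↔ k ∈ (c.2.2.1 s t).1
  lab_eq : ∀ s, lab (b s) = c.2.2.2.1 s
  G_iff : ∀ i s t (k : ℤ), G i (b s) ((F ^ k) (b t)) ↔
    ∃ d, (i, d) ∈ c.2.2.2.2.1 s t ∧ k ∈ d.1
  pos : ∀ x, a x = (F ^ (c.2.2.2.2.2 x).1) (b (c.2.2.2.2.2 x).2)

/-- The times at which an iterate of `b` is above, or after, or in a given cone at another point form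
convex sets, because the iterates of `b` form a monotone sequence in the linear order. -/
theorem exists_hasCode {A X : Type u} [OTree A] {F : Equiv.Perm A} (hF : IsEmb F) {t : Set A}
    (ht : t.Finite) (hall : ∀ x, x ∈ orbits F t) (a : X → A) : ∃ c b, HasCode F a c b := by
  classical
  obtain ⟨m, b, hb⟩ : ∃ (m : ℕ) (b : Fin m → A), Set.range b = t := by
    have := ht.to_subtype
    obtain ⟨m, ⟨e⟩⟩ := Finite.exists_equiv_fin t
    exact ⟨m, fun i => (e.symm i).1, by
      ext x
      exact ⟨fun ⟨i, hi⟩ => hi ▸ (e.symm i).2, fun hx => ⟨e ⟨x, hx⟩, by simp⟩⟩⟩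
  have hall' : ∀ x, ∃ (k : ℤ) (s : Fin m), (F ^ k) (b s) = x := by
    intro x
    obtain ⟨y, hy, k, hk⟩ := hall x
    rw [← hb] at hy
    obtain ⟨s, rfl⟩ := hy
    exact ⟨k, s, hk⟩
  have h1 : ∀ s t, {k : ℤ | b s ≤ (F ^ k) (b t)}.OrdConnected := fun s t =>
    ⟨fun k hk l hl r hr => (le_inf hk hl).trans (zpow_inf_le hF _ hr.1 hr.2)⟩
  have h2 : ∀ s t, {k : ℤ | prec (b s) ((F ^ k) (b t))}.OrdConnected := fun s t =>
    ⟨fun k hk l hl r hr => by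
      rcases zpow_between hF (b t) hr.1 hr.2 with h | h
      · exact prec_of_prec_of_preceq hk h.1
      · exact prec_of_prec_of_preceq hl h.1⟩
  have h3 : ∀ i s t, {k : ℤ | G i (b s) ((F ^ k) (b t))}.OrdConnected := fun i s t =>
    ⟨fun k hk l hl r hr => by
      have hlt := lt_inf (G_dom hk).2.1.le (G_dom hl).2.1.le (G_sep hk hl)
      exact G_mono ((G_iff_of_le hlt inf_le_left).2 hk) (zpow_inf_le hF _ hr.1 hr.2)⟩
  choose k s hks using hall'
  refine ⟨⟨m, fun s t => ⟨_, h1 s t⟩, fun s t => ⟨_, h2 s t⟩, fun s => lab (b s),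
    fun s t => if lab (b s) = ⊤ then ∅ else
      (Finset.range (lab (b s)).toNat).image fun i => (i, ⟨_, h3 i s t⟩),
    fun x => (k (a x), s (a x))⟩, b, fun x => ⟨k x, s x, hks x⟩, fun _ _ _ => Iff.rfl,
    fun _ _ _ => Iff.rfl, fun _ => rfl, fun i s t r => ?_, fun x => (hks (a x)).symm⟩
  by_cases hs : lab (b s) = ⊤
  · simp only [hs, if_true, Finset.notMem_empty, false_and, exists_false, iff_false]
    exact fun h => (G_dom h).1 hs
  · simp only [hs, if_false, Finset.mem_image, Finset.mem_range, Prod.mk.injEq]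
    constructor
    · intro h
      refine ⟨_, ⟨i, ?_, rfl, rfl⟩, h⟩
      have := (G_dom h).2.2
      rw [← ENat.natCast_toNat hs] at this
      have h' : i + 1 < (lab (b s)).toNat := by exact_mod_cast this
      lia
    · rintro ⟨d, ⟨j, -, rfl, rfl⟩, hd⟩
      exact hd

/-- Families with the same code have the same type. -/
theorem piso_of_hasCode {A B X : Type u} [OTree A] [OTree B] {F : Equiv.Perm A} {F' : Equiv.Perm B}
    (hF : IsEmb F) (hF' : IsEmb F') {a : X → A} {a' : X → B} {c : Code X} {b : Fin c.1 → A}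
    {b' : Fin c.1 → B} (h : HasCode F a c b) (h' : HasCode F' a' c b') :
    PIso (Set.range fun p : ℤ × X => ((F ^ p.1) (a p.2), (F' ^ p.1) (a' p.2))) := by
  have hsh : ∀ {A : Type u} [OTree A] {F : Equiv.Perm A} (b : Fin c.1 → A) (k l : ℤ) (t : Fin c.1),
      (F ^ l) (b t) = (F ^ k) ((F ^ (l - k)) (b t)) := by
    intro A _ F b k l t
    rw [← Equiv.Perm.mul_apply, ← zpow_add]
    congr 2; ring
  have hle : ∀ (k l : ℤ) s t, (F ^ k) (b s) ≤ (F ^ l) (b t) ↔ (F' ^ k) (b' s) ≤ (F' ^ l) (b' t) := by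
    intro k l s t
    rw [hsh b k l, hsh b' k l, (hF.zpow k).le_iff, (hF'.zpow k).le_iff, h.le_iff, h'.le_iff]
  choose k s hks using h.exists_eq
  let φ : A → B := fun x => (F' ^ k x) (b' (s x))
  have hφ : ∀ (l : ℤ) t, φ ((F ^ l) (b t)) = (F' ^ l) (b' t) := by
    intro l t
    have h1 := hle (k ((F ^ l) (b t))) l (s ((F ^ l) (b t))) t
    have h2 := hle l (k ((F ^ l) (b t))) t (s ((F ^ l) (b t)))
    rw [hks] at h1 h2
    exact le_antisymm (h1.1 le_rfl) (h2.1 le_rfl)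
  have hemb : IsEmb φ := by
    refine IsEmb.of_le_iff φ (fun x y => ?_) (fun x y => ?_) (fun x y => ?_) (fun x => ?_)
      fun i x y => ?_
    · obtain ⟨l, t, rfl⟩ := h.exists_eq x
      obtain ⟨l', t', rfl⟩ := h.exists_eq y
      rw [hφ, hφ, hle]
    · obtain ⟨l, t, hlt⟩ := h'.exists_eq (φ x ⊓ φ y)
      exact ⟨_, (hφ l t).trans hlt⟩
    · obtain ⟨l, t, rfl⟩ := h.exists_eq x
      obtain ⟨l', t', rfl⟩ := h.exists_eq y
      rw [hφ, hφ, hsh b l l', hsh b' l l', (hF.zpow l).prec_iff, (hF'.zpow l).prec_iff,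
        h.prec_iff, h'.prec_iff]
    · obtain ⟨l, t, rfl⟩ := h.exists_eq x
      rw [hφ, (hF.zpow l).lab_eq, (hF'.zpow l).lab_eq, h.lab_eq, h'.lab_eq]
    · obtain ⟨l, t, rfl⟩ := h.exists_eq x
      obtain ⟨l', t', rfl⟩ := h.exists_eq y
      rw [hφ, hφ, hsh b l l', hsh b' l l', (hF.zpow l).G_iff, (hF'.zpow l).G_iff,
        h.G_iff, h'.G_iff]
  refine (piso_of_isEmb IsEmb.id hemb fun p : ℤ × X => (F ^ p.1) (a p.2)).mono ?_
  rintro _ ⟨⟨i, x⟩, rfl⟩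
  refine ⟨(i, x), Prod.ext rfl ?_⟩
  simp only [h.pos x, h'.pos x, ← Equiv.Perm.mul_apply, ← zpow_add]
  rw [hφ]

end OTree
end Dendrite

namespace Dendrite
namespace OTree

/-! ### Isolated types of orbits -/

/-- The families `y` and `z` have the same quantifier-free type, in the language with meets. -/
def SameType {T : Type*} {A B : Type u} [OTree A] [OTree B] (y : T → A) (z : T → B) : Prop :=
  PIso (Set.range fun t => (y t, z t))

namespace SameType

variable {T T' : Type*} {A B C : Type u} [OTree A] [OTree B] [OTree C] {y : T → A} {z : T → B}
  {w : T → C}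

theorem of_isEmb {I : Type u} [OTree I] {φ : I → A} {ψ : I → B} (hφ : IsEmb φ) (hψ : IsEmb ψ)
    (f : T → I) : SameType (fun t => φ (f t)) (fun t => ψ (f t)) := piso_of_isEmb hφ hψ f

theorem symm (h : SameType y z) : SameType z y := by
  refine PIso.mono (PIso.symm h) ?_
  rintro _ ⟨t, rfl⟩
  exact ⟨t, rfl⟩

theorem trans (h : SameType y z) (h' : SameType z w) : SameType y w := by
  refine PIso.mono (PIso.comp h h') ?_
  rintro _ ⟨t, rfl⟩
  exact ⟨z t, ⟨t, rfl⟩, ⟨t, rfl⟩⟩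

/-- Same type, restricted to those members of the families that are listed by `r`. -/
theorem of_forall {y' : T' → A} {z' : T' → B} (h : SameType y z)
    (hr : ∀ t', ∃ t, y t = y' t' ∧ z t = z' t') : SameType y' z' := by
  refine PIso.mono h ?_
  rintro _ ⟨t', rfl⟩
  obtain ⟨t, h1, h2⟩ := hr t'
  exact ⟨t, Prod.ext h1 h2⟩

theorem of_finite (h : ∀ s : Set T, s.Finite → SameType (fun t : s => y t) (fun t : s => z t)) :
    SameType y z := by
  refine piso_of_finite fun Δ hΔ hfin => ?_
  choose r hr using fun p : Δ => hΔ p.2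
  have := hfin.to_subtype
  refine PIso.mono (h (Set.range r) (Set.finite_range r)) fun p hp => ?_
  exact ⟨⟨r ⟨p, hp⟩, _, rfl⟩, hr ⟨p, hp⟩⟩

end SameType

/-- A partial isomorphism from a set onto itself generates an automorphism of its meet-closure. -/
theorem PIso.exists_perm {A : Type u} [OTree A] {Γ : Set (A × A)} (h : PIso Γ) {R : Set A}
    (h1 : Prod.fst '' Γ = R) (h2 : Prod.snd '' Γ = R) :
    letI := sub _ (clos_meetClosed R)
    ∃ F : Equiv.Perm (clos R), IsEmb F ∧ ∀ p ∈ Γ, ∀ hp, (F ⟨p.1, hp⟩ : A) = p.2 := by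
  subst h1
  let := sub _ (clos_meetClosed (Prod.fst '' Γ))
  let := sub _ (clos_meetClosed (Prod.snd '' Γ))
  obtain ⟨e, he, hv⟩ := h.exists_equiv
  have hc : ∀ {S S' : Set A} (hS : MeetClosed S) (hS' : MeetClosed S') (h : S = S'),
      @IsEmb S S' (sub S hS) (sub S' hS') (Equiv.setCongr h) := by
    rintro S _ hS _ rfl
    let := sub S hS
    exact IsEmb.id
  exact ⟨e.trans (Equiv.setCongr (congrArg clos h2)),
    (hc _ (clos_meetClosed _) (congrArg clos h2)).comp he, fun p hp _ => hv p hp⟩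

/-- The type of the orbits of the elements of `S` under the automorphism `f` is determined by the
restriction of `f` to `S`. -/
def Isolated {M : Type u} [OTree M] (f : Equiv.Perm M) (S : Set M) : Prop :=
  ∀ f' : Equiv.Perm M, IsEmb f' → (∀ x ∈ S, f' x = f x) →
    SameType (fun p : ℤ × S => (f ^ p.1) p.2.1) (fun p : ℤ × S => (f' ^ p.1) p.2.1)

/-- The part of the orbits of `S` under `f` between the times `-k` and `k`. -/
def window {M : Type u} (f : Equiv.Perm M) (S : Set M) (k : ℕ) : Set M :=
  {x | ∃ i : ℤ, -k ≤ i ∧ i < k ∧ ∃ y ∈ S, (f ^ i) y = x}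

theorem finite_window {M : Type u} (f : Equiv.Perm M) {S : Set M} (hS : S.Finite) (k : ℕ) :
    (window f S k).Finite := by
  refine ((Set.finite_Ico (-k : ℤ) k).image2 (fun i y => (f ^ i) y) hS).subset ?_
  rintro _ ⟨i, h1, h2, y, hy, rfl⟩
  exact ⟨i, ⟨h1, h2⟩, y, hy, rfl⟩

theorem zpow_eq_of_window {M : Type u} {f f' : Equiv.Perm M} {S : Set M} {k : ℕ}
    (h : ∀ x ∈ window f S k, f' x = f x) {i : ℤ} (hi : |i| ≤ k) {y : M} (hy : y ∈ S) :
    (f' ^ i) y = (f ^ i) y := by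
  have h1 : ∀ n : ℕ, n ≤ k → (f' ^ (n : ℤ)) y = (f ^ (n : ℤ)) y := by
    intro n
    induction n with
    | zero => intro _; rfl
    | succ n ih =>
      intro hn
      rw [Nat.cast_succ, add_comm, zpow_one_add, zpow_one_add, Equiv.Perm.mul_apply, ih (by lia)]
      exact h _ ⟨n, by lia, by lia, y, hy, rfl⟩
  have h2 : ∀ n : ℕ, n ≤ k → (f' ^ (-n : ℤ)) y = (f ^ (-n : ℤ)) y := by
    intro n
    induction n with
    | zero => intro _; rfl
    | succ n ih =>
      intro hn
      have h3 : ∀ g : Equiv.Perm M, g ((g ^ (-(n + 1 : ℕ) : ℤ)) y) = (g ^ (-n : ℤ)) y := by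
        intro g
        rw [← Equiv.Perm.mul_apply, ← zpow_one_add]
        congr 2; push_cast; ring
      refine f'.injective ?_
      rw [h3, ih (by lia), ← h3 f]
      exact (h _ ⟨_, by lia, by lia, y, hy, rfl⟩).symm
  obtain ⟨n, rfl | rfl⟩ := i.eq_nat_or_neg
  · exact h1 n (by simpa using hi)
  · exact h2 n (by simpa using hi)

/-- Automorphisms with an isolated type are dense. Otherwise all of the countably many types of
orbits could be avoided. -/
theorem exists_isolated {M : Type u} [OTree M] {f₀ : Equiv.Perm M}
    (hf₀ : IsEmb f₀) {S₀ : Set M} (hS₀ : S₀.Finite) :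
    ∃ f : Equiv.Perm M, IsEmb f ∧ (∀ x ∈ S₀, f x = f₀ x) ∧
      ∃ S : Set M, S.Finite ∧ S₀ ⊆ S ∧ Isolated f S := by
  by_contra hcon
  have hX : Finite S₀ := hS₀.to_subtype
  let Q := {q : Equiv.Perm M × ℕ // IsEmb q.1 ∧ 1 ≤ q.2 ∧ ∀ x ∈ S₀, q.1 x = f₀ x}
  let _ : Preorder Q :=
    { le := fun q q' => q.1.2 ≤ q'.1.2 ∧ ∀ i : ℤ, |i| ≤ q.1.2 → ∀ x ∈ S₀,
        (q.1.1 ^ i) x = (q'.1.1 ^ i) x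
      le_refl := fun q => ⟨le_rfl, fun _ _ _ _ => rfl⟩
      le_trans := fun q q' q'' h h' => ⟨h.1.trans h'.1, fun i hi x hx =>
        (h.2 i hi x hx).trans (h'.2 i (hi.trans (by exact_mod_cast h.1)) x hx)⟩ }
  let fam : Equiv.Perm M → ℤ × S₀ → M := fun f p => (f ^ p.1) p.2.1
  -- each condition is compatible with two different types
  have hsplit : ∀ q : Q, ∃ q' : Q, q ≤ q' ∧ q'.1.2 = q.1.2 ∧ ¬ SameType (fam q.1.1) (fam q'.1.1) := by
    rintro ⟨⟨f, k⟩, hf, hk, hf0⟩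
    have hsub : S₀ ⊆ window f S₀ k := fun x hx => ⟨0, by lia, by exact_mod_cast hk, x, hx, rfl⟩
    have : ¬ Isolated f (window f S₀ k) := fun h =>
      hcon ⟨f, hf, hf0, _, finite_window f hS₀ k, hsub, h⟩
    unfold Isolated at this
    push Not at this
    obtain ⟨f', hf', hag, hne⟩ := this
    refine ⟨⟨⟨f', k⟩, hf', hk, fun x hx => (hag x (hsub hx)).trans (hf0 x hx)⟩,
      ⟨le_rfl, fun i hi x hx => (zpow_eq_of_window hag hi hx).symm⟩, rfl, fun h => hne ?_⟩
    refine h.of_forall ?_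
    rintro ⟨i, _, l, h1, h2, y, hy, rfl⟩
    refine ⟨(i + l, ⟨y, hy⟩), ?_, ?_⟩
    · change (f ^ (i + l)) y = (f ^ i) ((f ^ l) y)
      rw [zpow_add]; rfl
    · change (f' ^ (i + l)) y = (f' ^ i) ((f ^ l) y)
      rw [← zpow_eq_of_window hag (abs_le.2 ⟨h1, h2.le⟩) hy, zpow_add]; rfl
  -- conditions that differ from all families with a given code, within their window, are cofinal
  let D : Code S₀ ⊕ ℕ → Set Q := fun i => match i with
    | .inl c => {q | ∀ (N : Type u) (_ : OTree N) (F : Equiv.Perm N) (a : S₀ → N) (b : _),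
        IsEmb F → HasCode F a c b → ¬ SameType (fun p : {p : ℤ × S₀ // |p.1| ≤ q.1.2} => fam q.1.1 p.1)
          (fun p : {p : ℤ × S₀ // |p.1| ≤ q.1.2} => (F ^ p.1.1) (a p.1.2))}
    | .inr m => {q | m ≤ q.1.2}
  obtain ⟨s, hs, -, hD⟩ := exists_generic_seq (⟨⟨f₀, 1⟩, hf₀, le_rfl, fun _ _ => rfl⟩ : Q) D (by
    rintro (c | m) q
    swap
    · exact ⟨⟨⟨q.1.1, max q.1.2 m⟩, q.2.1, q.2.2.1.trans (le_max_left _ _), q.2.2.2⟩,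
        le_max_right q.1.2 m, le_max_left q.1.2 m, fun _ _ _ _ => rfl⟩
    by_cases hc : ∃ (N : Type u) (_ : OTree N) (F : Equiv.Perm N) (a : S₀ → N) (b : _),
      IsEmb F ∧ HasCode F a c b
    swap
    · exact ⟨q, fun N o F a b hF h => absurd ⟨N, o, F, a, b, hF, h⟩ hc, le_rfl⟩
    obtain ⟨N, _, F, a, b, hF, hN⟩ := hc
    obtain ⟨q', hqq', hne⟩ : ∃ q' : Q, q ≤ q' ∧
        ¬ SameType (fam q'.1.1) fun p : ℤ × S₀ => (F ^ p.1) (a p.2) := by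
      by_cases h : SameType (fam q.1.1) fun p : ℤ × S₀ => (F ^ p.1) (a p.2)
      · obtain ⟨q', hle, -, hne⟩ := hsplit q
        exact ⟨q', hle, fun h' => hne (h.trans h'.symm)⟩
      · exact ⟨q, le_rfl, h⟩
    have hfin := mt SameType.of_finite hne
    push Not at hfin
    obtain ⟨T, hT, hTne⟩ := hfin
    obtain ⟨k, hk⟩ := (hT.image fun p : ℤ × S₀ => p.1.natAbs).bddAbove
    refine ⟨⟨⟨q'.1.1, max q'.1.2 k⟩, q'.2.1, q'.2.2.1.trans (le_max_left _ _), q'.2.2.2⟩,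
      fun N' _ F' a' b' hF' hN' h => hTne ?_, hqq'.1.trans (le_max_left _ _), hqq'.2⟩
    have h2 : SameType _ _ := piso_of_hasCode hF' hF hN' hN
    refine (h.trans (h2.of_forall fun p => ⟨p.1, rfl, rfl⟩)).of_forall ?_
    rintro ⟨p, hp⟩
    have hpk : p.1.natAbs ≤ k := hk ⟨p, hp, rfl⟩
    have : |p.1| ≤ ((max q'.1.2 k : ℕ) : ℤ) := by
      rw [Int.abs_eq_natAbs]
      exact_mod_cast hpk.trans (le_max_right _ _)
    exact ⟨⟨p, this⟩, rfl, rfl⟩)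
  have hex : ∀ m : ℕ, ∃ n, m ≤ (s n).1.2 := fun m => by
    obtain ⟨n, -, hn⟩ := hD (.inr m) 0
    exact ⟨n, hn⟩
  -- the limit family and the automorphism of its closure
  choose n hn using hex
  let y : ℤ × S₀ → M := fun p => fam (s (n p.1.natAbs)).1.1 p
  have hy : ∀ m (p : ℤ × S₀), |p.1| ≤ (s m).1.2 → fam (s m).1.1 p = y p := by
    intro m p hp
    have hp' : |p.1| ≤ (s (n p.1.natAbs)).1.2 := by
      rw [Int.abs_eq_natAbs]; exact_mod_cast hn _
    exact ((hs (le_max_left m (n p.1.natAbs))).2 _ hp _ p.2.2).trans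
      ((hs (le_max_right m (n p.1.natAbs))).2 _ hp' _ p.2.2).symm
  let sh : ℤ × S₀ → ℤ × S₀ := fun p => (p.1 + 1, p.2)
  have hshift : SameType y (y ∘ sh) := by
    refine SameType.of_finite fun T hT => ?_
    obtain ⟨k, hk⟩ := (hT.image fun p : ℤ × S₀ => p.1.natAbs).bddAbove
    have hb : ∀ p ∈ T, |p.1| ≤ (s (n (k + 1))).1.2 ∧ |p.1 + 1| ≤ (s (n (k + 1))).1.2 := by
      intro p hp
      have h1 : p.1.natAbs ≤ k := hk ⟨p, hp, rfl⟩
      have h2 := hn (k + 1)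
      constructor <;> rw [abs_le] <;> constructor <;> lia
    refine (SameType.of_isEmb IsEmb.id (s (n (k + 1))).2.1 fun t : T => y t).of_forall fun t =>
      ⟨t, rfl, ?_⟩
    change (s (n (k + 1))).1.1 (y t) = y (sh t)
    rw [← hy (n (k + 1)) t (hb t t.2).1, ← hy (n (k + 1)) (sh t) (hb t t.2).2]
    change _ = ((s (n (k + 1))).1.1 ^ (t.1.1 + 1)) t.1.2.1
    rw [add_comm t.1.1 1, zpow_one_add]; rfl
  have hR1 : Prod.fst '' Set.range (fun t => (y t, (y ∘ sh) t)) = Set.range y := by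
    rw [← Set.range_comp]; rfl
  have hR2 : Prod.snd '' Set.range (fun t => (y t, (y ∘ sh) t)) = Set.range y := by
    rw [← Set.range_comp]
    refine Function.Surjective.range_comp (f := sh) (fun p => ⟨(p.1 - 1, p.2), ?_⟩) y
    simp [sh]
  let := sub _ (clos_meetClosed (Set.range y))
  obtain ⟨F, hF, hFy⟩ := PIso.exists_perm hshift hR1 hR2
  have hmem : ∀ p, y p ∈ clos (Set.range y) := fun p => subset_clos _ ⟨p, rfl⟩
  have hstep : ∀ p, F ⟨y p, hmem p⟩ = ⟨y (sh p), hmem _⟩ := fun p =>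
    Subtype.ext (hFy _ ⟨p, rfl⟩ (hmem p))
  let a : S₀ → clos (Set.range y) := fun x => ⟨y (0, x), hmem _⟩
  have hFa : ∀ (i : ℤ) x, (F ^ i) (a x) = ⟨y (i, x), hmem _⟩ := by
    intro i x
    induction i using Int.induction_on with
    | zero => rfl
    | succ i ih => rw [add_comm, zpow_one_add, Equiv.Perm.mul_apply, ih, hstep, add_comm]
    | pred i ih =>
      apply F.injective
      rw [hstep, ← Equiv.Perm.mul_apply, ← zpow_one_add,
        show 1 + (-(i : ℤ) - 1) = -i by ring, ih]
      simp [sh]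
  -- the limit family has a code, which it was supposed to avoid
  obtain ⟨t, ht, hsub⟩ := finite_orbits hF (Set.finite_range a)
  obtain ⟨c, b, hc⟩ := exists_hasCode hF ht (fun x => hsub (by
    obtain ⟨_, _, ⟨p, rfl⟩, _, ⟨q, rfl⟩, rfl⟩ := x
    exact ⟨_, ⟨_, ⟨p.2, rfl⟩, p.1, hFa _ _⟩, _, ⟨_, ⟨q.2, rfl⟩, q.1, hFa _ _⟩, rfl⟩)) a
  obtain ⟨m, -, hm⟩ := hD (.inl c) 0
  refine hm _ _ F a b hF hc ?_
  refine (SameType.of_isEmb (isEmb_val _ (clos_meetClosed (Set.range y))) IsEmb.id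
    fun p : {p : ℤ × S₀ // |p.1| ≤ (s m).1.2} => (F ^ p.1.1) (a p.1.2)).of_forall fun p => ⟨p, ?_, rfl⟩
  rw [hFa, hy m p.1 p.2]

end OTree
end Dendrite

namespace Dendrite

/-! ### Amalgamation over isolated orbits -/

section Joint

open OTree

variable {P : Set ℕ∞} {M : Type u} [OTree M]

theorem Nice.nonempty (hM : Nice P M) (hP : ∀ p ∈ P, 2 ≤ p) (hne : P.Nonempty) : Nonempty M := by
  obtain ⟨p, hp⟩ := hne
  let := point.{u} p (hP p hp)
  obtain ⟨θ, -, -⟩ := hM.ext PUnit (fun _ => hp) ∅ (fun _ h => h.elim)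
  exact ⟨θ ⟨⟩⟩

/-- Finite extensions of finite parts of `M` are realised in `M`. -/
theorem Nice.exists_realize (hM : Nice P M) [Nonempty M] {U : Type u} [OTree U] (hU : LabIn P U)
    {j : M → U} (hj : IsEmb j) {W : Set U} (hW : W.Finite) {T : Set M} (hT : T.Finite) :
    ∃ θ : U → M, (∀ x ∈ T, θ (j x) = x) ∧ SameType (fun u : W => (u : U)) fun u : W => θ u := by
  classical
  have hc := clos_meetClosed (W ∪ j '' T)
  let := sub _ hc
  have hfin : Finite (clos (W ∪ j '' T)) := (finite_clos (hW.union (hT.image j))).to_subtype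
  have hjT : ∀ x ∈ T, j x ∈ clos (W ∪ j '' T) := fun x hx => subset_clos _ (Or.inr ⟨x, hx, rfl⟩)
  have hmem : ∀ u ∈ W, u ∈ clos (W ∪ j '' T) := fun u hu => subset_clos _ (Or.inl hu)
  let Γ : Set (M × clos (W ∪ j '' T)) := Set.range fun x : T => (x.1, ⟨j x, hjT x x.2⟩)
  have hΓ : PIso Γ := by
    refine PIso.of_map IsEmb.id (isEmb_val _ hc)
      ((piso_of_isEmb IsEmb.id hj fun x : T => x.1).mono ?_)
    rintro _ ⟨_, ⟨x, rfl⟩, rfl⟩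
    exact ⟨x, rfl⟩
  obtain ⟨θ, hθ, hθΓ⟩ := hM.ext _ (fun a => hU a.1) Γ hΓ
  refine ⟨fun u => if h : u ∈ clos (W ∪ j '' T) then θ ⟨u, h⟩ else Classical.arbitrary M,
    fun x hx => ?_, ?_⟩
  · exact (dif_pos (hjT x hx)).trans (hθΓ _ ⟨⟨x, hx⟩, rfl⟩)
  · refine (SameType.of_isEmb (isEmb_val _ hc) hθ fun u : W => ⟨u.1, hmem u u.2⟩).of_forall
      fun u => ⟨u, rfl, ?_⟩
    dsimp only
    rw [dif_pos (hmem u u.2)]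

theorem OTree.Isolated.congr {f f' : Equiv.Perm M} {S : Set M} (h : Isolated f S) (hf' : IsEmb f')
    (hff' : ∀ x ∈ S, f' x = f x) : Isolated f' S := fun f'' hf'' h'' =>
  (h f' hf' hff').symm.trans (h f'' hf'' fun x hx => (h'' x hx).trans (hff' x hx))

/-- A map between sets of generators of the same type extends to the meet-closure. -/
theorem OTree.PIso.exists_isEmb {A B : Type u} [OTree A] [OTree B] {Γ : Set (A × B)} (h : PIso Γ)
    {R : Set A} (hR : Prod.fst '' Γ = R) :
    letI := sub _ (clos_meetClosed R)
    ∃ φ : clos R → B, IsEmb φ ∧ ∀ p ∈ Γ, ∀ hp, φ ⟨p.1, hp⟩ = p.2 := by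
  subst hR
  let := sub _ (clos_meetClosed (Prod.fst '' Γ))
  let := sub _ (clos_meetClosed (Prod.snd '' Γ))
  obtain ⟨e, he, hv⟩ := h.exists_equiv
  exact ⟨fun x => e x, (isEmb_val _ (clos_meetClosed _)).comp he, fun p hp _ => hv p hp⟩

/-- Two automorphisms that agree on a set over which one of them is isolated can be amalgamated:
some automorphism agrees with the second one on a given finite set, and a conjugate of it by an
automorphism fixing `S` agrees with the first one on a given finite set. -/
theorem Nice.exists_joint (hM : Nice P M) [Nonempty M] {f₁ f₂ : Equiv.Perm M} (h₁ : IsEmb f₁)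
    (h₂ : IsEmb f₂) {S T₁ T₂ : Set M} (hT₁ : T₁.Finite) (hT₂ : T₂.Finite)
    (hS : Isolated f₁ S) (hag : ∀ x ∈ S, f₂ x = f₁ x) (hS₁ : S ⊆ T₁) (hS₂ : S ⊆ T₂) :
    ∃ f g : Equiv.Perm M, IsEmb f ∧ IsEmb g ∧ (∀ x ∈ S, g x = x) ∧ (∀ x ∈ T₂, f x = f₂ x) ∧
      ∀ x ∈ T₁, f (g x) = g (f₁ x) := by
  let R₀ := orbits f₁ S
  let R₁ := orbits f₁ T₁
  have c₀ := clos_meetClosed R₀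
  have c₁ := clos_meetClosed R₁
  let := sub _ c₀
  let := sub _ c₁
  have hR : R₀ ⊆ R₁ := by
    rintro _ ⟨b, hb, k, rfl⟩
    exact ⟨b, hS₁ hb, k, rfl⟩
  let i₁ : clos R₀ → clos R₁ := Set.inclusion (clos_mono hR)
  have hi₁ : IsEmb i₁ := ⟨fun _ _ => rfl, fun _ _ => Iff.rfl, fun _ => rfl, fun _ _ _ => Iff.rfl⟩
  let F₀ : Equiv.Perm (clos R₀) := f₁.subtypePerm fun x => (mem_clos_orbits_iff h₁ S x).symm
  let F₁ : Equiv.Perm (clos R₁) := f₁.subtypePerm fun x => (mem_clos_orbits_iff h₁ T₁ x).symm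
  have hF₁ : IsEmb F₁ := ⟨fun a b => Subtype.ext (h₁.map_inf a.1 b.1),
    fun a b => h₁.prec_iff a.1 b.1, fun a => h₁.lab_eq a.1, fun i a b => h₁.G_iff i a.1 b.1⟩
  obtain ⟨i₂, hi₂, hv⟩ := (hS f₂ h₂ hag).exists_isEmb (R := R₀) (by
    ext x
    constructor
    · rintro ⟨_, ⟨⟨k, b⟩, rfl⟩, rfl⟩
      exact ⟨b, b.2, k, rfl⟩
    · rintro ⟨b, hb, k, rfl⟩
      exact ⟨_, ⟨⟨k, ⟨b, hb⟩⟩, rfl⟩, rfl⟩)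
  have hc : ∀ x (hx : x ∈ R₀), f₂ (i₂ ⟨x, subset_clos _ hx⟩) = i₂ (F₀ ⟨x, subset_clos _ hx⟩) := by
    rintro _ ⟨b, hb, k, rfl⟩
    have e1 := hv _ ⟨⟨k, ⟨b, hb⟩⟩, rfl⟩ (subset_clos _ ⟨b, hb, k, rfl⟩)
    have e2 := hv _ ⟨⟨1 + k, ⟨b, hb⟩⟩, rfl⟩ (subset_clos _ ⟨b, hb, 1 + k, rfl⟩)
    simp only [zpow_one_add] at e1 e2
    rw [e1]
    exact e2.symm
  have hpow : ∀ (k : ℤ) (x : clos R₁), ((F₁ ^ k) x : M) = (f₁ ^ k) x.1 := fun k x => by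
    rw [Equiv.Perm.subtypePerm_zpow]; rfl
  obtain ⟨t, ht, hts⟩ := finite_orbits h₁ hT₁
  have htf : {x : clos R₁ | x.1 ∈ t}.Finite := ht.preimage Subtype.val_injective.injOn
  obtain ⟨U, _, j₁, j₂, F, hj₁, hj₂, hF, hcom, hFj₁, hFj₂, hcov⟩ := exists_amalgam i₁ i₂ hi₁ hi₂
    F₀ F₁ f₂ hF₁ h₂ (fun _ => rfl) (by
      rintro ⟨_, p, hp, q, hq, rfl⟩
      change f₂ (i₂ (⟨p, subset_clos _ hp⟩ ⊓ ⟨q, subset_clos _ hq⟩)) =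
        i₂ (⟨f₁ (p ⊓ q), _⟩)
      have e : F₀ ⟨p ⊓ q, p, hp, q, hq, rfl⟩ =
          F₀ ⟨p, subset_clos _ hp⟩ ⊓ F₀ ⟨q, subset_clos _ hq⟩ := Subtype.ext (h₁.map_inf p q)
      refine Eq.trans ?_ (congrArg i₂ e).symm
      rw [hi₂.map_inf, hi₂.map_inf, h₂.map_inf, hc p hp, hc q hq]) htf.toFinset (by
      rintro x -
      obtain ⟨b, hb, k, hk⟩ := hts x.2
      have hbm : b ∈ clos R₁ := by
        have : b = ((F₁ ^ (-k)) x).1 := by rw [hpow, ← hk, zpow_neg]; simp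
        rw [this]; exact Subtype.property _
      exact ⟨⟨b, hbm⟩, by simpa using hb, k, Subtype.ext ((hpow k _).trans hk)⟩)
  have hU : LabIn P U := fun u => by
    rcases hcov u with ⟨x, rfl⟩ | ⟨x, rfl⟩
    · rw [hj₁.lab_eq]; exact hM.labIn x.1
    · rw [hj₂.lab_eq]; exact hM.labIn x
  have m₁ : ∀ x ∈ T₁, x ∈ clos R₁ := fun x hx => subset_clos _ (subset_orbits _ _ hx)
  let κ : T₁ → clos R₁ := fun x => ⟨x, m₁ x x.2⟩
  have := hT₁.to_subtype
  let W₀ : Set U := Set.range (fun x => j₁ (κ x)) ∪ j₂ '' T₂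
  have hW₀ : W₀.Finite := (Set.finite_range _).union (hT₂.image _)
  obtain ⟨θ, hθ, hty⟩ := hM.exists_realize hU hj₂ (hW₀.union (hW₀.image F))
    (hT₂.union (hT₂.image f₂))
  have hΓ : SameType (fun u : W₀ => θ u) fun u : W₀ => θ (F u) := by
    have e1 := (hty.of_forall (y' := fun u : W₀ => u.1) (z' := fun u : W₀ => θ u)
      fun u => ⟨⟨u, Or.inl u.2⟩, rfl, rfl⟩)
    have e2 := (hty.of_forall (y' := fun u : W₀ => F u.1) (z' := fun u : W₀ => θ (F u))
      fun u => ⟨⟨F u, Or.inr ⟨u, u.2, rfl⟩⟩, rfl, rfl⟩)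
    exact e1.symm.trans ((SameType.of_isEmb IsEmb.id hF Subtype.val).trans e2)
  have := hW₀.to_subtype
  obtain ⟨f, hf, hfΓ⟩ := hM.hom _ (Set.finite_range _) hΓ
  have hfθ : ∀ u ∈ W₀, f (θ u) = θ (F u) := fun u hu => hfΓ _ ⟨⟨u, hu⟩, rfl⟩
  have hΔ : SameType (fun x : T₁ ⊕ T₁ => (x.elim κ fun y => F₁ (κ y)).1)
      fun x : T₁ ⊕ T₁ => θ (j₁ (x.elim κ fun y => F₁ (κ y))) := by
    refine (SameType.of_isEmb (isEmb_val _ c₁) hj₁ _).trans (hty.of_forall ?_)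
    rintro (x | x)
    · exact ⟨⟨j₁ (κ x), Or.inl (Or.inl ⟨x, rfl⟩)⟩, rfl, rfl⟩
    · exact ⟨⟨j₁ (F₁ (κ x)), Or.inr ⟨_, Or.inl ⟨x, rfl⟩, hFj₁ _⟩⟩, rfl, rfl⟩
  obtain ⟨g, hg, hgΔ⟩ := hM.hom _ (Set.finite_range _) hΔ
  have hg1 : ∀ x : T₁, g x = θ (j₁ (κ x)) := fun x => hgΔ _ ⟨.inl x, rfl⟩
  have hg2 : ∀ x : T₁, g (f₁ x) = θ (j₁ (F₁ (κ x))) := fun x => hgΔ _ ⟨.inr x, rfl⟩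
  refine ⟨f, g, hf, hg, fun x hx => ?_, fun x hx => ?_, fun x hx => ?_⟩
  · rw [hg1 ⟨x, hS₁ hx⟩]
    have e : j₁ (κ ⟨x, hS₁ hx⟩) = j₂ (i₂ ⟨x, subset_clos _ (subset_orbits _ _ hx)⟩) :=
      hcom ⟨x, subset_clos _ (subset_orbits _ _ hx)⟩
    have e' := hv _ ⟨⟨0, ⟨x, hx⟩⟩, rfl⟩ (subset_clos _ (subset_orbits _ _ hx))
    rw [e]
    exact (congrArg (fun z => θ (j₂ z)) e').trans (hθ x (Or.inl (hS₂ hx)))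
  · rw [← hθ x (Or.inl hx), hfθ _ (Or.inr ⟨x, hx, rfl⟩), hFj₂, hθ _ (Or.inr ⟨x, hx, rfl⟩),
      hθ _ (Or.inl hx)]
  · rw [hg1 ⟨x, hx⟩, hg2 ⟨x, hx⟩, hfθ _ (Or.inl ⟨_, rfl⟩), hFj₁]

end Joint
end Dendrite

namespace Dendrite

open OTree

theorem OTree.IsEmb.of_comp {A B C : Type u} [OTree A] [OTree B] [OTree C] {φ : A → B} {ψ : B → C}
    (hψ : IsEmb ψ) (h : IsEmb (ψ ∘ φ)) : IsEmb φ where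
  map_inf a b := hψ.injective (by rw [hψ.map_inf]; exact h.map_inf a b)
  prec_iff a b := (hψ.prec_iff _ _).symm.trans (h.prec_iff a b)
  lab_eq a := (hψ.lab_eq _).symm.trans (h.lab_eq a)
  G_iff i a b := (hψ.G_iff _ _ _).symm.trans (h.G_iff i a b)

/-! ### Tuples of partial automorphisms inside a homogeneous structure -/

section Realize

variable {P : Set ℕ∞} {n : ℕ} {M : Type u} [OTree M]

/-- A tuple of partial automorphisms embeds in `M` over a partial isomorphism, and there its maps
extend to automorphisms. -/
theorem Nice.exists_auts (hM : Nice P M) (B : PartialAuts.{u} P n) [OTree B.carrier]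
    [Finite B.carrier] (hL : LabIn P B.carrier) (hB : ∀ i, PIso (B.graph i))
    {Γ : Set (M × B.carrier)} (hΓ : PIso Γ) :
    ∃ (θ : B.carrier → M) (f : Fin n → Equiv.Perm M), IsEmb θ ∧ (∀ p ∈ Γ, θ p.2 = p.1) ∧
      (∀ i, IsEmb (f i)) ∧ ∀ i, ∀ p ∈ B.graph i, f i (θ p.1) = θ p.2 := by
  obtain ⟨θ, hθ, hθΓ⟩ := hM.ext _ hL Γ hΓ
  have := fun i => hM.hom _ ((B.graph i).toFinite.image _) ((hB i).map hθ hθ)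
  choose f hf hfg using this
  exact ⟨θ, f, hθ, hθΓ, hf, fun i p hp => hfg i _ ⟨p, hp, rfl⟩⟩

/-- Automorphisms of `M`, restricted to finite sets `D i`, form a tuple of partial
automorphisms. -/
theorem Nice.exists_partialAuts (hM : Nice P M) (hP : ∀ p ∈ P, 2 ≤ p) (hne : P.Nonempty)
    {f : Fin n → Equiv.Perm M} (hf : ∀ i, IsEmb (f i)) {E : Set M} (hE : E.Finite) (D : Fin n → Set M) :
    ∃ (S : PartialAuts.{u} P n) (_ : OTree S.carrier) (ε : S.carrier → M), Compat P S.carrier ∧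
      IsEmb ε ∧ (∀ s, ε s ∈ clos E) ∧ (∀ x ∈ E, ∃ s, ε s = x) ∧
      ∀ i s s', ε s ∈ D i → ε s' = f i (ε s) → (s, s') ∈ S.graph i := by
  let := sub _ (clos_meetClosed E)
  have := (finite_clos hE).to_subtype
  obtain ⟨S, o, e, hC, hL, he, hg⟩ := Dendrite.exists_partialAuts hP hne (clos E)
    (fun a => hM.labIn a.1) (fun i => {p | p.1.1 ∈ D i ∧ p.2.1 = f i p.1}) (fun i => by
      refine PIso.of_map (isEmb_val _ (clos_meetClosed E)) (isEmb_val _ (clos_meetClosed E))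
        ((piso_of_isEmb IsEmb.id (hf i) id).mono ?_)
      rintro _ ⟨p, hp, rfl⟩
      exact ⟨p.1, Prod.ext rfl hp.2.symm⟩)
  refine ⟨S, o, fun s => (e.symm s).1, hC, (isEmb_val _ (clos_meetClosed E)).comp he.symm,
    fun s => (e.symm s).2, fun x hx => ⟨e ⟨x, subset_clos _ hx⟩, by simp⟩, fun i s s' h1 h2 => ?_⟩
  simpa using hg i (e.symm s, e.symm s') ⟨h1, h2⟩

end Realize

/-! ### Cofinal amalgamation for single partial automorphisms -/

/-- Any two extensions of `A` can be amalgamated over `A`. -/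
def IsAmalgBase {P : Set ℕ∞} {n : ℕ} (A : PartialAuts.{u} P n) : Prop :=
  ∀ (B₁ B₂ : PartialAuts.{u} P n) (φ₁ : A.Emb B₁) (φ₂ : A.Emb B₂),
    ∃ (C : PartialAuts.{u} P n) (ψ₁ : B₁.Emb C) (ψ₂ : B₂.Emb C),
      ∀ x, ψ₁.toEmb (φ₁.toEmb x) = ψ₂.toEmb (φ₂.toEmb x)

/-- Composition of embeddings. -/
def PartialAuts.Emb.trans {P : Set ℕ∞} {n : ℕ} {A B C : PartialAuts.{u} P n} (φ : A.Emb B)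
    (ψ : B.Emb C) : A.Emb C where
  toEmb := ψ.toEmb.comp φ.toEmb
  comm i x := (ψ.graph_mem (φ.graph_mem (p := (x.1, (A.maps i).toEquiv x)) ⟨x.2, rfl⟩))

theorem hasCAP_of_cofinal {P : Set ℕ∞} {n : ℕ}
    (h : ∀ S : PartialAuts.{u} P n, ∃ S', IsAmalgBase S' ∧ Nonempty (S.Emb S')) :
    HasCAP.{u} P n := by
  refine ⟨{S | IsAmalgBase S}, h, fun A hA B₁ _ B₂ _ φ₁ φ₂ => ?_⟩
  obtain ⟨C, ψ₁, ψ₂, hc⟩ := hA B₁ B₂ φ₁ φ₂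
  obtain ⟨C', hC', ⟨χ⟩⟩ := h C
  exact ⟨C', hC', ψ₁.trans χ, ψ₂.trans χ, fun x => congrArg χ.toEmb (hc x)⟩

/-- A restriction of an automorphism to a set over which it is isolated is an amalgamation base. -/
theorem Nice.isAmalgBase_of_isolated {P : Set ℕ∞} {M : Type u} [OTree M] (hM : Nice P M)
    (hP : ∀ p ∈ P, 2 ≤ p) (hne : P.Nonempty) {f : Equiv.Perm M} {S : Set M}
    (hS : Isolated f S) {A : PartialAuts.{u} P 1} [OTree A.carrier] (hA : Compat P A.carrier)
    (lA : LabIn P A.carrier) {ε : A.carrier → M} (hε : IsEmb ε) (hcl : ∀ s, ε s ∈ clos (S ∪ f '' S))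
    (hgr : ∀ x ∈ S, ∃ p ∈ A.graph 0, ε p.1 = x ∧ ε p.2 = f x) :
    IsAmalgBase A := by
  intro B₁ B₂ φ₁ φ₂
  have := hM.nonempty hP hne
  obtain ⟨_, o₁, L₁, C₁, G₁⟩ := B₁.exists_otree hP
  obtain ⟨_, o₂, L₂, C₂, G₂⟩ := B₂.exists_otree hP
  have hφ₁ := isEmb_of_embedding hA C₁ lA L₁ φ₁.toEmb
  have hφ₂ := isEmb_of_embedding hA C₂ lA L₂ φ₂.toEmb
  obtain ⟨θ₁, F₁, hθ₁, hΓ₁, hF₁, hg₁⟩ := hM.exists_auts B₁ L₁ G₁ (piso_of_isEmb hε hφ₁ id)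
  obtain ⟨θ₂, F₂, hθ₂, hΓ₂, hF₂, hg₂⟩ := hM.exists_auts B₂ L₂ G₂ (piso_of_isEmb hε hφ₂ id)
  have e₁ : ∀ a, θ₁ (φ₁.toEmb a) = ε a := fun a => hΓ₁ _ ⟨a, rfl⟩
  have e₂ : ∀ a, θ₂ (φ₂.toEmb a) = ε a := fun a => hΓ₂ _ ⟨a, rfl⟩
  have hFS : ∀ x ∈ S, F₁ 0 x = f x ∧ F₂ 0 x = f x := by
    intro x hx
    obtain ⟨p, hp, h1, h2⟩ := hgr x hx
    rw [← h1, ← h2.trans (congrArg f h1.symm)]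
    constructor
    · rw [← e₁, ← e₁]; exact hg₁ 0 _ (φ₁.graph_mem hp)
    · rw [← e₂, ← e₂]; exact hg₂ 0 _ (φ₂.graph_mem hp)
  have hS₁ : S ⊆ Set.range θ₁ := fun x hx => by
    obtain ⟨p, hp, h1, -⟩ := hgr x hx
    exact ⟨_, (e₁ p.1).trans h1⟩
  have hS₂ : S ⊆ Set.range θ₂ := fun x hx => by
    obtain ⟨p, hp, h1, -⟩ := hgr x hx
    exact ⟨_, (e₂ p.1).trans h1⟩
  obtain ⟨h, g, hh, hg, hgS, hh₂, hhg⟩ := hM.exists_joint (hF₁ 0) (hF₂ 0) (Set.finite_range θ₁)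
    (Set.finite_range θ₂) (hS.congr (hF₁ 0) fun x hx => (hFS x hx).1)
    (fun x hx => (hFS x hx).2.trans (hFS x hx).1.symm) hS₁ hS₂
  have hgε : ∀ a, g (ε a) = ε a := by
    intro a
    have key : ∀ x ∈ S ∪ f '' S, g x = x := by
      rintro _ (hx | ⟨x, hx, rfl⟩)
      · exact hgS _ hx
      · rw [← (hFS x hx).1, ← hhg x (hS₁ hx), hgS x hx, hh₂ x (hS₂ hx), (hFS x hx).1,
          (hFS x hx).2]
    obtain ⟨x, hx, y, hy, hxy⟩ := hcl a
    rw [← hxy, hg.map_inf, key x hx, key y hy]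
  obtain ⟨C, oC, η, hC, hη, -, hsurj, hCg⟩ := hM.exists_partialAuts hP hne (n := 1)
    (f := fun _ => h) (fun _ => hh) ((Set.finite_range (g ∘ θ₁)).union (Set.finite_range θ₂))
    (fun _ => (fun p => g (θ₁ p.1)) '' B₁.graph 0 ∪ (fun p => θ₂ p.1) '' B₂.graph 0)
  choose κ₁ hκ₁ using fun b => hsurj (g (θ₁ b)) (Or.inl ⟨b, rfl⟩)
  choose κ₂ hκ₂ using fun b => hsurj (θ₂ b) (Or.inr ⟨b, rfl⟩)
  obtain ⟨ψ₁, hψ₁⟩ := PartialAuts.exists_emb C₁ hC (φ := κ₁)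
    (hη.of_comp ((funext hκ₁ : η ∘ κ₁ = g ∘ θ₁) ▸ hg.comp hθ₁)) (fun i p hp => by
      obtain rfl : i = 0 := Subsingleton.elim _ _
      refine hCg 0 _ _ (Or.inl ⟨p, hp, (hκ₁ _).symm⟩) ?_
      rw [hκ₁, hκ₁, hhg _ ⟨_, rfl⟩, hg₁ 0 p hp])
  obtain ⟨ψ₂, hψ₂⟩ := PartialAuts.exists_emb C₂ hC (φ := κ₂)
    (hη.of_comp ((funext hκ₂ : η ∘ κ₂ = θ₂) ▸ hθ₂)) (fun i p hp => by
      obtain rfl : i = 0 := Subsingleton.elim _ _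
      refine hCg 0 _ _ (Or.inr ⟨p, hp, (hκ₂ _).symm⟩) ?_
      rw [hκ₂, hκ₂, hh₂ _ ⟨_, rfl⟩, hg₂ 0 p hp])
  refine ⟨C, ψ₁, ψ₂, fun a => hη.injective ?_⟩
  rw [hψ₁, hψ₂, hκ₁, hκ₂, e₁, e₂, hgε]

/-- A partial automorphism extends to an automorphism of the limit, and this can be changed to be
isolated over a finite set containing the given one. -/
theorem hasCAP_one {P : Set ℕ∞} (hP : ∀ p ∈ P, 2 ≤ p) (hne : P.Nonempty) : HasCAP.{u} P 1 := by
  refine hasCAP_of_cofinal fun S => ?_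
  obtain ⟨M, _, hM⟩ := exists_nice.{u} P
  obtain ⟨_, o, L, hC, hG⟩ := S.exists_otree hP
  obtain ⟨θ, F, hθ, -, hF, hg⟩ := hM.exists_auts S L hG (Γ := ∅) (fun _ h => h.elim)
  obtain ⟨f, hf, hfF, R, hR, hsub, hiso⟩ := exists_isolated (hF 0) (Set.finite_range θ)
  obtain ⟨A, oA, ε, hA, hε, hcl, hsurj, hAg⟩ := hM.exists_partialAuts hP hne (n := 1)
    (f := fun _ => f) (fun _ => hf) (hR.union (hR.image f)) fun _ => R
  have lA : LabIn P A.carrier := fun a => by rw [← hε.lab_eq]; exact hM.labIn _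
  refine ⟨A, hM.isAmalgBase_of_isolated hP hne hiso hA lA hε hcl fun x hx => ?_, ?_⟩
  · obtain ⟨s, rfl⟩ := hsurj x (Or.inl hx)
    obtain ⟨s', hs'⟩ := hsurj _ (Or.inr ⟨_, hx, rfl⟩)
    exact ⟨(s, s'), hAg 0 _ _ hx hs', rfl, hs'⟩
  · choose κ hκ using fun b => hsurj (θ b) (Or.inl (hsub ⟨b, rfl⟩))
    obtain ⟨ψ, -⟩ := PartialAuts.exists_emb hC hA (φ := κ)
      (hε.of_comp ((funext hκ : ε ∘ κ = θ) ▸ hθ)) (fun i p hp => by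
        obtain rfl : i = 0 := Subsingleton.elim _ _
        refine hAg 0 _ _ (by rw [hκ]; exact hsub ⟨_, rfl⟩) ?_
        rw [hκ, hκ, hfF _ ⟨_, rfl⟩, hg 0 p hp])
    exact ⟨ψ⟩

end Dendrite

namespace Dendrite
namespace OTree

/-! ### Points on chains -/

section Chains

variable {A : Type u} [OTree A]

/-- A strictly monotone map from a chain is an embedding if it respects labels and cones. -/
theorem isEmb_chain {α : Type u} [LinearOrder α] {l : α → ℕ∞} {ι : α → ℕ} {h2 : ∀ a, 2 ≤ l a}
    {hι : ∀ a, l a ≠ ⊤ → (ι a : ℕ∞) + 1 < l a} {φ : α → A} (hφ : StrictMono φ)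
    (hl : ∀ a, lab (φ a) = l a) (hG : ∀ a b, a < b → l a ≠ ⊤ → G (ι a) (φ a) (φ b)) :
    letI := chain l ι h2 hι
    IsEmb φ := by
  refine @IsEmb.mk α A (chain l ι h2 hι) _ φ (fun a b => ?_) (fun a b => ?_) hl fun i a b => ?_
  · change φ (a ⊓ b) = _
    rcases le_total a b with h | h
    · rw [inf_eq_left.2 h, inf_eq_left.2 (hφ.monotone h)]
    · rw [inf_eq_right.2 h, inf_eq_right.2 (hφ.monotone h)]
  · change _ ↔ a < b
    refine ⟨fun h => ?_, fun h => prec_of_lt (hφ h)⟩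
    by_contra hab
    exact not_prec.2 (preceq_of_le (hφ.monotone (not_lt.1 hab))) h
  · change _ ↔ l a ≠ ⊤ ∧ a < b ∧ i = ι a
    constructor
    · intro h
      have hd := G_dom h
      rw [hl] at hd
      have hab := hφ.lt_iff_lt.1 hd.2.1
      exact ⟨hd.1, hab, G_uniq h (hG a b hab hd.1)⟩
    · rintro ⟨h1, h3, rfl⟩
      exact hG a b h3 h1

theorem G_iff_cases {i : ℕ} {a b : A} (h : lab a = ⊤ ∨ G 0 a b) :
    G i a b ↔ lab a ≠ ⊤ ∧ i = 0 := by
  refine ⟨fun hi => ⟨(G_dom hi).1, ?_⟩, fun hi => ?_⟩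
  · rcases h with h | h
    · exact absurd h (G_dom hi).1
    · exact G_uniq hi h
  · rcases h with h | h
    · exact absurd h hi.1
    · exact hi.2 ▸ h

/-- Two points on the same gap of a meet-closed set, below an element of it, have the same type
over it if they have the same label and see that element in the same cone. -/
theorem piso_insert_of_lt {D : Set A} (hD : MeetClosed D) {b y g : A} (hb : b ∈ D) (hyb : y < b)
    (hgb : g < b) (hy : y ∉ D) (hg : g ∉ D) (h1 : ∀ e ∈ D, e < y ↔ e < g)
    (h2 : ∀ e ∈ D, y < e ↔ g < e) (hl : lab y = lab g) (hG : ∀ i, G i y b ↔ G i g b) :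
    MeetClosed (insert y D) ∧ PIso (insert (y, g) ((fun e => (e, e)) '' D)) := by
  -- the position of an element of `D` relative to a point of the gap
  have key : ∀ z, z < b → z ∉ D → ∀ e ∈ D, e ⊓ z ∈ insert z D ∧ (prec e z ↔ e < z ∨
      ¬ z < e ∧ prec e b) ∧ (∀ i, G i e z ↔ e < z ∧ G i e b) ∧
      ∀ i, G i z e ↔ z < e ∧ G i z b := by
    intro z hzb hz e he
    have hne : e ≠ z := fun h => hz (h ▸ he)
    refine ⟨?_, ?_, fun i => ⟨fun h => ?_, fun h => ?_⟩, fun i => ⟨fun h => ?_, fun h => ?_⟩⟩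
    · rcases le_total_of_le (inf_le_right : e ⊓ b ≤ b) hzb.le with h | h
      · have : e ⊓ z = e ⊓ b :=
          le_antisymm (inf_le_inf_left e hzb.le) (le_inf inf_le_left h)
        exact Or.inr (this ▸ hD e he b hb)
      · exact Or.inl (inf_eq_right.2 (h.trans inf_le_left))
    · constructor
      · intro h
        by_cases hez : e ≤ z
        · exact Or.inl (lt_of_le_of_ne hez hne)
        · exact Or.inr ⟨fun h' => prec_asymm h (prec_of_lt h'),
            prec_of_le_of_le h hez le_rfl hzb.le⟩
      · rintro (h | ⟨h, h'⟩)
        · exact prec_of_lt h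
        · by_contra hc
          have hc' := (prec_total hne).resolve_left hc
          refine prec_asymm h' (prec_of_le_of_le hc' (fun h'' => ?_) hzb.le le_rfl)
          exact h (lt_of_le_of_ne h'' hne.symm)
    · exact ⟨(G_dom h).2.1, G_mono h hzb.le⟩
    · exact (G_iff_of_le h.1 hzb.le).2 h.2
    · have hze := (G_dom h).2.1
      have hlt : z < e ⊓ b := lt_of_le_of_ne (le_inf hze.le hzb.le)
        fun h => hz (h ▸ hD e he b hb)
      exact ⟨hze, (G_iff_of_le hlt inf_le_right).1 ((G_iff_of_le hlt inf_le_left).2 h)⟩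
    · have hlt : z < e ⊓ b := lt_of_le_of_ne (le_inf h.1.le hzb.le)
        fun h => hz (h ▸ hD e he b hb)
      exact (G_iff_of_le hlt inf_le_left).1 ((G_iff_of_le hlt inf_le_right).2 h.2)
  have hcl : ∀ z, z < b → z ∉ D → MeetClosed (insert z D) := by
    rintro z hzb hz e (rfl | he) e' (rfl | he')
    · rw [inf_idem]; exact Or.inl rfl
    · rw [inf_comm]; exact (key _ hzb hz _ he').1
    · exact (key _ hzb hz _ he).1
    · exact Or.inr (hD _ he _ he')
  have c1 := hcl y hyb hy
  have c2 := hcl g hgb hg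
  refine ⟨c1, ?_⟩
  let := sub _ c1
  classical
  let φ : ↥(insert y D : Set A) → A := fun x => if x.1 = y then g else x.1
  have hφy : φ ⟨y, Or.inl rfl⟩ = g := if_pos rfl
  have hφD : ∀ e (he : e ∈ D), φ ⟨e, Or.inr he⟩ = e := fun e he =>
    if_neg fun h : e = y => hy (h ▸ he)
  have hφ : IsEmb φ := by
    have hc : ∀ x : ↥(insert y D : Set A), x.1 = y ∧ φ x = g ∨ x.1 ∈ D ∧ φ x = x.1 := by
      rintro ⟨e, rfl | he⟩
      · exact Or.inl ⟨rfl, hφy⟩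
      · exact Or.inr ⟨he, hφD e he⟩
    have hp : ∀ e ∈ D, prec e g ↔ prec e y := fun e he => by
      rw [(key g hgb hg e he).2.1, (key y hyb hy e he).2.1, h1 e he, h2 e he]
    refine IsEmb.of_le_iff φ (fun a b => ?_) ?_ (fun a b => ?_) (fun a => ?_) (fun i a b => ?_)
    · change _ ↔ a.1 ≤ b.1
      rcases hc a with ⟨ha, ha'⟩ | ⟨ha, ha'⟩ <;> rcases hc b with ⟨hb, hb'⟩ | ⟨hb, hb'⟩ <;>
        rw [ha', hb']
      · rw [ha, hb]; exact iff_of_true le_rfl le_rfl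
      · rw [ha, le_iff_lt_or_eq, le_iff_lt_or_eq, h2 _ hb]
        refine or_congr Iff.rfl (iff_of_false ?_ ?_)
        · intro h; exact hg (h ▸ hb)
        · intro h; exact hy (h ▸ hb)
      · rw [hb, le_iff_lt_or_eq, le_iff_lt_or_eq, h1 _ ha]
        refine or_congr Iff.rfl (iff_of_false ?_ ?_)
        · intro h; exact hg (h ▸ ha)
        · intro h; exact hy (h ▸ ha)
    · have hr : ∀ x ∈ insert g D, ∃ c, φ c = x := by
        rintro x (rfl | hx)
        · exact ⟨_, hφy⟩
        · exact ⟨_, hφD x hx⟩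
      have hm : ∀ x, φ x ∈ insert g D := fun x => by
        rcases hc x with ⟨-, h⟩ | ⟨h', h⟩ <;> rw [h]
        exacts [Or.inl rfl, Or.inr h']
      exact fun a b => hr _ (c2 _ (hm a) _ (hm b))
    · change _ ↔ prec a.1 b.1
      rcases hc a with ⟨ha, ha'⟩ | ⟨ha, ha'⟩ <;> rcases hc b with ⟨hb, hb'⟩ | ⟨hb, hb'⟩ <;>
        rw [ha', hb']
      · rw [ha, hb]; exact iff_of_false (prec_irrefl _) (prec_irrefl _)
      · rw [ha, ← not_preceq, ← not_preceq, preceq, preceq, hp _ hb]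
        refine not_congr (or_congr (iff_of_false ?_ ?_) Iff.rfl)
        · intro h; exact hg (h ▸ hb)
        · intro h; exact hy (h ▸ hb)
      · rw [hb]; exact hp _ ha
    · change _ = lab a.1
      rcases hc a with ⟨ha, ha'⟩ | ⟨ha, ha'⟩ <;> rw [ha']
      rw [ha, hl]
    · change _ ↔ G i a.1 b.1
      rcases hc a with ⟨ha, ha'⟩ | ⟨ha, ha'⟩ <;> rcases hc b with ⟨hb, hb'⟩ | ⟨hb, hb'⟩ <;>
        rw [ha', hb']
      · rw [ha, hb]
        exact iff_of_false (fun h => lt_irrefl _ (G_dom h).2.1)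
          (fun h => lt_irrefl _ (G_dom h).2.1)
      · rw [ha, (key g hgb hg _ hb).2.2.2, (key y hyb hy _ hb).2.2.2, h2 _ hb, hG]
      · rw [hb, (key g hgb hg _ ha).2.2.1, (key y hyb hy _ ha).2.2.1, h1 _ ha]
  refine (piso_of_isEmb (isEmb_val _ c1) hφ id).mono ?_
  rintro _ (rfl | ⟨e, he, rfl⟩)
  · exact ⟨⟨y, Or.inl rfl⟩, Prod.ext rfl hφy⟩
  · exact ⟨⟨e, Or.inr he⟩, Prod.ext rfl (hφD e he)⟩

end Chains
end OTree

open OTree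

section Below

variable {P : Set ℕ∞} {M : Type u} [OTree M]

theorem Nice.exists_lt (hM : Nice P M) (m : M) {p : ℕ∞} (hp : p ∈ P) (h2 : 2 ≤ p) :
    ∃ z, z < m ∧ lab z = p ∧ (p = ⊤ ∨ G 0 z m) := by
  let := pair.{u} p (lab m) 0 h2 (two_le_lab m) fun _ => zero_add_one_lt h2
  let := point.{u} (lab m) (two_le_lab m)
  have e : IsEmb fun _ : PUnit.{u + 1} => (⟨true⟩ : ULift.{u} Bool) := isEmb_point (⟨true⟩ : ULift.{u} Bool)
  obtain ⟨θ, hθ, hv⟩ := hM.ext (ULift.{u} Bool) (by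
    rintro ⟨_ | _⟩
    exacts [hp, hM.labIn m]) _ (piso_of_isEmb (isEmb_point m) e id)
  have hv' : θ ⟨true⟩ = m := hv _ ⟨⟨⟩, rfl⟩
  refine ⟨θ ⟨false⟩, ?_, hθ.lab_eq _, ?_⟩
  · rw [← hv']; exact hθ.lt_iff.2 ((by decide : (⟨false⟩ : ULift.{u} Bool) < ⟨true⟩))
  · by_cases h : p = ⊤
    · exact Or.inl h
    · right
      rw [← hv']
      exact (hθ.G_iff _ _ _).2 ⟨h, (by decide : (⟨false⟩ : ULift.{u} Bool) < ⟨true⟩), rfl⟩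

/-- Two comparable points of `M` have a third one between them, of any given label in `P`; if the
label is finite, the upper point can be put into the branch with number `0`. -/
theorem Nice.exists_between (hM : Nice P M) {l m : M} (hlm : l < m) {p : ℕ∞} (hp : p ∈ P)
    (h2 : 2 ≤ p) : ∃ z, l < z ∧ z < m ∧ lab z = p ∧ (p = ⊤ ∨ G 0 z m) := by
  obtain ⟨j, hj, hj'⟩ : ∃ j, (lab l ≠ ⊤ → G j l m) ∧ (lab l ≠ ⊤ → (j : ℕ∞) + 1 < lab l) := by
    by_cases h : lab l = ⊤
    · exact ⟨0, fun h' => absurd h h', fun h' => absurd h h'⟩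
    · obtain ⟨j, hj⟩ := G_ex h hlm
      exact ⟨j, fun _ => hj, fun _ => (G_dom hj).2.2⟩
  let L : ULift.{u} (Fin 3) → ℕ∞ := fun x => ![lab l, p, lab m] x.down
  let I : ULift.{u} (Fin 3) → ℕ := fun x => ![j, 0, 0] x.down
  let L' : ULift.{u} Bool → ℕ∞ := fun x => if x.down then lab m else lab l
  let I' : ULift.{u} Bool → ℕ := fun x => if x.down then 0 else j
  let o := chain L I (by
    rintro ⟨x⟩
    fin_cases x
    exacts [two_le_lab l, h2, two_le_lab m]) (by
    rintro ⟨x⟩ h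
    fin_cases x
    exacts [hj' h, zero_add_one_lt h2, zero_add_one_lt (two_le_lab m)])
  let o' := pair.{u} (lab l) (lab m) j (two_le_lab l) (two_le_lab m) hj'
  have e1 : IsEmb fun x : ULift.{u} Bool => if x.down then m else l := by
    refine isEmb_chain ?_ ?_ ?_
    · rintro ⟨_ | _⟩ ⟨_ | _⟩ h <;> first | exact absurd h (by decide) | exact hlm
    · rintro ⟨_ | _⟩ <;> rfl
    · rintro ⟨_ | _⟩ ⟨_ | _⟩ h h' <;> first | exact absurd h (by decide) | exact hj h'
  have e2 : IsEmb fun x : ULift.{u} Bool => (if x.down then ⟨2⟩ else ⟨0⟩ : ULift.{u} (Fin 3)) := by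
    refine isEmb_chain ?_ ?_ ?_
    · rintro ⟨_ | _⟩ ⟨_ | _⟩ h <;> first | exact absurd h (by decide) | exact (by decide : (⟨0⟩ : ULift.{u} (Fin 3)) < ⟨2⟩)
    · rintro ⟨_ | _⟩ <;> rfl
    · rintro ⟨_ | _⟩ ⟨_ | _⟩ h h' <;> first
      | exact absurd h (by decide)
      | exact ⟨h', (by decide : (⟨0⟩ : ULift.{u} (Fin 3)) < ⟨2⟩), rfl⟩
  obtain ⟨θ, hθ, hv⟩ := hM.ext (ULift.{u} (Fin 3)) (by
    rintro ⟨x⟩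
    fin_cases x
    exacts [hM.labIn l, hp, hM.labIn m]) _ (piso_of_isEmb e1 e2 id)
  have hl : θ ⟨0⟩ = l := hv _ ⟨⟨false⟩, rfl⟩
  have hm : θ ⟨2⟩ = m := hv _ ⟨⟨true⟩, rfl⟩
  refine ⟨θ ⟨1⟩, ?_, ?_, hθ.lab_eq _, ?_⟩
  · rw [← hl]; exact hθ.lt_iff.2 (by decide : (⟨0⟩ : ULift.{u} (Fin 3)) < ⟨1⟩)
  · rw [← hm]; exact hθ.lt_iff.2 (by decide : (⟨1⟩ : ULift.{u} (Fin 3)) < ⟨2⟩)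
  · by_cases h : p = ⊤
    · exact Or.inl h
    · right
      rw [← hm]
      exact (hθ.G_iff _ _ _).2 ⟨h, (by decide : (⟨1⟩ : ULift.{u} (Fin 3)) < ⟨2⟩), rfl⟩

end Below
end Dendrite

namespace Dendrite

open OTree

/-! ### Words in two free letters -/

section Words

variable {P : Set ℕ∞} {M : Type u} [OTree M]

theorem OTree.MeetClosed.image {A B : Type u} [OTree A] [OTree B] {S : Set A} (hS : MeetClosed S)
    {φ : A → B} (hφ : IsEmb φ) : MeetClosed (φ '' S) := by
  rintro _ ⟨a, ha, rfl⟩ _ ⟨b, hb, rfl⟩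
  exact ⟨a ⊓ b, hS a ha b hb, hφ.map_inf a b⟩

/-- Between finitely many points below `m` and the point `m` there are infinitely many points of
each label. -/
theorem Nice.exists_gap (hM : Nice P M) {m : M} {L Z : Set M} (hL : L.Finite) (hZ : Z.Finite)
    (hLm : ∀ l ∈ L, l < m) {p : ℕ∞} (hp : p ∈ P) (h2 : 2 ≤ p) :
    ∃ z, z < m ∧ (∀ l ∈ L, l < z) ∧ z ∉ Z ∧ lab z = p ∧ (p = ⊤ ∨ G 0 z m) := by
  have hfin : (insert m {x ∈ Z | x < m ∧ ∀ l ∈ L, l < x}).Finite := (hZ.sep _).insert m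
  obtain ⟨m', hm', hmin⟩ := hfin.exists_minimal (Set.insert_nonempty _ _)
  have hle : ∀ x ∈ insert m {x ∈ Z | x < m ∧ ∀ l ∈ L, l < x}, x ≤ m ∧ ∀ l ∈ L, l < x := by
    rintro x (rfl | hx)
    exacts [⟨le_rfl, hLm⟩, ⟨hx.2.1.le, hx.2.2⟩]
  have hm'm := (hle m' hm').1
  obtain ⟨z, hz, hzL, hl, hG⟩ : ∃ z, z < m' ∧ (∀ l ∈ L, l < z) ∧ lab z = p ∧ (p = ⊤ ∨ G 0 z m') := by
    rcases L.eq_empty_or_nonempty with rfl | hne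
    · obtain ⟨z, h1, h3, h4⟩ := hM.exists_lt m' hp h2
      exact ⟨z, h1, fun _ h => h.elim, h3, h4⟩
    · obtain ⟨l, hl, hmax⟩ := hL.exists_maximal hne
      obtain ⟨z, h0, h1, h3, h4⟩ := hM.exists_between ((hle m' hm').2 l hl) hp h2
      refine ⟨z, h1, fun l' hl' => ?_, h3, h4⟩
      rcases le_total_of_le (hLm l hl).le (hLm l' hl').le with h | h
      · exact (hmax hl' h).trans_lt h0
      · exact h.trans_lt h0
  refine ⟨z, hz.trans_le hm'm, hzL, fun h => ?_, hl, hG.imp_right fun h => G_mono h hm'm⟩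
  exact (hmin (Or.inr ⟨h, hz.trans_le hm'm, hzL⟩) hz.le).not_gt hz

/-- A point `y` outside the finite set `D` can be moved below `d` by an automorphism with
prescribed values on `D`, if these values permit it. -/
theorem Nice.exists_move (hM : Nice P M) {F : Equiv.Perm M} (hF : IsEmb F) {D Z : Set M}
    (hDf : D.Finite) (hD : MeetClosed D) (hZ : Z.Finite) {a b y d : M} (hb : b ∈ D) (hyb : y < b)
    (hba : F b ≤ a) (hy : y ∉ D) (hda : d ≤ a) (hlow : ∀ e ∈ D, e < y → F e < d)
    (hl : lab y = ⊤ ∨ G 0 y b) :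
    ∃ F' : Equiv.Perm M, IsEmb F' ∧ (∀ e ∈ D, F' e = F e) ∧ F' y < d ∧ F' y ∉ Z ∧
      MeetClosed (insert y D) ∧ (lab (F' y) = ⊤ ∨ G 0 (F' y) a) := by
  obtain ⟨e₂, ⟨he₂, hye₂⟩, hmin⟩ := (hDf.sep fun e => y < e).exists_minimal ⟨b, hb, hyb⟩
  have hle₂ : ∀ e ∈ D, y < e → e₂ ≤ e := fun e he hye => by
    have h1 : y < e ⊓ e₂ := lt_of_le_of_ne (le_inf hye.le hye₂.le) fun h => hy (h ▸ hD e he _ he₂)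
    exact (hmin ⟨hD e he _ he₂, h1⟩ inf_le_right).trans inf_le_left
  have hFe₂ : F e₂ ≤ a := (hF.le_iff.2 (hle₂ b hb hyb)).trans hba
  have hm : F e₂ ⊓ d = F e₂ ∨ F e₂ ⊓ d = d := by
    rcases le_total_of_le hFe₂ hda with h | h
    · exact Or.inl (inf_eq_left.2 h)
    · exact Or.inr (inf_eq_right.2 h)
  obtain ⟨z, hzm, hzL, hzZ, hlz, hGz⟩ := hM.exists_gap (m := F e₂ ⊓ d)
    (L := F '' {e ∈ D | e < y}) (Z := Z ∪ F '' D) ((hDf.sep _).image F) (hZ.union (hDf.image F)) (by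
      rintro _ ⟨e, ⟨he, hey⟩, rfl⟩
      rcases hm with h | h <;> rw [h]
      exacts [hF.lt_iff.2 (hey.trans hye₂), hlow e he hey]) (hM.labIn y) (two_le_lab y)
  obtain ⟨g, rfl⟩ := F.surjective z
  have hge₂ : g < e₂ := hF.lt_iff.1 (hzm.trans_le inf_le_left)
  have hgD : g ∉ D := fun h => hzZ (Or.inr ⟨g, h, rfl⟩)
  have hyg : ∀ e ∈ D, e < y ↔ e < g := fun e he => by
    refine ⟨fun h => hF.lt_iff.1 (hzL _ ⟨e, ⟨he, h⟩, rfl⟩), fun h => ?_⟩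
    rcases le_or_lt_of_le (h.trans hge₂).le hye₂.le with h' | h'
    · exact lt_of_le_of_ne h' fun h'' => hy (h'' ▸ he)
    · exact absurd (h.trans hge₂) (hle₂ e he h').not_gt
  obtain ⟨hcl, hiso⟩ := piso_insert_of_lt hD he₂ hye₂ hge₂ hy hgD hyg (fun e he => by
      refine ⟨fun h => hge₂.trans_le (hle₂ e he h), fun h => ?_⟩
      rcases le_or_lt_of_le (inf_le_right : e ⊓ e₂ ≤ e₂) hye₂.le with h' | h'
      · have h3 : e ⊓ e₂ < y := lt_of_le_of_ne h' fun h'' => hy (h'' ▸ hD e he _ he₂)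
        exact absurd ((hyg _ (hD e he _ he₂)).1 h3) (le_inf h.le hge₂.le).not_gt
      · exact h'.trans_le inf_le_left)
    (by rw [← hF.lab_eq g, hlz]) (fun i => by
      rw [G_iff_cases (hl.imp_right (G_iff_of_le hye₂ (hle₂ b hb hyb)).2), G_iff_cases (a := g),
        ← hF.lab_eq g, hlz]
      rw [← hF.lab_eq g, hlz]
      exact hGz.imp_right fun h => (hF.G_iff _ _ _).1 (G_mono h inf_le_left))
  obtain ⟨k, hk, hkv⟩ := hM.hom _ ((hDf.image _).insert _) hiso
  have hky : k y = g := hkv _ (Or.inl rfl)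
  refine ⟨F * k, hF.comp hk, fun e he => congrArg F (hkv _ (Or.inr ⟨e, he, rfl⟩)), ?_⟩
  simp only [Equiv.Perm.mul_apply, hky]
  refine ⟨hzm.trans_le inf_le_right, fun h => hzZ (Or.inl h), hcl, ?_⟩
  rw [hlz]
  exact hGz.imp_right fun h => G_mono h (inf_le_right.trans hda)

/-- Two automorphisms that move points up to `a` satisfy no relation near a point `y` far below
`a`: some word may fix or move `y`, depending on the choice of the automorphisms outside given
finite sets. The word is found by moving `y` past the points of these sets, applying the two
letters in turn so that the position of `y` is not determined by the earlier choices. -/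
theorem Nice.exists_word_of_lt (hM : Nice P M) (n : ℕ) : ∀ (f : Bool → Equiv.Perm M)
    (E : Bool → Set M) (t : Bool) (y a : M), (∀ s, IsEmb (f s)) → (∀ s, (E s).Finite) →
    (∀ s, MeetClosed (E s)) → (∀ s, ∃ b ∈ E s, f s b = a ∧ b < a ∧ y < b) → y ∉ E t →
    y ∉ f t '' E t → (lab y = ⊤ ∨ G 0 y a) →
    {x | (∃ s, x ∈ E s ∪ f s '' E s) ∧ x < y}.ncard = n →
    ∃ w : FreeGroup Bool,
      (∃ h : Bool → Equiv.Perm M, (∀ s, IsEmb (h s)) ∧ (∀ s, ∀ x ∈ E s, h s x = f s x) ∧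
        FreeGroup.lift h w y = y) ∧
      ∃ h : Bool → Equiv.Perm M, (∀ s, IsEmb (h s)) ∧ (∀ s, ∀ x ∈ E s, h s x = f s x) ∧
        FreeGroup.lift h w y ≠ y := by
  induction n using Nat.strong_induction_on with
  | _ n ih =>
  intro f E t y a hf hE hEc hb hy hfy hl hn
  obtain ⟨b, hbE, hfb, hba, hyb⟩ := hb t
  have hya := hyb.trans hba
  have hXf : {x | ∃ s, x ∈ E s ∪ f s '' E s}.Finite := by
    refine (Set.finite_iUnion fun s => (hE s).union ((hE s).image (f s))).subset ?_
    rintro x ⟨s, hs⟩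
    exact Set.mem_iUnion.2 ⟨s, hs⟩
  have hupd : ∀ f' : Equiv.Perm M, IsEmb f' → (∀ x ∈ E t, f' x = f t x) →
      (∀ s, IsEmb (Function.update f t f' s)) ∧
        ∀ s, ∀ x ∈ E s, Function.update f t f' s x = f s x := by
    intro f' hf' hag
    constructor <;> intro s <;> by_cases hs : s = t
    · subst hs; simpa using hf'
    · simpa [hs] using hf s
    · subst hs; simpa using hag
    · simp [hs]
  by_cases hA : ∀ e ∈ E t, e < y ↔ f t e < y
  · -- nothing prevents the letter `t` from fixing `y`
    refine ⟨FreeGroup.of t, ?_, ?_⟩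
    · obtain ⟨g, hg⟩ := (f t).surjective y
      have hgb : g < b := (hf t).lt_iff.1 (by rwa [hg, hfb])
      have hgE : g ∉ E t := fun h => hfy ⟨g, h, hg⟩
      have h1 : ∀ e ∈ E t, e < y ↔ e < g := fun e he => by
        rw [hA e he, ← (hf t).lt_iff (a := e), hg]
      have h2 : ∀ z, z < b → z ∉ E t → ∀ e ∈ E t, z < e ↔ ¬ e ⊓ b < z := by
        intro z hzb hz e he
        constructor
        · exact fun h h' => (le_inf h.le hzb.le).not_gt h'
        · intro h
          rcases le_or_lt_of_le (inf_le_right : e ⊓ b ≤ b) hzb.le with h' | h'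
          · exact absurd (lt_of_le_of_ne h' fun h'' => hz (h'' ▸ hEc t e he b hbE)) h
          · exact h'.trans_le inf_le_left
      obtain ⟨-, hiso⟩ := piso_insert_of_lt (hEc t) hbE hyb hgb hy hgE h1
        (fun e he => by rw [h2 y hyb hy e he, h2 g hgb hgE e he, h1 _ (hEc t e he b hbE)])
        (by rw [← (hf t).lab_eq g, hg]) (fun i => by
          rw [← (hf t).G_iff i g b, hg, hfb, G_iff_of_le hyb hba.le])
      obtain ⟨k, hk, hkv⟩ := hM.hom _ (((hE t).image _).insert _) hiso
      obtain ⟨u1, u2⟩ := hupd (f t * k) ((hf t).comp hk)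
        fun x hx => congrArg (f t) (hkv _ (Or.inr ⟨x, hx, rfl⟩))
      refine ⟨_, u1, u2, ?_⟩
      simp only [FreeGroup.lift_apply_of, Function.update_self, Equiv.Perm.mul_apply]
      rw [show k y = g from hkv _ (Or.inl rfl), hg]
    · obtain ⟨f', hf', hag, hlt, -⟩ := hM.exists_move (hf t) (hE t) (hEc t) Set.finite_empty hbE hyb
        hfb.le hy hya.le (fun e he h => (hA e he).1 h) (hl.imp_right (G_iff_of_le hyb hba.le).2)
      obtain ⟨u1, u2⟩ := hupd f' hf' hag
      refine ⟨_, u1, u2, ?_⟩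
      simp only [FreeGroup.lift_apply_of, Function.update_self]
      exact hlt.ne
  -- `y` can be moved below some `d`, by the letter `t` or its inverse `c`
  have cont : ∀ (f' : Equiv.Perm M) (x y' d : M) (c : FreeGroup Bool), IsEmb f' →
      (∀ e ∈ E t, f' e = f t e) → MeetClosed (insert x (E t)) → y' < d → d < y →
      (∃ s, d ∈ E s ∪ f s '' E s) → (¬ ∃ s, y' ∈ E s ∪ f s '' E s) → (lab y' = ⊤ ∨ G 0 y' a) →
      (x = y ∧ f' x = y' ∨ x = y' ∧ f' x = y) →
      (∀ h : Bool → Equiv.Perm M, h t x = f' x → FreeGroup.lift h c y = y') →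
      ∃ w : FreeGroup Bool,
        (∃ h : Bool → Equiv.Perm M, (∀ s, IsEmb (h s)) ∧ (∀ s, ∀ x ∈ E s, h s x = f s x) ∧
          FreeGroup.lift h w y = y) ∧
        ∃ h : Bool → Equiv.Perm M, (∀ s, IsEmb (h s)) ∧ (∀ s, ∀ x ∈ E s, h s x = f s x) ∧
          FreeGroup.lift h w y ≠ y := by
    intro f' x y' d c hf' hag hcl hyd hdy hdX hyX hl' hx hc
    obtain ⟨u1, u2⟩ := hupd f' hf' hag
    have ht : (!t) ≠ t := by cases t <;> decide
    have hsub : ∀ z, (∃ s, z ∈ Function.update E t (insert x (E t)) s ∪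
        Function.update f t f' s '' Function.update E t (insert x (E t)) s) → z < y' →
        ∃ s, z ∈ E s ∪ f s '' E s := by
      rintro z ⟨s, hz⟩ hzy
      have hne : z ≠ x ∧ z ≠ f' x := by
        constructor <;> rintro rfl <;> rcases hx with ⟨h1, h2⟩ | ⟨h1, h2⟩
        · exact lt_asymm hzy (h1 ▸ hyd.trans hdy)
        · exact lt_irrefl _ (h1 ▸ hzy)
        · exact lt_irrefl _ (h2 ▸ hzy)
        · exact lt_asymm hzy (h2 ▸ hyd.trans hdy)
      by_cases hs : s = t
      · subst hs
        simp only [Function.update_self] at hz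
        rcases hz with (rfl | hz) | ⟨v, rfl | hv, rfl⟩
        · exact absurd rfl hne.1
        · exact ⟨s, Or.inl hz⟩
        · exact absurd rfl hne.2
        · exact ⟨s, Or.inr ⟨v, hv, (hag v hv).symm⟩⟩
      · simp only [Function.update_of_ne hs] at hz
        exact ⟨s, hz⟩
    have hcard : {z | (∃ s, z ∈ Function.update E t (insert x (E t)) s ∪
        Function.update f t f' s '' Function.update E t (insert x (E t)) s) ∧ z < y'}.ncard < n := by
      rw [← hn]
      refine Set.ncard_lt_ncard ⟨fun z hz => ⟨hsub z hz.1 hz.2, hz.2.trans (hyd.trans hdy)⟩,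
        fun h => ?_⟩ (hXf.subset fun z hz => hz.1)
      exact lt_asymm hyd (h ⟨hdX, hdy⟩).2
    obtain ⟨w, ⟨h₁, g1, g2, g3⟩, h₂, g4, g5, g6⟩ := ih _ hcard (Function.update f t f')
      (Function.update E t (insert x (E t))) (!t) y' a u1 (fun s => by
        by_cases hs : s = t
        · subst hs; simpa using (hE s).insert x
        · simpa [hs] using hE s) (fun s => by
        by_cases hs : s = t
        · subst hs; simpa using hcl
        · simpa [hs] using hEc s) (fun s => by
        obtain ⟨b', hb', e1, e2, e3⟩ := hb s
        refine ⟨b', ?_, (u2 s b' hb').trans e1, e2, (hyd.trans hdy).trans e3⟩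
        by_cases hs : s = t
        · subst hs; simpa using Or.inr hb'
        · simpa [hs] using hb')
      (by
        rw [Function.update_of_ne ht]
        exact fun h => hyX ⟨_, Or.inl h⟩)
      (by
        rw [Function.update_of_ne ht, Function.update_of_ne ht]
        exact fun h => hyX ⟨_, Or.inr h⟩) hl' rfl
    have hEsub : ∀ s, E s ⊆ Function.update E t (insert x (E t)) s := fun s => by
      by_cases hs : s = t
      · subst hs; simp
      · simp [hs]
    have hw : ∀ h : Bool → Equiv.Perm M,
        (∀ s, ∀ z ∈ Function.update E t (insert x (E t)) s, h s z = Function.update f t f' s z) →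
        (FreeGroup.lift h (c⁻¹ * w * c) y = y ↔ FreeGroup.lift h w y' = y') := by
      intro h hh
      have hcy := hc h (by simpa using hh t x (by simp))
      rw [map_mul, map_mul, map_inv, Equiv.Perm.mul_apply, Equiv.Perm.mul_apply, hcy,
        Equiv.Perm.inv_eq_iff_eq, hcy]
    exact ⟨c⁻¹ * w * c, ⟨h₁, g1, fun s z hz => (g2 s z (hEsub s hz)).trans (u2 s z hz),
      (hw h₁ g2).2 g3⟩, h₂, g4, fun s z hz => (g5 s z (hEsub s hz)).trans (u2 s z hz),
      fun h => g6 ((hw h₂ g5).1 h)⟩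
  push Not at hA
  obtain ⟨e, he, ⟨hey, hfe⟩ | ⟨hey, hfe⟩⟩ := hA
  · -- `f t` moves `e < y` above `y`, so its inverse moves `y` below `e`
    have heb := hey.trans hyb
    have hyfe : y < f t e := by
      have h1 : f t e ≤ a := hfb ▸ ((hf t).lt_iff.2 heb).le
      rcases le_or_lt_of_le h1 hya.le with h | h
      · exact absurd (lt_of_le_of_ne h fun h => hfy ⟨e, he, h⟩) hfe
      · exact h
    obtain ⟨F, hF, hag, hlt, hX, hcl, hl'⟩ := hM.exists_move (F := (f t)⁻¹) (a := a) (d := e)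
      (hf t).symm ((hE t).image _) ((hEc t).image (hf t)) hXf ⟨b, hbE, hfb⟩ hya
      ((Equiv.Perm.inv_eq_iff_eq.2 hfb.symm).le.trans hba.le) hfy (hey.trans hya).le (by
        rintro _ ⟨e', he', rfl⟩ h
        simpa using (hf t).lt_iff.1 (h.trans hyfe)) hl
    have hag' : ∀ x ∈ E t, F (f t x) = x := fun x hx => by simpa using hag _ ⟨x, hx, rfl⟩
    refine cont F⁻¹ (F y) (F y) e (FreeGroup.of t)⁻¹ hF.symm (fun x hx => ?_) ?_ hlt hey
      ⟨t, Or.inl he⟩ hX hl' (Or.inr ⟨rfl, by simp⟩) fun h hh => ?_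
    · rw [Equiv.Perm.inv_eq_iff_eq, hag' x hx]
    · have := hcl.image hF
      rw [Set.image_insert_eq, Set.image_image] at this
      rwa [Set.image_congr hag', Set.image_id'] at this
    · rw [map_inv, FreeGroup.lift_apply_of, Equiv.Perm.inv_eq_iff_eq, hh]; simp
  · -- `f t` moves `e > y` below `y`, and thus `y` below `f t e`
    have heb : e < b := (hf t).lt_iff.1 (by rw [hfb]; exact hfe.trans hya)
    have hye : y < e := by
      rcases le_or_lt_of_le heb.le hyb.le with h | h
      · exact absurd (lt_of_le_of_ne h fun h => hy (h ▸ he)) hey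
      · exact h
    obtain ⟨F, hF, hag, hlt, hX, hcl, hl'⟩ := hM.exists_move (a := a) (d := f t e) (hf t) (hE t)
      (hEc t) hXf hbE hyb hfb.le hy (hfe.trans hya).le
      (fun e' _ h => (hf t).lt_iff.2 (h.trans hye)) (hl.imp_right (G_iff_of_le hyb hba.le).2)
    refine cont F y (F y) (f t e) (FreeGroup.of t) hF hag hcl hlt hfe ⟨t, Or.inr ⟨e, he, rfl⟩⟩ hX hl'
      (Or.inl ⟨rfl, rfl⟩) fun h hh => ?_
    rw [FreeGroup.lift_apply_of, hh]

/-- Two automorphisms that move `a₀` up to `a` satisfy no relation at `a`: some word may fix or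
move `a`, depending on the choice of the automorphisms outside given finite sets. -/
theorem Nice.exists_word (hM : Nice P M) {f : Bool → Equiv.Perm M} (hf : ∀ s, IsEmb (f s))
    {E : Bool → Set M} (hE : ∀ s, (E s).Finite) {a₀ a : M} (hlt : a₀ < a) (hfa : ∀ s, f s a₀ = a)
    (hl : lab a₀ = ⊤ ∨ G 0 a₀ a) :
    ∃ w : FreeGroup Bool,
      (∃ h : Bool → Equiv.Perm M, (∀ s, IsEmb (h s)) ∧ (∀ s, ∀ x ∈ E s, h s x = f s x) ∧
        FreeGroup.lift h w a = a) ∧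
      ∃ h : Bool → Equiv.Perm M, (∀ s, IsEmb (h s)) ∧ (∀ s, ∀ x ∈ E s, h s x = f s x) ∧
        FreeGroup.lift h w a ≠ a := by
  let v : ℕ → M := fun k => ((f false)⁻¹ ^ k) a
  have hv : ∀ k, f false (v (k + 1)) = v k := fun k => by
    change f false (((f false)⁻¹ ^ (k + 1)) a) = _
    rw [pow_succ', Equiv.Perm.mul_apply]
    exact (f false).apply_symm_apply _
  have hv1 : v 1 = a₀ := (f false).injective (by rw [hv, hfa]; rfl)
  have hstep : ∀ k, v (k + 1) < v k := fun k => by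
    induction k with
    | zero => rw [zero_add, hv1]; exact hlt
    | succ k ih => rwa [← (hf false).lt_iff, hv, hv]
  have hanti : StrictAnti v := strictAnti_nat_of_succ_lt hstep
  have hlv : ∀ k, lab (v (k + 1)) = ⊤ ∨ G 0 (v (k + 1)) a := fun k => by
    have : lab (v (k + 1)) = ⊤ ∨ G 0 (v (k + 1)) (v k) := by
      induction k with
      | zero => rw [zero_add, hv1]; exact hl
      | succ k ih => rwa [← (hf false).lab_eq, ← (hf false).G_iff 0, hv, hv]
    exact this.imp_right fun h => G_mono h (hanti.antitone (Nat.zero_le k))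
  let X := clos (insert a₀ (E true))
  have hX : X.Finite := finite_clos ((hE true).insert _)
  obtain ⟨_, ⟨k, rfl⟩, hk⟩ := (Set.infinite_range_of_injective (f := fun k => v (k + 2))
    (hanti.injective.comp (add_left_injective 2))).exists_notMem_finite (hX.union (hX.image (f true)))
  -- the orbit of `a` under the first letter is fixed down to `v (k + 2)`; the second one is free there
  let E' : Bool → Set M := fun s => cond s X (clos (E false ∪ v '' Set.Iic (k + 2)))
  have hEE' : ∀ s, E s ⊆ E' s := by
    rintro (_ | _) x hx
    exacts [subset_clos _ (Or.inl hx), subset_clos _ (Or.inr hx)]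
  obtain ⟨w, ⟨h₁, g1, g2, g3⟩, h₂, g4, g5, g6⟩ := hM.exists_word_of_lt _ f E' true (v (k + 2)) a hf
    (by
      rintro (_ | _)
      exacts [finite_clos ((hE false).union ((Set.finite_Iic _).image _)), hX])
    (by rintro (_ | _) <;> exact clos_meetClosed _)
    (fun s => ⟨a₀, by
      cases s
      · exact subset_clos _ (Or.inr ⟨1, by simp, hv1⟩)
      · exact subset_clos _ (Or.inl rfl), hfa s, hlt, hv1 ▸ hanti (by lia)⟩)
    (fun h => hk (Or.inl h)) (fun h => hk (Or.inr h)) (hlv _) rfl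
  let c : FreeGroup Bool := (FreeGroup.of false)⁻¹ ^ (k + 2)
  have hw : ∀ h : Bool → Equiv.Perm M, (∀ s, ∀ x ∈ E' s, h s x = f s x) →
      (FreeGroup.lift h (c⁻¹ * w * c) a = a ↔ FreeGroup.lift h w (v (k + 2)) = v (k + 2)) := by
    intro h hh
    have hc : ∀ m ≤ k + 2, ((h false)⁻¹ ^ m) a = v m := by
      intro m
      induction m with
      | zero => intro _; rfl
      | succ m ihm =>
        intro hm
        rw [pow_succ', Equiv.Perm.mul_apply, ihm (by lia), Equiv.Perm.inv_eq_iff_eq,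
          hh false _ (subset_clos _ (Or.inr ⟨m + 1, hm, rfl⟩)), hv]
    have hcy : FreeGroup.lift h c a = v (k + 2) := by
      rw [map_pow, map_inv, FreeGroup.lift_apply_of, hc _ le_rfl]
    rw [map_mul, map_mul, map_inv, Equiv.Perm.mul_apply, Equiv.Perm.mul_apply, hcy,
      Equiv.Perm.inv_eq_iff_eq, hcy]
  exact ⟨c⁻¹ * w * c, ⟨h₁, g1, fun s x hx => g2 s x (hEE' s hx), (hw h₁ g2).2 g3⟩, h₂, g4,
    fun s x hx => g5 s x (hEE' s hx), fun h => g6 ((hw h₂ g5).1 h)⟩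

end Words
end Dendrite

namespace Dendrite

open OTree

/-! ### Failure of weak amalgamation for pairs -/

section Pairs

variable {P : Set ℕ∞} {n : ℕ} {M : Type u} [OTree M]

theorem OTree.piso_singleton {A B : Type u} [OTree A] [OTree B] {a : A} {b : B}
    (h : lab a = lab b) : PIso {(a, b)} := by
  rintro _ rfl _ rfl _ rfl _ rfl
  simp only [inf_idem]
  exact ⟨iff_of_true le_rfl le_rfl, iff_of_false (prec_irrefl a) (prec_irrefl b), h,
    fun i => iff_of_false (fun h => lt_irrefl _ (G_dom h).2.1) fun h => lt_irrefl _ (G_dom h).2.1⟩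

/-- The value of a word at a point depends on finitely many values of the letters only. -/
theorem exists_finite_lift {X : Type u} (h : Bool → Equiv.Perm X) (w : FreeGroup Bool) : ∀ x : X,
    ∃ Q : Set X, Q.Finite ∧ ∀ (k : Bool → Equiv.Perm X) (η : X → X),
      (∀ s, ∀ z ∈ Q, k s (η z) = η (h s z)) →
        FreeGroup.lift k w (η x) = η (FreeGroup.lift h w x) := by
  induction w using FreeGroup.induction_on with
  | C1 => exact fun x => ⟨∅, Set.finite_empty, fun k η _ => rfl⟩
  | of s =>
    intro x
    refine ⟨{x}, Set.finite_singleton x, fun k η hk => ?_⟩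
    rw [FreeGroup.lift_apply_of, FreeGroup.lift_apply_of]
    exact hk s x rfl
  | inv_of s _ =>
    intro x
    refine ⟨{(h s)⁻¹ x}, Set.finite_singleton _, fun k η hk => ?_⟩
    rw [map_inv, map_inv, FreeGroup.lift_apply_of, FreeGroup.lift_apply_of,
      Equiv.Perm.inv_eq_iff_eq, hk s _ rfl]
    exact congrArg η ((h s).apply_symm_apply x).symm
  | mul v w hv hw =>
    intro x
    obtain ⟨Q, hQ, hQ'⟩ := hw x
    obtain ⟨R, hR, hR'⟩ := hv (FreeGroup.lift h w x)
    refine ⟨Q ∪ R, hQ.union hR, fun k η hk => ?_⟩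
    rw [map_mul, map_mul, Equiv.Perm.mul_apply, Equiv.Perm.mul_apply,
      hQ' k η fun s z hz => hk s z (Or.inl hz), hR' k η fun s z hz => hk s z (Or.inr hz)]

/-- Automorphisms of `M` that extend the maps of `A` yield extensions of `A` whose maps are defined
at any given finite set. -/
theorem Nice.exists_extension (hM : Nice P M) (hP : ∀ p ∈ P, 2 ≤ p) (hne : P.Nonempty)
    {A : PartialAuts.{u} P n} [OTree A.carrier] [Finite A.carrier] (hA : Compat P A.carrier)
    {θ : A.carrier → M} (hθ : IsEmb θ) {h : Fin n → Equiv.Perm M} (hh : ∀ i, IsEmb (h i))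
    (hg : ∀ i, ∀ p ∈ A.graph i, h i (θ p.1) = θ p.2) {Q : Set M} (hQ : Q.Finite) :
    ∃ (B : PartialAuts.{u} P n) (_ : OTree B.carrier) (φ : A.Emb B) (ε : B.carrier → M),
      IsEmb ε ∧ Compat P B.carrier ∧ (∀ a, ε (φ.toEmb a) = θ a) ∧
      (∀ x ∈ Q, ∃ s, ε s = x) ∧ ∀ i, ∀ x ∈ Q, ∃ p ∈ B.graph i, ε p.1 = x ∧ ε p.2 = h i x := by
  obtain ⟨B, oB, ε, hB, hε, -, hsurj, hBg⟩ := hM.exists_partialAuts hP hne hh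
    ((hQ.union (Set.finite_range θ)).union (Set.finite_iUnion fun i => hQ.image (h i)))
    (fun _ => Q ∪ Set.range θ)
  choose κ hκ using fun a => hsurj (θ a) (Or.inl (Or.inr ⟨a, rfl⟩))
  obtain ⟨φ, hφ⟩ := PartialAuts.exists_emb hA hB (φ := κ)
    (hε.of_comp ((funext hκ : ε ∘ κ = θ) ▸ hθ)) fun i p hp => by
      refine hBg i _ _ (by rw [hκ]; exact Or.inr ⟨_, rfl⟩) ?_
      rw [hκ, hκ, hg i p hp]
  refine ⟨B, oB, φ, ε, hε, hB, fun a => by rw [hφ, hκ],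
    fun x hx => hsurj x (Or.inl (Or.inl hx)), fun i x hx => ?_⟩
  obtain ⟨s, rfl⟩ := hsurj x (Or.inl (Or.inl hx))
  obtain ⟨s', hs'⟩ := hsurj (h i (ε s)) (Or.inr (Set.mem_iUnion.2 ⟨i, _, hx, rfl⟩))
  exact ⟨(s, s'), hBg i _ _ (Or.inl hx) hs', rfl, hs'⟩

/-- There are two points, one below the other, that look the same. -/
theorem Nice.exists_pair (hM : Nice P M) (a : M) :
    ∃ a₀, a₀ < a ∧ lab a₀ = lab a ∧ (lab a₀ = ⊤ ∨ G 0 a₀ a) ∧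
      ∃ f : Equiv.Perm M, IsEmb f ∧ f a₀ = a := by
  obtain ⟨a₀, h1, h2, h3⟩ := hM.exists_lt a (hM.labIn a) (two_le_lab a)
  obtain ⟨f, hf, hfa⟩ := hM.hom _ (Set.finite_singleton _) (piso_singleton h2)
  exact ⟨a₀, h1, h2, by rwa [h2], f, hf, hfa _ rfl⟩

/-- If both letters move `a₀` up to `a`, then no extension decides all words at `a`. -/
theorem not_hasWAP_two (hP : ∀ p ∈ P, 2 ≤ p) (hne : P.Nonempty) : ¬ HasWAP.{u} P 2 := by
  intro hW
  obtain ⟨M, _, hM⟩ := exists_nice.{u} P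
  have := hM.nonempty hP hne
  obtain ⟨a₀, hlt, -, hl, f, hf, hfa⟩ := hM.exists_pair (Classical.arbitrary M)
  obtain ⟨A, oA, ε, hA, hε, -, hsurj, hAg⟩ := hM.exists_partialAuts hP hne (n := 2)
    (f := fun _ => f) (fun _ => hf) (Set.toFinite {a₀, Classical.arbitrary M}) fun _ => {a₀}
  have lA : LabIn P A.carrier := fun a => by rw [← hε.lab_eq]; exact hM.labIn _
  obtain ⟨b₀, hb₀⟩ := hsurj a₀ (Or.inl rfl)
  obtain ⟨b, hb⟩ := hsurj _ (Or.inr rfl)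
  have hgr : ∀ i, (b₀, b) ∈ A.graph i := fun i => hAg i _ _ hb₀ (by rw [hb, hb₀, hfa])
  obtain ⟨A', τ, hτ⟩ := hW A
  obtain ⟨_, oA', L', C', G'⟩ := A'.exists_otree hP
  have eτ := isEmb_of_embedding hA C' lA L' τ.toEmb
  obtain ⟨θ, F, hθ, -, hF, hFg⟩ := hM.exists_auts A' L' G' (Γ := ∅) fun _ h => h.elim
  let c₀ := θ (τ.toEmb b₀)
  let c := θ (τ.toEmb b)
  have hθτ : IsEmb fun x => θ (τ.toEmb x) := hθ.comp eτ
  have hc : c₀ < c := hθτ.lt_iff.2 (hε.lt_iff.1 (by rwa [hb, hb₀]))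
  have hlc : lab c₀ = ⊤ ∨ G 0 c₀ c := by
    rw [hθτ.lab_eq, hθτ.G_iff, ← hε.lab_eq, ← hε.G_iff, hb₀, hb]
    exact hl
  obtain ⟨w, ⟨h₁, g1, g2, g3⟩, h₂, g4, g5, g6⟩ := hM.exists_word
    (f := fun s => F (finTwoEquiv.symm s)) (fun s => hF _) (E := fun _ => Set.range θ)
    (fun _ => Set.finite_range θ) hc (fun s => hFg _ _ (τ.graph_mem (hgr _))) hlc
  -- both possibilities occur in extensions of `A'`, by finite parts of the orbit of `c`
  have key : ∀ h : Bool → Equiv.Perm M, (∀ s, IsEmb (h s)) →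
      (∀ s, ∀ x ∈ Set.range θ, h s x = F (finTwoEquiv.symm s) x) →
      ∃ (B : PartialAuts.{u} P 2) (φ : A'.Emb B), ∀ (C : PartialAuts.{u} P 2) (ψ : B.Emb C)
        (χ : C.carrier → M) (K : Fin 2 → Equiv.Perm M), Function.Injective χ →
        (∀ i, ∀ p ∈ C.graph i, K i (χ p.1) = χ p.2) →
        (FreeGroup.lift (fun s => K (finTwoEquiv.symm s)) w (χ (ψ.toEmb (φ.toEmb (τ.toEmb b)))) =
          χ (ψ.toEmb (φ.toEmb (τ.toEmb b))) ↔ FreeGroup.lift h w c = c) := by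
    intro h hh hag
    obtain ⟨Q, hQ, hQw⟩ := exists_finite_lift h w c
    obtain ⟨B, oB, φ, δ, hδ, -, hφ, hQs, hQg⟩ := hM.exists_extension hP hne C' hθ
      (h := fun i => h (finTwoEquiv i)) (fun i => hh _) (fun i p hp => by
        rw [hag _ _ ⟨_, rfl⟩, Equiv.symm_apply_apply]; exact hFg i p hp)
      (hQ.insert (FreeGroup.lift h w c))
    refine ⟨B, φ, fun C ψ χ K hχ hK => ?_⟩
    have hη : ∀ s, Function.extend δ (fun s => χ (ψ.toEmb s)) id (δ s) = χ (ψ.toEmb s) :=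
      fun s => hδ.injective.extend_apply _ _ s
    have hw := hQw (fun s => K (finTwoEquiv.symm s)) (Function.extend δ (fun s => χ (ψ.toEmb s)) id)
      fun s z hz => by
        obtain ⟨p, hp, hp1, hp2⟩ := hQg (finTwoEquiv.symm s) z (Or.inr hz)
        rw [Equiv.apply_symm_apply] at hp2
        rw [← hp1, hη, hp1, ← hp2, hη]
        exact hK _ _ (ψ.graph_mem hp)
    obtain ⟨r, hr⟩ := hQs _ (Or.inl rfl)
    have hcφ : c = δ (φ.toEmb (τ.toEmb b)) := (hφ _).symm
    rw [← hr, hη, hcφ, hη] at hw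
    rw [hw, hχ.eq_iff, ψ.toEmb.injective.eq_iff, ← hδ.injective.eq_iff, hr, ← hcφ]
  obtain ⟨B₁, φ₁, k₁⟩ := key h₁ g1 g2
  obtain ⟨B₂, φ₂, k₂⟩ := key h₂ g4 g5
  obtain ⟨C, ψ₁, ψ₂, hψ⟩ := hτ B₁ B₂ φ₁ φ₂
  obtain ⟨_, oC, LC, -, GC⟩ := C.exists_otree hP
  obtain ⟨χ, K, hχ, -, -, hK⟩ := hM.exists_auts C LC GC (Γ := ∅) fun _ h => h.elim
  have e₁ := (k₁ C ψ₁ χ K hχ.injective hK).2 g3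
  rw [hψ] at e₁
  exact g6 ((k₂ C ψ₂ χ K hχ.injective hK).1 e₁)

end Pairs
end Dendrite

namespace Dendrite

open OTree

/-! ### Generic automorphisms are conjugate -/

section Generic

variable {P : Set ℕ∞} {M : Type u} [OTree M]

theorem OTree.Isolated.conj {f g : Equiv.Perm M} {S : Set M} (h : Isolated f S) (hg : IsEmb g) :
    Isolated (g * f * g⁻¹) (g '' S) := by
  intro f' hf' hag
  have h1 := h (g⁻¹ * f' * g) ((hg.symm.comp hf').comp hg) fun x hx => by
    have := hag _ ⟨x, hx, rfl⟩
    simp only [Equiv.Perm.mul_apply] at this ⊢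
    rw [this, Equiv.Perm.inv_eq_iff_eq]
    congr 2
    exact g.symm_apply_apply x
  have h2 : SameType (fun p : ℤ × S => g ((f ^ p.1) p.2.1))
      fun p : ℤ × S => g (((g⁻¹ * f' * g) ^ p.1) p.2.1) :=
    ((SameType.of_isEmb hg IsEmb.id fun p : ℤ × S => (f ^ p.1) p.2.1).trans h1).trans
      (SameType.of_isEmb IsEmb.id hg _)
  refine h2.of_forall ?_
  rintro ⟨i, _, x, hx, rfl⟩
  refine ⟨(i, ⟨x, hx⟩), ?_, ?_⟩
  · simp only [conj_zpow, Equiv.Perm.mul_apply]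
    congr 2
    exact (g.symm_apply_apply x).symm
  · have : (g⁻¹ * f' * g) ^ i = g⁻¹ * f' ^ i * g := by
      simpa using (conj_zpow (i := i) (a := g⁻¹) (b := f'))
    simp only [this, Equiv.Perm.mul_apply]
    exact g.apply_symm_apply _

/-- The automorphism `f` is isolated over some finite set containing `S`. -/
def IsolatedAbove (S : Set M) (f : Equiv.Perm M) : Prop := ∃ T, T.Finite ∧ S ⊆ T ∧ Isolated f T

/-- If `f` agrees with `h` on `S`, then the restriction of `h` to `T` is realised in `f`
over `S`. -/
def Realizes (S T : Set M) (h f : Equiv.Perm M) : Prop :=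
  (∀ x ∈ S, f x = h x) → ∃ g : Equiv.Perm M, IsEmb g ∧ (∀ x ∈ S, g x = x) ∧
    ∀ x ∈ T, f (g x) = g (h x)

/-- An automorphism that is isolated over arbitrarily large finite sets, and realises all finite
extensions of its isolated restrictions. -/
structure IsGeneric (f : Equiv.Perm M) : Prop where
  isEmb : IsEmb f
  isolatedAbove : ∀ S : Set M, S.Finite → IsolatedAbove S f
  realizes : ∀ (S T : Set M) (h : Equiv.Perm M), T.Finite → S ⊆ T → IsEmb h → Isolated h S →
    Realizes S T h f

/-- The restriction of the automorphism `g` to `S` transports the isolated restriction of `f` to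
`S` into `f'`. -/
structure ConjOn (f f' : Equiv.Perm M) (S : Set M) (g : Equiv.Perm M) : Prop where
  isEmb : IsEmb g
  finite : S.Finite
  isolated : Isolated f S
  comm : ∀ x ∈ S, f' (g x) = g (f x)

namespace ConjOn

variable {f f' g : Equiv.Perm M} {S : Set M}

theorem agree (h : ConjOn f f' S g) : ∀ y ∈ g '' S, f' y = (g * f * g⁻¹) y := by
  rintro _ ⟨x, hx, rfl⟩
  rw [h.comm x hx]
  exact congrArg (fun z => g (f z)) (g.symm_apply_apply x).symm

theorem symm (h : ConjOn f f' S g) (hf' : IsEmb f') : ConjOn f' f (g '' S) g⁻¹ where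
  isEmb := h.isEmb.symm
  finite := h.finite.image g
  isolated := (h.isolated.conj h.isEmb).congr hf' h.agree
  comm := by
    rintro _ ⟨x, hx, rfl⟩
    rw [h.comm x hx]
    exact (congrArg f (g.symm_apply_apply x)).trans (g.symm_apply_apply _).symm

theorem forth (h : ConjOn f f' S g) (hf : IsGeneric f) (hf' : IsGeneric f') (x : M) :
    ∃ T g', ConjOn f f' T g' ∧ x ∈ T ∧ S ⊆ T ∧ ∀ y ∈ S, g' y = g y := by
  obtain ⟨T, hT, hST, hiso⟩ := hf.isolatedAbove (insert x S) (h.finite.insert x)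
  obtain ⟨q, hq, hqS, hqT⟩ := hf'.realizes (g '' S) (g '' T) (g * f * g⁻¹) (hT.image g)
    (Set.image_mono ((Set.subset_insert _ _).trans hST))
    ((h.isEmb.comp hf.isEmb).comp h.isEmb.symm) (h.isolated.conj h.isEmb) h.agree
  refine ⟨T, q * g, ⟨hq.comp h.isEmb, hT, hiso, fun y hy => ?_⟩, hST (Or.inl rfl),
    (Set.subset_insert _ _).trans hST, fun y hy => hqS _ ⟨y, hy, rfl⟩⟩
  refine (hqT _ ⟨y, hy, rfl⟩).trans ?_
  exact congrArg (fun z => q (g (f z))) (g.symm_apply_apply y)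

end ConjOn

/-- Any two generic automorphisms are conjugate, by back-and-forth. -/
theorem IsGeneric.exists_conj [Countable M] {f f' : Equiv.Perm M} (hf : IsGeneric f)
    (hf' : IsGeneric f') : ∃ g : Equiv.Perm M, IsEmb g ∧ f' = g * f * g⁻¹ := by
  let gr : Set M → Equiv.Perm M → Set (M × M) := fun S g => (fun x => (x, g x)) '' S
  let 𝓑 : Set (Set (M × M)) := {Γ | ∃ S g, ConjOn f f' S g ∧ Γ = gr S g}
  obtain ⟨G, -, hG⟩ := back_and_forth 𝓑 (by
      rintro _ ⟨S, g, h, rfl⟩ _ ⟨x, hx, rfl⟩ _ ⟨y, hy, rfl⟩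
      exact g.injective.eq_iff.symm) (by
      rintro _ ⟨S, g, h, rfl⟩ x
      obtain ⟨T, g', h', hx, hST, hg⟩ := h.forth hf hf' x
      refine ⟨_, ⟨T, g', h', rfl⟩, ?_, g' x, x, hx, rfl⟩
      rintro _ ⟨y, hy, rfl⟩
      exact ⟨y, hST hy, Prod.ext rfl (hg y hy)⟩) (by
      rintro _ ⟨S, g, h, rfl⟩ y
      obtain ⟨T, g', h', hy, hST, hg⟩ := (h.symm hf'.isEmb).forth hf' hf y
      refine ⟨_, ⟨_, _, h'.symm hf.isEmb, rfl⟩, ?_, g' y, g' y, ⟨y, hy, rfl⟩,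
        Prod.ext rfl (g'.symm_apply_apply y)⟩
      rintro _ ⟨x, hx, rfl⟩
      have e : g' (g x) = x := (hg _ ⟨x, hx, rfl⟩).trans (g.symm_apply_apply x)
      refine ⟨x, ⟨g x, hST ⟨x, hx, rfl⟩, e⟩, Prod.ext rfl ?_⟩
      exact g'.symm_apply_eq.2 e.symm)
    (Γ₀ := ∅) ⟨∅, 1, ⟨IsEmb.id, Set.finite_empty, fun _ _ _ => by
      rintro _ ⟨⟨_, _, h⟩, _⟩
      exact h.elim, fun _ h => h.elim⟩, (Set.image_empty _).symm⟩
  have key : ∀ F : Set M, F.Finite → ∃ g : Equiv.Perm M, IsEmb g ∧ ∀ x ∈ F, G x = g x ∧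
      f' (g x) = g (f x) := by
    intro F hF
    obtain ⟨_, ⟨S, g, h, rfl⟩, -, hS⟩ := hG F hF
    refine ⟨g, h.isEmb, fun x hx => ?_⟩
    obtain ⟨y, hy, hyx⟩ := hS x hx
    obtain ⟨rfl, h2⟩ := Prod.ext_iff.1 hyx
    exact ⟨h2.symm, h.comm _ hy⟩
  refine ⟨G, ⟨fun a b => ?_, fun a b => ?_, fun a => ?_, fun i a b => ?_⟩, Equiv.ext fun x => ?_⟩
  · obtain ⟨g, hg, h⟩ := key {a, b, a ⊓ b} (Set.toFinite _)
    rw [(h a (by simp)).1, (h b (by simp)).1, (h _ (by simp)).1, hg.map_inf]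
  · obtain ⟨g, hg, h⟩ := key {a, b} (Set.toFinite _)
    rw [(h a (by simp)).1, (h b (by simp)).1, hg.prec_iff]
  · obtain ⟨g, hg, h⟩ := key {a} (Set.toFinite _)
    rw [(h a (by simp)).1, hg.lab_eq]
  · obtain ⟨g, hg, h⟩ := key {a, b} (Set.toFinite _)
    rw [(h a (by simp)).1, (h b (by simp)).1, hg.G_iff]
  · obtain ⟨y, rfl⟩ := G.surjective x
    obtain ⟨g, hg, h⟩ := key {y, f y} (Set.toFinite _)
    change _ = G (f (G.symm (G y)))
    rw [G.symm_apply_apply, (h y (by simp)).1, (h (f y) (by simp)).1, (h y (by simp)).2]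

theorem IsolatedAbove.dense {f₀ : Equiv.Perm M} (hf₀ : IsEmb f₀) {S E : Set M} (hS : S.Finite)
    (hE : E.Finite) : ∃ f : Equiv.Perm M, IsEmb f ∧ (∀ x ∈ E, f x = f₀ x) ∧ IsolatedAbove S f := by
  obtain ⟨f, hf, hag, T, hT, hsub, hiso⟩ := exists_isolated hf₀ (hS.union hE)
  exact ⟨f, hf, fun x hx => hag x (Or.inr hx), T, hT, fun x hx => hsub (Or.inl hx), hiso⟩

theorem Nice.realizes_dense (hM : Nice P M) [Nonempty M] {f₀ h : Equiv.Perm M} (hf₀ : IsEmb f₀)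
    (hh : IsEmb h) {S T E : Set M} (hT : T.Finite) (hST : S ⊆ T) (hS : Isolated h S)
    (hE : E.Finite) : ∃ f : Equiv.Perm M, IsEmb f ∧ (∀ x ∈ E, f x = f₀ x) ∧ Realizes S T h f := by
  by_cases hag : ∀ x ∈ S, f₀ x = h x
  · obtain ⟨f, g, hf, hg, hgS, hfE, hfg⟩ := hM.exists_joint hh hf₀ hT (hE.union (hT.subset hST)) hS
      hag hST Set.subset_union_right
    exact ⟨f, hf, fun x hx => hfE x (Or.inl hx), fun _ => ⟨g, hg, hgS, hfg⟩⟩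
  · exact ⟨f₀, hf₀, fun _ _ => rfl, fun h => absurd h hag⟩

end Generic
end Dendrite

namespace Dendrite

open OTree Topology

/-! ### The topological group of automorphisms -/

section Topological

variable {P : Set ℕ∞} {M : Type u} [(lang P).Structure M]

/-- The action of automorphisms on the structure. -/
def Aut.toPerm : Aut (lang P) M →* Equiv.Perm M := (autSubgroup (lang P) M).subtype

theorem Aut.toPerm_injective : Function.Injective (Aut.toPerm : Aut (lang P) M →* _) :=
  Subtype.val_injective

theorem Aut.isOpen_apply_eq (x y : M) : IsOpen {g : Aut (lang P) M | g.toPerm x = y} := by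
  let : TopologicalSpace M := ⊥
  have : DiscreteTopology M := ⟨rfl⟩
  refine isOpen_induced_iff.2 ⟨{u : M → M | u x = y}, ?_, rfl⟩
  exact (isOpen_discrete ({y} : Set M)).preimage (f := fun u : M → M => u x) (continuous_apply x)

/-- The tuples of automorphisms with given values on a finite set form a basis of the topology. -/
theorem Aut.exists_finite_of_isOpen {ι : Type*} [Finite ι] {U : Set (ι → Aut (lang P) M)}
    (hU : IsOpen U) {g : ι → Aut (lang P) M} (hg : g ∈ U) :
    ∃ E : Set M, E.Finite ∧ ∀ h : ι → Aut (lang P) M,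
      (∀ i, ∀ x ∈ E, (h i).toPerm x = (g i).toPerm x) → h ∈ U := by
  have h1 : ∀ {V : Set (Aut (lang P) M)}, IsOpen V → ∀ {g}, g ∈ V →
      ∃ E : Set M, E.Finite ∧ ∀ h : Aut (lang P) M, (∀ x ∈ E, h.toPerm x = g.toPerm x) → h ∈ V := by
    intro V hV g hg
    let : TopologicalSpace M := ⊥
    obtain ⟨W, hW, rfl⟩ := isOpen_induced_iff.1 hV
    obtain ⟨I, u, hu, hsub⟩ := isOpen_pi_iff.1 hW _ hg
    refine ⟨I, I.finite_toSet, fun h hh => hsub fun x hx => ?_⟩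
    change h.toPerm x ∈ u x
    rw [hh x hx]
    exact (hu x hx).2
  obtain ⟨I, u, hu, hsub⟩ := isOpen_pi_iff.1 hU g hg
  choose! E hE hEu using fun i (hi : i ∈ I) => h1 (hu i hi).1 (hu i hi).2
  refine ⟨⋃ i ∈ I, E i, I.finite_toSet.biUnion hE, fun h hh => hsub fun i hi =>
    hEu i hi _ fun x hx => hh i x (Set.mem_biUnion hi hx)⟩

theorem Aut.isOpen_of_exists_finite {U : Set (Aut (lang P) M)}
    (h : ∀ g ∈ U, ∃ E : Set M, E.Finite ∧ ∀ h : Aut (lang P) M,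
      (∀ x ∈ E, h.toPerm x = g.toPerm x) → h ∈ U) : IsOpen U := by
  refine isOpen_iff_mem_nhds.2 fun g hg => ?_
  obtain ⟨E, hE, hEU⟩ := h g hg
  refine Filter.mem_of_superset (IsOpen.mem_nhds (hE.isOpen_biInter fun x _ =>
    Aut.isOpen_apply_eq x (g.toPerm x)) (Set.mem_iInter₂.2 fun _ _ => rfl)) fun h hh => ?_
  exact hEU h fun x hx => Set.mem_iInter₂.1 hh x hx

variable [OTree M]

theorem Aut.isEmb (hC : Compat P M) (hL : LabIn P M) (g : Aut (lang P) M) : IsEmb g.toPerm := by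
  obtain ⟨g, f, rfl⟩ := g
  exact isEmb_of_equiv hC hC hL hL f

theorem Aut.exists_toPerm_eq (hC : Compat P M) {g : Equiv.Perm M} (hg : IsEmb g) :
    ∃ h : Aut (lang P) M, h.toPerm = g :=
  ⟨⟨g, equivOfIsEmb hC hC g hg, rfl⟩, rfl⟩

/-- The automorphism group is a closed subset of a countable power of a countable discrete space:
an automorphism is encoded together with its inverse. -/
theorem Aut.polishSpace [Countable M] (hC : Compat P M) (hL : LabIn P M) :
    PolishSpace (Aut (lang P) M) := by
  let : TopologicalSpace M := ⊥
  have : DiscreteTopology M := ⟨rfl⟩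
  have : PolishSpace M := inferInstance
  let Φ : Aut (lang P) M → Bool × M → M := fun g p => cond p.1 g.toPerm g.toPerm.symm p.2
  have hΦ : Continuous Φ := by
    refine continuous_pi ?_
    rintro ⟨_ | _, x⟩ <;> refine continuous_discrete_rng.2 fun y => ?_
    · convert Aut.isOpen_apply_eq (P := P) y x using 1
      ext g
      exact (g.toPerm.symm_apply_eq.trans eq_comm)
    · exact Aut.isOpen_apply_eq x y
  have hind : IsInducing Φ := by
    refine IsInducing.of_comp (g := fun (u : Bool × M → M) (x : M) => u (true, x)) hΦ
      (continuous_pi fun x => continuous_apply _) ⟨rfl⟩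
  have hinj : Function.Injective Φ := fun g h hgh => Aut.toPerm_injective
    (Equiv.ext fun x => congrFun hgh (true, x))
  have hcl : ∀ (i j k : Bool × M) (S : Set (M × M × M)),
      IsClosed {u : Bool × M → M | (u i, u j, u k) ∈ S} := fun i j k S =>
    (isClosed_discrete S).preimage
      ((continuous_apply i).prodMk ((continuous_apply j).prodMk (continuous_apply k)))
  have hrange : Set.range Φ =
      (⋂ (x) (y), {u | u (true, x) = y ↔ u (false, y) = x}) ∩
      ((⋂ (x) (y), {u | u (true, x ⊓ y) = u (true, x) ⊓ u (true, y)}) ∩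
      ((⋂ (x) (y), {u | prec (u (true, x)) (u (true, y)) ↔ prec x y}) ∩
      ((⋂ x, {u | lab (u (true, x)) = lab x}) ∩
      ⋂ (i) (x) (y), {u | G i (u (true, x)) (u (true, y)) ↔ G i x y}))) := by
    ext u
    simp only [Set.mem_inter_iff, Set.mem_iInter, Set.mem_ofPred_eq]
    constructor
    · rintro ⟨g, rfl⟩
      have hg := g.isEmb hC hL
      exact ⟨fun x y => eq_comm.trans g.toPerm.symm_apply_eq.symm, hg.map_inf, hg.prec_iff, hg.lab_eq, hg.G_iff⟩
    · rintro ⟨h1, h2, h3, h4, h5⟩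
      let g : Equiv.Perm M := ⟨fun x => u (true, x), fun x => u (false, x),
        fun x => (h1 x _).1 rfl, fun x => (h1 _ x).2 rfl⟩
      obtain ⟨k, hk⟩ := Aut.exists_toPerm_eq hC (g := g) ⟨h2, h3, h4, h5⟩
      refine ⟨k, funext ?_⟩
      rintro ⟨_ | _, x⟩
      · change k.toPerm.symm x = _
        rw [hk]; rfl
      · change k.toPerm x = _
        rw [hk]; rfl
  have : PolishSpace (Bool × M → M) := inferInstance
  refine IsClosedEmbedding.polishSpace (f := Φ) ⟨⟨hind, hinj⟩, ?_⟩
  rw [hrange]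
  refine (isClosed_iInter fun x => isClosed_iInter fun y => ?_).inter
    ((isClosed_iInter fun x => isClosed_iInter fun y => ?_).inter
    ((isClosed_iInter fun x => isClosed_iInter fun y => ?_).inter
    ((isClosed_iInter fun x => ?_).inter
    (isClosed_iInter fun i => isClosed_iInter fun x => isClosed_iInter fun y => ?_))))
  · exact hcl (true, x) (false, y) (true, x) {p | p.1 = y ↔ p.2.1 = x}
  · exact hcl (true, x ⊓ y) (true, x) (true, y) {p | p.1 = p.2.1 ⊓ p.2.2}
  · exact hcl (true, x) (true, y) (true, x) {p | prec p.1 p.2.1 ↔ prec x y}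
  · exact hcl (true, x) (true, x) (true, x) {p | lab p.1 = lab x}
  · exact hcl (true, x) (true, y) (true, x) {p | G i p.1 p.2.1 ↔ G i x y}

/-! ### A comeager conjugacy class -/

/-- The generic automorphisms form a comeager set, which is contained in one conjugacy class. -/
theorem hasComeagerConjClass [Countable M] (hM : Nice P M) [Nonempty M] (hC : Compat P M) :
    HasComeagerConjClass (Aut (lang P) M) := by
  have hL := hM.labIn
  have := Aut.polishSpace hC hL
  -- density of a set of automorphisms, tested on finite sets
  have hdense : ∀ W : Set (Equiv.Perm M), (∀ f₀ : Equiv.Perm M, IsEmb f₀ → ∀ E : Set M, E.Finite →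
      ∃ f : Equiv.Perm M, IsEmb f ∧ (∀ x ∈ E, f x = f₀ x) ∧ f ∈ W) →
      Dense {g : Aut (lang P) M | g.toPerm ∈ W} := by
    intro W hW
    refine dense_iff_inter_open.2 fun U hU ⟨g, hg⟩ => ?_
    have hU' : IsOpen ((fun g : Unit → Aut (lang P) M => g ()) ⁻¹' U) :=
      hU.preimage (continuous_apply ())
    obtain ⟨E, hE, hEU⟩ := Aut.exists_finite_of_isOpen hU' (g := fun _ => g) hg
    obtain ⟨f, hf, hag, hfW⟩ := hW _ (g.isEmb hC hL) E hE
    obtain ⟨k, rfl⟩ := Aut.exists_toPerm_eq hC hf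
    exact ⟨k, hEU (fun _ => k) fun _ => hag, hfW⟩
  have h1 : ∀ S : Finset M, {g : Aut (lang P) M | IsolatedAbove (S : Set M) g.toPerm} ∈
      residual (Aut (lang P) M) := by
    intro S
    refine residual_of_dense_open (Aut.isOpen_of_exists_finite ?_)
      (hdense {f | IsolatedAbove (S : Set M) f} fun f₀ hf₀ E hE =>
        IsolatedAbove.dense hf₀ S.finite_toSet hE)
    rintro g ⟨T, hT, hST, hiso⟩
    exact ⟨T, hT, fun h hh => ⟨T, hT, hST, hiso.congr (h.isEmb hC hL) hh⟩⟩
  -- the isolated restrictions are given by finite graphs, so there are countably many of them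
  let D : Set (Finset M × Finset (M × M)) := {d | ∃ h : Equiv.Perm M, IsEmb h ∧
    Isolated h (d.1 : Set M) ∧ (∀ p ∈ d.2, h p.1 = p.2) ∧ ∀ x ∈ d.1, (x, h x) ∈ d.2}
  have h2 : ∀ d : D, {g : Aut (lang P) M | ∃ h : Equiv.Perm M, (∀ p ∈ d.1.2, h p.1 = p.2) ∧
      Realizes (d.1.1 : Set M) (Prod.fst '' (d.1.2 : Set (M × M))) h g.toPerm} ∈
      residual (Aut (lang P) M) := by
    rintro ⟨⟨S, Γ⟩, h, hh, hS, hΓ, hSΓ⟩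
    have hT : (Prod.fst '' (Γ : Set (M × M))).Finite := Γ.finite_toSet.image _
    have hST : (S : Set M) ⊆ Prod.fst '' (Γ : Set (M × M)) := fun x hx => ⟨_, hSΓ x hx, rfl⟩
    refine residual_of_dense_open (Aut.isOpen_of_exists_finite ?_)
      (hdense {f | ∃ h : Equiv.Perm M, (∀ p ∈ Γ, h p.1 = p.2) ∧
        Realizes (S : Set M) (Prod.fst '' (Γ : Set (M × M))) h f} fun f₀ hf₀ E hE => ?_)
    · rintro g ⟨h', hh', hr⟩
      by_cases hag : ∀ x ∈ S, g.toPerm x = h' x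
      · obtain ⟨q, hq, hqS, hqT⟩ := hr hag
        refine ⟨q '' (Prod.fst '' (Γ : Set (M × M))), hT.image q, fun k hk =>
          ⟨h', hh', fun _ => ⟨q, hq, hqS, fun x hx => ?_⟩⟩⟩
        rw [hk _ ⟨x, hx, rfl⟩, hqT x hx]
      · exact ⟨S, S.finite_toSet, fun k hk => ⟨h', hh', fun hk' =>
          absurd (fun x hx => (hk x hx).symm.trans (hk' x hx)) hag⟩⟩
    · obtain ⟨f, hf, hfE, hr⟩ := hM.realizes_dense hf₀ hh hT hST hS hE
      exact ⟨f, hf, hfE, h, hΓ, hr⟩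
  have hgen : {g : Aut (lang P) M | IsGeneric g.toPerm} ∈ residual (Aut (lang P) M) := by
    refine Filter.mem_of_superset (Filter.inter_mem (countable_iInter_mem.2 h1)
      (countable_iInter_mem.2 h2)) ?_
    rintro g ⟨hg1, hg2⟩
    rw [Set.mem_iInter] at hg1 hg2
    refine ⟨g.isEmb hC hL, fun S hS => ?_, fun S T h hT hST hh hiso hag => ?_⟩
    · simpa using hg1 hS.toFinset
    · classical
      have hS := hT.subset hST
      obtain ⟨h', hh', hr⟩ := hg2 ⟨(hS.toFinset, hT.toFinset.image fun x => (x, h x)), h, hh,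
        by simpa using hiso, by simp, by
          intro x hx
          simp only [Set.Finite.mem_toFinset] at hx
          simpa using hST hx⟩
      have hT' : ∀ x ∈ T, h' x = h x := fun x hx => hh' (x, h x) (by simpa using hx)
      obtain ⟨q, hq, hqS, hqT⟩ := hr (fun x hx => by
        have hx : x ∈ S := by simpa using hx
        rw [hag x hx, hT' x (hST hx)])
      refine ⟨q, hq, fun x hx => hqS x (by simpa using hx), fun x hx => ?_⟩
      rw [← hT' x hx]
      exact hqT x ⟨(x, h x), by simpa using hx, rfl⟩
  obtain ⟨f, hf⟩ := (dense_of_mem_residual hgen).nonempty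
  refine ⟨f, Filter.mem_of_superset hgen fun h hh => ?_⟩
  obtain ⟨g, hg, hfg⟩ := IsGeneric.exists_conj hf hh
  obtain ⟨k, rfl⟩ := Aut.exists_toPerm_eq hC hg
  exact ⟨k, Aut.toPerm_injective (by rw [hfg, map_mul, map_mul, map_inv])⟩

/-! ### No comeager diagonal conjugacy class of pairs -/

theorem lift_conj {G : Type*} [Group G] {ι : Type*} (g : G) (f : ι → G) (w : FreeGroup ι) :
    FreeGroup.lift (fun s => g * f s * g⁻¹) w = g * FreeGroup.lift f w * g⁻¹ := by
  have : FreeGroup.lift (fun s => g * f s * g⁻¹) =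
      (MulAut.conj g).toMonoidHom.comp (FreeGroup.lift f) := by
    ext s
    simp
  rw [this]; rfl

/-- On some open set of pairs moving `a₀` up to `a`, the conjugates in which `a` corresponds to a
fixed point `b` would be dense, and then the position of `b` would decide all words at `a`. -/
theorem not_hasComeagerDiagConjClass [Countable M] (hM : Nice P M) [Nonempty M]
    (hC : Compat P M) : ¬ HasComeagerDiagConjClass (Aut (lang P) M) 2 := by
  rintro ⟨f, hf⟩
  have hL := hM.labIn
  have := Aut.polishSpace hC hL
  let a : M := Classical.arbitrary M
  obtain ⟨a₀, hlt, -, hl, f₁, hf₁, hfa⟩ := hM.exists_pair a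
  obtain ⟨k₁, rfl⟩ := Aut.exists_toPerm_eq hC hf₁
  let U : Set (Fin 2 → Aut (lang P) M) := {h | ∀ i, (h i).toPerm a₀ = a}
  have hU : IsOpen U := by
    have : U = ⋂ i, {h | (h i).toPerm a₀ = a} := by ext; simp [U]
    rw [this]
    exact isOpen_iInter_of_finite fun i => (Aut.isOpen_apply_eq a₀ a).preimage
      (f := fun h : Fin 2 → Aut (lang P) M => h i) (continuous_apply i)
  let C : M → Set (Fin 2 → Aut (lang P) M) := fun b =>
    {h | h ∈ U ∧ ∃ g : Aut (lang P) M, g.toPerm b = a ∧ ∀ i, h i = g * f i * g⁻¹}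
  obtain ⟨b, hb⟩ : ∃ b, ¬ IsNowhereDense (C b) := by
    by_contra! hcon
    have h1 : IsMeagre (⋃ b, C b) := isMeagre_iUnion fun b => (hcon b).isMeagre
    refine not_isMeagre_of_isOpen hU ⟨fun _ => k₁, fun _ => hfa⟩ ?_
    refine Filter.mem_of_superset (Filter.inter_mem hf h1) ?_
    rintro h ⟨⟨g, hg⟩, h2⟩ h3
    exact h2 (Set.mem_iUnion.2 ⟨g.toPerm.symm a, h3, g, g.toPerm.apply_symm_apply a, hg⟩)
  obtain ⟨k, hkV⟩ := Set.nonempty_iff_ne_empty.2 hb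
  obtain ⟨k, hkV, hkC⟩ := mem_closure_iff.1 (interior_subset hkV) _ isOpen_interior hkV
  obtain ⟨E, hE, hEV⟩ := Aut.exists_finite_of_isOpen isOpen_interior hkV
  let σ : Fin 2 ≃ Bool := finTwoEquiv
  obtain ⟨w, ⟨h₁, g1, g2, g3⟩, h₂, g4, g5, g6⟩ := hM.exists_word
    (f := fun s => (k (σ.symm s)).toPerm) (fun s => Aut.isEmb hC hL _) (E := fun _ => E)
    (fun _ => hE) hlt (fun s => hkC.1 _) hl
  have key : ∀ h : Bool → Equiv.Perm M, (∀ s, IsEmb (h s)) →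
      (∀ s, ∀ x ∈ E, h s x = (k (σ.symm s)).toPerm x) → (FreeGroup.lift h w a = a ↔
      FreeGroup.lift (fun s => (f (σ.symm s)).toPerm) w b = b) := by
    intro h hh hag
    obtain ⟨Q, hQ, hQw⟩ := exists_finite_lift h w a
    choose h' hh' using fun i => Aut.exists_toPerm_eq hC (hh (σ i))
    have hV : h' ∈ interior (closure (C b)) := hEV h' fun i x hx => by
      rw [hh', hag _ x hx, Equiv.symm_apply_apply]
    have hO : IsOpen {r : Fin 2 → Aut (lang P) M | ∀ i, ∀ x ∈ Q, (r i).toPerm x = (h' i).toPerm x} := by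
      have : {r : Fin 2 → Aut (lang P) M | ∀ i, ∀ x ∈ Q, (r i).toPerm x = (h' i).toPerm x} =
          ⋂ i, ⋂ x ∈ Q, {r | (r i).toPerm x = (h' i).toPerm x} := by ext; simp
      rw [this]
      exact isOpen_iInter_of_finite fun i => hQ.isOpen_biInter fun x _ =>
        (Aut.isOpen_apply_eq x _).preimage (f := fun h : Fin 2 → Aut (lang P) M => h i)
          (continuous_apply i)
    obtain ⟨r, hr, -, g, hgb, hg⟩ := mem_closure_iff.1 (interior_subset hV) _ hO fun _ _ _ => rfl
    have e1 : FreeGroup.lift (fun s => (r (σ.symm s)).toPerm) w a = FreeGroup.lift h w a :=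
      hQw (fun s => (r (σ.symm s)).toPerm) id fun s x hx => by
        have := hr (σ.symm s) x hx
        rwa [hh', Equiv.apply_symm_apply] at this
    have e2 : (fun s => (r (σ.symm s)).toPerm) =
        fun s => g.toPerm * (f (σ.symm s)).toPerm * g.toPerm⁻¹ := by
      funext s
      rw [hg, map_mul, map_mul, map_inv]
    rw [e2, lift_conj] at e1
    rw [← e1, Equiv.Perm.mul_apply, Equiv.Perm.mul_apply, ← hgb,
      show g.toPerm⁻¹ (g.toPerm b) = b from g.toPerm.symm_apply_apply b, g.toPerm.injective.eq_iff]
  exact g6 ((key h₂ g4 g5).2 ((key h₁ g1 g2).1 g3))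

end Topological

end Dendrite

theorem mainTheorem8 (P : Set ℕ∞) (hP : ∀ p ∈ P, 2 ≤ p) (hne : P.Nonempty) :
    Dendrite.HasCAP.{u} P 1 ∧ ¬ Dendrite.HasWAP.{u} P 2 ∧
    ∀ (M : Type u) [(Dendrite.lang P).Structure M], Dendrite.IsWazewskiDendrite P M →
      Dendrite.HasComeagerConjClass (Dendrite.Aut (Dendrite.lang P) M) ∧
      ¬ Dendrite.HasComeagerDiagConjClass (Dendrite.Aut (Dendrite.lang P) M) 2 := by
  refine ⟨Dendrite.hasCAP_one hP hne, Dendrite.not_hasWAP_two hP hne, fun M _ hD => ?_⟩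
  obtain ⟨_, hL, hC⟩ := hD.exists_otree hP
  have hM := hD.nice hP hne hL hC
  have := hM.countable
  have := hM.nonempty hP hne
  exact ⟨Dendrite.hasComeagerConjClass hM hC, Dendrite.not_hasComeagerDiagConjClass hM hC⟩
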